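/- Let $k$ be a field. All tensor products are over $k$. Conventions. For a $k$-vector space $V$ and a subspace $P\subseteq T(V)$, let $I(P)$ be the two-sided ideal of the tensor algebra $T(V)$ generated by $P$. Let $N\ge 2$, let $R\subseteq V^{\otimes N}$ be a subspace, and put $A=A(V,R)=T(V)/I(R)$, graded by $A_n=$ image of $V^{\otimes n}$. Put $W_m=\bigcap_{i+N+j=m}V^{\otimes i}\otimes R\otimes V^{\otimes j}\subseteq V^{\otimes m}$ (so $W_m=V^{\otimes m}$ for $m<N$) and $\nu_N(2i)=Ni$, $\nu_N(2i+1)=Ni+1$. The Koszul complex of $A$ has terms $K_i=A\otimes W_{\nu_N(i)}$ ($i\ge 0$) and left $A$-linear differentials $K_i\to K_{i-1}$ induced by the inclusion $W_{\nu_N(i)}\subseteq V^{\otimes(\nu_N(i)-\nu_N(i-1))}\otimes W_{\nu_N(i-1)}$ and the product $A\otimes V^{\otimes(\nu_N(i)-\nu_N(i-1))}\to A$. The algebra $A$ is $N$-Koszul if the homology of this complex is $0$ in every degree $i>0$. For a linear map $\varphi:R\to k$ let $P=(\mathrm{Id}-\varphi)(R)=\{r-\varphi(r)\cdot 1 : r\in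 R\}$ and $U=T(V)/I(P)$, filtered by the images of $F^n=\bigoplus_{i\le n}V^{\otimes i}$. Then $U$ is a PBW deformation of $A$ if the natural morphism of graded algebras $A\to\mathrm{gr}(U)$ is an isomorphism. For an integer $d\ge 1$, a $k$-algebra $B$ is $d$-Calabi–Yau if, with $B^e=B\otimes B^{op}$, the bimodule $B$ has a finite-length resolution by finitely generated projective $B$-bimodules, $\mathrm{Ext}^i_{B^e}(B,B^e)=0$ for $i\neq d$, and $\mathrm{Ext}^d_{B^e}(B,B^e)\cong B$ as right $B^e$-modules (Ext of left $B^e$-modules). For a Lie algebra $\mathfrak g$ over $k$ and an alternating $2$-cocycle $f:\mathfrak g\times\mathfrak g\to k$ (trivial coefficients), the Sridharan enveloping algebra $U_f(\mathfrak g)$ is the quotient of $T(\mathfrak g)$ by the relations $xy-yx=[x,y]+f(x,y)$ for $x,y\in\mathfrak g$. The Weyl algebra $A_n$ over $k$ is generated by $x_1,\dots,x_n,y_1,\dots,y_n$ with relations $x_ix_j=x_jx_i$, $y_iy_j=y_jy_i$, $y_ix_j-x_jy_i=\delta_{ij}$. Theorem. (1) Let $V$ be finite-dimensional, $N\geq 2$,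 $R\subseteq V^{\otimes N}$ a subspace such that $A=A(V,R)$ is $N$-Koszul, and $\varphi:R\to k$ a linear map such that $U=T(V)/I(P)$, $P=(\mathrm{Id}-\varphi)(R)$, is a PBW deformation of $A$. If $A$ is $d$-Calabi–Yau for some $d\ge 2$, then $U$ is $d$-Calabi–Yau. (2) For every $n\ge 1$, every Sridharan enveloping algebra of an $n$-dimensional abelian Lie algebra over $k$ is $n$-Calabi–Yau. (3) For every $n\ge 1$, the Weyl algebra $A_n$ over $k$ is $2n$-Calabi–Yau. -/

import Mathlib

open scoped TensorProduct
open CategoryTheory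

universe u v w

namespace NKoszulCY

noncomputable section

/-! ### Calabi–Yau algebras -/

section CalabiYau

variable (k : Type u) [Field k] (A : Type v) [Ring A] [Algebra k A]

/-- The enveloping algebra `Aᵉ = A ⊗ Aᵒᵖ` of a `k`-algebra; left `Aᵉ`-modules are `A`-bimodules. -/
abbrev Env : Type v := A ⊗[k] Aᵐᵒᵖ

/-- `A` as a left `Aᵉ`-module, i.e. as a bimodule over itself: `(x ⊗ y) • a = x * a * y`. -/
def selfBimodule : ModuleCat.{v} (Env k A) :=
  letI : Module (Env k A) A := instModuleTensorProductMop k A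
  ModuleCat.of (Env k A) A

/-- `Aᵉ` as a left module over itself. -/
def envLeft : ModuleCat.{v} (Env k A) := ModuleCat.of (Env k A) (Env k A)

/-- Check that the left action of `Aᵉ` on `A` is the expected one. -/
theorem selfBimodule_smul (x y a : A) :
    ((x ⊗ₜ[k] MulOpposite.op y : Env k A) • (show selfBimodule k A from a) : selfBimodule k A) =
      (show selfBimodule k A from x * a * y) :=
  AlgHom.mulLeftRight_apply k A x (MulOpposite.op y) a

/-- Right multiplication `x ↦ x * e` on `Aᵉ`, which is left `Aᵉ`-linear. -/
def envRightMul (e : Env k A) : envLeft k A ⟶ envLeft k A :=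
  ModuleCat.ofHom (LinearMap.toSpanSingleton (Env k A) (Env k A) e)

variable {k A} in
/-- The right `Aᵉ`-module structure of `Extⁱ(A, Aᵉ)` (Ext of left `Aᵉ`-modules), which comes from
the right multiplication of `Aᵉ` on the second argument. -/
def extRightAct {i : ℕ} (ξ : Abelian.Ext.{v} (selfBimodule k A) (envLeft k A) i) (e : Env k A) :
    Abelian.Ext.{v} (selfBimodule k A) (envLeft k A) i :=
  ξ.comp (Abelian.Ext.mk₀ (envRightMul k A e)) (add_zero i)

/-- `A` has a resolution of finite length by finitely generated projective `A`-bimodules. -/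
def HasFiniteBimoduleResolution : Prop :=
  ∃ P : ProjectiveResolution (selfBimodule k A),
    (∀ i, Module.Finite (Env k A) (P.complex.X i)) ∧
      ∃ m : ℕ, ∀ i, m < i → Limits.IsZero (P.complex.X i)

/-- `A` is a Calabi–Yau algebra of dimension `d ≥ 1` (Ginzburg): `A` has a finite resolution by
finitely generated projective bimodules, `Extⁱ(A, Aᵉ) = 0` for `i ≠ d`, and `Extᵈ(A, Aᵉ) ≅ A` as
right `Aᵉ`-modules. The right `Aᵉ`-module structure of `A` is `a · (x ⊗ y) = y * a * x`; as the
pure tensors generate `Aᵉ` additively, it suffices to express linearity for these. -/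
structure IsCalabiYau (d : ℕ) : Prop where
  one_le : 1 ≤ d
  finite_resolution : HasFiniteBimoduleResolution k A
  ext_eq_zero : ∀ i : ℕ, i ≠ d →
    Subsingleton (Abelian.Ext.{v} (selfBimodule k A) (envLeft k A) i)
  ext_iso : ∃ Φ : Abelian.Ext.{v} (selfBimodule k A) (envLeft k A) d ≃+ A,
    ∀ (ξ : Abelian.Ext.{v} (selfBimodule k A) (envLeft k A) d) (x y : A),
      Φ (extRightAct ξ (x ⊗ₜ[k] MulOpposite.op y)) = y * Φ ξ * x

end CalabiYau

/-! ### Algebras `T(V) / I(P)` -/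

section Quotients

variable {k : Type u} [Field k] {V : Type v} [AddCommGroup V] [Module k V]

/-- `T(V) / I(P)`, the quotient of the tensor algebra by the two-sided ideal generated by `P`. -/
def QuotAlg (P : Submodule k (TensorAlgebra k V)) : Type (max u v) :=
  RingQuot (fun a b : TensorAlgebra k V => a ∈ P ∧ b = 0)

instance (P : Submodule k (TensorAlgebra k V)) : Ring (QuotAlg P) :=
  inferInstanceAs (Ring (RingQuot (fun a b : TensorAlgebra k V => a ∈ P ∧ b = 0)))

instance (P : Submodule k (TensorAlgebra k V)) : Algebra k (QuotAlg P) :=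
  inferInstanceAs (Algebra k (RingQuot (fun a b : TensorAlgebra k V => a ∈ P ∧ b = 0)))

/-- The projection `T(V) → T(V) / I(P)`. -/
def quotMk (P : Submodule k (TensorAlgebra k V)) : TensorAlgebra k V →ₐ[k] QuotAlg P :=
  RingQuot.mkAlgHom k (fun a b : TensorAlgebra k V => a ∈ P ∧ b = 0)

variable (k V) in
/-- The homogeneous component `V^{⊗ m}` of the tensor algebra. -/
def tpow (m : ℕ) : Submodule k (TensorAlgebra k V) :=
  LinearMap.range (TensorAlgebra.ι k : V →ₗ[k] TensorAlgebra k V) ^ m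

/-! ### The Koszul complex -/

/-- The jump function `ν_N (2 i) = N i`, `ν_N (2 i + 1) = N i + 1`. -/
def nu (N i : ℕ) : ℕ := N * (i / 2) + i % 2

/-- `W_m = ⋂_{i + N + j = m} V^{⊗ i} ⊗ R ⊗ V^{⊗ j}`, a subspace of `V^{⊗ m}`
(all of `V^{⊗ m}` if `m < N`). -/
def koszulW (N : ℕ) (R : Submodule k (TensorAlgebra k V)) (m : ℕ) :
    Submodule k (TensorAlgebra k V) :=
  tpow k V m ⊓ ⨅ (i : ℕ) (j : ℕ) (_ : i + N + j = m), tpow k V i * R * tpow k V j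

variable (k V) in
/-- The map `k × (V ⊗ T(V)) → T(V)`, `(c, v ⊗ t) ↦ c + v * t`. -/
def glue : k × (V ⊗[k] TensorAlgebra k V) →ₗ[k] TensorAlgebra k V :=
  LinearMap.coprod (Algebra.linearMap k (TensorAlgebra k V))
    (TensorProduct.lift ((LinearMap.mul k (TensorAlgebra k V)) ∘ₗ (TensorAlgebra.ι k)))

variable (k V) in
/-- Left multiplication by `v ∈ V`, transported to `k × (V ⊗ T(V))`:
`z ↦ (0, v ⊗ glue z)`. -/
def prepend : V →ₗ[k] Module.End k (k × (V ⊗[k] TensorAlgebra k V)) where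
  toFun v := (LinearMap.inr k k (V ⊗[k] TensorAlgebra k V)) ∘ₗ
    (TensorProduct.mk k V (TensorAlgebra k V) v) ∘ₗ glue k V
  map_add' v w := by
    ext <;> simp
  map_smul' c v := by
    ext <;> simp [TensorProduct.smul_tmul']

variable (k V) in
/-- Splitting off the leftmost letter: the linear map `T(V) → V ⊗ T(V)` with
`1 ↦ 0` and `v * t ↦ v ⊗ t`. -/
def splitLeft : TensorAlgebra k V →ₗ[k] V ⊗[k] TensorAlgebra k V :=
  (LinearMap.snd k k (V ⊗[k] TensorAlgebra k V)) ∘ₗ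
    (LinearMap.applyₗ ((1, 0) : k × (V ⊗[k] TensorAlgebra k V))) ∘ₗ
      (TensorAlgebra.lift k (prepend k V)).toLinearMap

theorem glue_lift_prepend (t : TensorAlgebra k V) (z : k × (V ⊗[k] TensorAlgebra k V)) :
    glue k V (TensorAlgebra.lift k (prepend k V) t z) = t * glue k V z := by
  induction t using TensorAlgebra.induction generalizing z with
  | algebraMap r => simp [Algebra.algebraMap_eq_smul_one]
  | ι v => simp [prepend, glue]
  | mul a b ha hb => simp [ha, hb, mul_assoc]
  | add a b ha hb => simp [ha, hb, add_mul]

theorem splitLeft_algebraMap (c : k) :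
    splitLeft k V (algebraMap k (TensorAlgebra k V) c) = 0 := by
  simp [splitLeft, Algebra.algebraMap_eq_smul_one]

theorem splitLeft_ι_mul (v : V) (t : TensorAlgebra k V) :
    splitLeft k V (TensorAlgebra.ι k v * t) = v ⊗ₜ[k] t := by
  have h := glue_lift_prepend t ((1, 0) : k × (V ⊗[k] TensorAlgebra k V))
  have h1 : glue k V ((1, 0) : k × (V ⊗[k] TensorAlgebra k V)) = 1 := by simp [glue]
  rw [h1, mul_one] at h
  have h2 (z : k × (V ⊗[k] TensorAlgebra k V)) : prepend k V v z = (0, v ⊗ₜ[k] glue k V z) := rfl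
  simp [splitLeft, h, h2]

/-- The linear map `A ⊗ T(V) → A ⊗ T(V)`, `a ⊗ (v * t) ↦ (a v) ⊗ t`, `a ⊗ 1 ↦ 0`,
where `A = T(V) / I(R)`. -/
def shift (R : Submodule k (TensorAlgebra k V)) :
    QuotAlg R ⊗[k] TensorAlgebra k V →ₗ[k] QuotAlg R ⊗[k] TensorAlgebra k V :=
  (LinearMap.rTensor (TensorAlgebra k V)
      (TensorProduct.lift ((LinearMap.mul k (QuotAlg R)).compl₂
        ((quotMk R).toLinearMap ∘ₗ TensorAlgebra.ι k)))) ∘ₗ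
    (TensorProduct.assoc k (QuotAlg R) V (TensorAlgebra k V)).symm.toLinearMap ∘ₗ
      LinearMap.lTensor (QuotAlg R) (splitLeft k V)

theorem shift_tmul_ι_mul (R : Submodule k (TensorAlgebra k V)) (a : QuotAlg R) (v : V)
    (t : TensorAlgebra k V) :
    shift R (a ⊗ₜ[k] (TensorAlgebra.ι k v * t)) =
      (a * quotMk R (TensorAlgebra.ι k v)) ⊗ₜ[k] t := by
  simp [shift, splitLeft_ι_mul]

/-- The inclusion of the term `K_i = A ⊗ W_{ν_N(i)}` of the Koszul complex into `A ⊗ T(V)`. -/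
def koszulIncl (N : ℕ) (R : Submodule k (TensorAlgebra k V)) (i : ℕ) :
    QuotAlg R ⊗[k] koszulW N R (nu N i) →ₗ[k] QuotAlg R ⊗[k] TensorAlgebra k V :=
  LinearMap.lTensor (QuotAlg R) (koszulW N R (nu N i)).subtype

/-- The differential `δ_{i+1} : K_{i+1} → K_i` of the Koszul complex, given by the inclusion of
`W_{ν_N(i+1)}` into `V^{⊗ (ν_N(i+1) - ν_N(i))} ⊗ W_{ν_N(i)}` followed by the product
`A ⊗ V^{⊗ (ν_N(i+1) - ν_N(i))} → A`. It takes its values in `K_i = A ⊗ W_{ν_N(i)}`, which is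
regarded here as a subspace of `A ⊗ T(V)`. -/
def koszulDiff (N : ℕ) (R : Submodule k (TensorAlgebra k V)) (i : ℕ) :
    QuotAlg R ⊗[k] koszulW N R (nu N (i + 1)) →ₗ[k] QuotAlg R ⊗[k] TensorAlgebra k V :=
  (shift R ^ (nu N (i + 1) - nu N i)) ∘ₗ koszulIncl N R (i + 1)

/-- The `N`-homogeneous algebra `A = T(V) / I(R)`, `R ⊆ V^{⊗ N}`, is `N`-Koszul: the homology of
the Koszul complex vanishes in all degrees `i + 1 > 0`, i.e. the kernel of `δ_{i+1}` equals the
image of `δ_{i+2}` (both seen in `A ⊗ T(V)`). -/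
def IsKoszul (N : ℕ) (R : Submodule k (TensorAlgebra k V)) : Prop :=
  ∀ i : ℕ, Submodule.map (koszulIncl N R (i + 1)) (LinearMap.ker (koszulDiff N R i)) =
    LinearMap.range (koszulDiff N R (i + 1))

/-! ### PBW deformations -/

variable (k V) in
/-- The subspace `F^{m-1} = ⨁_{i < m} V^{⊗ i}` of the tensor algebra (zero if `m = 0`). -/
def tensorLt (m : ℕ) : Submodule k (TensorAlgebra k V) :=
  ⨆ i ∈ Finset.range m, tpow k V i

/-- The filtration of `U = T(V) / I(P)`: the image of `F^{m-1}`. -/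
def filtLt (P : Submodule k (TensorAlgebra k V)) (m : ℕ) : Submodule k (QuotAlg P) :=
  Submodule.map (quotMk P).toLinearMap (tensorLt k V m)

/-- The component of degree `n` of the associated graded algebra of the filtered algebra
`U = T(V) / I(P)`, i.e. the image of `F^n` modulo the image of `F^{n-1}`. -/
abbrev GrPiece (P : Submodule k (TensorAlgebra k V)) (n : ℕ) : Type (max u v) :=
  filtLt P (n + 1) ⧸ (filtLt P n).submoduleOf (filtLt P (n + 1))

theorem quotMk_mem_filtLt (P : Submodule k (TensorAlgebra k V)) (n : ℕ) (t : tpow k V n) :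
    quotMk P t ∈ filtLt P (n + 1) :=
  Submodule.mem_map_of_mem (f := (quotMk P).toLinearMap)
    ((le_biSup (fun i => tpow k V i) (Finset.self_mem_range_succ n) :
      tpow k V n ≤ tensorLt k V (n + 1)) t.2)

/-- The natural map `V^{⊗ n} → gr_n(U)`. -/
def toGr (P : Submodule k (TensorAlgebra k V)) (n : ℕ) : tpow k V n →ₗ[k] GrPiece P n :=
  (Submodule.mkQ _) ∘ₗ LinearMap.codRestrict (filtLt P (n + 1))
    ((quotMk P).toLinearMap ∘ₗ (tpow k V n).subtype) (quotMk_mem_filtLt P n)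

/-- The component `A_n` of the graded algebra `A = T(V) / I(R)`, the image of `V^{⊗ n}`. -/
def homPiece (R : Submodule k (TensorAlgebra k V)) (n : ℕ) : Submodule k (QuotAlg R) :=
  Submodule.map (quotMk R).toLinearMap (tpow k V n)

/-- The natural map `V^{⊗ n} → A_n`. -/
def toHomPiece (R : Submodule k (TensorAlgebra k V)) (n : ℕ) : tpow k V n →ₗ[k] homPiece R n :=
  (quotMk R).toLinearMap.submoduleMap (tpow k V n)

/-- `U = T(V) / I(P)` is a PBW deformation of the graded algebra `A = T(V) / I(R)`: the natural
graded morphism `p : A → gr(U)` is an isomorphism. Its component `p_n : A_n → gr_n(U)` is the only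
map whose composite with the surjection `V^{⊗ n} → A_n` is the natural map `V^{⊗ n} → gr_n(U)`. -/
def IsPBWDeformation (R P : Submodule k (TensorAlgebra k V)) : Prop :=
  ∀ n : ℕ, ∃ p : homPiece R n ≃ₗ[k] GrPiece P n, ∀ t : tpow k V n, p (toHomPiece R n t) = toGr P n t

/-- The space of relations `P = (Id - φ)(R)` obtained from `R` by adding constants, given by a
linear form `φ : R → k`. -/
def deformedRel (R : Submodule k (TensorAlgebra k V)) (φ : R →ₗ[k] k) :
    Submodule k (TensorAlgebra k V) :=
  LinearMap.range (R.subtype - (Algebra.linearMap k (TensorAlgebra k V)) ∘ₗ φ)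

end Quotients

/-! ### Sridharan enveloping algebras and Weyl algebras -/

section Examples

variable (k : Type u) [Field k]

/-- `f` is a `2`-cocycle of the Lie algebra `g` with values in the trivial module `k`. -/
structure IsTwoCocycle {g : Type v} [LieRing g] [LieAlgebra k g] (f : g →ₗ[k] g →ₗ[k] k) :
    Prop where
  alt : ∀ x, f x x = 0
  cocycle : ∀ x y z, f ⁅x, y⁆ z + f ⁅y, z⁆ x + f ⁅z, x⁆ y = 0

/-- The relations `x y - y x = [x, y] + f(x, y)` of the Sridharan enveloping algebra. -/
inductive SridharanRel {g : Type v} [LieRing g] [LieAlgebra k g] (f : g →ₗ[k] g →ₗ[k] k) :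
    TensorAlgebra k g → TensorAlgebra k g → Prop
  | rel (x y : g) : SridharanRel f
      (TensorAlgebra.ι k x * TensorAlgebra.ι k y - TensorAlgebra.ι k y * TensorAlgebra.ι k x)
      (TensorAlgebra.ι k ⁅x, y⁆ + algebraMap k (TensorAlgebra k g) (f x y))

/-- The Sridharan enveloping algebra `U_f(g)` of a Lie algebra `g` with `2`-cocycle `f`. -/
abbrev Sridharan {g : Type v} [LieRing g] [LieAlgebra k g] (f : g →ₗ[k] g →ₗ[k] k) :
    Type (max u v) :=
  RingQuot (SridharanRel k f)

/-- The relations of the Weyl algebra `A_n`, with generators `x_i = inl i` and `y_i = inr i`: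
the `x_i` commute, the `y_i` commute, and `y_i x_j - x_j y_i = δ_{ij}`. -/
inductive WeylRel (n : ℕ) : FreeAlgebra k (Fin n ⊕ Fin n) → FreeAlgebra k (Fin n ⊕ Fin n) → Prop
  | xx (i j : Fin n) : WeylRel n
      (FreeAlgebra.ι k (Sum.inl i) * FreeAlgebra.ι k (Sum.inl j))
      (FreeAlgebra.ι k (Sum.inl j) * FreeAlgebra.ι k (Sum.inl i))
  | yy (i j : Fin n) : WeylRel n
      (FreeAlgebra.ι k (Sum.inr i) * FreeAlgebra.ι k (Sum.inr j))
      (FreeAlgebra.ι k (Sum.inr j) * FreeAlgebra.ι k (Sum.inr i))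
  | yx (i j : Fin n) : WeylRel n
      (FreeAlgebra.ι k (Sum.inr i) * FreeAlgebra.ι k (Sum.inl j) -
        FreeAlgebra.ι k (Sum.inl j) * FreeAlgebra.ι k (Sum.inr i))
      (if i = j then 1 else 0)

/-- The Weyl algebra `A_n` over `k`. -/
abbrev Weyl (n : ℕ) : Type u := RingQuot (WeylRel k n)

end Examples

end

end NKoszulCY

namespace NKoszulCY
noncomputable section

/-! ### Projective resolutions from explicit exact sequences, and Ext computed on them -/

section Resolution

variable {E : Type v} [Ring E] {X : ModuleCat.{v} E} (P : ℕ → ModuleCat.{v} E)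
  (d : ∀ i, P (i + 1) ⟶ P i) (ε : P 0 ⟶ X)

/-! Part (1) compares two complexes built on one underlying space. For an `N`-Koszul algebra `A` the
bimodule Koszul complex with terms `Aᵉ ⊗ W_{ν(i)}` resolves `A`. Its differentials are alternately
`dl - dr` and `∑ dl^a dr^(N-1-a)`, where `dl` and `dr` absorb the first and the last letter of a
word into the outer factors. The same formulas, with letters multiplied in `U`, give a complex over
`Uᵉ`: two consecutive differentials compose to `dl^N - dr^N`, and on the spaces `W_{m+N}` these two
powers agree (`tensorL_pow_eq_tensorR_pow`).

The PBW property gives a linear isomorphism `A ≃ U` (`deformEquiv`). Under it, multiplication by a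
letter in `U` is multiplication in `A` plus terms whose degree is lower by positive multiples of
`N`, because a relation only replaces `r` by the constant `φ r` (`letterOps_deform`). So every
complex attached to `U` is a perturbation of the corresponding complex of `A`. Degrees are bounded
below, hence exactness passes from the leading terms to the perturbed complex by successive
approximation (`GrMod.Perturb.exact_F`, `GrMod.Perturb.exact`). To keep all operators on fixed
spaces, chains live in `M ⊗ T(V)` and cochains in `Hom(T(V), M)`, and the actual terms are
subquotients of these.

The exactness of the bimodule Koszul complex itself is obtained in the same way from the one-sided
one (`LetterOps.tensorExact`). Applied to `Hom(-, Uᵉ)`, the principle yields the vanishing of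
`Extⁱ(U, Uᵉ)` for `i ≠ d`. The resolution is finite because the Koszul complex of `A` is minimal
(`koszulW_eq_bot`).

In degree `d`, `ClassMap.exists_pure` changes the isomorphism of `Extᵈ(A, Aᵉ)` with `A` so that `1`
is the class of a homogeneous cocycle `c`, of degree `l` say. It deforms to a cocycle over `Uᵉ`
(`exists_lift_cocycle`), and perturbing the map `(a, h) ↦ c·a + d h` shows that its multiples
represent every class exactly once. It remains to see that `c·(x ⊗ 1)` and `c·(1 ⊗ x)` are
cohomologous for letters `x`. The leading terms are. The remainder has degree at most `l + 1 - N <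
l`, and below degree `l` every cocycle of `A` is a coboundary, as `A` has no elements of negative
degree (`ClassMap.exists_central_lift`). Here it is essential that the relations are changed by
constants only.

Parts (2) and (3) are proved directly, from one statement about algebras presented by scalar
commutators (`isCalabiYau_of_scalar_commutators`). The elements `x_j ⊗ 1 - 1 ⊗ x_j` commute and
generate the kernel of the multiplication `Bᵉ → B`. If they form a regular sequence, the Koszul
complex on them resolves `B`. Its dual is a Koszul complex for multiplication on the other side, and
the anti-automorphism `x ⊗ y ↦ y ⊗ x` brings its top cohomology back to `B`
(`isCalabiYau_of_regularOps`). Regularity holds because `Bᵉ` is a retract of `k[X] ⊗ B`, with `X_j`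
corresponding to multiplication by the `j`-th difference (`regularOps_envDiff`). -/

theorem exact_of_function_exact {A B C : ModuleCat.{v} E} (f : A ⟶ B) (g : B ⟶ C)
    (h : Function.Exact f.hom g.hom) (w : f ≫ g = 0) : (ShortComplex.mk f g w).Exact := by
  rw [ShortComplex.moduleCat_exact_iff]
  intro x hx
  exact (h x).1 hx

theorem comp_eq_zero_of_exact {A B C : ModuleCat.{v} E} (f : A ⟶ B) (g : B ⟶ C)
    (h : Function.Exact f.hom g.hom) : f ≫ g = 0 := by
  ext x
  exact h.apply_apply_eq_zero x

/-- The projective resolution given by an explicit exact sequence of projective modules. -/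
def mkResolution (hP : ∀ i, Projective (P i)) (hε : Function.Surjective ε.hom)
    (h0 : Function.Exact (d 0).hom ε.hom)
    (h : ∀ i, Function.Exact (d (i + 1)).hom (d i).hom) : ProjectiveResolution X where
  complex := ChainComplex.of P d (fun i => comp_eq_zero_of_exact _ _ (h i))
  projective := hP
  π := (ChainComplex.toSingle₀Equiv _ _).symm ⟨ε, by
    rw [show (ChainComplex.of P d (fun i => comp_eq_zero_of_exact _ _ (h i))).d 1 0 = d 0 from
      ChainComplex.of_d P d 0]
    exact comp_eq_zero_of_exact _ _ h0⟩
  quasiIso := ⟨fun n => by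
    cases n
    · rw [ChainComplex.quasiIsoAt₀_iff, ShortComplex.quasiIso_iff_of_zeros']
      · dsimp
        have hepi : Epi ε := (ModuleCat.epi_iff_surjective ε).2 hε
        refine (ShortComplex.exact_and_epi_g_iff_of_iso ?_).2
          ⟨exact_of_function_exact _ _ h0 (comp_eq_zero_of_exact _ _ h0), hepi⟩
        exact ShortComplex.isoMk (Iso.refl _) (Iso.refl _) (Iso.refl _)
          ((Category.id_comp _).trans
            ((ChainComplex.of_d P d 0).symm.trans (Category.comp_id _).symm))
          ((Category.id_comp _).trans (Eq.trans rfl (Category.comp_id _).symm))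
      all_goals rfl
    · rename_i n
      rw [quasiIsoAt_iff_exactAt']
      · rw [HomologicalComplex.exactAt_iff' _ (n + 1 + 1) (n + 1) n (by simp) (by simp)]
        simp only [HomologicalComplex.sc', HomologicalComplex.shortComplexFunctor',
          ChainComplex.of_d]
        exact exact_of_function_exact _ _ (h n) _
      · apply ChainComplex.exactAt_succ_single_obj⟩

theorem subsingleton_ext_succ_iff {Y : ModuleCat.{v} E} (R : ProjectiveResolution X) (n : ℕ) :
    Subsingleton (Abelian.Ext.{v} X Y (n + 1)) ↔
      ∀ f : R.complex.X (n + 1) ⟶ Y, R.complex.d (n + 2) (n + 1) ≫ f = 0 →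
        ∃ g : R.complex.X n ⟶ Y, R.complex.d (n + 1) n ≫ g = f := by
  constructor
  · intro h f hf
    exact (R.extMk_eq_zero_iff f (n + 2) rfl hf n rfl).1 (Subsingleton.elim _ _)
  · intro h
    refine subsingleton_of_forall_eq 0 fun ξ => ?_
    obtain ⟨f, hf, rfl⟩ := R.extMk_surjective ξ (n + 2) rfl
    exact (R.extMk_eq_zero_iff f (n + 2) rfl hf n rfl).2 (h f hf)

theorem subsingleton_ext_zero_of {Y : ModuleCat.{v} E} (R : ProjectiveResolution X)
    (h : ∀ f : R.complex.X 0 ⟶ Y, R.complex.d 1 0 ≫ f = 0 → f = 0) :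
    Subsingleton (Abelian.Ext.{v} X Y 0) := by
  refine subsingleton_of_forall_eq 0 fun ξ => ?_
  obtain ⟨f, hf, rfl⟩ := R.extMk_surjective ξ 1 rfl
  obtain rfl := h f hf
  exact R.extMk_zero 1 rfl

end Resolution

/-! ### The Calabi–Yau property in terms of an explicit bimodule resolution -/

section Criterion

variable {k : Type u} [Field k] {B : Type v} [Ring B] [Algebra k B]

/-- Right multiplication by `r` on a ring, as a left linear map. -/
def rmul {E : Type v} [Semiring E] (r : E) : E →ₗ[E] E := LinearMap.toSpanSingleton E E r

@[simp]
theorem rmul_apply {E : Type v} [Semiring E] (r x : E) : rmul r x = x * r := rfl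

theorem rmul_mul {E : Type v} [Semiring E] (r s : E) : rmul (r * s) = rmul s ∘ₗ rmul r := by
  ext; simp

theorem rmul_add {E : Type v} [Semiring E] (r s : E) : rmul (r + s) = rmul r + rmul s := by
  ext; simp

theorem rmul_sub {E : Type v} [Ring E] (r s : E) : rmul (r - s) = rmul r - rmul s := by
  ext; simp

variable (k B) in
/-- The multiplication map of the enveloping algebra onto the algebra. -/
def envMul : Env k B →ₗ[Env k B] selfBimodule k B :=
  LinearMap.toSpanSingleton (Env k B) (selfBimodule k B) (id (1 : B) : selfBimodule k B)

theorem envMul_tmul (x y : B) :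
    envMul k B (x ⊗ₜ[k] MulOpposite.op y) = (show selfBimodule k B from x * y) := by
  have := selfBimodule_smul k B x y 1
  rw [mul_one] at this
  exact this

theorem envMul_surjective : Function.Surjective (envMul k B) := fun b =>
  ⟨(id b : B) ⊗ₜ[k] MulOpposite.op 1, by
    rw [envMul_tmul]; exact mul_one (id b : B)⟩

variable {P : ℕ → Type v} [∀ i, AddCommGroup (P i)] [∀ i, Module (Env k B) (P i)]
  (δ : ∀ i, P (i + 1) →ₗ[Env k B] P i) (ε : P 0 →ₗ[Env k B] selfBimodule k B)

/-- The projective resolution of a bimodule given by an explicit exact sequence. -/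
def bimoduleResolution (hP : ∀ i, Module.Projective (Env k B) (P i))
    (hε : Function.Surjective ε) (h0 : Function.Exact (δ 0) ε)
    (h : ∀ i, Function.Exact (δ (i + 1)) (δ i)) : ProjectiveResolution (selfBimodule k B) :=
  mkResolution (fun i => ModuleCat.of (Env k B) (P i)) (fun i => ModuleCat.ofHom (δ i))
    (ConcreteCategory.ofHom (X := ModuleCat.of (Env k B) (P 0)) (Y := selfBimodule k B) ε) (fun i => (IsProjective.iff_projective (P i)).1 (hP i)) hε h0 h

section

variable (hP : ∀ i, Module.Projective (Env k B) (P i))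
    (hε : Function.Surjective ε) (h0 : Function.Exact (δ 0) ε)
    (h : ∀ i, Function.Exact (δ (i + 1)) (δ i))

theorem bimoduleResolution_d (i : ℕ) :
    (bimoduleResolution δ ε hP hε h0 h).complex.d (i + 1) i = ModuleCat.ofHom (δ i) :=
  ChainComplex.of_d (fun i => ModuleCat.of (Env k B) (P i)) (fun i => ModuleCat.ofHom (δ i)) i

theorem bimoduleResolution_d_comp_eq_zero (i : ℕ) {Y : ModuleCat.{v} (Env k B)}
    (f : P i →ₗ[Env k B] Y) :
    (bimoduleResolution δ ε hP hε h0 h).complex.d (i + 1) i ≫ ModuleCat.ofHom f = 0 ↔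
      f ∘ₗ δ i = 0 := by
  rw [bimoduleResolution_d]
  exact ⟨fun hf => congrArg ModuleCat.Hom.hom hf, fun hf => ModuleCat.hom_ext hf⟩

/-- The class in `Ext` of a cocycle. -/
def extClass {Y : ModuleCat.{v} (Env k B)} {i : ℕ} (f : P i →ₗ[Env k B] Y) (hf : f ∘ₗ δ i = 0) :
    Abelian.Ext.{v} (selfBimodule k B) Y i :=
  (bimoduleResolution δ ε hP hε h0 h).extMk (ModuleCat.ofHom f) (i + 1) rfl
    ((bimoduleResolution_d_comp_eq_zero δ ε hP hε h0 h i f).2 hf)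

theorem extClass_surjective {Y : ModuleCat.{v} (Env k B)} {i : ℕ}
    (ξ : Abelian.Ext.{v} (selfBimodule k B) Y i) :
    ∃ (f : P i →ₗ[Env k B] Y) (hf : f ∘ₗ δ i = 0), extClass δ ε hP hε h0 h f hf = ξ := by
  obtain ⟨f, hf, hξ⟩ := (bimoduleResolution δ ε hP hε h0 h).extMk_surjective ξ (i + 1) rfl
  exact ⟨ModuleCat.Hom.hom f,
    (bimoduleResolution_d_comp_eq_zero δ ε hP hε h0 h i (ModuleCat.Hom.hom f)).1 hf, hξ⟩

theorem extClass_add {Y : ModuleCat.{v} (Env k B)} {i : ℕ} (f g : P i →ₗ[Env k B] Y)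
    (hf : f ∘ₗ δ i = 0) (hg : g ∘ₗ δ i = 0) :
    extClass δ ε hP hε h0 h (f + g) (by rw [LinearMap.add_comp, hf, hg, add_zero]) =
      extClass δ ε hP hε h0 h f hf + extClass δ ε hP hε h0 h g hg :=
  (ProjectiveResolution.add_extMk _ _ _ _ _ _ _).symm

theorem extClass_eq_zero_iff {Y : ModuleCat.{v} (Env k B)} {i : ℕ}
    (f : P (i + 1) →ₗ[Env k B] Y) (hf : f ∘ₗ δ (i + 1) = 0) :
    extClass δ ε hP hε h0 h f hf = 0 ↔ ∃ g : P i →ₗ[Env k B] Y, g ∘ₗ δ i = f := by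
  refine (ProjectiveResolution.extMk_eq_zero_iff _ _ _ _ _ i rfl).trans ?_
  rw [bimoduleResolution_d]
  exact ⟨fun ⟨g, hg⟩ => ⟨ModuleCat.Hom.hom g, congrArg ModuleCat.Hom.hom hg⟩,
    fun ⟨g, hg⟩ => ⟨ModuleCat.ofHom g, ModuleCat.hom_ext hg⟩⟩

/-- The class in `Ext(B, Bᵉ)` of a cocycle. -/
def envClass {i : ℕ} (f : P i →ₗ[Env k B] Env k B) (hf : f ∘ₗ δ i = 0) :
    Abelian.Ext.{v} (selfBimodule k B) (envLeft k B) i :=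
  extClass δ ε hP hε h0 h (Y := envLeft k B) f hf

theorem envClass_surjective {i : ℕ} (ξ : Abelian.Ext.{v} (selfBimodule k B) (envLeft k B) i) :
    ∃ (f : P i →ₗ[Env k B] Env k B) (hf : f ∘ₗ δ i = 0), envClass δ ε hP hε h0 h f hf = ξ :=
  extClass_surjective δ ε hP hε h0 h ξ

theorem envClass_add {i : ℕ} (f g : P i →ₗ[Env k B] Env k B) (hf : f ∘ₗ δ i = 0)
    (hg : g ∘ₗ δ i = 0) (hfg : (f + g) ∘ₗ δ i = 0) :
    envClass δ ε hP hε h0 h (f + g) hfg =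
      envClass δ ε hP hε h0 h f hf + envClass δ ε hP hε h0 h g hg :=
  extClass_add δ ε hP hε h0 h (Y := envLeft k B) f g hf hg

theorem envClass_eq_zero_iff {i : ℕ} (f : P (i + 1) →ₗ[Env k B] Env k B)
    (hf : f ∘ₗ δ (i + 1) = 0) :
    envClass δ ε hP hε h0 h f hf = 0 ↔ ∃ g : P i →ₗ[Env k B] Env k B, g ∘ₗ δ i = f :=
  extClass_eq_zero_iff δ ε hP hε h0 h (Y := envLeft k B) f hf

theorem envClass_rightAct {i : ℕ} (f : P i →ₗ[Env k B] Env k B) (hf : f ∘ₗ δ i = 0)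
    (e : Env k B) (hfe : (rmul e ∘ₗ f) ∘ₗ δ i = 0) :
    extRightAct (envClass δ ε hP hε h0 h f hf) e =
      envClass δ ε hP hε h0 h (rmul e ∘ₗ f) hfe :=
  ProjectiveResolution.extMk_comp_mk₀ _ _ _ rfl
    ((bimoduleResolution_d_comp_eq_zero δ ε hP hε h0 h i (Y := envLeft k B) f).2 hf)
    (envRightMul k B e)

end

/-- The cocycle `c` plays the role of the class of `1`. By `hgen` and `hinj` its multiples by `b ⊗
1` represent each class in the critical degree exactly once; `hcent` makes this bijection with `B`
compatible with the right action. Centrality is asked only of generators. -/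
theorem isCalabiYau_of_resolution (hP : ∀ i, Module.Projective (Env k B) (P i))
    (hε : Function.Surjective ε) (h0 : Function.Exact (δ 0) ε)
    (h : ∀ i, Function.Exact (δ (i + 1)) (δ i)) (hfin : ∀ i, Module.Finite (Env k B) (P i))
    (m : ℕ) (hm : ∀ i, m < i → Subsingleton (P i)) (e : ℕ)
    (hzero : ∀ f : P 0 →ₗ[Env k B] Env k B, f ∘ₗ δ 0 = 0 → f = 0)
    (hsucc : ∀ i, i ≠ e → ∀ f : P (i + 1) →ₗ[Env k B] Env k B, f ∘ₗ δ (i + 1) = 0 →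
      ∃ g : P i →ₗ[Env k B] Env k B, g ∘ₗ δ i = f)
    (c : P (e + 1) →ₗ[Env k B] Env k B) (hc : c ∘ₗ δ (e + 1) = 0)
    (hgen : ∀ f : P (e + 1) →ₗ[Env k B] Env k B, f ∘ₗ δ (e + 1) = 0 →
      ∃ (b : B) (g : P e →ₗ[Env k B] Env k B), f = rmul (b ⊗ₜ[k] 1) ∘ₗ c + g ∘ₗ δ e)
    (hinj : ∀ (b : B) (g : P e →ₗ[Env k B] Env k B), rmul (b ⊗ₜ[k] 1) ∘ₗ c = g ∘ₗ δ e → b = 0)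
    (S : Set B) (hS : Algebra.adjoin k S = ⊤)
    (hcent : ∀ x ∈ S, ∃ g : P e →ₗ[Env k B] Env k B,
      rmul (x ⊗ₜ[k] 1) ∘ₗ c - rmul (1 ⊗ₜ[k] MulOpposite.op x) ∘ₗ c = g ∘ₗ δ e) :
    IsCalabiYau k B (e + 1) := by
  -- The elements for which the two multiples of `c` are cohomologous form a subalgebra.
  have hcent' : ∀ x : B, ∃ g : P e →ₗ[Env k B] Env k B,
      rmul (x ⊗ₜ[k] 1) ∘ₗ c - rmul (1 ⊗ₜ[k] MulOpposite.op x) ∘ₗ c = g ∘ₗ δ e := by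
    intro x
    have hx : x ∈ Algebra.adjoin k S := hS ▸ Algebra.mem_top
    induction hx using Algebra.adjoin_induction with
    | mem x hx => exact hcent x hx
    | algebraMap r =>
      refine ⟨0, ?_⟩
      have : (algebraMap k B r ⊗ₜ[k] (1 : Bᵐᵒᵖ) : Env k B) =
          1 ⊗ₜ[k] MulOpposite.op (algebraMap k B r) := by
        rw [Algebra.algebraMap_eq_smul_one, MulOpposite.op_smul, TensorProduct.smul_tmul]
        rfl
      rw [this, LinearMap.zero_comp]
      exact sub_self (rmul (1 ⊗ₜ[k] MulOpposite.op ((algebraMap k B) r)) ∘ₗ c)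
    | add x y _ _ hx hy =>
      obtain ⟨g, hg⟩ := hx
      obtain ⟨g', hg'⟩ := hy
      refine ⟨g + g', ?_⟩
      rw [LinearMap.add_comp, ← hg, ← hg', TensorProduct.add_tmul, MulOpposite.op_add,
        TensorProduct.tmul_add, rmul_add, rmul_add, LinearMap.add_comp, LinearMap.add_comp]
      abel
    | mul x y _ _ hx hy =>
      obtain ⟨g, hg⟩ := hx
      obtain ⟨g', hg'⟩ := hy
      -- The chain is `c·(xy ⊗ 1) ∼ c·(y ⊗ x) ∼ c·(1 ⊗ xy)`.
      refine ⟨rmul (y ⊗ₜ[k] 1) ∘ₗ g + rmul (1 ⊗ₜ[k] MulOpposite.op x) ∘ₗ g', ?_⟩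
      rw [LinearMap.add_comp, LinearMap.comp_assoc, LinearMap.comp_assoc, ← hg, ← hg',
        LinearMap.comp_sub, LinearMap.comp_sub]
      simp only [← LinearMap.comp_assoc, ← rmul_mul, Algebra.TensorProduct.tmul_mul_tmul, one_mul,
        mul_one, MulOpposite.op_mul]
      abel
  have hcoc : ∀ r : Env k B, (rmul r ∘ₗ c) ∘ₗ δ (e + 1) = 0 := fun r => by
    rw [LinearMap.comp_assoc, hc, LinearMap.comp_zero]
  let Ψ : B →+ Abelian.Ext.{v} (selfBimodule k B) (envLeft k B) (e + 1) :=
    AddMonoidHom.mk' (fun b => envClass δ ε hP hε h0 h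
      (rmul (b ⊗ₜ[k] 1) ∘ₗ c) (hcoc _)) (fun b b' => by
        rw [← envClass_add δ ε hP hε h0 h _ _ _ _
          (by rw [LinearMap.add_comp, hcoc, hcoc, add_zero])]
        congr 1
        rw [TensorProduct.add_tmul, rmul_add, LinearMap.add_comp])
  have hΨ : ∀ b, Ψ b = envClass δ ε hP hε h0 h
      (rmul (b ⊗ₜ[k] 1) ∘ₗ c) (hcoc _) := fun _ => rfl
  have hclass : ∀ (f f' : P (e + 1) →ₗ[Env k B] Env k B) (hf : f ∘ₗ δ (e + 1) = 0)
      (hf' : f' ∘ₗ δ (e + 1) = 0) (g : P e →ₗ[Env k B] Env k B), f = f' + g ∘ₗ δ e →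
      envClass δ ε hP hε h0 h f hf =
        envClass δ ε hP hε h0 h f' hf' := by
    rintro f f' hf hf' g rfl
    have hg : (g ∘ₗ δ e) ∘ₗ δ (e + 1) = 0 := by
      have h3 := hf
      rwa [LinearMap.add_comp, hf', zero_add] at h3
    have h1 := envClass_add δ ε hP hε h0 h f' (g ∘ₗ δ e) hf' hg hf
    have h2 := (envClass_eq_zero_iff δ ε hP hε h0 h (g ∘ₗ δ e) hg).2 ⟨g, rfl⟩
    exact h1.trans ((congrArg _ h2).trans (add_zero _))
  have hbij : Function.Bijective Ψ := by
    constructor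
    · rw [injective_iff_map_eq_zero]
      intro b hb
      obtain ⟨g, hg⟩ := (envClass_eq_zero_iff δ ε hP hε h0 h _ (hcoc _)).1 hb
      exact hinj b g hg.symm
    · intro ξ
      obtain ⟨f, hf, rfl⟩ := envClass_surjective δ ε hP hε h0 h ξ
      obtain ⟨b, g, hfg⟩ := hgen f hf
      exact ⟨b, (hclass _ _ hf (hcoc _) g hfg).symm⟩
  refine ⟨Nat.le_add_left 1 e, ⟨bimoduleResolution δ ε hP hε h0 h, hfin, m, fun i hi => ?_⟩, ?_, ?_⟩
  · have := hm i hi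
    exact ModuleCat.isZero_of_subsingleton (ModuleCat.of (Env k B) (P i))
  · rintro (_ | i) hi
    · refine subsingleton_ext_zero_of (bimoduleResolution δ ε hP hε h0 h) fun f hf => ?_
      refine ModuleCat.hom_ext (hzero (ModuleCat.Hom.hom f) ?_)
      exact (bimoduleResolution_d_comp_eq_zero δ ε hP hε h0 h 0
        (ModuleCat.Hom.hom f)).1 hf
    · refine subsingleton_of_forall_eq 0 fun ξ => ?_
      obtain ⟨f, hf, rfl⟩ := envClass_surjective δ ε hP hε h0 h ξ
      exact (envClass_eq_zero_iff δ ε hP hε h0 h f hf).2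
        (hsucc i (fun hie => hi (by rw [hie])) f hf)
  · refine ⟨(AddEquiv.ofBijective Ψ hbij).symm, fun ξ x y => ?_⟩
    obtain ⟨b, rfl⟩ := hbij.2 ξ
    rw [AddEquiv.symm_apply_eq, show (AddEquiv.ofBijective Ψ hbij).symm (Ψ b) = b from
      (AddEquiv.ofBijective Ψ hbij).symm_apply_apply b]
    change extRightAct (Ψ b) _ = Ψ (y * b * x)
    have hcoc' : (rmul (x ⊗ₜ[k] MulOpposite.op y) ∘ₗ (rmul (b ⊗ₜ[k] 1) ∘ₗ c)) ∘ₗ δ (e + 1) = 0 := by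
      rw [← LinearMap.comp_assoc, ← rmul_mul, hcoc]
    rw [hΨ, hΨ, envClass_rightAct δ ε hP hε h0 h _ (hcoc _) _ hcoc']
    -- Since `(b ⊗ 1)(x ⊗ y) = (1 ⊗ y)(bx ⊗ 1)`, replacing `c·(1 ⊗ y)` by `c·(y ⊗ 1)` turns the
    -- class into that of `c·(ybx ⊗ 1)`.
    obtain ⟨g, hg⟩ := hcent' y
    refine hclass _ _ _ _ (-(rmul ((b * x) ⊗ₜ[k] 1) ∘ₗ g)) ?_
    rw [LinearMap.neg_comp, LinearMap.comp_assoc, ← hg, LinearMap.comp_sub]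
    simp only [← LinearMap.comp_assoc, ← rmul_mul, Algebra.TensorProduct.tmul_mul_tmul, one_mul,
      mul_one, mul_assoc]
    abel

/-! ### Consequences of the Calabi–Yau property for an arbitrary explicit resolution -/

section Converse

variable (hP : ∀ i, Module.Projective (Env k B) (P i))
    (hε : Function.Surjective ε) (h0 : Function.Exact (δ 0) ε)
    (h : ∀ i, Function.Exact (δ (i + 1)) (δ i))


/-- Such an `f` kills the kernel of the augmentation and factors through `B`; as `d ≥ 1`, there is
no nonzero bimodule map `B → Bᵉ`. -/
theorem IsCalabiYau.eq_zero_of_comp_eq_zero {d : ℕ} (hCY : IsCalabiYau k B d)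
    (hε : Function.Surjective ε) (h0 : Function.Exact (δ 0) ε)
    (f : P 0 →ₗ[Env k B] Env k B) (hf : f ∘ₗ δ 0 = 0) : f = 0 := by
  have hker : LinearMap.ker ε ≤ LinearMap.ker f := by
    intro x hx
    obtain ⟨y, rfl⟩ := (h0 x).1 hx
    exact LinearMap.congr_fun hf y
  let g : selfBimodule k B →ₗ[Env k B] Env k B :=
    (LinearMap.ker ε).liftQ f hker ∘ₗ (ε.quotKerEquivOfSurjective hε).symm.toLinearMap
  have hg : ∀ x, g (ε x) = f x := by
    intro x
    have : (ε.quotKerEquivOfSurjective hε).symm (ε x) = (LinearMap.ker ε).mkQ x := by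
      rw [LinearEquiv.symm_apply_eq]
      rfl
    simp only [g, LinearMap.comp_apply, LinearEquiv.coe_coe, this]
    rfl
  have hsub := hCY.ext_eq_zero 0 (by have := hCY.one_le; omega)
  have hmk : Abelian.Ext.mk₀ (C := ModuleCat.{v} (Env k B)) (X := selfBimodule k B)
      (Y := envLeft k B) (ConcreteCategory.ofHom (X := selfBimodule k B) (Y := envLeft k B) g) = 0 :=
    Subsingleton.elim _ _
  rw [Abelian.Ext.mk₀_eq_zero_iff] at hmk
  ext x
  rw [← hg x]
  exact LinearMap.congr_fun (congrArg ModuleCat.Hom.hom hmk) (ε x)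

include hP hε h0 h in
theorem IsCalabiYau.exists_comp_eq {d : ℕ} (hCY : IsCalabiYau k B d) (i : ℕ) (hi : i + 1 ≠ d)
    (f : P (i + 1) →ₗ[Env k B] Env k B) (hf : f ∘ₗ δ (i + 1) = 0) :
    ∃ g : P i →ₗ[Env k B] Env k B, g ∘ₗ δ i = f := by
  have hsub := hCY.ext_eq_zero (i + 1) hi
  exact (envClass_eq_zero_iff δ ε hP hε h0 h f hf).1 (Subsingleton.elim _ _)

include hP hε h0 h in
theorem IsCalabiYau.exists_classMap {e : ℕ} (hCY : IsCalabiYau k B (e + 1)) :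
    ∃ θ : (P (e + 1) →ₗ[Env k B] Env k B) → B,
      (∀ f g, f ∘ₗ δ (e + 1) = 0 → g ∘ₗ δ (e + 1) = 0 → θ (f + g) = θ f + θ g) ∧
      (∀ f, f ∘ₗ δ (e + 1) = 0 → (θ f = 0 ↔ ∃ g : P e →ₗ[Env k B] Env k B, g ∘ₗ δ e = f)) ∧
      (∀ f, f ∘ₗ δ (e + 1) = 0 → ∀ x y : B,
        θ (rmul (x ⊗ₜ[k] MulOpposite.op y) ∘ₗ f) = y * θ f * x) ∧
      ∀ b, ∃ f, f ∘ₗ δ (e + 1) = 0 ∧ θ f = b := by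
  classical
  obtain ⟨Φ, hΦ⟩ := hCY.ext_iso
  let θ : (P (e + 1) →ₗ[Env k B] Env k B) → B := fun f =>
    if hf : f ∘ₗ δ (e + 1) = 0 then Φ (envClass δ ε hP hε h0 h f hf) else 0
  have hθ : ∀ f (hf : f ∘ₗ δ (e + 1) = 0), θ f = Φ (envClass δ ε hP hε h0 h f hf) :=
    fun f hf => dif_pos hf
  refine ⟨θ, fun f g hf hg => ?_, fun f hf => ?_, fun f hf x y => ?_, fun b => ?_⟩
  · have hfg : (f + g) ∘ₗ δ (e + 1) = 0 := by rw [LinearMap.add_comp, hf, hg, add_zero]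
    rw [hθ f hf, hθ g hg, hθ _ hfg, envClass_add δ ε hP hε h0 h f g hf hg hfg, map_add]
  · rw [hθ f hf, EmbeddingLike.map_eq_zero_iff, envClass_eq_zero_iff]
  · have hfe : (rmul (x ⊗ₜ[k] MulOpposite.op y) ∘ₗ f) ∘ₗ δ (e + 1) = 0 := by
      rw [LinearMap.comp_assoc, hf, LinearMap.comp_zero]
    rw [hθ f hf, hθ _ hfe, ← envClass_rightAct δ ε hP hε h0 h f hf _ hfe, hΦ]
  · obtain ⟨f, hf, hfb⟩ := envClass_surjective δ ε hP hε h0 h (Φ.symm b)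
    exact ⟨f, hf, by rw [hθ f hf, hfb, AddEquiv.apply_symm_apply]⟩

include hP hε h0 h in
-- Ext may be computed on either resolution, and on the finite one it vanishes in large degrees for
-- all coefficients.
theorem HasFiniteBimoduleResolution.exists_comp_eq (hB : HasFiniteBimoduleResolution k B) :
    ∃ m : ℕ, ∀ i, m ≤ i → ∀ (Y : Type v) [AddCommGroup Y] [Module (Env k B) Y]
      (f : P (i + 1) →ₗ[Env k B] Y), f ∘ₗ δ (i + 1) = 0 →
        ∃ g : P i →ₗ[Env k B] Y, g ∘ₗ δ i = f := by
  obtain ⟨Q, -, m, hm⟩ := hB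
  refine ⟨m, fun i hi Y _ _ f hf => ?_⟩
  refine (extClass_eq_zero_iff δ ε hP hε h0 h (Y := ModuleCat.of (Env k B) Y) f hf).1 ?_
  have hsub : Subsingleton (Abelian.Ext.{v} (selfBimodule k B) (ModuleCat.of (Env k B) Y)
      (i + 1)) := (subsingleton_ext_succ_iff Q i).2 fun f _ =>
    ⟨0, (hm (i + 1) (by omega)).eq_of_src _ _⟩
  exact Subsingleton.elim _ _

end Converse

end Criterion
end
end NKoszulCY

namespace NKoszulCY
noncomputable section

/-! ### Exactness of perturbations of graded complexes -/

section Perturbation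

/-- A grading with bounded below degrees on the subquotient `one ⧸ zero` of a vector space. -/
structure GrMod (k : Type u) [Field k] (Y : Type v) [AddCommGroup Y] [Module k Y] where
  proj : ℤ → Y →ₗ[k] Y
  one : Submodule k Y
  zero : Submodule k Y
  zero_le : zero ≤ one
  proj_proj_self : ∀ i y, proj i (proj i y) = proj i y
  proj_proj_of_ne : ∀ i j y, i ≠ j → proj i (proj j y) = 0
  proj_mem_one : ∀ i, ∀ y ∈ one, proj i y ∈ one
  proj_mem_zero : ∀ i, ∀ y ∈ zero, proj i y ∈ zero
  exists_sum : ∀ y ∈ one, ∃ s : Finset ℤ, y - ∑ i ∈ s, proj i y ∈ zero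
  bdd : ∃ b : ℤ, ∀ i < b, ∀ y ∈ one, proj i y ∈ zero

namespace GrMod

variable {k : Type u} [Field k]
  {W : Type*} [AddCommGroup W] [Module k W] {X : Type*} [AddCommGroup X] [Module k X]
  {Y : Type*} [AddCommGroup Y] [Module k Y] {Z : Type*} [AddCommGroup Z] [Module k Z]
  (GW : GrMod k W) (GX : GrMod k X) (GY : GrMod k Y) (GZ : GrMod k Z) (N : ℕ)

/-- The elements whose components have degrees `≤ n` and congruent to `n` modulo `N`. -/
def F (n : ℤ) : Submodule k Y where
  carrier := {y | y ∈ GY.one ∧ ∀ j, ¬ (j ≤ n ∧ (N : ℤ) ∣ n - j) → GY.proj j y ∈ GY.zero}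
  add_mem' := fun ha hb => ⟨GY.one.add_mem ha.1 hb.1, fun j hj => by
    rw [map_add]; exact GY.zero.add_mem (ha.2 j hj) (hb.2 j hj)⟩
  zero_mem' := ⟨GY.one.zero_mem, fun j _ => by rw [map_zero]; exact GY.zero.zero_mem⟩
  smul_mem' := fun c x hx => ⟨GY.one.smul_mem c hx.1, fun j hj => by
    rw [map_smul]; exact GY.zero.smul_mem c (hx.2 j hj)⟩

theorem mem_F {n : ℤ} {y : Y} : y ∈ GY.F N n ↔
    y ∈ GY.one ∧ ∀ j, ¬ (j ≤ n ∧ (N : ℤ) ∣ n - j) → GY.proj j y ∈ GY.zero := Iff.rfl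

theorem zero_le_F (n : ℤ) : GY.zero ≤ GY.F N n :=
  fun _ hy => ⟨GY.zero_le hy, fun j _ => GY.proj_mem_zero j _ hy⟩

theorem F_le_of_dvd {m n : ℤ} (h : m ≤ n) (hN : (N : ℤ) ∣ n - m) : GY.F N m ≤ GY.F N n :=
  fun _ hy => ⟨hy.1, fun j hj => hy.2 j fun hj' => hj ⟨hj'.1.trans h, by
    have := dvd_add hN hj'.2
    rwa [sub_add_sub_cancel] at this⟩⟩

theorem F_sub_le (n : ℤ) : GY.F N (n - N) ≤ GY.F N n :=
  GY.F_le_of_dvd N (by omega) (by simp)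

theorem F_one_mono {m n : ℤ} (h : m ≤ n) : GY.F 1 m ≤ GY.F 1 n :=
  GY.F_le_of_dvd 1 h (by simp)

theorem F_le_F_one (n : ℤ) : GY.F N n ≤ GY.F 1 n :=
  fun _ hy => ⟨hy.1, fun j hj => hy.2 j fun hj' => hj ⟨hj'.1, by simp⟩⟩

theorem mem_F_of_pure {n : ℤ} {y : Y} (hy : y ∈ GY.one) (h : GY.proj n y = y) :
    y ∈ GY.F N n := by
  refine ⟨hy, fun j hj => ?_⟩
  have hjn : j ≠ n := fun h' => hj ⟨h'.le, by simp [h']⟩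
  rw [← h, GY.proj_proj_of_ne j n y hjn]
  exact GY.zero.zero_mem

/-- A degree below `n` and congruent to `n` modulo `N` is at most `n - N`. -/
theorem sub_proj_mem_F {n : ℤ} {y : Y} (hy : y ∈ GY.F N n) :
    y - GY.proj n y ∈ GY.F N (n - N) := by
  refine ⟨GY.one.sub_mem hy.1 (GY.proj_mem_one n y hy.1), fun j hj => ?_⟩
  rw [map_sub]
  by_cases hjn : j = n
  · subst hjn
    rw [GY.proj_proj_self, sub_self]
    exact GY.zero.zero_mem
  · rw [GY.proj_proj_of_ne j n y hjn, sub_zero]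
    refine hy.2 j fun hj' => hj ⟨?_, ?_⟩
    · have := Int.le_of_dvd (by omega) hj'.2
      omega
    · have := dvd_sub hj'.2 (dvd_refl (N : ℤ))
      rwa [show n - j - (N : ℤ) = n - N - j by ring] at this

theorem mem_zero_of_forall_proj {y : Y} (hy : y ∈ GY.one) (h : ∀ j, GY.proj j y ∈ GY.zero) :
    y ∈ GY.zero := by
  obtain ⟨s, hs⟩ := GY.exists_sum y hy
  have := GY.zero.add_mem hs (GY.zero.sum_mem (t := s) fun i _ => h i)
  rwa [sub_add_cancel] at this

/-- This is what makes successive approximation stop. -/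
theorem exists_F_le_zero : ∃ b : ℤ, ∀ n < b, ∀ N, GY.F N n ≤ GY.zero := by
  obtain ⟨b, hb⟩ := GY.bdd
  refine ⟨b, fun n hn N y hy => GY.mem_zero_of_forall_proj hy.1 fun j => ?_⟩
  by_cases hj : j ≤ n ∧ (N : ℤ) ∣ n - j
  · exact hb j (by omega) y hy.1
  · exact hy.2 j hj

/-- Step `1` is needed: an element with components in several residue classes modulo `N` lies in no
`F N n`. Hence both `F N`, for sharp degree estimates, and `F 1`, for arbitrary elements, are used
later. -/
theorem exists_mem_F {y : Y} (hy : y ∈ GY.one) : ∃ n, y ∈ GY.F 1 n := by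
  obtain ⟨s, hs⟩ := GY.exists_sum y hy
  obtain ⟨n, hn⟩ : ∃ n : ℤ, ∀ j ∈ s, j ≤ n := s.exists_le
  refine ⟨n, hy, fun j hj => ?_⟩
  have hjs : j ∉ s := fun h' => hj ⟨hn j h', by simp⟩
  have := GY.proj_mem_zero j _ hs
  rw [map_sub, map_sum, Finset.sum_eq_zero, sub_zero] at this
  · exact this
  · intro i hi
    exact GY.proj_proj_of_ne j i y (fun h' => hjs (h' ▸ hi))

variable {GW GX GY GZ N}

/-- `f` is a perturbation of the homogeneous map `f₀` by terms of lower degree. -/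
structure Perturb (GX : GrMod k X) (GY : GrMod k Y) (N : ℕ) (f₀ f : X →ₗ[k] Y) : Prop where
  homog : ∀ n x, GY.proj n (f₀ x) = f₀ (GX.proj n x)
  map_one₀ : ∀ x ∈ GX.one, f₀ x ∈ GY.one
  map_zero₀ : ∀ x ∈ GX.zero, f₀ x ∈ GY.zero
  map_zero : ∀ x ∈ GX.zero, f x ∈ GY.zero
  lower : ∀ n, ∀ x ∈ GX.F N n, f x - f₀ x ∈ GY.F N (n - N)

namespace Perturb

variable {f₀ f : X →ₗ[k] Y} {g₀ g : Y →ₗ[k] Z} {e₀ e : W →ₗ[k] X}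

/-- The correction step: a leading term is removed. -/
theorem step (hf : Perturb GX GY N f₀ f) (hg : Perturb GY GZ N g₀ g) {n : ℤ} (hN : 1 ≤ N)
    (hex : ∀ y ∈ GY.one, GY.proj n y = y → g₀ y ∈ GZ.zero → ∃ x ∈ GX.one, y - f₀ x ∈ GY.zero)
    {y : Y} (hy : y ∈ GY.F N n) (hgy : g y ∈ GZ.F N (n - N)) :
    ∃ x ∈ GX.F N n, y - f x ∈ GY.F N (n - N) := by
  -- Both `g y` and `g y - g₀ y` lie in `F N (n - N)`, so `g₀ y` has no component of degree `n`.
  have h1 : g₀ (GY.proj n y) ∈ GZ.zero := by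
    rw [← hg.homog]
    have h2 := (GZ.F N (n - N)).sub_mem hgy (hg.lower n y hy)
    rw [sub_sub_cancel] at h2
    exact h2.2 n fun h' => by omega
  obtain ⟨x, hx, hxy⟩ := hex _ (GY.proj_mem_one n y hy.1) (GY.proj_proj_self n y) h1
  -- Only the component of degree `n` of the preimage is kept; its filtration degree controls the
  -- error `f x - f₀ x`.
  have hx' : GX.proj n x ∈ GX.F N n :=
    GX.mem_F_of_pure N (GX.proj_mem_one n x hx) (GX.proj_proj_self n x)
  refine ⟨GX.proj n x, hx', ?_⟩
  have h3 : GY.proj n y - f₀ (GX.proj n x) ∈ GY.zero := by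
    have := GY.proj_mem_zero n _ hxy
    rwa [map_sub, GY.proj_proj_self, hf.homog] at this
  have h4 : y - f (GX.proj n x) = (y - GY.proj n y) + (GY.proj n y - f₀ (GX.proj n x))
      - (f (GX.proj n x) - f₀ (GX.proj n x)) := by abel
  rw [h4]
  exact Submodule.sub_mem _ (Submodule.add_mem _ (GY.sub_proj_mem_F N hy)
    (GY.zero_le_F N _ h3)) (hf.lower n _ hx')

/-- Successive approximation: each correction lowers the filtration by `N`. Exactness of the leading
complex is used in degrees `≤ n` only, which matters in the top cohomology, where it holds only
below the degree of the generator. -/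
theorem exact_F (hf : Perturb GX GY N f₀ f) (hg : Perturb GY GZ N g₀ g) (hN : 1 ≤ N)
    (hgf : ∀ x ∈ GX.one, g (f x) ∈ GZ.zero) {n : ℤ}
    (hex : ∀ j ≤ n, ∀ y ∈ GY.one, GY.proj j y = y → g₀ y ∈ GZ.zero →
      ∃ x ∈ GX.one, y - f₀ x ∈ GY.zero)
    {y : Y} (hy : y ∈ GY.F N n) (hgy : g y ∈ GZ.zero) :
    ∃ x ∈ GX.F N n, y - f x ∈ GY.zero := by
  obtain ⟨b, hb⟩ := GY.exists_F_le_zero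
  obtain ⟨m, hm⟩ : ∃ m : ℕ, n - m < b := ⟨(n - b).toNat + 1, by omega⟩
  induction m using Nat.strong_induction_on generalizing n y with
  | _ m ih =>
    by_cases hnb : n < b
    · exact ⟨0, Submodule.zero_mem _, by
        rw [_root_.map_zero, sub_zero]; exact hb n hnb N hy⟩
    · obtain ⟨x, hx, hxy⟩ := hf.step hg hN (hex n le_rfl) hy (GZ.zero_le_F N _ hgy)
      obtain ⟨x', hx', hxy'⟩ := ih (m - N) (by omega) (n := n - N)
        (fun j hj => hex j (by omega)) hxy (by
          rw [map_sub]
          exact GZ.zero.sub_mem hgy (hgf x hx.1)) (by omega)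
      refine ⟨x + x', Submodule.add_mem _ hx (GX.F_sub_le N n hx'), ?_⟩
      rwa [map_add, ← sub_sub]

theorem exact (hf : Perturb GX GY 1 f₀ f) (hg : Perturb GY GZ 1 g₀ g)
    (hgf : ∀ x ∈ GX.one, g (f x) ∈ GZ.zero)
    (hex : ∀ y ∈ GY.one, g₀ y ∈ GZ.zero → ∃ x ∈ GX.one, y - f₀ x ∈ GY.zero)
    {y : Y} (hy : y ∈ GY.one) (hgy : g y ∈ GZ.zero) :
    ∃ x ∈ GX.one, y - f x ∈ GY.zero := by
  obtain ⟨n, hn⟩ := GY.exists_mem_F hy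
  obtain ⟨x, hx, hxy⟩ := exact_F hf hg le_rfl hgf (fun j _ y hy _ => hex y hy) hn hgy
  exact ⟨x, hx.1, hxy⟩

end Perturb

end GrMod

end Perturbation
end
end NKoszulCY

namespace NKoszulCY
noncomputable section

/-! ### Contractions of tensors at either end, and the spaces `W_m` -/

section Contraction

variable {k : Type u} [Field k] {V : Type v} [AddCommGroup V] [Module k V]

/-- Letting `t` act on `(1, 0)` and applying `glue` returns `t`, so every tensor is a constant plus
a sum of products `v * s`. -/
theorem tensor_left_induction {Q : TensorAlgebra k V → Prop}
    (h0 : ∀ c : k, Q (algebraMap k _ c))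
    (h1 : ∀ (v : V) (t : TensorAlgebra k V), Q (TensorAlgebra.ι k v * t))
    (hadd : ∀ a b, Q a → Q b → Q (a + b)) (t : TensorAlgebra k V) : Q t := by
  have h := glue_lift_prepend t ((1, 0) : k × (V ⊗[k] TensorAlgebra k V))
  have h1' : glue k V ((1, 0) : k × (V ⊗[k] TensorAlgebra k V)) = 1 := by simp [glue]
  rw [h1', mul_one] at h
  rw [← h, glue, LinearMap.coprod_apply]
  refine hadd _ _ (h0 _) ?_
  generalize (TensorAlgebra.lift k (prepend k V) t (1, 0)).2 = z
  induction z using TensorProduct.induction_on with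
  | zero => rw [map_zero]; simpa using h0 0
  | tmul v s => exact h1 v s
  | add a b ha hb => rw [map_add]; exact hadd _ _ ha hb

/-- Contraction of the first letter with a linear form. -/
def lcontr (ξ : V →ₗ[k] k) : TensorAlgebra k V →ₗ[k] TensorAlgebra k V :=
  (TensorProduct.lid k (TensorAlgebra k V)).toLinearMap ∘ₗ
    LinearMap.rTensor (TensorAlgebra k V) ξ ∘ₗ splitLeft k V

theorem lcontr_ι_mul (ξ : V →ₗ[k] k) (v : V) (t : TensorAlgebra k V) :
    lcontr ξ (TensorAlgebra.ι k v * t) = ξ v • t := by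
  simp [lcontr, splitLeft_ι_mul]

theorem lcontr_algebraMap (ξ : V →ₗ[k] k) (c : k) :
    lcontr ξ (algebraMap k (TensorAlgebra k V) c) = 0 := by
  simp [lcontr, splitLeft_algebraMap]

variable (k V) in
/-- The reversal of words. -/
def wordRev : TensorAlgebra k V →ₗ[k] TensorAlgebra k V :=
  (MulOpposite.opLinearEquiv k).symm.toLinearMap ∘ₗ
    (TensorAlgebra.lift k ((MulOpposite.opLinearEquiv k).toLinearMap ∘ₗ
      TensorAlgebra.ι k) : TensorAlgebra k V →ₐ[k] (TensorAlgebra k V)ᵐᵒᵖ).toLinearMap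

theorem wordRev_mul (a b : TensorAlgebra k V) :
    wordRev k V (a * b) = wordRev k V b * wordRev k V a := by
  simp [wordRev]

theorem wordRev_ι (v : V) : wordRev k V (TensorAlgebra.ι k v) = TensorAlgebra.ι k v := by
  simp [wordRev]

theorem wordRev_algebraMap (c : k) : wordRev k V (algebraMap k _ c) = algebraMap k _ c := by
  simp [wordRev]

theorem wordRev_wordRev (t : TensorAlgebra k V) : wordRev k V (wordRev k V t) = t := by
  induction t using TensorAlgebra.induction with
  | algebraMap r => simp [wordRev_algebraMap]
  | ι v => simp [wordRev_ι]
  | mul a b ha hb => simp [wordRev_mul, ha, hb]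
  | add a b ha hb => simp [ha, hb]

theorem tensor_right_induction {Q : TensorAlgebra k V → Prop}
    (h0 : ∀ c : k, Q (algebraMap k _ c))
    (h1 : ∀ (v : V) (t : TensorAlgebra k V), Q (t * TensorAlgebra.ι k v))
    (hadd : ∀ a b, Q a → Q b → Q (a + b)) (t : TensorAlgebra k V) : Q t := by
  have : Q (wordRev k V (wordRev k V t)) := by
    refine tensor_left_induction (Q := fun s => Q (wordRev k V s)) ?_ ?_ ?_ (wordRev k V t)
    · intro c; simpa [wordRev_algebraMap] using h0 c
    · intro v t; simpa [wordRev_mul, wordRev_ι] using h1 v _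
    · intro a b ha hb; simpa using hadd _ _ ha hb
  rwa [wordRev_wordRev] at this

/-- Contraction of the last letter with a linear form. -/
def rcontr (ξ : V →ₗ[k] k) : TensorAlgebra k V →ₗ[k] TensorAlgebra k V :=
  wordRev k V ∘ₗ lcontr ξ ∘ₗ wordRev k V

theorem rcontr_mul_ι (ξ : V →ₗ[k] k) (v : V) (t : TensorAlgebra k V) :
    rcontr ξ (t * TensorAlgebra.ι k v) = ξ v • t := by
  simp [rcontr, wordRev_mul, wordRev_ι, lcontr_ι_mul, wordRev_wordRev]

theorem rcontr_algebraMap (ξ : V →ₗ[k] k) (c : k) :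
    rcontr ξ (algebraMap k (TensorAlgebra k V) c) = 0 := by
  simp [rcontr, wordRev_algebraMap, lcontr_algebraMap]

/-- The last letter of `v * t` is the last letter of `t`, except on the constant term of `t`, where
it is `v` itself. -/
theorem rcontr_ι_mul (ξ : V →ₗ[k] k) (v : V) (t : TensorAlgebra k V) :
    rcontr ξ (TensorAlgebra.ι k v * t) = TensorAlgebra.ι k v * rcontr ξ t +
      algebraMap k _ (ξ v * TensorAlgebra.algebraMapInv t) := by
  induction t using tensor_right_induction with
  | h0 c =>
    have h1 := rcontr_mul_ι ξ v (algebraMap k _ c)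
    rw [← Algebra.commutes] at *
    simp [h1, rcontr_algebraMap, TensorAlgebra.algebraMap_leftInverse V c, Algebra.smul_def]
  | h1 w t =>
    rw [← mul_assoc, rcontr_mul_ι, rcontr_mul_ι]
    simp [TensorAlgebra.algebraMapInv]
  | hadd a b ha hb =>
    rw [mul_add, map_add, ha, hb]
    simp only [map_add, mul_add]
    abel

/-- On longer words the first and the last letter are different; on a single letter both sides
vanish, because one contraction leaves a constant. -/
theorem lcontr_rcontr (ξ η : V →ₗ[k] k) (t : TensorAlgebra k V) :
    lcontr ξ (rcontr η t) = rcontr η (lcontr ξ t) := by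
  induction t using tensor_left_induction with
  | h0 c => simp [rcontr_algebraMap, lcontr_algebraMap]
  | h1 v t => rw [rcontr_ι_mul, map_add, lcontr_ι_mul, lcontr_ι_mul, lcontr_algebraMap, map_smul,
      add_zero]
  | hadd a b ha hb => simp only [map_add, ha, hb]

variable {ι : Type*} [Fintype ι] (e : Module.Basis ι k V)

theorem sum_ι_mul_lcontr (t : TensorAlgebra k V) :
    algebraMap k _ (TensorAlgebra.algebraMapInv t) +
      ∑ i, TensorAlgebra.ι k (e i) * lcontr (e.coord i) t = t := by
  induction t using tensor_left_induction with
  | h0 c => simp [lcontr_algebraMap, TensorAlgebra.algebraMap_leftInverse V c]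
  | h1 v t =>
    simp only [lcontr_ι_mul, mul_smul_comm, ← smul_mul_assoc, ← Finset.sum_mul, ← map_smul,
      ← map_sum, Module.Basis.coord_apply, e.sum_repr]
    simp [TensorAlgebra.algebraMapInv]
  | hadd a b ha hb =>
    conv_rhs => rw [← ha, ← hb]
    simp only [map_add, mul_add, Finset.sum_add_distrib]
    abel

theorem sum_rcontr_mul_ι (t : TensorAlgebra k V) :
    algebraMap k _ (TensorAlgebra.algebraMapInv t) +
      ∑ i, rcontr (e.coord i) t * TensorAlgebra.ι k (e i) = t := by
  induction t using tensor_right_induction with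
  | h0 c => simp [rcontr_algebraMap, TensorAlgebra.algebraMap_leftInverse V c]
  | h1 v t =>
    simp only [rcontr_mul_ι, smul_mul_assoc, ← mul_smul_comm, ← Finset.mul_sum, ← map_smul,
      ← map_sum, Module.Basis.coord_apply, e.sum_repr]
    simp [TensorAlgebra.algebraMapInv]
  | hadd a b ha hb =>
    conv_rhs => rw [← ha, ← hb]
    simp only [map_add, add_mul, Finset.sum_add_distrib]
    abel

theorem lcontr_mem_of_mem_range_mul (ξ : V →ₗ[k] k) (S : Submodule k (TensorAlgebra k V))
    {t : TensorAlgebra k V} (ht : t ∈ LinearMap.range (TensorAlgebra.ι k : V →ₗ[k] _) * S) :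
    lcontr ξ t ∈ S := by
  induction ht using Submodule.mul_induction_on' with
  | mem_mul_mem m hm n hn =>
    obtain ⟨v, rfl⟩ := hm
    rw [lcontr_ι_mul]
    exact S.smul_mem _ hn
  | add x _ y _ hx hy => rw [map_add]; exact S.add_mem hx hy

theorem rcontr_mem_of_mem_mul_range (ξ : V →ₗ[k] k) (S : Submodule k (TensorAlgebra k V))
    {t : TensorAlgebra k V} (ht : t ∈ S * LinearMap.range (TensorAlgebra.ι k : V →ₗ[k] _)) :
    rcontr ξ t ∈ S := by
  induction ht using Submodule.mul_induction_on' with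
  | mem_mul_mem m hm n hn =>
    obtain ⟨v, rfl⟩ := hn
    rw [rcontr_mul_ι]
    exact S.smul_mem _ hm
  | add x _ y _ hx hy => rw [map_add]; exact S.add_mem hx hy

variable (k V) in
theorem tpow_zero : tpow k V 0 = 1 := pow_zero _

variable (k V) in
theorem tpow_one : tpow k V 1 = LinearMap.range (TensorAlgebra.ι k : V →ₗ[k] _) := pow_one _

variable (k V) in
theorem tpow_add (m n : ℕ) : tpow k V (m + n) = tpow k V m * tpow k V n := pow_add _ _ _

theorem ι_mem_tpow (v : V) : TensorAlgebra.ι k v ∈ tpow k V 1 := by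
  rw [tpow_one]; exact ⟨v, rfl⟩

theorem mul_mem_tpow {m n : ℕ} {a b : TensorAlgebra k V} (ha : a ∈ tpow k V m)
    (hb : b ∈ tpow k V n) : a * b ∈ tpow k V (m + n) := by
  rw [tpow_add]; exact Submodule.mul_mem_mul ha hb

theorem lcontr_mem_tpow (ξ : V →ₗ[k] k) {m : ℕ} {t : TensorAlgebra k V}
    (ht : t ∈ tpow k V (m + 1)) : lcontr ξ t ∈ tpow k V m := by
  rw [add_comm, tpow_add, tpow_one] at ht
  exact lcontr_mem_of_mem_range_mul ξ _ ht

theorem rcontr_mem_tpow (ξ : V →ₗ[k] k) {m : ℕ} {t : TensorAlgebra k V}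
    (ht : t ∈ tpow k V (m + 1)) : rcontr ξ t ∈ tpow k V m := by
  rw [tpow_add, tpow_one] at ht
  exact rcontr_mem_of_mem_mul_range ξ _ ht

theorem algebraMapInv_of_mem_tpow {m : ℕ} {t : TensorAlgebra k V}
    (ht : t ∈ tpow k V (m + 1)) : TensorAlgebra.algebraMapInv t = (0 : k) := by
  rw [tpow_add, tpow_one] at ht
  induction ht using Submodule.mul_induction_on' with
  | mem_mul_mem m hm n hn =>
    obtain ⟨v, rfl⟩ := hn
    simp [TensorAlgebra.algebraMapInv]
  | add x _ y _ hx hy => rw [map_add, hx, hy, add_zero]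

variable (N : ℕ) (R : Submodule k (TensorAlgebra k V))

theorem mem_koszulW {m : ℕ} {t : TensorAlgebra k V} : t ∈ koszulW N R m ↔
    t ∈ tpow k V m ∧ ∀ i j, i + N + j = m → t ∈ tpow k V i * R * tpow k V j := by
  simp [koszulW, Submodule.mem_iInf]

theorem koszulW_le_tpow (m : ℕ) : koszulW N R m ≤ tpow k V m := inf_le_left

/-- The condition at position `(i, j)` for the contracted tensor is the condition at `(i + 1, j)`
for `t` with its first letter removed. So operators built from contractions restrict to the spaces
`W`. -/
theorem lcontr_mem_koszulW (ξ : V →ₗ[k] k) {m : ℕ} {t : TensorAlgebra k V}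
    (ht : t ∈ koszulW N R (m + 1)) : lcontr ξ t ∈ koszulW N R m := by
  rw [mem_koszulW] at ht ⊢
  refine ⟨lcontr_mem_tpow ξ ht.1, fun i j hij => ?_⟩
  have := ht.2 (1 + i) j (by omega)
  rw [tpow_add, tpow_one, mul_assoc, mul_assoc] at this
  rw [mul_assoc]
  exact lcontr_mem_of_mem_range_mul ξ _ this

theorem rcontr_mem_koszulW (ξ : V →ₗ[k] k) {m : ℕ} {t : TensorAlgebra k V}
    (ht : t ∈ koszulW N R (m + 1)) : rcontr ξ t ∈ koszulW N R m := by
  rw [mem_koszulW] at ht ⊢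
  refine ⟨rcontr_mem_tpow ξ ht.1, fun i j hij => ?_⟩
  have := ht.2 i (j + 1) (by omega)
  rw [tpow_add, tpow_one, ← mul_assoc] at this
  exact rcontr_mem_of_mem_mul_range ξ _ this

theorem koszulW_zero (hN : 1 ≤ N) : koszulW N R 0 = 1 := by
  ext t
  rw [mem_koszulW, tpow_zero]
  exact ⟨fun h => h.1, fun h => ⟨h, fun i j hij => by omega⟩⟩

theorem koszulW_one (hN : 2 ≤ N) :
    koszulW N R 1 = LinearMap.range (TensorAlgebra.ι k : V →ₗ[k] _) := by
  ext t
  rw [mem_koszulW, tpow_one]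
  exact ⟨fun h => h.1, fun h => ⟨h, fun i j hij => by omega⟩⟩

theorem koszulW_self_le : koszulW N R N ≤ R := by
  intro t ht
  have := ((mem_koszulW N R).1 ht).2 0 0 (by omega)
  rwa [tpow_zero, one_mul, mul_one] at this

theorem koszulW_succ_le : koszulW N R (N + 1) ≤
    R * LinearMap.range (TensorAlgebra.ι k : V →ₗ[k] _) ⊓
      LinearMap.range (TensorAlgebra.ι k : V →ₗ[k] _) * R := by
  intro t ht
  have h1 := ((mem_koszulW N R).1 ht).2 0 1 (by omega)
  have h2 := ((mem_koszulW N R).1 ht).2 1 0 (by omega)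
  rw [tpow_zero, one_mul, tpow_one] at h1
  rw [tpow_zero, mul_one, tpow_one] at h2
  exact ⟨h1, h2⟩

instance finite_koszulW [FiniteDimensional k V] (m : ℕ) :
    FiniteDimensional k (koszulW N R m) := by
  have hfg : (LinearMap.range (TensorAlgebra.ι k : V →ₗ[k] TensorAlgebra k V)).FG := by
    rw [LinearMap.range_eq_map]
    exact Module.Finite.fg_top.map _
  have : FiniteDimensional k (tpow k V m) := Module.Finite.iff_fg.2 (hfg.pow m)
  exact Submodule.finiteDimensional_of_le (koszulW_le_tpow N R m)

end Contraction
end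
end NKoszulCY

namespace NKoszulCY
noncomputable section

/-! ### Koszul differentials as polynomials in two commuting operators -/

section KoszulOperators

/-- The length of the step from `ν_N(i)` to `ν_N(i + 1)`. -/
def jump (N i : ℕ) : ℕ := if Even i then 1 else N - 1

theorem nu_succ {N : ℕ} (hN : 1 ≤ N) (i : ℕ) : nu N (i + 1) = nu N i + jump N i := by
  unfold nu jump
  split_ifs with h
  · obtain ⟨j, rfl⟩ := h
    have h1 : (j + j + 1) / 2 = j := by omega
    have h2 : (j + j) / 2 = j := by omega
    rw [h1, h2]
    omega
  · obtain ⟨j, rfl⟩ := Nat.not_even_iff_odd.1 h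
    have h1 : (2 * j + 1 + 1) / 2 = j + 1 := by omega
    have h2 : (2 * j + 1) / 2 = j := by omega
    rw [h1, h2, mul_add]
    omega

theorem jump_add_jump {N : ℕ} (hN : 1 ≤ N) (i : ℕ) : jump N i + jump N (i + 1) = N := by
  unfold jump
  rcases Nat.even_or_odd i with h | h
  · rw [if_pos h, if_neg (by simpa [Nat.even_add_one] using h)]; omega
  · rw [if_neg (by simpa using h), if_pos (by simpa [Nat.even_add_one] using h)]; omega

variable {k : Type u} [Field k] {X : Type*} [AddCommGroup X] [Module k X]

/-- The differential of the Koszul complexes in terms of the left and right contractions. -/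
def koszulOp (N i : ℕ) (dl dr : Module.End k X) : Module.End k X :=
  if Even i then dl - dr else ∑ a ∈ Finset.range N, dl ^ a * dr ^ (N - 1 - a)

/-- A telescoping geometric sum. Thus `d² = 0` reduces, in both parities, to the equality of the
`N`-th powers. -/
theorem koszulOp_mul_koszulOp_succ (N i : ℕ) {dl dr : Module.End k X} (h : Commute dl dr) :
    koszulOp N i dl dr * koszulOp N (i + 1) dl dr = dl ^ N - dr ^ N := by
  unfold koszulOp
  rcases Nat.even_or_odd i with hi | hi
  · have hi' : ¬ Even (i + 1) := by simpa [Nat.even_add_one] using hi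
    rw [if_pos hi, if_neg hi', h.mul_geom_sum₂]
  · have hi' : ¬ Even i := Nat.not_even_iff_odd.2 hi
    rw [if_neg hi', if_pos hi.add_one, h.geom_sum₂_mul]

/-- Switching off the right operator recovers the one-sided Koszul complex, so one formalism covers
both complexes. -/
theorem koszulOp_zero_right {N : ℕ} (hN : 1 ≤ N) (i : ℕ) (dl : Module.End k X) :
    koszulOp N i dl 0 = dl ^ jump N i := by
  unfold koszulOp jump
  split_ifs with h
  · rw [sub_zero, pow_one]
  · rw [Finset.sum_eq_single (N - 1)]
    · simp
    · intro b hb hb'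
      rw [zero_pow, mul_zero]
      have := Finset.mem_range.1 hb
      omega
    · intro h'
      simp at h'
      omega

theorem koszulOp_conj {Y : Type*} [AddCommGroup Y] [Module k Y] (N i : ℕ) (s : X →ₗ[k] Y)
    {dl dr : Module.End k X} {dl' dr' : Module.End k Y} (hl : ∀ x, s (dl x) = dl' (s x))
    (hr : ∀ x, s (dr x) = dr' (s x)) (x : X) :
    s (koszulOp N i dl dr x) = koszulOp N i dl' dr' (s x) := by
  have hp : ∀ (f : Module.End k X) (f' : Module.End k Y), (∀ x, s (f x) = f' (s x)) →
      ∀ (n : ℕ) x, s ((f ^ n) x) = (f' ^ n) (s x) := by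
    intro f f' hf n
    induction n with
    | zero => intro x; simp
    | succ n ih => intro x; rw [pow_succ, pow_succ, Module.End.mul_apply, Module.End.mul_apply,
        ih, hf]
  unfold koszulOp
  split_ifs
  · rw [LinearMap.sub_apply, LinearMap.sub_apply, map_sub, hl, hr]
  · rw [LinearMap.sum_apply, LinearMap.sum_apply, map_sum]
    refine Finset.sum_congr rfl fun a _ => ?_
    rw [Module.End.mul_apply, Module.End.mul_apply, hp dl dl' hl, hp dr dr' hr]

theorem pow_mem_of_desc (S : ℕ → Submodule k X) {d : Module.End k X}
    (hd : ∀ m, ∀ x ∈ S (m + 1), d x ∈ S m) (n m : ℕ) :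
    ∀ x ∈ S (m + n), (d ^ n) x ∈ S m := by
  induction n with
  | zero => intro x hx; simpa using hx
  | succ n ih =>
    intro x hx
    rw [pow_succ, Module.End.mul_apply]
    exact ih _ (hd _ _ hx)

theorem pow_mem_of_asc (S : ℕ → Submodule k X) {d : Module.End k X}
    (hd : ∀ m, ∀ x ∈ S m, d x ∈ S (m + 1)) (n m : ℕ) :
    ∀ x ∈ S m, (d ^ n) x ∈ S (m + n) := by
  induction n with
  | zero => intro x hx; simpa using hx
  | succ n ih =>
    intro x hx
    rw [pow_succ', Module.End.mul_apply]
    exact hd _ _ (ih _ hx)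

theorem koszulOp_mem_of_desc {N : ℕ} (hN : 1 ≤ N) (i : ℕ) (S : ℕ → Submodule k X)
    {dl dr : Module.End k X} (hl : ∀ m, ∀ x ∈ S (m + 1), dl x ∈ S m)
    (hr : ∀ m, ∀ x ∈ S (m + 1), dr x ∈ S m) :
    ∀ x ∈ S (nu N (i + 1)), koszulOp N i dl dr x ∈ S (nu N i) := by
  intro x hx
  rw [nu_succ hN] at hx
  unfold koszulOp
  unfold jump at hx
  split_ifs at hx ⊢ with h
  · exact Submodule.sub_mem _ (hl _ _ hx) (hr _ _ hx)
  · rw [LinearMap.sum_apply]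
    refine Submodule.sum_mem _ fun a ha => ?_
    rw [Module.End.mul_apply]
    refine pow_mem_of_desc S hl _ _ _ (pow_mem_of_desc S hr _ _ _ ?_)
    have := Finset.mem_range.1 ha
    rwa [show nu N i + a + (N - 1 - a) = nu N i + (N - 1) by omega]

theorem koszulOp_mem_of_asc {N : ℕ} (hN : 1 ≤ N) (i : ℕ) (S : ℕ → Submodule k X)
    {dl dr : Module.End k X} (hl : ∀ m, ∀ x ∈ S m, dl x ∈ S (m + 1))
    (hr : ∀ m, ∀ x ∈ S m, dr x ∈ S (m + 1)) :
    ∀ x ∈ S (nu N i), koszulOp N i dl dr x ∈ S (nu N (i + 1)) := by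
  intro x hx
  rw [nu_succ hN]
  unfold koszulOp jump
  split_ifs with h
  · exact Submodule.sub_mem _ (hl _ _ hx) (hr _ _ hx)
  · rw [LinearMap.sum_apply]
    refine Submodule.sum_mem _ fun a ha => ?_
    rw [Module.End.mul_apply]
    have := pow_mem_of_asc S hl a _ _ (pow_mem_of_asc S hr (N - 1 - a) _ _ hx)
    have h' := Finset.mem_range.1 ha
    rwa [show nu N i + (N - 1 - a) + a = nu N i + (N - 1) by omega] at this

/-- `T` is congruent to `T₀`, an operator of degree `p`, up to terms of lower degree. -/
structure CongrOp (F : ℤ → Submodule k X) (N : ℕ) (p : ℤ) (T₀ T : Module.End k X) : Prop where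
  map₀ : ∀ n, ∀ x ∈ F n, T₀ x ∈ F (n + p)
  lower : ∀ n, ∀ x ∈ F n, T x - T₀ x ∈ F (n + p - N)

namespace CongrOp

variable {F : ℤ → Submodule k X} {N : ℕ} {p q : ℤ} {S₀ S T₀ T : Module.End k X}

theorem map (hF : ∀ n, F (n - N) ≤ F n) (h : CongrOp F N p T₀ T) (n : ℤ) :
    ∀ x ∈ F n, T x ∈ F (n + p) := fun x hx => by
  have := (F (n + p)).add_mem (hF _ (h.lower n x hx)) (h.map₀ n x hx)
  rwa [sub_add_cancel] at this

theorem one : CongrOp F N 0 1 1 :=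
  ⟨fun n x hx => by simpa using hx, fun n x _ => by simp⟩

/-- By `T S - T₀ S₀ = (T - T₀) S + T₀ (S - S₀)`. -/
theorem mul (hF : ∀ n, F (n - N) ≤ F n) (hT : CongrOp F N p T₀ T) (hS : CongrOp F N q S₀ S) :
    CongrOp F N (q + p) (T₀ * S₀) (T * S) := by
  refine ⟨fun n x hx => ?_, fun n x hx => ?_⟩
  · rw [← add_assoc]
    exact hT.map₀ _ _ (hS.map₀ _ _ hx)
  · have h1 := hT.lower _ _ (hS.map hF _ _ hx)
    have h2 := hT.map₀ _ _ (hS.lower _ _ hx)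
    rw [show n + q - N + p = n + q + p - N by ring] at h2
    have h3 := Submodule.add_mem _ h1 h2
    rw [← add_assoc]
    rwa [map_sub, sub_add_sub_cancel] at h3

theorem sub (hT : CongrOp F N p T₀ T) (hS : CongrOp F N p S₀ S) :
    CongrOp F N p (T₀ - S₀) (T - S) := by
  refine ⟨fun n x hx => Submodule.sub_mem _ (hT.map₀ _ _ hx) (hS.map₀ _ _ hx), fun n x hx => ?_⟩
  have := Submodule.sub_mem _ (hT.lower _ _ hx) (hS.lower _ _ hx)
  rwa [sub_sub_sub_comm] at this

theorem sum {α : Type*} (s : Finset α) {f₀ f : α → Module.End k X}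
    (h : ∀ a ∈ s, CongrOp F N p (f₀ a) (f a)) :
    CongrOp F N p (∑ a ∈ s, f₀ a) (∑ a ∈ s, f a) := by
  refine ⟨fun n x hx => ?_, fun n x hx => ?_⟩
  · rw [LinearMap.sum_apply]
    exact Submodule.sum_mem _ fun a ha => (h a ha).map₀ _ _ hx
  · rw [LinearMap.sum_apply, LinearMap.sum_apply, ← Finset.sum_sub_distrib]
    exact Submodule.sum_mem _ fun a ha => (h a ha).lower _ _ hx

theorem pow (hF : ∀ n, F (n - N) ≤ F n) (hT : CongrOp F N p T₀ T) (m : ℕ) :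
    CongrOp F N (m * p) (T₀ ^ m) (T ^ m) := by
  induction m with
  | zero => simpa using one
  | succ m ih =>
    rw [pow_succ, pow_succ]
    have := mul hF ih hT
    rwa [show p + m * p = ((m + 1 : ℕ) : ℤ) * p by push_cast; ring] at this

theorem koszulOp (hF : ∀ n, F (n - N) ≤ F n) (M i : ℕ) (hT : CongrOp F N p T₀ T)
    (hS : CongrOp F N p S₀ S) :
    CongrOp F N (jump M i * p) (NKoszulCY.koszulOp M i T₀ S₀) (NKoszulCY.koszulOp M i T S) := by
  unfold NKoszulCY.koszulOp jump
  split_ifs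
  · simpa using sub hT hS
  · refine sum _ fun a ha => ?_
    have := mul hF (hT.pow hF a) (hS.pow hF (M - 1 - a))
    have h' := Finset.mem_range.1 ha
    rwa [show ((M - 1 - a : ℕ) : ℤ) * p + a * p = ((M - 1 : ℕ) : ℤ) * p by
      rw [← add_mul, ← Nat.cast_add]; congr 2; omega] at this

end CongrOp

variable {V : Type v} [AddCommGroup V] [Module k V]
  {ι : Type*} [Fintype ι] (e : Module.Basis ι k V) {M : Type*} [AddCommGroup M] [Module k M]

/-- The operator on `M ⊗ T(V)` absorbing the first letter by means of the operators `lam`. -/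
def tensorL (lam : ι → Module.End k M) : Module.End k (M ⊗[k] TensorAlgebra k V) :=
  ∑ i, TensorProduct.map (lam i) (lcontr (e.coord i))

/-- The operator on `M ⊗ T(V)` absorbing the last letter by means of the operators `rho`. -/
def tensorR (rho : ι → Module.End k M) : Module.End k (M ⊗[k] TensorAlgebra k V) :=
  ∑ i, TensorProduct.map (rho i) (rcontr (e.coord i))

/-- The operator on `Hom(T(V), M)` dual to `tensorL`. -/
def homL (lam : ι → Module.End k M) : Module.End k (TensorAlgebra k V →ₗ[k] M) :=
  ∑ i, LinearMap.lcomp k M (lcontr (e.coord i)) ∘ₗ LinearMap.llcomp k _ _ _ (lam i)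

/-- The operator on `Hom(T(V), M)` dual to `tensorR`. -/
def homR (rho : ι → Module.End k M) : Module.End k (TensorAlgebra k V →ₗ[k] M) :=
  ∑ i, LinearMap.lcomp k M (rcontr (e.coord i)) ∘ₗ LinearMap.llcomp k _ _ _ (rho i)

theorem tensorL_tmul (lam : ι → Module.End k M) (m : M) (t : TensorAlgebra k V) :
    tensorL e lam (m ⊗ₜ t) = ∑ i, lam i m ⊗ₜ lcontr (e.coord i) t := by
  simp [tensorL]

theorem tensorR_tmul (rho : ι → Module.End k M) (m : M) (t : TensorAlgebra k V) :
    tensorR e rho (m ⊗ₜ t) = ∑ i, rho i m ⊗ₜ rcontr (e.coord i) t := by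
  simp [tensorR]

theorem homL_apply (lam : ι → Module.End k M) (f : TensorAlgebra k V →ₗ[k] M)
    (t : TensorAlgebra k V) : homL e lam f t = ∑ i, lam i (f (lcontr (e.coord i) t)) := by
  simp [homL]

theorem homR_apply (rho : ι → Module.End k M) (f : TensorAlgebra k V →ₗ[k] M)
    (t : TensorAlgebra k V) : homR e rho f t = ∑ i, rho i (f (rcontr (e.coord i) t)) := by
  simp [homR]

theorem tensorR_zero : tensorR e (0 : ι → Module.End k M) = 0 := by
  simp [tensorR]

theorem commute_tensorL_tensorR {lam rho : ι → Module.End k M}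
    (h : ∀ i j, Commute (lam i) (rho j)) : Commute (tensorL e lam) (tensorR e rho) := by
  unfold tensorL tensorR
  refine Commute.sum_left _ _ _ fun i _ => Commute.sum_right _ _ _ fun j _ => ?_
  refine TensorProduct.ext' fun m t => ?_
  simp only [Module.End.mul_apply, TensorProduct.map_tmul, lcontr_rcontr]
  rw [← Module.End.mul_apply, (h i j).eq, Module.End.mul_apply]

theorem commute_homL_homR {lam rho : ι → Module.End k M}
    (h : ∀ i j, Commute (lam i) (rho j)) : Commute (homL e lam) (homR e rho) := by
  refine LinearMap.ext fun f => LinearMap.ext fun t => ?_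
  simp only [Module.End.mul_apply, homL_apply, homR_apply, map_sum]
  rw [Finset.sum_comm]
  refine Finset.sum_congr rfl fun j _ => Finset.sum_congr rfl fun i _ => ?_
  rw [lcontr_rcontr, ← Module.End.mul_apply, (h i j).eq, Module.End.mul_apply]

variable (N : ℕ) (R : Submodule k (TensorAlgebra k V))

variable (M) in
/-- `M ⊗ W` as a subspace of `M ⊗ T(V)`. -/
def tensorSub (W : Submodule k (TensorAlgebra k V)) : Submodule k (M ⊗[k] TensorAlgebra k V) :=
  LinearMap.range (LinearMap.lTensor M W.subtype)

variable (M) in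
/-- The linear maps `T(V) → M` which vanish on `W`. -/
def homVanish (W : Submodule k (TensorAlgebra k V)) : Submodule k (TensorAlgebra k V →ₗ[k] M) where
  carrier := {f | ∀ w ∈ W, f w = 0}
  add_mem' := fun ha hb w hw => by rw [LinearMap.add_apply, ha w hw, hb w hw, add_zero]
  zero_mem' := fun _ _ => rfl
  smul_mem' := fun c f hf w hw => by rw [LinearMap.smul_apply, hf w hw, smul_zero]

theorem tmul_mem_tensorSub {W : Submodule k (TensorAlgebra k V)} (m : M) {t : TensorAlgebra k V}
    (ht : t ∈ W) : m ⊗ₜ[k] t ∈ tensorSub M W := ⟨m ⊗ₜ ⟨t, ht⟩, rfl⟩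

theorem tensorSub_induction {W : Submodule k (TensorAlgebra k V)}
    {Q : (x : M ⊗[k] TensorAlgebra k V) → x ∈ tensorSub M W → Prop}
    (h0 : Q 0 (Submodule.zero_mem _))
    (h1 : ∀ m t (ht : t ∈ W), Q (m ⊗ₜ t) (tmul_mem_tensorSub m ht))
    (hadd : ∀ a b ha hb, Q a ha → Q b hb → Q (a + b) (Submodule.add_mem _ ha hb))
    {x : M ⊗[k] TensorAlgebra k V} (hx : x ∈ tensorSub M W) : Q x hx := by
  suffices h : ∀ (z : M ⊗[k] W) x (hx : x ∈ tensorSub M W),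
      LinearMap.lTensor M W.subtype z = x → Q x hx by
    obtain ⟨z, hz⟩ := hx
    exact h z x _ hz
  intro z
  induction z using TensorProduct.induction_on with
  | zero =>
    rintro x hx h
    obtain rfl := (map_zero _).symm.trans h
    exact h0
  | tmul m t => rintro x hx rfl; exact h1 m t t.2
  | add a b ha hb =>
    rintro x hx h
    obtain rfl := (map_add _ _ _).symm.trans h
    exact hadd _ _ _ _ (ha _ ⟨a, rfl⟩ rfl) (hb _ ⟨b, rfl⟩ rfl)

theorem tensorL_mem (lam : ι → Module.End k M) (m : ℕ) :
    ∀ x ∈ tensorSub M (koszulW N R (m + 1)), tensorL e lam x ∈ tensorSub M (koszulW N R m) := by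
  intro x hx
  induction hx using tensorSub_induction with
  | h0 => rw [map_zero]; exact Submodule.zero_mem _
  | h1 m t ht =>
    rw [tensorL_tmul]
    exact Submodule.sum_mem _ fun i _ => tmul_mem_tensorSub _ (lcontr_mem_koszulW N R _ ht)
  | hadd a b _ _ ha hb => rw [map_add]; exact Submodule.add_mem _ ha hb

theorem tensorR_mem (rho : ι → Module.End k M) (m : ℕ) :
    ∀ x ∈ tensorSub M (koszulW N R (m + 1)), tensorR e rho x ∈ tensorSub M (koszulW N R m) := by
  intro x hx
  induction hx using tensorSub_induction with
  | h0 => rw [map_zero]; exact Submodule.zero_mem _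
  | h1 m t ht =>
    rw [tensorR_tmul]
    exact Submodule.sum_mem _ fun i _ => tmul_mem_tensorSub _ (rcontr_mem_koszulW N R _ ht)
  | hadd a b _ _ ha hb => rw [map_add]; exact Submodule.add_mem _ ha hb

theorem homL_mem (lam : ι → Module.End k M) (m : ℕ) :
    ∀ f ∈ homVanish M (koszulW N R m), homL e lam f ∈ homVanish M (koszulW N R (m + 1)) := by
  intro f hf w hw
  rw [homL_apply]
  exact Finset.sum_eq_zero fun i _ => by rw [hf _ (lcontr_mem_koszulW N R _ hw), map_zero]

theorem homR_mem (rho : ι → Module.End k M) (m : ℕ) :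
    ∀ f ∈ homVanish M (koszulW N R m), homR e rho f ∈ homVanish M (koszulW N R (m + 1)) := by
  intro f hf w hw
  rw [homR_apply]
  exact Finset.sum_eq_zero fun i _ => by rw [hf _ (rcontr_mem_koszulW N R _ hw), map_zero]

/-- The differential of the Koszul complex with coefficients in `M`. -/
def tensorD (lam rho : ι → Module.End k M) (i : ℕ) : Module.End k (M ⊗[k] TensorAlgebra k V) :=
  koszulOp N i (tensorL e lam) (tensorR e rho)

/-- The differential of the Koszul cochain complex with coefficients in `M`. -/
def homD (lam rho : ι → Module.End k M) (i : ℕ) : Module.End k (TensorAlgebra k V →ₗ[k] M) :=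
  koszulOp N i (homL e lam) (homR e rho)

theorem tensorD_mem (hN : 1 ≤ N) (lam rho : ι → Module.End k M) (i : ℕ) :
    ∀ x ∈ tensorSub M (koszulW N R (nu N (i + 1))),
      tensorD e N lam rho i x ∈ tensorSub M (koszulW N R (nu N i)) :=
  koszulOp_mem_of_desc hN i (fun m => tensorSub M (koszulW N R m)) (tensorL_mem e N R lam)
    (tensorR_mem e N R rho)

theorem homD_mem (hN : 1 ≤ N) (lam rho : ι → Module.End k M) (i : ℕ) :
    ∀ f ∈ homVanish M (koszulW N R (nu N i)),
      homD e N lam rho i f ∈ homVanish M (koszulW N R (nu N (i + 1))) :=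
  koszulOp_mem_of_asc hN i (fun m => homVanish M (koszulW N R m)) (homL_mem e N R lam)
    (homR_mem e N R rho)

/-- The homology of the Koszul complex with coefficients in `M` vanishes in degree `i + 1`. -/
def TensorExact (lam rho : ι → Module.End k M) (i : ℕ) : Prop :=
  ∀ x ∈ tensorSub M (koszulW N R (nu N (i + 1))), tensorD e N lam rho i x = 0 →
    ∃ y ∈ tensorSub M (koszulW N R (nu N (i + 2))), tensorD e N lam rho (i + 1) y = x

theorem TensorExact.of_equiv {M' : Type*} [AddCommGroup M'] [Module k M'] (s : M ≃ₗ[k] M')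
    {lam rho : ι → Module.End k M} {lam' rho' : ι → Module.End k M'}
    (hl : ∀ i x, s (lam i x) = lam' i (s x)) (hr : ∀ i x, s (rho i x) = rho' i (s x)) {i : ℕ}
    (h : TensorExact e N R lam rho i) : TensorExact e N R lam' rho' i := by
  let S := TensorProduct.congr s (LinearEquiv.refl k (TensorAlgebra k V))
  have hS : ∀ m t, S (m ⊗ₜ t) = s m ⊗ₜ t := fun _ _ => rfl
  have hSl : ∀ x, S.toLinearMap (tensorL e lam x) = tensorL e lam' (S.toLinearMap x) := by
    intro x
    induction x using TensorProduct.induction_on with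
    | zero => simp
    | tmul m t => simp [tensorL_tmul, hS, hl]
    | add a b ha hb => simp only [map_add, ha, hb]
  have hSr : ∀ x, S.toLinearMap (tensorR e rho x) = tensorR e rho' (S.toLinearMap x) := by
    intro x
    induction x using TensorProduct.induction_on with
    | zero => simp
    | tmul m t => simp [tensorR_tmul, hS, hr]
    | add a b ha hb => simp only [map_add, ha, hb]
  have hD : ∀ j x, S (tensorD e N lam rho j x) = tensorD e N lam' rho' j (S x) := fun j x =>
    koszulOp_conj N j S.toLinearMap hSl hSr x
  have hm : ∀ W x, x ∈ tensorSub M W → S x ∈ tensorSub M' W := by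
    intro W x hx
    induction hx using tensorSub_induction with
    | h0 => rw [map_zero]; exact Submodule.zero_mem _
    | h1 m t ht => exact tmul_mem_tensorSub _ ht
    | hadd a b _ _ ha hb => rw [map_add]; exact Submodule.add_mem _ ha hb
  have hm' : ∀ W x, x ∈ tensorSub M' W → S.symm x ∈ tensorSub M W := by
    intro W x hx
    induction hx using tensorSub_induction with
    | h0 => rw [map_zero]; exact Submodule.zero_mem _
    | h1 m t ht => exact tmul_mem_tensorSub _ ht
    | hadd a b _ _ ha hb => rw [map_add]; exact Submodule.add_mem _ ha hb
  intro x hx hx0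
  obtain ⟨y, hy, hyx⟩ := h (S.symm x) (hm' _ _ hx)
    (S.injective (by rw [hD, LinearEquiv.apply_symm_apply, hx0, map_zero]))
  exact ⟨S y, hm _ _ hy, by rw [← hD, hyx, LinearEquiv.apply_symm_apply]⟩

end KoszulOperators
end
end NKoszulCY

namespace NKoszulCY
noncomputable section

/-! ### Gradings on chains and cochains -/

section Gradings

variable {k : Type u} [Field k] {M : Type*} [AddCommGroup M] [Module k M]

namespace GrMod

/-- The grading is on the whole space. -/
structure Full (G : GrMod k M) : Prop where
  one_eq : G.one = ⊤
  zero_eq : G.zero = ⊥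

theorem Full.mem_one {G : GrMod k M} (hG : G.Full) (x : M) : x ∈ G.one := by
  rw [hG.one_eq]; trivial

theorem Full.mem_zero {G : GrMod k M} (hG : G.Full) {x : M} : x ∈ G.zero ↔ x = 0 := by
  rw [hG.zero_eq, Submodule.mem_bot]

theorem Full.mem_F {G : GrMod k M} (hG : G.Full) {N : ℕ} {n : ℤ} {x : M} :
    x ∈ G.F N n ↔ ∀ j, ¬ (j ≤ n ∧ (N : ℤ) ∣ n - j) → G.proj j x = 0 := by
  rw [GrMod.mem_F]
  simp only [hG.mem_zero]
  exact ⟨fun h => h.2, fun h => ⟨hG.mem_one x, h⟩⟩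

theorem Full.exists_sum {G : GrMod k M} (hG : G.Full) (x : M) :
    ∃ s : Finset ℤ, ∀ s', s ⊆ s' → ∑ i ∈ s', G.proj i x = x := by
  obtain ⟨s, hs⟩ := G.exists_sum x (hG.mem_one x)
  rw [hG.mem_zero, sub_eq_zero] at hs
  refine ⟨s, fun s' hs' => ?_⟩
  conv_rhs => rw [hs]
  refine (Finset.sum_subset hs' fun i _ hi => ?_).symm
  rw [hs, map_sum]
  exact Finset.sum_eq_zero fun j hj => G.proj_proj_of_ne i j x fun h => hi (h ▸ hj)

/-- The projection onto the span of the members of degree `n` of a basis. -/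
def basisProj {β : Type*} (b : Module.Basis β k M) (wt : β → ℤ) (n : ℤ) : M →ₗ[k] M := by
  classical
  exact b.constr k fun i => if wt i = n then b i else 0

theorem basisProj_basis {β : Type*} (b : Module.Basis β k M) (wt : β → ℤ) (n : ℤ) (i : β)
    [Decidable (wt i = n)] : basisProj b wt n (b i) = if wt i = n then b i else 0 := by
  unfold basisProj
  rw [Module.Basis.constr_basis]
  congr

/-- The grading given by a basis whose members have degrees. -/
def ofBasis {β : Type*} (b : Module.Basis β k M) (wt : β → ℤ) (hb : ∃ B : ℤ, ∀ i, B ≤ wt i) :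
    GrMod k M where
  proj := basisProj b wt
  one := ⊤
  zero := ⊥
  zero_le := bot_le
  proj_proj_self n y := by
    classical
    refine LinearMap.congr_fun (f := basisProj b wt n ∘ₗ basisProj b wt n)
      (b.ext fun i => ?_) y
    rw [LinearMap.comp_apply, basisProj_basis]
    split_ifs with h
    · rw [basisProj_basis, if_pos h]
    · rw [map_zero]
  proj_proj_of_ne m n y h := by
    classical
    refine LinearMap.congr_fun (f := basisProj b wt m ∘ₗ basisProj b wt n) (g := 0)
      (b.ext fun i => ?_) y
    rw [LinearMap.comp_apply, basisProj_basis]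
    split_ifs with h'
    · rw [basisProj_basis, if_neg (by omega), LinearMap.zero_apply]
    · rw [map_zero, LinearMap.zero_apply]
  proj_mem_one _ _ _ := trivial
  proj_mem_zero _ _ hy := by
    rw [Submodule.mem_bot] at hy ⊢
    rw [hy, map_zero]
  exists_sum y _ := by
    classical
    refine ⟨(b.repr y).support.image wt, ?_⟩
    rw [Submodule.mem_bot, sub_eq_zero]
    have hy := b.linearCombination_repr y
    rw [Finsupp.linearCombination_apply, Finsupp.sum] at hy
    have hy' : ∀ n, basisProj b wt n y = ∑ i ∈ (b.repr y).support,
        if wt i = n then b.repr y i • b i else 0 := by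
      intro n
      conv_lhs => rw [← hy]
      rw [map_sum]
      refine Finset.sum_congr rfl fun i _ => ?_
      rw [map_smul, basisProj_basis, smul_ite, smul_zero]
    simp only [hy']
    rw [Finset.sum_comm]
    conv_lhs => rw [← hy]
    refine Finset.sum_congr rfl fun i hi => ?_
    rw [Finset.sum_ite_eq, if_pos (Finset.mem_image_of_mem wt hi)]
  bdd := by
    classical
    obtain ⟨B, hB⟩ := hb
    refine ⟨B, fun n hn y _ => ?_⟩
    rw [Submodule.mem_bot]
    refine LinearMap.congr_fun (g := 0) (b.ext fun i => ?_) y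
    rw [basisProj_basis, if_neg (by have := hB i; omega), LinearMap.zero_apply]

section ofBasis

variable {β : Type*} (b : Module.Basis β k M) (wt : β → ℤ) (hb : ∃ B : ℤ, ∀ i, B ≤ wt i)

theorem full_ofBasis : (ofBasis b wt hb).Full := ⟨rfl, rfl⟩

theorem ofBasis_proj_basis (n : ℤ) (i : β) [Decidable (wt i = n)] :
    (ofBasis b wt hb).proj n (b i) = if wt i = n then b i else 0 :=
  basisProj_basis b wt n i

theorem basis_mem_F (N : ℕ) {n : ℤ} {i : β} (h : wt i ≤ n) (hN : (N : ℤ) ∣ n - wt i) :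
    b i ∈ (ofBasis b wt hb).F N n := by
  classical
  rw [(full_ofBasis b wt hb).mem_F]
  intro j hj
  rw [ofBasis_proj_basis, if_neg]
  rintro rfl
  exact hj ⟨h, hN⟩

theorem ofBasis_induction (N : ℕ) {n : ℤ} (S : Submodule k M)
    (h : ∀ i, wt i ≤ n → (N : ℤ) ∣ n - wt i → b i ∈ S) {x : M}
    (hx : x ∈ (ofBasis b wt hb).F N n) : x ∈ S := by
  classical
  have hrepr : ∀ i, b.repr x i ≠ 0 → wt i ≤ n ∧ (N : ℤ) ∣ n - wt i := by
    intro i hi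
    by_contra hcon
    have h0 := ((full_ofBasis b wt hb).mem_F).1 hx _ hcon
    apply hi
    -- Passing to the component of degree `wt i` does not change the coordinate at `i`; so a nonzero
    -- coordinate forces an admissible degree.
    have h1 : ∀ y, b.repr ((ofBasis b wt hb).proj (wt i) y) i = b.repr y i := by
      intro y
      refine LinearMap.congr_fun (f := b.coord i ∘ₗ (ofBasis b wt hb).proj (wt i))
        (g := b.coord i) (b.ext fun j => ?_) y
      rw [LinearMap.comp_apply, ofBasis_proj_basis]
      split_ifs with hj
      · rfl
      · rw [map_zero, Module.Basis.coord_apply, Module.Basis.repr_self, Finsupp.single_apply,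
          if_neg (fun h' => hj (by rw [h']))]
    rw [← h1, h0, map_zero, Finsupp.zero_apply]
  rw [← b.linearCombination_repr x, Finsupp.linearCombination_apply]
  refine Submodule.sum_mem _ fun i hi => S.smul_mem _ ?_
  have := hrepr i (Finsupp.mem_support_iff.1 hi)
  exact h i this.1 this.2

theorem ofBasis_homog {M' : Type*} [AddCommGroup M'] [Module k M'] (G : GrMod k M')
    (f : M →ₗ[k] M') (p : ℤ) (hf : ∀ i, G.proj (wt i + p) (f (b i)) = f (b i)) (n : ℤ) (x : M) :
    G.proj (n + p) (f x) = f ((ofBasis b wt hb).proj n x) := by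
  classical
  refine LinearMap.congr_fun (f := G.proj (n + p) ∘ₗ f) (g := f ∘ₗ (ofBasis b wt hb).proj n)
    (b.ext fun i => ?_) x
  rw [LinearMap.comp_apply, LinearMap.comp_apply, ofBasis_proj_basis]
  split_ifs with h
  · rw [← h, hf]
  · rw [map_zero, ← hf, G.proj_proj_of_ne _ _ _ (by omega)]

end ofBasis

variable {V : Type v} [AddCommGroup V] [Module k V]

theorem Full.exists_sum_tensor {G : GrMod k M} (hG : G.Full) (c : ℤ)
    (x : M ⊗[k] TensorAlgebra k V) : ∃ s : Finset ℤ, ∀ s', s ⊆ s' →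
      ∑ i ∈ s', LinearMap.rTensor (TensorAlgebra k V) (G.proj (i - c)) x = x := by
  classical
  induction x using TensorProduct.induction_on with
  | zero => exact ⟨∅, fun s' _ => by simp⟩
  | tmul m t =>
    obtain ⟨s, hs⟩ := hG.exists_sum m
    refine ⟨s.image (· + c), fun s' hs' => ?_⟩
    simp only [LinearMap.rTensor_tmul, ← TensorProduct.sum_tmul]
    congr 1
    refine Eq.trans ?_ (hs (s'.image (· - c)) fun i hi => ?_)
    · rw [Finset.sum_image (fun a _ b _ h => by simpa using h)]
    have := hs' (Finset.mem_image_of_mem _ hi)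
    exact Finset.mem_image.2 ⟨i + c, this, by simp⟩
  | add a b ha hb =>
    obtain ⟨s, hs⟩ := ha
    obtain ⟨t, ht⟩ := hb
    refine ⟨s ∪ t, fun s' hs' => ?_⟩
    simp only [map_add, Finset.sum_add_distrib]
    rw [hs s' (Finset.union_subset_left hs'), ht s' (Finset.union_subset_right hs')]

theorem rTensor_proj_self (G : GrMod k M) (n : ℤ) (x : M ⊗[k] TensorAlgebra k V) :
    LinearMap.rTensor (TensorAlgebra k V) (G.proj n)
      (LinearMap.rTensor (TensorAlgebra k V) (G.proj n) x) =
      LinearMap.rTensor (TensorAlgebra k V) (G.proj n) x := by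
  rw [← LinearMap.comp_apply, ← LinearMap.rTensor_comp]
  congr 2
  exact LinearMap.ext fun y => G.proj_proj_self n y

/-- The grading of `M ⊗ W` coming from a grading of `M`, with degrees raised by `c`. -/
def tensor (G : GrMod k M) (hG : G.Full) (W : Submodule k (TensorAlgebra k V)) (c : ℤ) :
    GrMod k (M ⊗[k] TensorAlgebra k V) where
  proj n := LinearMap.rTensor (TensorAlgebra k V) (G.proj (n - c))
  one := tensorSub M W
  zero := ⊥
  zero_le := bot_le
  proj_proj_self n y := G.rTensor_proj_self _ y
  proj_proj_of_ne m n y h := by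
    rw [← LinearMap.comp_apply, ← LinearMap.rTensor_comp,
      show G.proj (m - c) ∘ₗ G.proj (n - c) = 0 from
        LinearMap.ext fun y => G.proj_proj_of_ne _ _ y (by omega), LinearMap.rTensor_zero,
      LinearMap.zero_apply]
  proj_mem_one n y hy := by
    induction hy using tensorSub_induction with
    | h0 => rw [map_zero]; exact Submodule.zero_mem _
    | h1 m t ht => exact tmul_mem_tensorSub _ ht
    | hadd a b _ _ ha hb => rw [map_add]; exact Submodule.add_mem _ ha hb
  proj_mem_zero n y hy := by
    rw [Submodule.mem_bot] at hy ⊢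
    rw [hy, map_zero]
  exists_sum y _ := by
    obtain ⟨s, hs⟩ := hG.exists_sum_tensor c y
    exact ⟨s, by rw [Submodule.mem_bot, hs s subset_rfl, sub_self]⟩
  bdd := by
    obtain ⟨b, hb⟩ := G.bdd
    refine ⟨b + c, fun n hn y _ => ?_⟩
    rw [Submodule.mem_bot, show G.proj (n - c) = 0 from LinearMap.ext fun y =>
      hG.mem_zero.1 (hb _ (by omega) y (hG.mem_one y)), LinearMap.rTensor_zero,
      LinearMap.zero_apply]

/-- The grading of `Hom(W, M)` coming from a grading of `M`, with degrees lowered by `c`. -/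
def hom (G : GrMod k M) (hG : G.Full) (W : Submodule k (TensorAlgebra k V))
    [FiniteDimensional k W] (c : ℤ) : GrMod k (TensorAlgebra k V →ₗ[k] M) where
  proj n := LinearMap.llcomp k _ _ _ (G.proj (n + c))
  one := ⊤
  zero := homVanish M W
  zero_le := le_top
  proj_proj_self n f := LinearMap.ext fun t => G.proj_proj_self _ _
  proj_proj_of_ne m n f h := LinearMap.ext fun t => G.proj_proj_of_ne _ _ _ (by omega)
  proj_mem_one _ _ _ := trivial
  proj_mem_zero n f hf w hw := by
    change G.proj _ (f w) = 0
    rw [hf w hw, map_zero]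
  exists_sum f _ := by
    classical
    let b := Module.finBasis k W
    choose s hs using fun i => hG.exists_sum (f (b i))
    refine ⟨(Finset.univ.biUnion s).image (· - c), fun w hw => ?_⟩
    have h0 : (f - ∑ n ∈ (Finset.univ.biUnion s).image (· - c),
        LinearMap.llcomp k _ _ _ (G.proj (n + c)) f) ∘ₗ W.subtype = 0 := by
      refine b.ext fun i => ?_
      rw [LinearMap.comp_apply, LinearMap.sub_apply, LinearMap.sum_apply, LinearMap.zero_apply,
        sub_eq_zero]
      simp only [LinearMap.llcomp_apply]
      rw [Finset.sum_image (fun a _ b _ h => by simpa using h)]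
      simp only [sub_add_cancel]
      exact (hs i _ (Finset.subset_biUnion_of_mem s (Finset.mem_univ i))).symm
    exact LinearMap.congr_fun h0 ⟨w, hw⟩
  bdd := by
    obtain ⟨b, hb⟩ := G.bdd
    refine ⟨b - c, fun n hn f _ w _ => ?_⟩
    exact hG.mem_zero.1 (hb _ (by omega) _ (hG.mem_one _))

end GrMod

/-- `T` is homogeneous of degree `p`. -/
def HomogOp {X : Type*} [AddCommGroup X] [Module k X] (P : ℤ → X →ₗ[k] X) (p : ℤ)
    (T : Module.End k X) : Prop :=
  ∀ n x, P (n + p) (T x) = T (P n x)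

namespace HomogOp

variable {X : Type*} [AddCommGroup X] [Module k X] {P : ℤ → X →ₗ[k] X} {p q : ℤ}
  {S T : Module.End k X}

theorem mul (hT : HomogOp P p T) (hS : HomogOp P q S) : HomogOp P (q + p) (T * S) := fun n x => by
  rw [Module.End.mul_apply, Module.End.mul_apply, ← add_assoc, hT, hS]

theorem pow (hT : HomogOp P p T) (m : ℕ) : HomogOp P (m * p) (T ^ m) := by
  induction m with
  | zero => intro n x; simp
  | succ m ih =>
    have := ih.mul hT
    rwa [← pow_succ, show p + m * p = ((m + 1 : ℕ) : ℤ) * p by push_cast; ring] at this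

theorem sub (hT : HomogOp P p T) (hS : HomogOp P p S) : HomogOp P p (T - S) := fun n x => by
  rw [LinearMap.sub_apply, LinearMap.sub_apply, map_sub, hT, hS]

theorem sum {α : Type*} (s : Finset α) {f : α → Module.End k X}
    (h : ∀ a ∈ s, HomogOp P p (f a)) : HomogOp P p (∑ a ∈ s, f a) := fun n x => by
  rw [LinearMap.sum_apply, LinearMap.sum_apply, map_sum]
  exact Finset.sum_congr rfl fun a ha => h a ha n x

theorem koszulOp (N i : ℕ) (hT : HomogOp P p T) (hS : HomogOp P p S) :
    HomogOp P (jump N i * p) (NKoszulCY.koszulOp N i T S) := by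
  unfold NKoszulCY.koszulOp jump
  split_ifs
  · simpa using sub hT hS
  · refine sum _ fun a ha => ?_
    have := (hT.pow a).mul (hS.pow (N - 1 - a))
    have h' := Finset.mem_range.1 ha
    rwa [show ((N - 1 - a : ℕ) : ℤ) * p + a * p = ((N - 1 : ℕ) : ℤ) * p by
      rw [← add_mul, ← Nat.cast_add]; congr 2; omega] at this

end HomogOp

variable {V : Type v} [AddCommGroup V] [Module k V] {ι : Type*} [Fintype ι]
  (e : Module.Basis ι k V) (N : ℕ) (R : Submodule k (TensorAlgebra k V))
  {G : GrMod k M} (hG : G.Full) {N' : ℕ} {p : ℤ} {lam₀ rho₀ lam rho : ι → Module.End k M}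

include hG in
theorem mem_range_rTensor_of_mem_F {W : Submodule k (TensorAlgebra k V)} {c n : ℤ}
    {x : M ⊗[k] TensorAlgebra k V} (hx : x ∈ (G.tensor hG W c).F N' n) :
    x ∈ LinearMap.range (LinearMap.rTensor (TensorAlgebra k V) (G.F N' (n - c)).subtype) := by
  obtain ⟨s, hs⟩ := hG.exists_sum_tensor c x
  rw [← hs s subset_rfl]
  refine Submodule.sum_mem _ fun i _ => ?_
  by_cases hi : i ≤ n ∧ (N' : ℤ) ∣ n - i
  · have hle : ∀ m, G.proj (i - c) m ∈ G.F N' (n - c) := fun m =>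
      G.F_le_of_dvd N' (show i - c ≤ n - c by omega) (by simpa using hi.2)
        (G.mem_F_of_pure N' (hG.mem_one _) (G.proj_proj_self _ _))
    refine ⟨LinearMap.rTensor (TensorAlgebra k V)
      ((G.proj (i - c)).codRestrict (G.F N' (n - c)) hle) x, ?_⟩
    rw [← LinearMap.comp_apply, ← LinearMap.rTensor_comp, LinearMap.subtype_comp_codRestrict]
  · have h0 : LinearMap.rTensor (TensorAlgebra k V) (G.proj (i - c)) x ∈ (⊥ : Submodule k _) :=
      hx.2 i hi
    rw [(Submodule.mem_bot k).1 h0]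
    exact Submodule.zero_mem _

include hG in
theorem mem_F_of_mem_range_rTensor {W : Submodule k (TensorAlgebra k V)} {c n : ℤ}
    {x : M ⊗[k] TensorAlgebra k V} (hxW : x ∈ tensorSub M W)
    (hx : x ∈ LinearMap.range (LinearMap.rTensor (TensorAlgebra k V) (G.F N' (n - c)).subtype)) :
    x ∈ (G.tensor hG W c).F N' n := by
  refine ⟨hxW, fun j hj => ?_⟩
  obtain ⟨z, rfl⟩ := hx
  have h0 : G.proj (j - c) ∘ₗ (G.F N' (n - c)).subtype = 0 := LinearMap.ext fun y =>
    hG.mem_F.1 y.2 _ (by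
      rw [show n - c - (j - c) = n - j by ring]
      exact fun h => hj ⟨by omega, h.2⟩)
  change LinearMap.rTensor _ _ _ ∈ (⊥ : Submodule k _)
  rw [← LinearMap.comp_apply, ← LinearMap.rTensor_comp, h0, LinearMap.rTensor_zero,
    LinearMap.zero_apply]
  exact Submodule.zero_mem _

theorem map_mem_range_rTensor {A B : Submodule k M} (f : M →ₗ[k] M) (hf : ∀ x ∈ A, f x ∈ B)
    (g : TensorAlgebra k V →ₗ[k] TensorAlgebra k V) {x : M ⊗[k] TensorAlgebra k V}
    (hx : x ∈ LinearMap.range (LinearMap.rTensor (TensorAlgebra k V) A.subtype)) :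
    TensorProduct.map f g x ∈
      LinearMap.range (LinearMap.rTensor (TensorAlgebra k V) B.subtype) := by
  obtain ⟨z, rfl⟩ := hx
  induction z using TensorProduct.induction_on with
  | zero => rw [map_zero, map_zero]; exact Submodule.zero_mem _
  | tmul m t => exact ⟨⟨f m, hf _ m.2⟩ ⊗ₜ g t, rfl⟩
  | add a b ha hb => rw [map_add, map_add]; exact Submodule.add_mem _ ha hb

theorem congrOp_sum_map (f₀ f : ι → Module.End k M)
    (h : ∀ i, CongrOp (G.F N') N' p (f₀ i) (f i)) (g : ι → Module.End k (TensorAlgebra k V)) :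
    CongrOp (fun n => LinearMap.range (LinearMap.rTensor (TensorAlgebra k V) (G.F N' n).subtype))
      N' p (∑ i, TensorProduct.map (f₀ i) (g i)) (∑ i, TensorProduct.map (f i) (g i)) := by
  refine CongrOp.sum _ fun i _ => ⟨fun n x hx => map_mem_range_rTensor _ ((h i).map₀ n) _ hx,
    fun n x hx => ?_⟩
  have := map_mem_range_rTensor (f i - f₀ i) ((h i).lower n) (g i) hx
  have h' : TensorProduct.map (f i) (g i) =
      TensorProduct.map (f i - f₀ i) (g i) + TensorProduct.map (f₀ i) (g i) := by
    rw [← TensorProduct.map_add_left, sub_add_cancel]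
  rwa [h', LinearMap.add_apply, add_sub_cancel_right]

/-- The shift `p * ν(i)` gives every letter of a word the degree `p`. Absorbing a letter by an
operator of degree `p` then preserves the total degree, so the leading differential is homogeneous
of degree `0`. -/
theorem perturb_tensorD (hN : 1 ≤ N) (hl : ∀ i, HomogOp G.proj p (lam₀ i))
    (hr : ∀ i, HomogOp G.proj p (rho₀ i))
    (hl' : ∀ i, CongrOp (G.F N') N' p (lam₀ i) (lam i))
    (hr' : ∀ i, CongrOp (G.F N') N' p (rho₀ i) (rho i)) (i : ℕ) :
    GrMod.Perturb (G.tensor hG (koszulW N R (nu N (i + 1))) (p * nu N (i + 1)))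
      (G.tensor hG (koszulW N R (nu N i)) (p * nu N i)) N'
      (tensorD e N lam₀ rho₀ i) (tensorD e N lam rho i) := by
  have hnu : (p * nu N (i + 1) : ℤ) = p * nu N i + jump N i * p := by
    rw [nu_succ hN]; push_cast; ring
  have hmono : ∀ n, LinearMap.range (LinearMap.rTensor (TensorAlgebra k V)
      (G.F N' (n - N')).subtype) ≤ LinearMap.range (LinearMap.rTensor (TensorAlgebra k V)
      (G.F N' n).subtype) := by
    intro n x hx
    have := map_mem_range_rTensor LinearMap.id (G.F_sub_le N' n) LinearMap.id hx
    rwa [TensorProduct.map_id] at this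
  have hhom : ∀ (f : ι → Module.End k M), (∀ i, HomogOp G.proj p (f i)) →
      ∀ g : ι → Module.End k (TensorAlgebra k V),
      HomogOp (fun n => LinearMap.rTensor (TensorAlgebra k V) (G.proj n)) p
        (∑ i, TensorProduct.map (f i) (g i)) := by
    intro f hf g
    refine HomogOp.sum _ fun i _ n x => ?_
    refine LinearMap.congr_fun (f := LinearMap.rTensor _ (G.proj (n + p)) ∘ₗ
      TensorProduct.map (f i) (g i)) (g := TensorProduct.map (f i) (g i) ∘ₗ
      LinearMap.rTensor _ (G.proj n)) (TensorProduct.ext' fun m t => ?_) x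
    simp only [LinearMap.comp_apply, TensorProduct.map_tmul, LinearMap.rTensor_tmul, hf i n m]
  refine ⟨fun n x => ?_, tensorD_mem e N R hN _ _ i, ?_, ?_, fun n x hx => ?_⟩
  · have := HomogOp.koszulOp N i (hhom _ hl fun i => lcontr (e.coord i))
      (hhom _ hr fun i => rcontr (e.coord i)) (n - p * nu N (i + 1)) x
    rw [show n - p * nu N (i + 1) + jump N i * p = n - p * nu N i by rw [hnu]; ring] at this
    exact this
  · intro x hx
    rw [(Submodule.mem_bot k).1 hx, map_zero]
    exact Submodule.zero_mem _
  · intro x hx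
    rw [(Submodule.mem_bot k).1 hx, map_zero]
    exact Submodule.zero_mem _
  · refine mem_F_of_mem_range_rTensor hG (Submodule.sub_mem _
      (tensorD_mem e N R hN _ _ i x hx.1) (tensorD_mem e N R hN _ _ i x hx.1)) ?_
    have := (CongrOp.koszulOp hmono N i (congrOp_sum_map _ _ hl' fun i => lcontr (e.coord i))
      (congrOp_sum_map _ _ hr' fun i => rcontr (e.coord i))).lower _ x
      (mem_range_rTensor_of_mem_F hG hx)
    rw [show n - p * nu N (i + 1) + jump N i * p - N' = n - N' - p * nu N i by
      rw [hnu]; ring] at this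
    exact this

/-- The dual of `perturb_tensorD`: a cochain that raises degrees by `r` on `W`, with letters of
degree `p`, counts with the same bookkeeping. Finite dimension of `W` ensures that a cochain has
finitely many components on it. -/
theorem perturb_homD [FiniteDimensional k V] (hN : 1 ≤ N) (hl : ∀ i, HomogOp G.proj p (lam₀ i))
    (hr : ∀ i, HomogOp G.proj p (rho₀ i))
    (hl' : ∀ i, CongrOp (G.F N') N' p (lam₀ i) (lam i))
    (hr' : ∀ i, CongrOp (G.F N') N' p (rho₀ i) (rho i)) (i : ℕ) :
    GrMod.Perturb (G.hom hG (koszulW N R (nu N i)) (p * nu N i))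
      (G.hom hG (koszulW N R (nu N (i + 1))) (p * nu N (i + 1))) N'
      (homD e N lam₀ rho₀ i) (homD e N lam rho i) := by
  have hnu : (p * nu N (i + 1) : ℤ) = p * nu N i + jump N i * p := by
    rw [nu_succ hN]; push_cast; ring
  let HF : ℤ → Submodule k (TensorAlgebra k V →ₗ[k] M) := fun n =>
    { carrier := {f | ∀ t, f t ∈ G.F N' n}
      add_mem' := fun ha hb t => Submodule.add_mem _ (ha t) (hb t)
      zero_mem' := fun t => Submodule.zero_mem _
      smul_mem' := fun c f hf t => Submodule.smul_mem _ c (hf t) }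
  have hmono : ∀ n, HF (n - N') ≤ HF n := fun n f hf t => G.F_sub_le N' n (hf t)
  have hcongr : ∀ (f₀ f : ι → Module.End k M), (∀ i, CongrOp (G.F N') N' p (f₀ i) (f i)) →
      ∀ g : ι → Module.End k (TensorAlgebra k V),
      CongrOp HF N' p (∑ i, LinearMap.lcomp k M (g i) ∘ₗ LinearMap.llcomp k _ _ _ (f₀ i))
        (∑ i, LinearMap.lcomp k M (g i) ∘ₗ LinearMap.llcomp k _ _ _ (f i)) := by
    intro f₀ f hf g
    exact CongrOp.sum _ fun i _ => ⟨fun n x hx t => (hf i).map₀ n _ (hx _),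
      fun n x hx t => (hf i).lower n _ (hx _)⟩
  have hhom : ∀ (f : ι → Module.End k M), (∀ i, HomogOp G.proj p (f i)) →
      ∀ g : ι → Module.End k (TensorAlgebra k V),
      HomogOp (fun n => LinearMap.llcomp k (TensorAlgebra k V) M M (G.proj n)) p
        (∑ i, LinearMap.lcomp k M (g i) ∘ₗ LinearMap.llcomp k _ _ _ (f i)) := by
    intro f hf g
    exact HomogOp.sum _ fun i _ n x => LinearMap.ext fun t => hf i n _
  refine ⟨fun n f => ?_, fun _ _ => trivial, homD_mem e N R hN _ _ i, homD_mem e N R hN _ _ i,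
    fun n f hf => ?_⟩
  · have := HomogOp.koszulOp N i (hhom _ hl fun i => lcontr (e.coord i))
      (hhom _ hr fun i => rcontr (e.coord i)) (n + p * nu N i) f
    rw [show n + p * nu N i + jump N i * p = n + p * nu N (i + 1) by rw [hnu]; ring] at this
    exact this
  · have hfW : ∀ w ∈ koszulW N R (nu N i), f w ∈ G.F N' (n + p * nu N i) := by
      intro w hw
      rw [hG.mem_F]
      intro j hj
      have := hf.2 (j - p * nu N i) (by
        rw [show n - (j - p * nu N i) = n + p * nu N i - j by ring]
        exact fun h => hj ⟨by omega, h.2⟩) w hw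
      rwa [show (G.hom hG (koszulW N R (nu N i)) (p * nu N i)).proj (j - p * nu N i) f w =
        G.proj (j - p * nu N i + p * nu N i) (f w) from rfl, sub_add_cancel] at this
    -- Off `W` the values of `f` are unrestricted. Precomposing with a projection onto `W` gives a
    -- cochain that is controlled on all of `T(V)` and differs from `f` by one vanishing on `W`, a
    -- condition that both differentials preserve.
    obtain ⟨r, hr0⟩ := Submodule.exists_isCompl (koszulW N R (nu N i))
    let q : TensorAlgebra k V →ₗ[k] TensorAlgebra k V := (koszulW N R (nu N i)).subtype ∘ₗ
      Submodule.projectionOnto _ r hr0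
    have hq : ∀ w ∈ koszulW N R (nu N i), q w = w := fun w hw => by
      simp only [q, LinearMap.comp_apply, Submodule.subtype_apply]
      rw [show Submodule.projectionOnto _ r hr0 w = ⟨w, hw⟩ from
        Submodule.projectionOnto_apply_left hr0 ⟨w, hw⟩]
    have hqW : ∀ t, q t ∈ koszulW N R (nu N i) := fun t => Subtype.mem _
    have hfq : f ∘ₗ q ∈ HF (n + p * nu N i) := fun t => hfW _ (hqW t)
    have hdiff : f - f ∘ₗ q ∈ homVanish M (koszulW N R (nu N i)) := fun w hw => by
      rw [LinearMap.sub_apply, LinearMap.comp_apply, hq w hw, sub_self]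
    have hlow := (CongrOp.koszulOp hmono N i (hcongr _ _ hl' fun i => lcontr (e.coord i))
      (hcongr _ _ hr' fun i => rcontr (e.coord i))).lower _ _ hfq
    refine ⟨trivial, fun j hj w hw => ?_⟩
    have h1 := homD_mem e N R hN lam rho i _ hdiff w hw
    have h2 := homD_mem e N R hN lam₀ rho₀ i _ hdiff w hw
    rw [map_sub, LinearMap.sub_apply, sub_eq_zero] at h1 h2
    change G.proj _ ((homD e N lam rho i f - homD e N lam₀ rho₀ i f) w) = 0
    rw [LinearMap.sub_apply, h1, h2, ← LinearMap.sub_apply]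
    refine hG.mem_F.1 (hlow w) _ ?_
    rw [show n + p * nu N i + jump N i * p - N' = n - N' + p * nu N (i + 1) by rw [hnu]; ring,
      add_sub_add_right_eq_sub]
    exact fun h => hj ⟨by omega, h.2⟩

end Gradings
end
end NKoszulCY

namespace NKoszulCY
noncomputable section

/-! ### Operators of multiplication by letters, and exactness of the bimodule complex -/

section Letters

variable {k : Type u} [Field k] {H : Type*} [AddCommGroup H] [Module k H] {β : Type*}
  (a : Module.Basis β k H) (deg : β → ℕ)

/-- The grading given by a basis with nonnegative degrees. -/
def gr : GrMod k H := GrMod.ofBasis a (fun b => (deg b : ℤ)) ⟨0, fun _ => by positivity⟩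

/-- The grading of the tensor square with weights `w₁` and `w₂` on the factors. -/
def gr2 (w₁ w₂ : ℕ) : GrMod k (H ⊗[k] H) :=
  GrMod.ofBasis (a.tensorProduct a) (fun p => (w₁ * deg p.1 + w₂ * deg p.2 : ℤ))
    ⟨0, fun _ => by positivity⟩

theorem full_gr : (gr a deg).Full := GrMod.full_ofBasis _ _ _

theorem full_gr2 (w₁ w₂ : ℕ) : (gr2 a deg w₁ w₂).Full := GrMod.full_ofBasis _ _ _

variable {a deg} {N N' w₁ w₂ : ℕ}

theorem tmul_mem_F (h₁ : (N' : ℤ) ∣ w₁ * N) (h₂ : (N' : ℤ) ∣ w₂ * N) {m m' : ℤ} {x y : H}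
    (hx : x ∈ (gr a deg).F N m) (hy : y ∈ (gr a deg).F N m') :
    x ⊗ₜ[k] y ∈ (gr2 a deg w₁ w₂).F N' (w₁ * m + w₂ * m') := by
  have key : ∀ b, (deg b : ℤ) ≤ m → (N : ℤ) ∣ m - deg b → a b ∈ Submodule.comap
      ((TensorProduct.mk k H H).flip y) ((gr2 a deg w₁ w₂).F N' (w₁ * m + w₂ * m')) := by
    intro b hb hbN
    refine GrMod.ofBasis_induction a _ _ N (Submodule.comap (TensorProduct.mk k H H (a b))
      ((gr2 a deg w₁ w₂).F N' (w₁ * m + w₂ * m'))) (fun c hc hcN => ?_) hy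
    rw [Submodule.mem_comap, TensorProduct.mk_apply, ← Module.Basis.tensorProduct_apply]
    refine GrMod.basis_mem_F _ _ _ N' ?_ ?_
    · dsimp only
      gcongr
    · dsimp only
      rw [show (w₁ * m + w₂ * m' : ℤ) - (w₁ * deg b + w₂ * deg c) =
        w₁ * (m - deg b) + w₂ * (m' - deg c) by ring]
      exact dvd_add (h₁.trans (mul_dvd_mul_left _ hbN)) (h₂.trans (mul_dvd_mul_left _ hcN))
  exact GrMod.ofBasis_induction a _ _ N _ key hx

theorem gr_basis_mem_F (b : β) : a b ∈ (gr a deg).F N (deg b) :=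
  GrMod.basis_mem_F _ _ _ N le_rfl (by simp)

/-- A drop by `N` in the first factor is a drop by `w₁ * N` in the total degree, which is at least
`N'` and a multiple of it. -/
theorem congrOp_rTensor (h₁ : (N' : ℤ) ∣ w₁ * N) (h₂ : (N' : ℤ) ∣ w₂ * N)
    (hle : (N' : ℤ) ≤ w₁ * N) {T₀ T : Module.End k H} {p : ℤ}
    (h : CongrOp ((gr a deg).F N) N p T₀ T) :
    CongrOp ((gr2 a deg w₁ w₂).F N') N' (w₁ * p) (LinearMap.rTensor H T₀)
      (LinearMap.rTensor H T) := by
  refine ⟨fun n x hx => ?_, fun n x hx => ?_⟩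
  · refine GrMod.ofBasis_induction (a.tensorProduct a) _ _ N' (Submodule.comap
      (LinearMap.rTensor H T₀) ((gr2 a deg w₁ w₂).F N' (n + w₁ * p))) (fun b hb hbN => ?_) hx
    rw [Submodule.mem_comap, Module.Basis.tensorProduct_apply, LinearMap.rTensor_tmul]
    refine GrMod.F_le_of_dvd _ _ ?_ ?_ (tmul_mem_F h₁ h₂ (h.map₀ _ _ (gr_basis_mem_F b.1))
      (gr_basis_mem_F b.2))
    · linarith
    · convert hbN using 1; ring
  · refine GrMod.ofBasis_induction (a.tensorProduct a) _ _ N' (Submodule.comap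
      (LinearMap.rTensor H T - LinearMap.rTensor H T₀)
        ((gr2 a deg w₁ w₂).F N' (n + w₁ * p - N'))) (fun b hb hbN => ?_) hx
    rw [Submodule.mem_comap, Module.Basis.tensorProduct_apply, LinearMap.sub_apply,
      LinearMap.rTensor_tmul, LinearMap.rTensor_tmul, ← TensorProduct.sub_tmul]
    refine GrMod.F_le_of_dvd _ _ ?_ ?_ (tmul_mem_F h₁ h₂ (h.lower _ _ (gr_basis_mem_F b.1))
      (gr_basis_mem_F b.2))
    · linarith
    · obtain ⟨c, hc⟩ := hbN
      obtain ⟨c', hc'⟩ := h₁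
      exact ⟨c + c' - 1, by linear_combination hc + hc'⟩

theorem congrOp_lTensor (h₁ : (N' : ℤ) ∣ w₁ * N) (h₂ : (N' : ℤ) ∣ w₂ * N)
    (hle : (N' : ℤ) ≤ w₂ * N) {T₀ T : Module.End k H} {p : ℤ}
    (h : CongrOp ((gr a deg).F N) N p T₀ T) :
    CongrOp ((gr2 a deg w₁ w₂).F N') N' (w₂ * p) (LinearMap.lTensor H T₀)
      (LinearMap.lTensor H T) := by
  refine ⟨fun n x hx => ?_, fun n x hx => ?_⟩
  · refine GrMod.ofBasis_induction (a.tensorProduct a) _ _ N' (Submodule.comap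
      (LinearMap.lTensor H T₀) ((gr2 a deg w₁ w₂).F N' (n + w₂ * p))) (fun b hb hbN => ?_) hx
    rw [Submodule.mem_comap, Module.Basis.tensorProduct_apply, LinearMap.lTensor_tmul]
    refine GrMod.F_le_of_dvd _ _ ?_ ?_ (tmul_mem_F h₁ h₂ (gr_basis_mem_F b.1)
      (h.map₀ _ _ (gr_basis_mem_F b.2)))
    · linarith
    · convert hbN using 1; ring
  · refine GrMod.ofBasis_induction (a.tensorProduct a) _ _ N' (Submodule.comap
      (LinearMap.lTensor H T - LinearMap.lTensor H T₀)
        ((gr2 a deg w₁ w₂).F N' (n + w₂ * p - N'))) (fun b hb hbN => ?_) hx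
    rw [Submodule.mem_comap, Module.Basis.tensorProduct_apply, LinearMap.sub_apply,
      LinearMap.lTensor_tmul, LinearMap.lTensor_tmul, ← TensorProduct.tmul_sub]
    refine GrMod.F_le_of_dvd _ _ ?_ ?_ (tmul_mem_F h₁ h₂ (gr_basis_mem_F b.1)
      (h.lower _ _ (gr_basis_mem_F b.2)))
    · linarith
    · obtain ⟨c, hc⟩ := hbN
      obtain ⟨c', hc'⟩ := h₂
      exact ⟨c + c' - 1, by linear_combination hc + hc'⟩

theorem gr2_proj_tmul {m m' : ℤ} {x y : H} (hx : (gr a deg).proj m x = x)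
    (hy : (gr a deg).proj m' y = y) :
    (gr2 a deg w₁ w₂).proj (w₁ * m + w₂ * m') (x ⊗ₜ[k] y) = x ⊗ₜ y := by
  classical
  have key : ∀ x y : H, (gr2 a deg w₁ w₂).proj (w₁ * m + w₂ * m')
      ((gr a deg).proj m x ⊗ₜ[k] (gr a deg).proj m' y) =
      (gr a deg).proj m x ⊗ₜ (gr a deg).proj m' y := by
    intro x y
    refine LinearMap.congr_fun (LinearMap.congr_fun (f := (LinearMap.llcomp k _ _ _
      ((gr2 a deg w₁ w₂).proj (w₁ * m + w₂ * m'))) ∘ₗ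
      (TensorProduct.mk k H H).compl₁₂ ((gr a deg).proj m) ((gr a deg).proj m'))
      (g := (TensorProduct.mk k H H).compl₁₂ ((gr a deg).proj m) ((gr a deg).proj m'))
      (a.ext fun b => a.ext fun c => ?_) x) y
    simp only [LinearMap.comp_apply, LinearMap.llcomp_apply, LinearMap.compl₁₂_apply,
      TensorProduct.mk_apply]
    rw [gr, GrMod.ofBasis_proj_basis, GrMod.ofBasis_proj_basis]
    split_ifs with h h'
    · rw [← Module.Basis.tensorProduct_apply, gr2, GrMod.ofBasis_proj_basis, if_pos]
      rw [h, h']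
    · rw [TensorProduct.tmul_zero, map_zero]
    · rw [TensorProduct.zero_tmul, map_zero]
    · rw [TensorProduct.zero_tmul, map_zero]
  have := key x y
  rwa [hx, hy] at this

theorem gr_proj_basis (b : β) : (gr a deg).proj (deg b) (a b) = a b := by
  classical
  rw [gr, GrMod.ofBasis_proj_basis, if_pos rfl]

theorem homogOp_rTensor {T : Module.End k H} {p : ℤ} (h : HomogOp (gr a deg).proj p T) :
    HomogOp (gr2 a deg w₁ w₂).proj (w₁ * p) (LinearMap.rTensor H T) := by
  refine GrMod.ofBasis_homog _ _ _ _ _ _ fun b => ?_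
  rw [Module.Basis.tensorProduct_apply, LinearMap.rTensor_tmul]
  convert gr2_proj_tmul (w₁ := w₁) (w₂ := w₂) (m := deg b.1 + p) (m' := deg b.2) ?_
    (gr_proj_basis b.2) using 2
  · ring_nf
  · rw [h, gr_proj_basis]

theorem homogOp_lTensor {T : Module.End k H} {p : ℤ} (h : HomogOp (gr a deg).proj p T) :
    HomogOp (gr2 a deg w₁ w₂).proj (w₂ * p) (LinearMap.lTensor H T) := by
  refine GrMod.ofBasis_homog _ _ _ _ _ _ fun b => ?_
  rw [Module.Basis.tensorProduct_apply, LinearMap.lTensor_tmul]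
  convert gr2_proj_tmul (w₁ := w₁) (w₂ := w₂) (m := deg b.1) (m' := deg b.2 + p)
    (gr_proj_basis b.1) ?_ using 2
  · ring_nf
  · rw [h, gr_proj_basis]

variable {ι : Type*}

variable (a deg N) in
/-- The operators `L`, `R` of left and right multiplication by letters are perturbations of
operators `L₀`, `R₀` of degree one. -/
structure LetterOps (L₀ R₀ L R : ι → Module.End k H) : Prop where
  homL : ∀ i, HomogOp (gr a deg).proj 1 (L₀ i)
  homR : ∀ i, HomogOp (gr a deg).proj 1 (R₀ i)
  congrL : ∀ i, CongrOp ((gr a deg).F N) N 1 (L₀ i) (L i)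
  congrR : ∀ i, CongrOp ((gr a deg).F N) N 1 (R₀ i) (R i)

variable {V : Type v} [AddCommGroup V] [Module k V] [Fintype ι]
  (e : Module.Basis ι k V) (R : Submodule k (TensorAlgebra k V))

/-- Exactness of the Koszul complex is inherited by perturbations. -/
theorem TensorExact.perturb {M : Type*} [AddCommGroup M] [Module k M] {G : GrMod k M}
    (hG : G.Full) {p : ℤ} {lam₀ rho₀ lam rho : ι → Module.End k M} (hN : 1 ≤ N)
    (hl : ∀ i, HomogOp G.proj p (lam₀ i)) (hr : ∀ i, HomogOp G.proj p (rho₀ i))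
    (hl' : ∀ i, CongrOp (G.F 1) 1 p (lam₀ i) (lam i))
    (hr' : ∀ i, CongrOp (G.F 1) 1 p (rho₀ i) (rho i)) {i : ℕ}
    (hD : ∀ x ∈ tensorSub M (koszulW N R (nu N (i + 2))),
      tensorD e N lam rho i (tensorD e N lam rho (i + 1) x) = 0)
    (h : TensorExact e N R lam₀ rho₀ i) : TensorExact e N R lam rho i := by
  intro x hx hx0
  have h1 := perturb_tensorD (N' := 1) e N R hG hN hl hr hl' hr' i
  have h2 := perturb_tensorD (N' := 1) e N R hG hN hl hr hl' hr' (i + 1)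
  obtain ⟨y, hy, hyx⟩ := GrMod.Perturb.exact h2 h1
    (fun z hz => (Submodule.mem_bot k).2 (hD z hz)) (fun z hz hz0 => by
      obtain ⟨y, hy, rfl⟩ := h z hz ((Submodule.mem_bot k).1 hz0)
      exact ⟨y, hy, by rw [sub_self]; exact Submodule.zero_mem _⟩) hx ((Submodule.mem_bot k).2 hx0)
  exact ⟨y, hy, (sub_eq_zero.1 ((Submodule.mem_bot k).1 hyx)).symm⟩

/-- Exactness is preserved by tensoring with a vector space. -/
theorem TensorExact.rTensor {lam : ι → Module.End k H} {i : ℕ} (Y : Type*) [AddCommGroup Y]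
    [Module k Y] (h : TensorExact e N R lam 0 i) :
    TensorExact e N R (fun j => LinearMap.rTensor Y (lam j)) 0 i := by
  classical
  -- A basis of `Y` cuts `H ⊗ Y` into copies of `H`: `θ j` extracts the `j`-th copy, `s j` inserts
  -- it, and both commute with the differentials.
  let c := Module.Basis.ofVectorSpace k Y
  let θ : _ → (H ⊗[k] Y) ⊗[k] TensorAlgebra k V →ₗ[k] H ⊗[k] TensorAlgebra k V := fun j =>
    LinearMap.rTensor _ ((TensorProduct.rid k H).toLinearMap ∘ₗ LinearMap.lTensor H (c.coord j))
  let s : _ → H ⊗[k] TensorAlgebra k V →ₗ[k] (H ⊗[k] Y) ⊗[k] TensorAlgebra k V := fun j =>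
    LinearMap.rTensor _ ((TensorProduct.mk k H Y).flip (c j))
  have hθ : ∀ j x y t, θ j ((x ⊗ₜ y) ⊗ₜ t) = (c.repr y j • x) ⊗ₜ t := fun j x y t => by
    simp [θ]
  have hs : ∀ j x t, s j (x ⊗ₜ t) = (x ⊗ₜ c j) ⊗ₜ t := fun j x t => rfl
  have hsum : ∀ x, ∃ S : Finset _, ∀ S', S ⊆ S' → ∑ j ∈ S', s j (θ j x) = x := by
    intro x
    induction x using TensorProduct.induction_on with
    | zero => exact ⟨∅, fun S' _ => by simp⟩
    | tmul m t =>
      induction m using TensorProduct.induction_on with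
      | zero => exact ⟨∅, fun S' _ => by simp⟩
      | tmul x y =>
        refine ⟨(c.repr y).support, fun S' hS' => ?_⟩
        rw [Finset.sum_congr rfl fun j _ => show s j (θ j ((x ⊗ₜ y) ⊗ₜ t)) =
          (x ⊗ₜ (c.repr y j • c j)) ⊗ₜ t by rw [hθ, hs, TensorProduct.smul_tmul],
          ← TensorProduct.sum_tmul, ← TensorProduct.tmul_sum]
        congr 2
        conv_rhs => rw [← c.linearCombination_repr y]
        rw [Finsupp.linearCombination_apply, Finsupp.sum_of_support_subset _ hS' _
          (fun i _ => zero_smul k (c i))]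
      | add a b ha hb =>
        obtain ⟨S₁, h₁⟩ := ha
        obtain ⟨S₂, h₂⟩ := hb
        refine ⟨S₁ ∪ S₂, fun S' hS' => ?_⟩
        simp only [TensorProduct.add_tmul, map_add, Finset.sum_add_distrib]
        rw [h₁ S' (Finset.union_subset_left hS'), h₂ S' (Finset.union_subset_right hS')]
    | add a b ha hb =>
      obtain ⟨S₁, h₁⟩ := ha
      obtain ⟨S₂, h₂⟩ := hb
      refine ⟨S₁ ∪ S₂, fun S' hS' => ?_⟩
      simp only [map_add, Finset.sum_add_distrib]
      rw [h₁ S' (Finset.union_subset_left hS'), h₂ S' (Finset.union_subset_right hS')]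
  have hθD : ∀ j n x, θ j (tensorD e N (fun j => LinearMap.rTensor Y (lam j)) 0 n x) =
      tensorD e N lam 0 n (θ j x) := by
    intro j n x
    refine koszulOp_conj N n (θ j) (fun x => ?_) (fun x => ?_) x
    · refine LinearMap.congr_fun (f := θ j ∘ₗ tensorL e _) (g := tensorL e lam ∘ₗ θ j)
        (TensorProduct.ext (TensorProduct.ext' fun x y => LinearMap.ext fun t => ?_)) x
      simp [tensorL_tmul, hθ, map_sum]
    · simp [tensorR_zero]
  have hsD : ∀ j n x, s j (tensorD e N lam 0 n x) =
      tensorD e N (fun j => LinearMap.rTensor Y (lam j)) 0 n (s j x) := by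
    intro j n x
    refine koszulOp_conj N n (s j) (fun x => ?_) (fun x => ?_) x
    · refine LinearMap.congr_fun (f := s j ∘ₗ tensorL e _) (g := tensorL e _ ∘ₗ s j)
        (TensorProduct.ext' fun x t => ?_) x
      simp [tensorL_tmul, hs, map_sum]
    · simp [tensorR_zero]
  have hθm : ∀ j W x, x ∈ tensorSub (H ⊗[k] Y) W → θ j x ∈ tensorSub H W := by
    intro j W x hx
    induction hx using tensorSub_induction with
    | h0 => rw [map_zero]; exact Submodule.zero_mem _
    | h1 m t ht => exact tmul_mem_tensorSub _ ht
    | hadd a b _ _ ha hb => rw [map_add]; exact Submodule.add_mem _ ha hb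
  have hsm : ∀ j W x, x ∈ tensorSub H W → s j x ∈ tensorSub (H ⊗[k] Y) W := by
    intro j W x hx
    induction hx using tensorSub_induction with
    | h0 => rw [map_zero]; exact Submodule.zero_mem _
    | h1 m t ht => exact tmul_mem_tensorSub _ ht
    | hadd a b _ _ ha hb => rw [map_add]; exact Submodule.add_mem _ ha hb
  intro x hx hx0
  choose y hy hyx using fun j => h (θ j x) (hθm j _ x hx) (by rw [← hθD, hx0, map_zero])
  obtain ⟨S, hS⟩ := hsum x
  refine ⟨∑ j ∈ S, s j (y j), Submodule.sum_mem _ fun j _ => hsm j _ _ (hy j), ?_⟩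
  rw [map_sum]
  conv_rhs => rw [← hS S subset_rfl]
  exact Finset.sum_congr rfl fun j _ => by rw [← hsD, hyx]

/-- The bimodule Koszul complex is exact if the one-sided one is. -/
theorem LetterOps.tensorExact {L₀ R₀ L₁ R₁ : ι → Module.End k H}
    (hop : LetterOps a deg N L₀ R₀ L₁ R₁) (hN : 1 ≤ N) {i : ℕ}
    (hD : ∀ x ∈ tensorSub (H ⊗[k] H) (koszulW N R (nu N (i + 2))),
      tensorD e N (fun j => LinearMap.rTensor H (R₁ j)) (fun j => LinearMap.lTensor H (L₁ j)) i
        (tensorD e N (fun j => LinearMap.rTensor H (R₁ j)) (fun j => LinearMap.lTensor H (L₁ j))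
          (i + 1) x) = 0)
    (h : TensorExact e N R R₀ 0 i) :
    TensorExact e N R (fun j => LinearMap.rTensor H (R₁ j))
      (fun j => LinearMap.lTensor H (L₁ j)) i := by
  have hF := fun n => (gr2 a deg 2 1).F_sub_le 1 n
  have hd : ∀ z : ℤ, ((1 : ℕ) : ℤ) ∣ z := fun z => by simp
  -- The weights `2` and `1` break the symmetry between the factors. Absorbing a letter into the
  -- first factor raises the degree by `2`, into the second only by `1`. So the latter is of lower
  -- order, and the bimodule complex is a perturbation of the one-sided complex tensored with `H`.
  refine TensorExact.perturb e R (full_gr2 a deg 2 1) (p := 2)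
    (lam₀ := fun j => LinearMap.rTensor H (R₀ j)) (rho₀ := 0) hN (fun j => ?_)
    (fun j n x => by simp) (fun j => ?_) (fun j => ⟨fun n x _ => by simp, fun n x hx => ?_⟩) hD
    (h.rTensor e R H)
  · simpa using homogOp_rTensor (w₁ := 2) (w₂ := 1) (hop.homR j)
  · simpa using congrOp_rTensor (w₁ := 2) (w₂ := 1) (N' := 1) (hd _) (hd _)
      (by push_cast; omega) (hop.congrR j)
  · have := (congrOp_lTensor (w₁ := 2) (w₂ := 1) (N' := 1) (hd _) (hd _)
      (by push_cast; omega) (hop.congrL j)).map hF n x hx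
    simpa [show n + 2 - 1 = n + 1 by ring] using this

end Letters
end
end NKoszulCY

namespace NKoszulCY
noncomputable section

/-! ### The graded algebra `T(V) / I(R)` -/

section GradedQuotient

variable {k : Type u} [Field k] {V : Type v} [AddCommGroup V] [Module k V]

theorem quotMk_surjective (P : Submodule k (TensorAlgebra k V)) :
    Function.Surjective (quotMk P) :=
  RingQuot.mkAlgHom_surjective k _

theorem quotMk_of_mem {P : Submodule k (TensorAlgebra k V)} {t : TensorAlgebra k V} (ht : t ∈ P) :
    quotMk P t = 0 := by
  rw [← map_zero (quotMk P)]
  exact RingQuot.mkAlgHom_rel k ⟨ht, rfl⟩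

/-- The algebra map out of `T(V) / I(P)` induced by a map killing `P`. -/
def quotLift (P : Submodule k (TensorAlgebra k V)) {B : Type*} [Ring B] [Algebra k B]
    (f : TensorAlgebra k V →ₐ[k] B) (hf : ∀ p ∈ P, f p = 0) : QuotAlg P →ₐ[k] B :=
  RingQuot.liftAlgHom k ⟨f, fun a b h => by rw [hf a h.1, h.2, map_zero]⟩

theorem quotLift_quotMk (P : Submodule k (TensorAlgebra k V)) {B : Type*} [Ring B] [Algebra k B]
    (f : TensorAlgebra k V →ₐ[k] B) (hf : ∀ p ∈ P, f p = 0) (t : TensorAlgebra k V) :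
    quotLift P f hf (quotMk P t) = f t :=
  RingQuot.liftAlgHom_mkAlgHom_apply k _ _ _

/-- The action of `T(V)` on the quotient by `⊤ * P * ⊤` kills `P`, so it factors through `T(V) /
I(P)`; apply `t` to the class of `1`. -/
theorem mem_of_quotMk_eq_zero (P : Submodule k (TensorAlgebra k V)) {t : TensorAlgebra k V}
    (ht : quotMk P t = 0) : t ∈ (⊤ : Submodule k (TensorAlgebra k V)) * P * ⊤ := by
  let I : Ideal (TensorAlgebra k V) :=
    { ((⊤ : Submodule k (TensorAlgebra k V)) * P * ⊤) with
      smul_mem' := fun c x hx => by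
        have h : c * x ∈ (⊤ : Submodule k (TensorAlgebra k V)) * (⊤ * P * ⊤) :=
          Submodule.mul_mem_mul trivial hx
        rw [← mul_assoc, ← mul_assoc] at h
        exact (mul_le_mul' (mul_le_mul' le_top le_rfl) le_rfl :
          (⊤ : Submodule k (TensorAlgebra k V)) * ⊤ * P * ⊤ ≤ ⊤ * P * ⊤) h }
  have hI : ∀ x, x ∈ I ↔ x ∈ (⊤ : Submodule k (TensorAlgebra k V)) * P * ⊤ := fun _ => Iff.rfl
  let f : TensorAlgebra k V →ₐ[k] Module.End k (TensorAlgebra k V ⧸ I) :=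
    Algebra.lsmul k k (TensorAlgebra k V ⧸ I)
  have hf : ∀ p ∈ P, f p = 0 := by
    intro p hp
    refine LinearMap.ext fun x => ?_
    obtain ⟨y, rfl⟩ := Submodule.Quotient.mk_surjective I x
    refine (Submodule.Quotient.mk_eq_zero I).2 ((hI _).2 ?_)
    change p * y ∈ _
    rw [← one_mul (p * y), ← mul_assoc]
    exact Submodule.mul_mem_mul (Submodule.mul_mem_mul trivial hp) trivial
  have h1 : f t (Submodule.Quotient.mk 1) = 0 := by
    rw [← quotLift_quotMk P f hf, ht, map_zero, LinearMap.zero_apply]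
  have h2 := (Submodule.Quotient.mk_eq_zero I).1 h1
  change t * 1 ∈ _ at h2
  rwa [mul_one] at h2

section Coaction

variable {B : Type*} [Ring B] [Algebra k B] (q : TensorAlgebra k V →ₐ[k] B)

open Polynomial in
/-- The algebra map `T(V) → B[X]` which sends `v` to `q v X`. -/
def coact : TensorAlgebra k V →ₐ[k] B[X] :=
  TensorAlgebra.lift k ((Polynomial.monomial 1).restrictScalars k ∘ₗ q.toLinearMap ∘ₗ
    TensorAlgebra.ι k)

theorem coact_of_mem_tpow {m : ℕ} {t : TensorAlgebra k V} (ht : t ∈ tpow k V m) :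
    coact q t = Polynomial.monomial m (q t) := by
  induction m generalizing t with
  | zero =>
    rw [tpow_zero, Submodule.mem_one] at ht
    obtain ⟨c, rfl⟩ := ht
    rw [AlgHom.commutes, AlgHom.commutes, Polynomial.monomial_zero_left]
    rfl
  | succ m ih =>
    rw [tpow_add, tpow_one] at ht
    induction ht using Submodule.mul_induction_on' with
    | mem_mul_mem a ha b hb =>
      obtain ⟨v, rfl⟩ := hb
      rw [map_mul, ih ha]
      simp [coact, Polynomial.monomial_mul_monomial]
    | add x _ y _ hx hy => rw [map_add, hx, hy, map_add, map_add]

end Coaction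

variable (k V) in
theorem iSup_tpow : ⨆ m, tpow k V m = ⊤ := by
  rw [eq_top_iff]
  rintro t -
  induction t using TensorAlgebra.induction with
  | algebraMap c =>
    refine Submodule.mem_iSup_of_mem 0 ?_
    rw [tpow_zero]
    exact Submodule.algebraMap_mem c
  | ι v => exact Submodule.mem_iSup_of_mem 1 (ι_mem_tpow v)
  | add a b ha hb => exact Submodule.add_mem _ ha hb
  | mul a b ha hb =>
    have h := Submodule.mul_mem_mul ha hb
    rw [Submodule.iSup_mul] at h
    simp only [Submodule.mul_iSup, ← tpow_add] at h
    exact (iSup_le fun i => iSup_le fun j => le_iSup (tpow k V) (i + j) :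
      ⨆ i, ⨆ j, tpow k V (i + j) ≤ _) h

/-- The kernel of `T(V) → T(V) / I(R)` is homogeneous. -/
theorem mem_iSup_of_quotMk_eq_zero {N : ℕ} {R : Submodule k (TensorAlgebra k V)}
    (hR : R ≤ tpow k V N) {m : ℕ} {t : TensorAlgebra k V} (ht : t ∈ tpow k V m)
    (h0 : quotMk R t = 0) :
    t ∈ ⨆ (i : ℕ) (j : ℕ) (_ : i + N + j = m), tpow k V i * R * tpow k V j := by
  -- The coefficient of `X^m` under the coaction is the projection onto `V^{⊗ m}`. Applied to `⊤ * R
  -- * ⊤` it retains the summands with `i + N + j = m`.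
  let π : TensorAlgebra k V →ₗ[k] TensorAlgebra k V :=
    (Polynomial.lcoeff (TensorAlgebra k V) m).restrictScalars k ∘ₗ (coact (AlgHom.id k _)).toLinearMap
  have hπ : ∀ n s, s ∈ tpow k V n → π s = if n = m then s else 0 := by
    intro n s hs
    simp [π, coact_of_mem_tpow _ hs, Polynomial.coeff_monomial]
  have h1 := mem_of_quotMk_eq_zero R h0
  have h2 : t = π t := by rw [hπ m t ht, if_pos rfl]
  rw [h2]
  have h3 := Submodule.mem_map_of_mem (f := π) h1
  refine (?_ : Submodule.map π _ ≤ _) h3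
  rw [← iSup_tpow k V]
  simp only [Submodule.iSup_mul, Submodule.mul_iSup, Submodule.map_iSup]
  refine iSup_le fun j => iSup_le fun i => ?_
  rintro _ ⟨s, hs, rfl⟩
  have hs' : s ∈ tpow k V (i + N + j) := by
    rw [tpow_add, tpow_add]
    exact mul_le_mul' (mul_le_mul' le_rfl hR) le_rfl hs
  rw [hπ _ _ hs']
  split_ifs with h
  · exact Submodule.mem_iSup_of_mem i (Submodule.mem_iSup_of_mem j (Submodule.mem_iSup_of_mem h hs))
  · exact Submodule.zero_mem _

variable {N : ℕ} {R : Submodule k (TensorAlgebra k V)}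

theorem quotMk_mem_homPiece {m : ℕ} {t : TensorAlgebra k V} (ht : t ∈ tpow k V m) :
    quotMk R t ∈ homPiece R m := ⟨t, ht, rfl⟩

theorem mul_mem_homPiece {m n : ℕ} {x y : QuotAlg R} (hx : x ∈ homPiece R m)
    (hy : y ∈ homPiece R n) : x * y ∈ homPiece R (m + n) := by
  obtain ⟨s, hs, rfl⟩ := hx
  obtain ⟨t, ht, rfl⟩ := hy
  exact ⟨s * t, mul_mem_tpow hs ht, map_mul (quotMk R) _ _⟩

/-- The coaction kills the homogeneous space `R`, hence descends to a map `A → A[X]` whose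
coefficients are the homogeneous components. -/
theorem exists_homogeneous_projection (hR : R ≤ tpow k V N) (m : ℕ) :
    ∃ π : QuotAlg R →ₗ[k] QuotAlg R, ∀ n, ∀ x ∈ homPiece R n, π x = if n = m then x else 0 := by
  have h0 : ∀ r ∈ R, coact (quotMk R) r = 0 := fun r hr => by
    rw [coact_of_mem_tpow _ (hR hr), quotMk_of_mem hr, map_zero]
  refine ⟨(Polynomial.lcoeff (QuotAlg R) m).restrictScalars k ∘ₗ
    (quotLift R (coact (quotMk R)) h0).toLinearMap, fun n x hx => ?_⟩
  obtain ⟨t, ht, rfl⟩ := hx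
  simp [quotLift_quotMk, coact_of_mem_tpow _ ht, Polynomial.coeff_monomial]

theorem iSup_homPiece : ⨆ m, homPiece R m = ⊤ := by
  rw [eq_top_iff]
  rintro x -
  obtain ⟨t, rfl⟩ := quotMk_surjective R x
  have ht : t ∈ ⨆ m, tpow k V m := by rw [iSup_tpow]; trivial
  have h := Submodule.mem_map_of_mem (f := (quotMk R).toLinearMap) ht
  rwa [Submodule.map_iSup] at h

theorem isInternal_homPiece (hR : R ≤ tpow k V N) : DirectSum.IsInternal (homPiece R) := by
  refine DirectSum.isInternal_submodule_of_iSupIndep_of_iSup_eq_top ?_ iSup_homPiece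
  refine iSupIndep_of_dfinsupp_lsum_injective _ ?_
  refine (injective_iff_map_eq_zero _).2 fun f hf => ?_
  ext m
  obtain ⟨π, hπ⟩ := exists_homogeneous_projection hR m
  have h1 : ∀ g : Π₀ i, homPiece R i, π (DFinsupp.lsum ℕ (fun i => (homPiece R i).subtype) g) = g m := by
    intro g
    induction g using DFinsupp.induction with
    | h0 => simp
    | ha i b g _ _ ih =>
      rw [map_add, map_add, ih]
      simp [DFinsupp.single_apply, hπ i b b.2]
      split_ifs with h
      · subst h; rfl
      · rfl
  have := h1 f
  rw [hf, map_zero] at this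
  exact this.symm

/-- The index type of a basis of `A` consisting of homogeneous elements. -/
abbrev HomIndex (R : Submodule k (TensorAlgebra k V)) : Type (max u v) :=
  Σ n, Module.Basis.ofVectorSpaceIndex k (homPiece R n)

/-- A basis of `A` consisting of homogeneous elements. -/
def homBasis (hR : R ≤ tpow k V N) : Module.Basis (HomIndex R) k (QuotAlg R) :=
  (isInternal_homPiece hR).collectedBasis fun n => Module.Basis.ofVectorSpace k (homPiece R n)

/-- The degree of a member of the homogeneous basis. -/
def homDeg (b : HomIndex R) : ℕ := b.1

theorem homBasis_mem (hR : R ≤ tpow k V N) (b : HomIndex R) :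
    homBasis hR b ∈ homPiece R (homDeg b) :=
  (isInternal_homPiece hR).collectedBasis_mem _ b

/-- The grading of `A = T(V) / I(R)`. -/
def grA (hR : R ≤ tpow k V N) : GrMod k (QuotAlg R) := gr (homBasis hR) homDeg

theorem grA_proj_of_mem (hR : R ≤ tpow k V N) {n : ℕ} {x : QuotAlg R} (hx : x ∈ homPiece R n)
    (m : ℤ) : (grA hR).proj m x = if (n : ℤ) = m then x else 0 := by
  classical
  by_cases hm : 0 ≤ m
  · lift m to ℕ using hm
    obtain ⟨π, hπ⟩ := exists_homogeneous_projection hR m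
    have : (grA hR).proj m = π := (homBasis hR).ext fun b => by
      rw [grA, gr, GrMod.ofBasis_proj_basis, hπ _ _ (homBasis_mem hR b)]
      simp
    rw [this, hπ n x hx]
    simp
  · have : (grA hR).proj m = 0 := (homBasis hR).ext fun b => by
      rw [grA, gr, GrMod.ofBasis_proj_basis, if_neg (by omega)]
      rfl
    rw [this, if_neg (by omega)]
    rfl

theorem grA_F_of_mem (hR : R ≤ tpow k V N) {n : ℕ} {x : QuotAlg R} (hx : x ∈ homPiece R n)
    (M : ℕ) : x ∈ (grA hR).F M n := by
  refine (full_gr _ _).mem_F.2 fun j hj => ?_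
  have := grA_proj_of_mem hR hx j
  rw [grA] at this
  rw [this, if_neg]
  rintro rfl
  exact hj ⟨le_rfl, by simp⟩

/-- Shifting letters from the tensor algebra to `A` in terms of a basis. -/
theorem tensorL_mulRight {ι : Type*} [Fintype ι] (e : Module.Basis ι k V) :
    tensorL e (fun j => LinearMap.mulRight k (quotMk R (TensorAlgebra.ι k (e j)))) = shift R := by
  refine TensorProduct.ext' fun x t => ?_
  rw [tensorL_tmul]
  conv_rhs => rw [← sum_ι_mul_lcontr e t, TensorProduct.tmul_add, TensorProduct.tmul_sum, map_add,
    map_sum]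
  simp only [shift_tmul_ι_mul, LinearMap.mulRight_apply]
  simp [shift, splitLeft_algebraMap]

/-- With zero right operators the differential `tensorD` is the power of `shift` that occurs in
`koszulDiff`. -/
theorem IsKoszul.tensorExact (hN : 2 ≤ N) (h : IsKoszul N R) {ι : Type*} [Fintype ι]
    (e : Module.Basis ι k V) (i : ℕ) :
    TensorExact e N R (fun j => LinearMap.mulRight k (quotMk R (TensorAlgebra.ι k (e j)))) 0 i := by
  have hD : ∀ i, tensorD e N
      (fun j => LinearMap.mulRight k (quotMk R (TensorAlgebra.ι k (e j)))) 0 i =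
      shift R ^ (nu N (i + 1) - nu N i) := by
    intro i
    rw [tensorD, tensorR_zero, koszulOp_zero_right (by omega), tensorL_mulRight, nu_succ (by omega),
      Nat.add_sub_cancel_left]
  rintro _ ⟨z, rfl⟩ hz0
  rw [hD] at hz0
  have h1 : LinearMap.lTensor (QuotAlg R) (koszulW N R (nu N (i + 1))).subtype z ∈
      Submodule.map (koszulIncl N R (i + 1)) (LinearMap.ker (koszulDiff N R i)) :=
    ⟨z, hz0, rfl⟩
  rw [h i] at h1
  obtain ⟨y, hy⟩ := h1
  exact ⟨_, ⟨y, rfl⟩, by rw [hD]; exact hy⟩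

end GradedQuotient
end
end NKoszulCY

namespace NKoszulCY
noncomputable section

/-! ### The linear isomorphism `A ≃ U` and its effect on multiplication by letters -/

section Deformation

variable {k : Type u} [Field k] {V : Type v} [AddCommGroup V] [Module k V]
  {N : ℕ} {R : Submodule k (TensorAlgebra k V)} (hR : R ≤ tpow k V N) (φ : R →ₗ[k] k)

theorem quotMk_deformedRel (r : R) :
    quotMk (deformedRel R φ) r = algebraMap k _ (φ r) := by
  have h : (r : TensorAlgebra k V) - algebraMap k _ (φ r) ∈ deformedRel R φ := ⟨r, rfl⟩
  have := quotMk_of_mem h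
  rwa [map_sub, AlgHom.commutes, sub_eq_zero] at this

/-- Representatives in the tensor algebra of the members of the homogeneous basis. -/
def homLift (b : HomIndex R) : TensorAlgebra k V := (homBasis_mem hR b).choose

theorem homLift_mem (b : HomIndex R) : homLift hR b ∈ tpow k V (homDeg b) :=
  (homBasis_mem hR b).choose_spec.1

theorem quotMk_homLift (b : HomIndex R) : quotMk R (homLift hR b) = homBasis hR b :=
  (homBasis_mem hR b).choose_spec.2

/-- A graded section of the projection `T(V) → A`. -/
def homSection : QuotAlg R →ₗ[k] TensorAlgebra k V := (homBasis hR).constr k (homLift hR)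

theorem homSection_homBasis (b : HomIndex R) : homSection hR (homBasis hR b) = homLift hR b :=
  Module.Basis.constr_basis _ _ _ _

theorem quotMk_homSection (x : QuotAlg R) : quotMk R (homSection hR x) = x := by
  refine LinearMap.congr_fun (f := (quotMk R).toLinearMap ∘ₗ homSection hR) (g := LinearMap.id)
    ((homBasis hR).ext fun b => ?_) x
  simp [homSection_homBasis, quotMk_homLift]

theorem homSection_proj_mem (n : ℕ) (x : QuotAlg R) :
    homSection hR ((grA hR).proj n x) ∈ tpow k V n := by
  have : LinearMap.range (homSection hR ∘ₗ (grA hR).proj n) ≤ tpow k V n := by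
    rw [LinearMap.range_eq_map, ← (homBasis hR).span_eq, Submodule.map_span_le]
    rintro _ ⟨b, rfl⟩
    rw [LinearMap.comp_apply, grA_proj_of_mem hR (homBasis_mem hR b)]
    split_ifs with h
    · have h2 := homLift_mem hR b
      rwa [Nat.cast_inj.1 h, ← homSection_homBasis hR] at h2
    · rw [map_zero]; exact Submodule.zero_mem _
  exact this ⟨x, rfl⟩

theorem homSection_mem {n : ℕ} {x : QuotAlg R} (hx : x ∈ homPiece R n) :
    homSection hR x ∈ tpow k V n := by
  have := homSection_proj_mem hR n x
  rwa [grA_proj_of_mem hR hx, if_pos rfl] at this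

/-- The linear map `A → U` determined by a graded section of `T(V) → A`. -/
def toDeform : QuotAlg R →ₗ[k] QuotAlg (deformedRel R φ) :=
  (quotMk (deformedRel R φ)).toLinearMap ∘ₗ homSection hR

/-- Modulo terms of lower degree, `U` looks like `A`. -/
theorem quotMk_sub_toDeform_mem (hN : 1 ≤ N) (m : ℕ) :
    ∀ t ∈ tpow k V m, quotMk (deformedRel R φ) t - toDeform hR φ (quotMk R t) ∈
      Submodule.map (toDeform hR φ) ((grA hR).F N (m - N)) := by
  induction m using Nat.strong_induction_on with
  | _ m ih =>
  intro t ht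
  set t' := t - homSection hR (quotMk R t) with ht'
  have hm : t' ∈ tpow k V m :=
    Submodule.sub_mem _ ht (homSection_mem hR (quotMk_mem_homPiece ht))
  have h0 : quotMk R t' = 0 := by rw [ht', map_sub, quotMk_homSection, sub_self]
  rw [show quotMk (deformedRel R φ) t - toDeform hR φ (quotMk R t) =
    (quotMk (deformedRel R φ)).toLinearMap t' from (map_sub _ _ _).symm]
  have hmem := mem_iSup_of_quotMk_eq_zero hR hm h0
  refine (iSup_le fun i => iSup_le fun j => iSup_le fun hij => ?_ :
    _ ≤ Submodule.comap (quotMk (deformedRel R φ)).toLinearMap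
      (Submodule.map (toDeform hR φ) ((grA hR).F N (m - N)))) hmem
  intro x hx
  induction hx using Submodule.mul_induction_on' with
  | add x _ y _ hx hy => exact Submodule.add_mem _ hx hy
  | mem_mul_mem y hy b hb =>
    induction hy using Submodule.mul_induction_on' with
    | add x _ y _ hx hy => rw [add_mul]; exact Submodule.add_mem _ hx hy
    | mem_mul_mem a ha r hr =>
      -- In `U` the relation `r` is the scalar `φ r`, so `a * r * b` becomes a multiple of `a * b`,
      -- of length smaller by exactly `N`. This is the source of all drops by multiples of `N`.
      have h1 : quotMk (deformedRel R φ) (a * r * b) =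
          φ ⟨r, hr⟩ • quotMk (deformedRel R φ) (a * b) := by
        rw [map_mul, map_mul, quotMk_deformedRel φ ⟨r, hr⟩, ← Algebra.commutes, mul_assoc,
          ← map_mul, Algebra.smul_def]
      rw [Submodule.mem_comap, AlgHom.toLinearMap_apply, h1]
      refine Submodule.smul_mem _ _ ?_
      have hab := mul_mem_tpow ha hb
      have h2 := ih (i + j) (by omega) _ hab
      rw [← sub_add_cancel (quotMk (deformedRel R φ) (a * b))
        (toDeform hR φ (quotMk R (a * b)))]
      have hcast : (m : ℤ) - N = (i + j : ℕ) := by rw [← hij]; push_cast; ring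
      rw [hcast]
      refine Submodule.add_mem _ (Submodule.map_mono ((grA hR).F_sub_le N _) h2) ?_
      exact Submodule.mem_map_of_mem (grA_F_of_mem hR (quotMk_mem_homPiece hab) N)

theorem toDeform_surjective (hN : 1 ≤ N) : Function.Surjective (toDeform hR φ) := by
  intro y
  obtain ⟨t, rfl⟩ := quotMk_surjective _ y
  have ht : t ∈ ⨆ m, tpow k V m := by rw [iSup_tpow]; trivial
  refine (iSup_le fun m t ht => ?_ : _ ≤ Submodule.comap (quotMk (deformedRel R φ)).toLinearMap
    (LinearMap.range (toDeform hR φ))) ht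
  rw [Submodule.mem_comap, AlgHom.toLinearMap_apply,
    ← sub_add_cancel (quotMk (deformedRel R φ) t) (toDeform hR φ (quotMk R t))]
  obtain ⟨x, -, hx⟩ := quotMk_sub_toDeform_mem hR φ hN m t ht
  exact Submodule.add_mem _ ⟨x, hx⟩ ⟨_, rfl⟩

/-- Let `n` be the top degree of a nonzero element of the kernel. In `U` its leading component is
minus the image of the lower ones, so it is zero in `gr_n(U)`, and the PBW isomorphism forces it to
vanish in `A_n`. -/
theorem toDeform_injective (hP : IsPBWDeformation R (deformedRel R φ)) :
    Function.Injective (toDeform hR φ) := by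
  classical
  refine (injective_iff_map_eq_zero _).2 fun x hx => ?_
  by_contra hx0
  have hfull : (grA hR).Full := full_gr _ _
  obtain ⟨S, hS⟩ := hfull.exists_sum x
  have hne : (S.filter fun n => (grA hR).proj n x ≠ 0).Nonempty := by
    by_contra hemp
    rw [Finset.not_nonempty_iff_eq_empty, Finset.filter_eq_empty_iff] at hemp
    refine hx0 ?_
    rw [← hS S subset_rfl]
    exact Finset.sum_eq_zero fun n hn => not_not.1 (hemp hn)
  set n := Finset.max' _ hne with hn
  have hnS := Finset.mem_filter.1 (Finset.max'_mem _ hne)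
  have hnonneg : ∀ j, (grA hR).proj j x ≠ 0 → 0 ≤ j := by
    intro j hj
    by_contra hneg
    refine hj ?_
    have : (grA hR).proj j = 0 := (homBasis hR).ext fun b => by
      rw [grA_proj_of_mem hR (homBasis_mem hR b), if_neg (by omega)]
      rfl
    rw [this]; rfl
  obtain ⟨n', hn'⟩ := Int.eq_ofNat_of_zero_le (hnonneg n hnS.2)
  have hlt : quotMk (deformedRel R φ) (homSection hR ((grA hR).proj n' x)) ∈
      filtLt (deformedRel R φ) n' := by
    have h1 : toDeform hR φ x = ∑ j ∈ S, toDeform hR φ ((grA hR).proj j x) := by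
      rw [← map_sum, hS S subset_rfl]
    rw [hx, ← Finset.add_sum_erase _ _ hnS.1] at h1
    rw [← hn, hn'] at h1
    have h2 := eq_neg_of_add_eq_zero_left h1.symm
    change toDeform hR φ _ ∈ _
    rw [h2]
    refine Submodule.neg_mem _ (Submodule.sum_mem _ fun j hj => ?_)
    rw [Finset.mem_erase] at hj
    by_cases hj0 : (grA hR).proj j x = 0
    · rw [hj0, map_zero]; exact Submodule.zero_mem _
    · obtain ⟨j', rfl⟩ := Int.eq_ofNat_of_zero_le (hnonneg j hj0)
      have hmem : (j' : ℤ) ∈ S.filter fun n => (grA hR).proj n x ≠ 0 :=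
        Finset.mem_filter.2 ⟨hj.2, hj0⟩
      have hle := Finset.le_max' _ _ hmem
      rw [← hn, hn'] at hle
      have hlt' : j' < n' := by
        have := hj.1
        omega
      refine ⟨homSection hR ((grA hR).proj j' x), ?_, rfl⟩
      exact (le_biSup (fun i => tpow k V i) (Finset.mem_range.2 hlt') :
        tpow k V j' ≤ tensorLt k V n') (homSection_proj_mem hR j' x)
  obtain ⟨p, hp⟩ := hP n'
  have h1 : toGr (deformedRel R φ) n' ⟨_, homSection_proj_mem hR n' x⟩ = 0 :=
    (Submodule.Quotient.mk_eq_zero _).2 hlt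
  rw [← hp, LinearEquiv.map_eq_zero_iff] at h1
  have h2 := congrArg Subtype.val h1
  change quotMk R (homSection hR ((grA hR).proj n' x)) = 0 at h2
  rw [quotMk_homSection] at h2
  refine hnS.2 ?_
  rw [← hn, hn']
  exact h2

/-- The linear isomorphism `A ≃ U` given by the PBW property. -/
def deformEquiv (hN : 1 ≤ N) (hP : IsPBWDeformation R (deformedRel R φ)) :
    QuotAlg R ≃ₗ[k] QuotAlg (deformedRel R φ) :=
  LinearEquiv.ofBijective (toDeform hR φ) ⟨toDeform_injective hR φ hP, toDeform_surjective hR φ hN⟩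

theorem homogOp_grA {p : ℕ} {T : Module.End k (QuotAlg R)}
    (h : ∀ n, ∀ x ∈ homPiece R n, T x ∈ homPiece R (n + p)) : HomogOp (grA hR).proj p T := by
  refine GrMod.ofBasis_homog _ _ ⟨0, fun _ => by positivity⟩ _ _ _ fun b => ?_
  have hb := h _ _ (homBasis_mem hR b)
  have := grA_proj_of_mem hR hb (homDeg b + p)
  rw [if_pos (by push_cast; rfl)] at this
  exact this

theorem congrOp_grA {p : ℕ} {T₀ T : Module.End k (QuotAlg R)}
    (h : ∀ n, ∀ x ∈ homPiece R n, T₀ x ∈ homPiece R (n + p))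
    (h' : ∀ b : HomIndex R, T (homBasis hR b) - T₀ (homBasis hR b) ∈
      (grA hR).F N (homDeg b + p - N)) : CongrOp ((grA hR).F N) N p T₀ T := by
  refine ⟨fun n x hx => ?_, fun n x hx => ?_⟩
  · refine GrMod.ofBasis_induction (homBasis hR) _ ⟨0, fun _ => by positivity⟩ N (Submodule.comap T₀ ((grA hR).F N (n + p)))
      (fun b hb hbN => ?_) hx
    refine GrMod.F_le_of_dvd _ _ ?_ ?_ (grA_F_of_mem hR (h _ _ (homBasis_mem hR b)) N)
    · push_cast; linarith
    · push_cast; convert hbN using 1; ring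
  · refine GrMod.ofBasis_induction (homBasis hR) _ ⟨0, fun _ => by positivity⟩ N
      (Submodule.comap (T - T₀) ((grA hR).F N (n + p - N))) (fun b hb hbN => ?_) hx
    refine GrMod.F_le_of_dvd _ _ ?_ ?_ (h' b)
    · linarith
    · convert hbN using 1; ring

theorem ι_mul_mem_homPiece (v : V) (n : ℕ) (x : QuotAlg R) (hx : x ∈ homPiece R n) :
    quotMk R (TensorAlgebra.ι k v) * x ∈ homPiece R (n + 1) := by
  rw [add_comm]
  exact mul_mem_homPiece (quotMk_mem_homPiece (ι_mem_tpow v)) hx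

theorem mul_ι_mem_homPiece (v : V) (n : ℕ) (x : QuotAlg R) (hx : x ∈ homPiece R n) :
    x * quotMk R (TensorAlgebra.ι k v) ∈ homPiece R (n + 1) :=
  mul_mem_homPiece hx (quotMk_mem_homPiece (ι_mem_tpow v))

/-- The operators of multiplication by letters in `U`, transported to `A`. -/
theorem letterOps_deform (hN : 1 ≤ N) (hP : IsPBWDeformation R (deformedRel R φ))
    {ι : Type*} (e : ι → V) :
    LetterOps (homBasis hR) homDeg N
      (fun i => LinearMap.mulLeft k (quotMk R (TensorAlgebra.ι k (e i))))
      (fun i => LinearMap.mulRight k (quotMk R (TensorAlgebra.ι k (e i))))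
      (fun i => (deformEquiv hR φ hN hP).symm.toLinearMap ∘ₗ LinearMap.mulLeft k
        (quotMk (deformedRel R φ) (TensorAlgebra.ι k (e i))) ∘ₗ (deformEquiv hR φ hN hP).toLinearMap)
      (fun i => (deformEquiv hR φ hN hP).symm.toLinearMap ∘ₗ LinearMap.mulRight k
        (quotMk (deformedRel R φ) (TensorAlgebra.ι k (e i))) ∘ₗ
          (deformEquiv hR φ hN hP).toLinearMap) := by
  have key : ∀ (m : ℕ) (t : TensorAlgebra k V), t ∈ tpow k V m →
      (deformEquiv hR φ hN hP).symm (quotMk (deformedRel R φ) t) - quotMk R t ∈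
        (grA hR).F N (m - N) := by
    intro m t ht
    obtain ⟨x, hx, hxt⟩ := quotMk_sub_toDeform_mem hR φ hN m t ht
    suffices h : (deformEquiv hR φ hN hP).symm (quotMk (deformedRel R φ) t) - quotMk R t = x by
      rw [h]; exact hx
    refine (deformEquiv hR φ hN hP).injective ?_
    rw [map_sub, LinearEquiv.apply_symm_apply]
    exact hxt.symm
  have hb : ∀ b, deformEquiv hR φ hN hP (homBasis hR b) =
      quotMk (deformedRel R φ) (homLift hR b) := fun b =>
    congrArg (quotMk (deformedRel R φ)) (homSection_homBasis hR b)
  refine ⟨fun i => homogOp_grA hR (p := 1) (ι_mul_mem_homPiece _),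
    fun i => homogOp_grA hR (p := 1) (mul_ι_mem_homPiece _),
    fun i => congrOp_grA hR (p := 1) (ι_mul_mem_homPiece _) fun b => ?_,
    fun i => congrOp_grA hR (p := 1) (mul_ι_mem_homPiece _) fun b => ?_⟩
  · have := key _ _ (mul_mem_tpow (ι_mem_tpow (e i)) (homLift_mem hR b))
    rw [map_mul (quotMk _), map_mul (quotMk R), quotMk_homLift] at this
    simp only [LinearMap.comp_apply, LinearEquiv.coe_coe, LinearMap.mulLeft_apply, hb]
    rwa [add_comm 1 (homDeg b), Nat.cast_add] at this
  · have := key _ _ (mul_mem_tpow (homLift_mem hR b) (ι_mem_tpow (e i)))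
    rw [map_mul (quotMk _), map_mul (quotMk R), quotMk_homLift] at this
    simp only [LinearMap.comp_apply, LinearEquiv.coe_coe, LinearMap.mulRight_apply, hb]
    rwa [Nat.cast_add] at this

/-- The operators of multiplication by letters in `A` itself. -/
theorem letterOps_self {ι : Type*} (e : ι → V) :
    LetterOps (homBasis hR) homDeg N
      (fun i => LinearMap.mulLeft k (quotMk R (TensorAlgebra.ι k (e i))))
      (fun i => LinearMap.mulRight k (quotMk R (TensorAlgebra.ι k (e i))))
      (fun i => LinearMap.mulLeft k (quotMk R (TensorAlgebra.ι k (e i))))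
      (fun i => LinearMap.mulRight k (quotMk R (TensorAlgebra.ι k (e i)))) :=
  ⟨fun i => homogOp_grA hR (p := 1) (ι_mul_mem_homPiece _),
    fun i => homogOp_grA hR (p := 1) (mul_ι_mem_homPiece _),
    fun i => congrOp_grA hR (p := 1) (ι_mul_mem_homPiece _) fun b => by
      rw [sub_self]; exact Submodule.zero_mem _,
    fun i => congrOp_grA hR (p := 1) (mul_ι_mem_homPiece _) fun b => by
      rw [sub_self]; exact Submodule.zero_mem _⟩

end Deformation
end
end NKoszulCY

namespace NKoszulCY
noncomputable section

/-! ### The square of the deformed differential is zero -/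

section BimoduleComplex

variable {k : Type u} [Field k] {V : Type v} [AddCommGroup V] [Module k V]
  {ι : Type*} [Fintype ι] (e : Module.Basis ι k V) {B : Type w} [Ring B] [Algebra k B]
  (q : TensorAlgebra k V →ₐ[k] B)

/-- The outer left action of a letter seen from the inside: right multiplication by `v ⊗ 1`. -/
def envLam (i : ι) : Module.End k (Env k B) :=
  LinearMap.mulRight k (q (TensorAlgebra.ι k (e i)) ⊗ₜ[k] (1 : Bᵐᵒᵖ))

/-- Right multiplication by `1 ⊗ v` on the enveloping algebra. -/
def envRho (i : ι) : Module.End k (Env k B) :=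
  LinearMap.mulRight k ((1 : B) ⊗ₜ[k] MulOpposite.op (q (TensorAlgebra.ι k (e i))))

omit [Fintype ι] in
theorem commute_envLam_envRho (i j : ι) : Commute (envLam e q i) (envRho e q j) := by
  refine LinearMap.ext fun x => ?_
  simp [envLam, envRho, mul_assoc]

theorem one_tmul_op_algebraMap (c : k) :
    ((1 : B) ⊗ₜ[k] MulOpposite.op (algebraMap k B c) : Env k B) = c • 1 := by
  rw [Algebra.algebraMap_eq_smul_one, MulOpposite.op_smul, TensorProduct.tmul_smul,
    MulOpposite.op_one, Algebra.TensorProduct.one_def]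

theorem tensorL_env_ι_mul (x : Env k B) (v : V) (t : TensorAlgebra k V) :
    tensorL e (envLam e q) (x ⊗ₜ (TensorAlgebra.ι k v * t)) =
      (x * (q (TensorAlgebra.ι k v) ⊗ₜ[k] 1)) ⊗ₜ t := by
  rw [tensorL_tmul]
  simp only [lcontr_ι_mul, ← TensorProduct.smul_tmul, ← TensorProduct.sum_tmul, envLam,
    LinearMap.mulRight_apply, ← mul_smul_comm, ← Finset.mul_sum, TensorProduct.smul_tmul',
    ← map_smul, ← map_sum, Module.Basis.coord_apply, e.sum_repr]

theorem tensorR_env_mul_ι (x : Env k B) (v : V) (t : TensorAlgebra k V) :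
    tensorR e (envRho e q) (x ⊗ₜ (t * TensorAlgebra.ι k v)) =
      (x * (1 ⊗ₜ[k] MulOpposite.op (q (TensorAlgebra.ι k v)))) ⊗ₜ t := by
  rw [tensorR_tmul]
  simp only [rcontr_mul_ι, ← TensorProduct.smul_tmul, ← TensorProduct.sum_tmul, envRho,
    LinearMap.mulRight_apply, ← mul_smul_comm, ← Finset.mul_sum, ← TensorProduct.tmul_smul,
    ← MulOpposite.op_smul, ← TensorProduct.tmul_sum, ← Finset.op_sum,
    ← map_smul, ← map_sum, Module.Basis.coord_apply, e.sum_repr]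

/-- Absorbing one letter after another moves a whole prefix into the left outer factor. -/
theorem tensorL_pow_mul (m : ℕ) {p : TensorAlgebra k V} (hp : p ∈ tpow k V m) (x : Env k B)
    (t : TensorAlgebra k V) :
    (tensorL e (envLam e q) ^ m) (x ⊗ₜ (p * t)) = (x * (q p ⊗ₜ[k] 1)) ⊗ₜ t := by
  induction m generalizing p x with
  | zero =>
    rw [tpow_zero, Submodule.mem_one] at hp
    obtain ⟨c, rfl⟩ := hp
    rw [pow_zero, Module.End.one_apply, ← Algebra.smul_def, AlgHom.commutes,
      Algebra.algebraMap_eq_smul_one, ← TensorProduct.smul_tmul', ← Algebra.TensorProduct.one_def,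
      mul_smul_comm, mul_one, TensorProduct.smul_tmul]
  | succ m ih =>
    rw [add_comm, tpow_add, tpow_one] at hp
    induction hp using Submodule.mul_induction_on' with
    | mem_mul_mem a ha b hb =>
      obtain ⟨v, rfl⟩ := ha
      rw [pow_succ, Module.End.mul_apply, mul_assoc, tensorL_env_ι_mul, ih hb, mul_assoc,
        Algebra.TensorProduct.tmul_mul_tmul, map_mul, one_mul]
    | add a _ b _ ha hb =>
      rw [add_mul, TensorProduct.tmul_add, map_add, ha, hb, map_add, TensorProduct.add_tmul,
        mul_add, TensorProduct.add_tmul]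

theorem tensorR_pow_mul (m : ℕ) {p : TensorAlgebra k V} (hp : p ∈ tpow k V m) (x : Env k B)
    (t : TensorAlgebra k V) :
    (tensorR e (envRho e q) ^ m) (x ⊗ₜ (t * p)) =
      (x * (1 ⊗ₜ[k] MulOpposite.op (q p))) ⊗ₜ t := by
  induction m generalizing p x with
  | zero =>
    rw [tpow_zero, Submodule.mem_one] at hp
    obtain ⟨c, rfl⟩ := hp
    rw [pow_zero, Module.End.one_apply, ← Algebra.commutes, ← Algebra.smul_def, AlgHom.commutes,
      one_tmul_op_algebraMap, mul_smul_comm, mul_one, TensorProduct.smul_tmul]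
  | succ m ih =>
    rw [tpow_add, tpow_one] at hp
    induction hp using Submodule.mul_induction_on' with
    | mem_mul_mem a ha b hb =>
      obtain ⟨v, rfl⟩ := hb
      rw [pow_succ, Module.End.mul_apply, ← mul_assoc, tensorR_env_mul_ι, ih ha, mul_assoc,
        Algebra.TensorProduct.tmul_mul_tmul, map_mul, one_mul, MulOpposite.op_mul]
    | add a _ b _ ha hb =>
      rw [mul_add, TensorProduct.tmul_add, map_add, ha, hb, map_add, MulOpposite.op_add,
        TensorProduct.tmul_add, mul_add, TensorProduct.add_tmul]

section Contractions

variable {M : Type*} [AddCommGroup M] [Module k M]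

theorem commute_lTensor_lcontr_tensorR (ξ : V →ₗ[k] k) (rho : ι → Module.End k M) :
    Commute (LinearMap.lTensor M (lcontr ξ)) (tensorR e rho) := by
  refine TensorProduct.ext' fun m t => ?_
  simp only [Module.End.mul_apply, tensorR_tmul, map_sum, LinearMap.lTensor_tmul, lcontr_rcontr]

theorem commute_lTensor_rcontr_tensorL (ξ : V →ₗ[k] k) (lam : ι → Module.End k M) :
    Commute (LinearMap.lTensor M (rcontr ξ)) (tensorL e lam) := by
  refine TensorProduct.ext' fun m t => ?_
  simp only [Module.End.mul_apply, tensorL_tmul, map_sum, LinearMap.lTensor_tmul, lcontr_rcontr]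

theorem tensorSub_map {W W' : Submodule k (TensorAlgebra k V)}
    (f : TensorAlgebra k V →ₗ[k] TensorAlgebra k V) (hf : ∀ w ∈ W, f w ∈ W')
    {x : M ⊗[k] TensorAlgebra k V} (hx : x ∈ tensorSub M W) :
    LinearMap.lTensor M f x ∈ tensorSub M W' := by
  induction hx using tensorSub_induction with
  | h0 => rw [map_zero]; exact Submodule.zero_mem _
  | h1 m t ht => exact tmul_mem_tensorSub _ (hf _ ht)
  | hadd a b _ _ ha hb => rw [map_add]; exact Submodule.add_mem _ ha hb

theorem koszulOp_koszulOp_eq_zero {dl dr : Module.End k M} (h : Commute dl dr) (N i : ℕ) {x : M}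
    (hx : (dl ^ N) x = (dr ^ N) x) : koszulOp N i dl dr (koszulOp N (i + 1) dl dr x) = 0 := by
  rw [← Module.End.mul_apply, koszulOp_mul_koszulOp_succ N i h, LinearMap.sub_apply, hx, sub_self]

theorem eq_zero_of_lcontr_eq_zero {n : ℕ} {x : M ⊗[k] TensorAlgebra k V}
    (hx : x ∈ tensorSub M (tpow k V (n + 1)))
    (h : ∀ i, LinearMap.lTensor M (lcontr (e.coord i)) x = 0) : x = 0 := by
  have key : x = ∑ i, LinearMap.lTensor M (LinearMap.mulLeft k (TensorAlgebra.ι k (e i)))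
      (LinearMap.lTensor M (lcontr (e.coord i)) x) := by
    clear h
    induction hx using tensorSub_induction with
    | h0 => simp
    | h1 m t ht =>
      have := sum_ι_mul_lcontr e t
      rw [algebraMapInv_of_mem_tpow ht, map_zero, zero_add] at this
      conv_lhs => rw [← this]
      simp [TensorProduct.tmul_sum]
    | hadd a b _ _ ha hb =>
      conv_lhs => rw [ha, hb]
      simp only [map_add, Finset.sum_add_distrib]
  rw [key]
  exact Finset.sum_eq_zero fun i _ => by rw [h i, map_zero]

theorem eq_zero_of_rcontr_eq_zero {n : ℕ} {x : M ⊗[k] TensorAlgebra k V}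
    (hx : x ∈ tensorSub M (tpow k V (n + 1)))
    (h : ∀ i, LinearMap.lTensor M (rcontr (e.coord i)) x = 0) : x = 0 := by
  have key : x = ∑ i, LinearMap.lTensor M (LinearMap.mulRight k (TensorAlgebra.ι k (e i)))
      (LinearMap.lTensor M (rcontr (e.coord i)) x) := by
    clear h
    induction hx using tensorSub_induction with
    | h0 => simp
    | h1 m t ht =>
      have := sum_rcontr_mul_ι e t
      rw [algebraMapInv_of_mem_tpow ht, map_zero, zero_add] at this
      conv_lhs => rw [← this]
      simp [TensorProduct.tmul_sum]
    | hadd a b _ _ ha hb =>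
      conv_lhs => rw [ha, hb]
      simp only [map_add, Finset.sum_add_distrib]
  rw [key]
  exact Finset.sum_eq_zero fun i _ => by rw [h i, map_zero]

theorem eq_of_lcontr_rcontr_eq {n : ℕ} {x y : M ⊗[k] TensorAlgebra k V}
    (hx : x ∈ tensorSub M (tpow k V (n + 2))) (hy : y ∈ tensorSub M (tpow k V (n + 2)))
    (h : ∀ i j, LinearMap.lTensor M (rcontr (e.coord j)) (LinearMap.lTensor M (lcontr (e.coord i)) x)
      = LinearMap.lTensor M (rcontr (e.coord j)) (LinearMap.lTensor M (lcontr (e.coord i)) y)) :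
    x = y := by
  rw [← sub_eq_zero]
  have hxy := Submodule.sub_mem _ hx hy
  refine eq_zero_of_lcontr_eq_zero e hxy fun i => ?_
  refine eq_zero_of_rcontr_eq_zero e (tensorSub_map _ (fun w hw => lcontr_mem_tpow _ hw) hxy)
    fun j => ?_
  rw [map_sub, map_sub, h i j, sub_self]

end Contractions

variable {N : ℕ} {R : Submodule k (TensorAlgebra k V)} (φ : R →ₗ[k] k)

/-- Either power evaluates `φ` at one end of the word. In length `N` there is nothing to compare. In
length `N + 1` the two results are letters with the same image `q w` in `B`, and letters embed into
`B`. Longer words are compared after removing both end letters. -/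
theorem tensorL_pow_eq_tensorR_pow (hR : R ≤ tpow k V N)
    (hq : ∀ r : R, q r = algebraMap k B (φ r))
    (hinj : Function.Injective (q ∘ TensorAlgebra.ι k)) (m : ℕ) :
    ∀ x ∈ tensorSub (Env k B) (koszulW N R (m + N)),
      (tensorL e (envLam e q) ^ N) x = (tensorR e (envRho e q) ^ N) x := by
  have hqL : ∀ (x : Env k B) (r : R) t, (tensorL e (envLam e q) ^ N) (x ⊗ₜ (r * t)) =
      x ⊗ₜ (φ r • t) := fun x r t => by
    rw [tensorL_pow_mul e q N (hR r.2), hq, Algebra.algebraMap_eq_smul_one,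
      ← TensorProduct.smul_tmul', ← Algebra.TensorProduct.one_def, mul_smul_comm, mul_one,
      TensorProduct.smul_tmul]
  have hqR : ∀ (x : Env k B) (r : R) t, (tensorR e (envRho e q) ^ N) (x ⊗ₜ (t * r)) =
      x ⊗ₜ (φ r • t) := fun x r t => by
    rw [tensorR_pow_mul e q N (hR r.2), hq, one_tmul_op_algebraMap, mul_smul_comm, mul_one,
      TensorProduct.smul_tmul]
  induction m using Nat.strong_induction_on with
  | _ m ih =>
  intro x hx
  obtain _ | _ | m := m
  · rw [zero_add] at hx
    induction hx using tensorSub_induction with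
    | h0 => simp
    | h1 x w hw =>
      have hwR := koszulW_self_le N R hw
      have h1 := hqL x ⟨w, hwR⟩ 1
      have h2 := hqR x ⟨w, hwR⟩ 1
      rw [mul_one] at h1
      rw [one_mul] at h2
      rw [h1, h2]
    | hadd a b _ _ ha hb => rw [map_add, map_add, ha, hb]
  · rw [zero_add, add_comm] at hx
    induction hx using tensorSub_induction with
    | h0 => simp
    | h1 x w hw =>
      have hwR := koszulW_succ_le N R hw
      have h1 : ∃ v : V, (tensorL e (envLam e q) ^ N) (x ⊗ₜ w) = x ⊗ₜ TensorAlgebra.ι k v ∧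
          q (TensorAlgebra.ι k v) = q w := by
        refine Submodule.mul_induction_on hwR.1 (fun r hr t ht => ?_) fun a b ha hb => ?_
        · obtain ⟨v, rfl⟩ := ht
          refine ⟨φ ⟨r, hr⟩ • v, ?_, ?_⟩
          · rw [hqL x ⟨r, hr⟩, map_smul]
          · rw [map_mul, hq ⟨r, hr⟩, map_smul, map_smul, Algebra.smul_def]
        · obtain ⟨v, h, h'⟩ := ha
          obtain ⟨v', h'', h'''⟩ := hb
          refine ⟨v + v', ?_, ?_⟩
          · rw [TensorProduct.tmul_add, map_add, h, h'', map_add, TensorProduct.tmul_add]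
          · rw [map_add, map_add, h', h''', map_add]
      have h2 : ∃ v : V, (tensorR e (envRho e q) ^ N) (x ⊗ₜ w) = x ⊗ₜ TensorAlgebra.ι k v ∧
          q (TensorAlgebra.ι k v) = q w := by
        refine Submodule.mul_induction_on hwR.2 (fun t ht r hr => ?_) fun a b ha hb => ?_
        · obtain ⟨v, rfl⟩ := ht
          refine ⟨φ ⟨r, hr⟩ • v, ?_, ?_⟩
          · rw [hqR x ⟨r, hr⟩, map_smul]
          · rw [map_mul, hq ⟨r, hr⟩, map_smul, map_smul, Algebra.smul_def, Algebra.commutes]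
        · obtain ⟨v, h, h'⟩ := ha
          obtain ⟨v', h'', h'''⟩ := hb
          refine ⟨v + v', ?_, ?_⟩
          · rw [TensorProduct.tmul_add, map_add, h, h'', map_add, TensorProduct.tmul_add]
          · rw [map_add, map_add, h', h''', map_add]
      obtain ⟨v, h1, h1'⟩ := h1
      obtain ⟨v', h2, h2'⟩ := h2
      rw [h1, h2, hinj (show (q ∘ TensorAlgebra.ι k) v = (q ∘ TensorAlgebra.ι k) v' from
        h1'.trans h2'.symm)]
    | hadd a b _ _ ha hb => rw [map_add, map_add, ha, hb]
  · have hmem : ∀ x ∈ tensorSub (Env k B) (koszulW N R (m + 1 + 1 + N)),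
        (tensorL e (envLam e q) ^ N) x ∈ tensorSub (Env k B) (koszulW N R (m + 1 + 1)) ∧
        (tensorR e (envRho e q) ^ N) x ∈ tensorSub (Env k B) (koszulW N R (m + 1 + 1)) := fun x hx =>
      ⟨pow_mem_of_desc (fun m => tensorSub (Env k B) (koszulW N R m)) (tensorL_mem e N R _) N
        (m + 1 + 1) x hx,
      pow_mem_of_desc (fun m => tensorSub (Env k B) (koszulW N R m)) (tensorR_mem e N R _) N
        (m + 1 + 1) x hx⟩
    have hle : ∀ {n} {x : Env k B ⊗[k] TensorAlgebra k V}, x ∈ tensorSub (Env k B) (koszulW N R n) →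
        x ∈ tensorSub (Env k B) (tpow k V n) := fun {n x} hx => by
      have := tensorSub_map LinearMap.id (koszulW_le_tpow N R n) hx
      rwa [LinearMap.lTensor_id] at this
    have hlm : ∀ {n} (ξ : V →ₗ[k] k) {x : Env k B ⊗[k] TensorAlgebra k V},
        x ∈ tensorSub (Env k B) (koszulW N R (n + 1)) →
        LinearMap.lTensor _ (lcontr ξ) x ∈ tensorSub (Env k B) (koszulW N R n) := fun ξ x hx =>
      tensorSub_map _ (fun w hw => lcontr_mem_koszulW N R ξ hw) hx
    have hrm : ∀ {n} (ξ : V →ₗ[k] k) {x : Env k B ⊗[k] TensorAlgebra k V},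
        x ∈ tensorSub (Env k B) (koszulW N R (n + 1)) →
        LinearMap.lTensor _ (rcontr ξ) x ∈ tensorSub (Env k B) (koszulW N R n) := fun ξ x hx =>
      tensorSub_map _ (fun w hw => rcontr_mem_koszulW N R ξ hw) hx
    have hLc : ∀ ξ x, LinearMap.lTensor _ (rcontr ξ) ((tensorL e (envLam e q) ^ N) x) =
        (tensorL e (envLam e q) ^ N) (LinearMap.lTensor _ (rcontr ξ) x) := fun ξ x =>
      LinearMap.congr_fun ((commute_lTensor_rcontr_tensorL e ξ (envLam e q)).pow_right N).eq x
    have hRc : ∀ ξ x, LinearMap.lTensor _ (lcontr ξ) ((tensorR e (envRho e q) ^ N) x) =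
        (tensorR e (envRho e q) ^ N) (LinearMap.lTensor _ (lcontr ξ) x) := fun ξ x =>
      LinearMap.congr_fun ((commute_lTensor_lcontr_tensorR e ξ (envRho e q)).pow_right N).eq x
    have hcc : ∀ ξ η (x : Env k B ⊗[k] TensorAlgebra k V),
        LinearMap.lTensor _ (lcontr ξ) (LinearMap.lTensor _ (rcontr η) x) =
        LinearMap.lTensor _ (rcontr η) (LinearMap.lTensor _ (lcontr ξ) x) := fun ξ η x => by
      rw [← LinearMap.comp_apply, ← LinearMap.comp_apply, ← LinearMap.lTensor_comp,
        ← LinearMap.lTensor_comp]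
      congr 2
      exact LinearMap.ext fun t => lcontr_rcontr ξ η t
    have hx' : x ∈ tensorSub (Env k B) (koszulW N R (m + N + 1 + 1)) := by
      rwa [show m + N + 1 + 1 = m + 1 + 1 + N by ring]
    refine eq_of_lcontr_rcontr_eq e (n := m) (hle (hmem x hx).1) (hle (hmem x hx).2) fun i j => ?_
    -- Contraction at the last letter passes through the left power, which induction turns into the
    -- right power, through which contraction at the first letter passes. The other side is treated
    -- symmetrically, and the case `m` compares the results.
    rw [hRc, ← hcc, hLc]
    rw [ih (m + 1) (by omega) _ (by
        rw [show m + 1 + N = m + N + 1 by ring]; exact hrm _ hx'),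
      ← ih (m + 1) (by omega) (LinearMap.lTensor _ (lcontr (e.coord i)) x) (by
        rw [show m + 1 + N = m + N + 1 by ring]; exact hlm _ hx'), hRc, hLc, ← hcc]
    exact (ih m (by omega) _ (hlm _ (hrm _ hx'))).symm

/-- As `ν(i + 2) = ν(i) + N`, the composite is `dl^N - dr^N` on `W_{ν(i) + N}`. -/
theorem tensorD_tensorD (hN : 1 ≤ N) (hR : R ≤ tpow k V N)
    (hq : ∀ r : R, q r = algebraMap k B (φ r))
    (hinj : Function.Injective (q ∘ TensorAlgebra.ι k)) (i : ℕ) :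
    ∀ x ∈ tensorSub (Env k B) (koszulW N R (nu N (i + 2))),
      tensorD e N (envLam e q) (envRho e q) i
        (tensorD e N (envLam e q) (envRho e q) (i + 1) x) = 0 := by
  intro x hx
  rw [nu_succ hN, nu_succ hN, add_assoc, jump_add_jump hN] at hx
  exact koszulOp_koszulOp_eq_zero
    (commute_tensorL_tensorR e fun i j => commute_envLam_envRho e q i j) N i
    (tensorL_pow_eq_tensorR_pow e q φ hR hq hinj _ x hx)

end BimoduleComplex
end
end NKoszulCY

namespace NKoszulCY
noncomputable section

/-! ### Bimodule maps on free modules `E ⊗ W` -/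

section FreeLift

theorem free_hom_ext {k : Type u} [Field k] {E : Type*} [Ring E] [Algebra k E] {W : Type*}
    [AddCommGroup W] [Module k W] {Y : Type*} [AddCommGroup Y] [Module E Y] {f g : E ⊗[k] W →ₗ[E] Y} (h : ∀ w, f (1 ⊗ₜ w) = g (1 ⊗ₜ w)) : f = g := by
  refine LinearMap.ext fun x => ?_
  induction x using TensorProduct.induction_on with
  | zero => simp
  | tmul x w =>
    have : x ⊗ₜ[k] w = x • ((1 : E) ⊗ₜ[k] w) := by rw [TensorProduct.smul_tmul', smul_eq_mul, mul_one]
    rw [this, map_smul, map_smul, h]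
  | add a b ha hb => simp only [map_add, ha, hb]

variable {k : Type u} [Field k] {E : Type*} [Ring E] [Algebra k E] {W : Type*} [AddCommGroup W]
  [Module k W] {Y : Type*} [AddCommGroup Y] [Module E Y] [Module k Y] [IsScalarTower k E Y]

/-- The `E`-linear map on the free module `E ⊗ W` given by a `k`-linear map on `W`. -/
def freeLift (F : W →ₗ[k] Y) : E ⊗[k] W →ₗ[E] Y where
  toFun := TensorProduct.lift (LinearMap.mk₂ k (fun (x : E) w => x • F w)
    (fun x y w => add_smul x y _) (fun c x w => smul_assoc c x _)
    (fun x w w' => by rw [map_add, smul_add])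
    (fun c x w => by
      rw [map_smul, ← algebraMap_smul E c (F w), ← mul_smul, ← Algebra.commutes, mul_smul,
        algebraMap_smul]))
  map_add' := map_add _
  map_smul' c x := by
    induction x using TensorProduct.induction_on with
    | zero => simp
    | tmul x w => simp [TensorProduct.smul_tmul', mul_smul]
    | add a b ha hb => simp only [smul_add, map_add, ha, hb]

theorem freeLift_tmul (F : W →ₗ[k] Y) (x : E) (w : W) : freeLift F (x ⊗ₜ w) = x • F w := by
  simp [freeLift]

theorem exists_freeLift (f : E ⊗[k] W →ₗ[E] Y) : ∃ F : W →ₗ[k] Y, freeLift F = f := by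
  refine ⟨{ toFun := fun w => f (1 ⊗ₜ w)
            map_add' := fun a b => by rw [TensorProduct.tmul_add, map_add]
            map_smul' := fun c w => ?_ }, free_hom_ext fun w => by
              rw [freeLift_tmul, one_smul]; rfl⟩
  rw [TensorProduct.tmul_smul, ← algebraMap_smul E c, map_smul, algebraMap_smul]; rfl

end FreeLift

/-! ### The kernel of the multiplication `Bᵉ → B` -/

section KerEnvMul

variable {k : Type u} [Field k] {B : Type v} [Ring B] [Algebra k B]

/-- The kernel of the multiplication is generated by the differences `x ⊗ 1 - 1 ⊗ x`. -/
theorem mem_of_envMul_eq_zero {S : Set B} (hS : Algebra.adjoin k S = ⊤)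
    (I : Submodule (Env k B) (Env k B))
    (hI : ∀ x ∈ S, x ⊗ₜ[k] (1 : Bᵐᵒᵖ) - 1 ⊗ₜ[k] MulOpposite.op x ∈ I) {z : Env k B}
    (hz : envMul k B z = 0) : z ∈ I := by
  have hI' : ∀ x : B, x ⊗ₜ[k] (1 : Bᵐᵒᵖ) - 1 ⊗ₜ[k] MulOpposite.op x ∈ I := by
    intro x
    have hx : x ∈ Algebra.adjoin k S := hS ▸ Algebra.mem_top
    induction hx using Algebra.adjoin_induction with
    | mem x hx => exact hI x hx
    | algebraMap r =>
      rw [one_tmul_op_algebraMap, Algebra.algebraMap_eq_smul_one, ← TensorProduct.smul_tmul',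
        ← Algebra.TensorProduct.one_def, sub_self]
      exact Submodule.zero_mem _
    | add x y _ _ hx hy =>
      have := Submodule.add_mem _ hx hy
      rwa [sub_add_sub_comm, ← TensorProduct.add_tmul, ← TensorProduct.tmul_add,
        ← MulOpposite.op_add] at this
    | mul x y _ _ hx hy =>
      -- By `xy ⊗ 1 - 1 ⊗ xy = (x ⊗ 1)(y ⊗ 1 - 1 ⊗ y) + (1 ⊗ y)(x ⊗ 1 - 1 ⊗ x)` in `Bᵉ`.
      have h1 := I.smul_mem (x ⊗ₜ[k] 1) hy
      have h2 := I.smul_mem (1 ⊗ₜ[k] MulOpposite.op y) hx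
      have h3 := Submodule.add_mem _ h1 h2
      simpa [smul_eq_mul, mul_sub] using h3
  -- Modulo `I` every element is congruent to `b ⊗ 1`, where `b` is its image under multiplication.
  have key : ∀ z : Env k B, ∃ b : B, envMul k B z = (show selfBimodule k B from b) ∧
      z - b ⊗ₜ[k] 1 ∈ I := by
    intro z
    induction z using TensorProduct.induction_on with
    | zero =>
      refine ⟨0, map_zero _, ?_⟩
      rw [TensorProduct.zero_tmul, sub_zero]
      exact Submodule.zero_mem _
    | tmul a b =>
      refine ⟨a * b.unop, envMul_tmul a b.unop, ?_⟩
      have h1 := I.neg_mem (I.smul_mem (a ⊗ₜ[k] 1) (hI' b.unop))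
      rw [smul_eq_mul, mul_sub, neg_sub, Algebra.TensorProduct.tmul_mul_tmul,
        Algebra.TensorProduct.tmul_mul_tmul, mul_one, one_mul, mul_one] at h1
      exact h1
    | add a b ha hb =>
      obtain ⟨x, hx, hx'⟩ := ha
      obtain ⟨y, hy, hy'⟩ := hb
      refine ⟨x + y, by rw [map_add, hx, hy]; rfl, ?_⟩
      rw [TensorProduct.add_tmul, add_sub_add_comm]
      exact Submodule.add_mem _ hx' hy'
  obtain ⟨b, hb, hb'⟩ := key z
  rw [hz] at hb
  have hb0 : b = 0 := hb.symm
  rwa [hb0, TensorProduct.zero_tmul, sub_zero] at hb'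

end KerEnvMul

/-! ### Restriction of the differentials to the terms `M ⊗ W` -/

section Restriction

variable {k : Type u} [Field k] {V : Type v} [AddCommGroup V] [Module k V]
  {ι : Type*} [Fintype ι] (e : Module.Basis ι k V) {N : ℕ} (hN : 2 ≤ N)
  (R : Submodule k (TensorAlgebra k V)) {M : Type*} [AddCommGroup M] [Module k M]
  (lam rho : ι → Module.End k M)

variable (M) in
/-- The inclusion `M ⊗ W → M ⊗ T(V)`. -/
def tensorIncl (W : Submodule k (TensorAlgebra k V)) : M ⊗[k] W →ₗ[k] M ⊗[k] TensorAlgebra k V :=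
  LinearMap.lTensor M W.subtype

theorem tensorIncl_injective (W : Submodule k (TensorAlgebra k V)) :
    Function.Injective (tensorIncl M W) :=
  Module.Flat.lTensor_preserves_injective_linearMap _ (Submodule.subtype_injective _)

theorem tensorIncl_mem {W : Submodule k (TensorAlgebra k V)} (x : M ⊗[k] W) :
    tensorIncl M W x ∈ tensorSub M W := ⟨x, rfl⟩

/-- The differential of the Koszul complex with coefficients in `M`. -/
def restrD (i : ℕ) : M ⊗[k] koszulW N R (nu N (i + 1)) →ₗ[k] M ⊗[k] koszulW N R (nu N i) :=
  LinearMap.codRestrictOfInjective (tensorD e N lam rho i ∘ₗ tensorIncl M _) (tensorIncl M _)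
    (tensorIncl_injective _) fun x => tensorD_mem e N R (by omega) lam rho i _ (tensorIncl_mem x)

theorem tensorIncl_restrD (i : ℕ) (x : M ⊗[k] koszulW N R (nu N (i + 1))) :
    tensorIncl M _ (restrD e hN R lam rho i x) = tensorD e N lam rho i (tensorIncl M _ x) :=
  LinearMap.codRestrictOfInjective_comp_apply _ _ _ _ _

theorem restrD_rTensor (s : Module.End k M) (hl : ∀ i, Commute s (lam i))
    (hr : ∀ i, Commute s (rho i)) (i : ℕ) (x : M ⊗[k] koszulW N R (nu N (i + 1))) :
    restrD e hN R lam rho i (LinearMap.rTensor _ s x) =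
      LinearMap.rTensor _ s (restrD e hN R lam rho i x) := by
  have hs : ∀ (W : Submodule k (TensorAlgebra k V)) (x : M ⊗[k] W),
      tensorIncl M W (LinearMap.rTensor _ s x) = LinearMap.rTensor _ s (tensorIncl M W x) := by
    intro W x
    rw [tensorIncl, ← LinearMap.comp_apply, ← LinearMap.comp_apply, LinearMap.lTensor_comp_rTensor,
      LinearMap.rTensor_comp_lTensor]
  refine tensorIncl_injective _ ?_
  rw [tensorIncl_restrD, hs, hs, tensorIncl_restrD]
  refine (koszulOp_conj N i _ (fun x => ?_) (fun x => ?_) _).symm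
  · induction x using TensorProduct.induction_on with
    | zero => simp
    | tmul x w =>
      simp only [tensorL_tmul, map_sum, LinearMap.rTensor_tmul, ← Module.End.mul_apply, (hl _).eq]
    | add a b ha hb => simp only [map_add, ha, hb]
  · induction x using TensorProduct.induction_on with
    | zero => simp
    | tmul x w =>
      simp only [tensorR_tmul, map_sum, LinearMap.rTensor_tmul, ← Module.End.mul_apply, (hr _).eq]
    | add a b ha hb => simp only [map_add, ha, hb]

theorem restrD_exact (i : ℕ)
    (hD : ∀ x ∈ tensorSub M (koszulW N R (nu N (i + 2))),
      tensorD e N lam rho i (tensorD e N lam rho (i + 1) x) = 0)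
    (h : TensorExact e N R lam rho i) :
    Function.Exact (restrD e hN R lam rho (i + 1)) (restrD e hN R lam rho i) := by
  intro x
  constructor
  · intro hx
    obtain ⟨_, ⟨y, rfl⟩, hy⟩ := h _ (tensorIncl_mem x) (by
      rw [← tensorIncl_restrD (hN := hN), hx, map_zero])
    refine ⟨y, tensorIncl_injective _ ?_⟩
    rw [tensorIncl_restrD]
    exact hy
  · rintro ⟨y, rfl⟩
    refine tensorIncl_injective _ ?_
    rw [tensorIncl_restrD, tensorIncl_restrD, map_zero]
    exact hD _ (tensorIncl_mem y)

end Restriction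

/-! ### The bimodule Koszul complex and its augmentation -/

section KoszulResolution

variable {k : Type u} [Field k] {V : Type v} [AddCommGroup V] [Module k V]
  {ι : Type*} [Fintype ι] (e : Module.Basis ι k V) {B : Type (max u v)} [Ring B] [Algebra k B]
  (q : TensorAlgebra k V →ₐ[k] B) {N : ℕ} (hN : 2 ≤ N) (R : Submodule k (TensorAlgebra k V))

variable (B N) in
/-- The terms of the bimodule Koszul complex. -/
abbrev KoszulBimod (i : ℕ) : Type (max u v) := Env k B ⊗[k] koszulW N R (nu N i)

theorem env_smul_eq (W : Submodule k (TensorAlgebra k V)) (c : Env k B) (x : Env k B ⊗[k] W) :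
    c • x = LinearMap.rTensor W (LinearMap.mulLeft k c) x := by
  induction x using TensorProduct.induction_on with
  | zero => simp
  | tmul x w => rfl
  | add a b ha hb => simp only [smul_add, map_add, ha, hb]

/-- The differential of the bimodule Koszul complex. -/
def bimodD (i : ℕ) : KoszulBimod B N R (i + 1) →ₗ[Env k B] KoszulBimod B N R i where
  toFun := restrD e hN R (envLam e q) (envRho e q) i
  map_add' := map_add _
  -- The letters act by right multiplication on `Bᵉ`, which commutes with the left module structure.
  map_smul' c x := by
    rw [env_smul_eq, env_smul_eq, restrD_rTensor]
    · rfl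
    · exact fun j => LinearMap.ext fun x => (mul_assoc c x _).symm
    · exact fun j => LinearMap.ext fun x => (mul_assoc c x _).symm

theorem bimodD_apply (i : ℕ) (x : KoszulBimod B N R (i + 1)) :
    bimodD e q hN R i x = restrD e hN R (envLam e q) (envRho e q) i x := rfl

variable (B N) in
/-- The isomorphism of the last term of the bimodule Koszul complex with `Bᵉ`. -/
def bimodZero : KoszulBimod B N R 0 →ₗ[Env k B] Env k B :=
  freeLift (Algebra.linearMap k (Env k B) ∘ₗ TensorAlgebra.algebraMapInv.toLinearMap ∘ₗ
    (koszulW N R (nu N 0)).subtype)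

theorem one_mem_koszulW_zero (hN : 2 ≤ N) : (1 : TensorAlgebra k V) ∈ koszulW N R (nu N 0) := by
  rw [show nu N 0 = 0 by simp [nu], koszulW_zero N R (by omega)]
  exact Submodule.one_le.1 le_rfl

theorem exists_algebraMap_of_mem_koszulW_zero {t : TensorAlgebra k V}
    (ht : t ∈ koszulW N R (nu N 0)) : ∃ c : k, algebraMap k _ c = t := by
  have := koszulW_le_tpow N R _ ht
  rwa [show nu N 0 = 0 by simp [nu], tpow_zero, Submodule.mem_one] at this

theorem exists_ι_of_mem_koszulW_one {t : TensorAlgebra k V}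
    (ht : t ∈ koszulW N R (nu N 1)) : ∃ v : V, TensorAlgebra.ι k v = t := by
  have := koszulW_le_tpow N R _ ht
  rwa [show nu N 1 = 1 by simp [nu], tpow_one] at this

theorem bimodZero_tmul_one (x : Env k B) :
    bimodZero B N R (x ⊗ₜ ⟨1, one_mem_koszulW_zero R hN⟩) = x := by
  rw [bimodZero, freeLift_tmul]
  simp [← Algebra.TensorProduct.one_def]

theorem eq_bimodZero_tmul_one (x : KoszulBimod B N R 0) :
    x = bimodZero B N R x ⊗ₜ ⟨1, one_mem_koszulW_zero R hN⟩ := by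
  induction x using TensorProduct.induction_on with
  | zero => simp
  | tmul x w =>
    obtain ⟨c, hc⟩ := exists_algebraMap_of_mem_koszulW_zero R w.2
    have hw : w = c • ⟨1, one_mem_koszulW_zero R hN⟩ := Subtype.ext (by
      rw [← hc, Algebra.algebraMap_eq_smul_one]; rfl)
    rw [hw, TensorProduct.tmul_smul, ← algebraMap_smul (Env k B) c, map_smul,
      bimodZero_tmul_one hN,
      TensorProduct.smul_tmul']
  | add a b ha hb =>
    conv_lhs => rw [ha, hb]
    rw [map_add, TensorProduct.add_tmul]

variable (B N) in
/-- The augmentation of the bimodule Koszul complex. -/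
def bimodAug : KoszulBimod B N R 0 →ₗ[Env k B] selfBimodule k B := envMul k B ∘ₗ bimodZero B N R

include hN in
theorem bimodAug_surjective : Function.Surjective (bimodAug B N R) := fun b => by
  obtain ⟨x, rfl⟩ := envMul_surjective b
  exact ⟨x ⊗ₜ ⟨1, one_mem_koszulW_zero R hN⟩, by
    rw [bimodAug, LinearMap.comp_apply, bimodZero_tmul_one hN]⟩

theorem ι_mem_koszulW_one (hN : 2 ≤ N) (v : V) : TensorAlgebra.ι k v ∈ koszulW N R (nu N 1) := by
  rw [show nu N 1 = 1 by simp [nu], koszulW_one N R hN]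
  exact ⟨v, rfl⟩

theorem bimodZero_bimodD (v : V) :
    bimodZero B N R (bimodD e q hN R 0 (1 ⊗ₜ ⟨TensorAlgebra.ι k v, ι_mem_koszulW_one R hN v⟩)) =
      q (TensorAlgebra.ι k v) ⊗ₜ[k] 1 - 1 ⊗ₜ[k] MulOpposite.op (q (TensorAlgebra.ι k v)) := by
  have h1 : ∀ x, bimodZero B N R x = freeLift (Algebra.linearMap k (Env k B) ∘ₗ
      TensorAlgebra.algebraMapInv.toLinearMap) (tensorIncl (Env k B) _ x) := by
    intro x
    induction x using TensorProduct.induction_on with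
    | zero => simp
    | tmul x w => simp only [bimodZero, tensorIncl, freeLift_tmul, LinearMap.lTensor_tmul]; rfl
    | add a b ha hb => simp only [map_add, ha, hb]
  have h2 := tensorL_env_ι_mul e q 1 v 1
  have h3 := tensorR_env_mul_ι e q 1 v 1
  rw [mul_one, one_mul] at h2
  rw [one_mul, one_mul] at h3
  have h4 : tensorD e N (envLam e q) (envRho e q) 0 (1 ⊗ₜ TensorAlgebra.ι k v) =
      (q (TensorAlgebra.ι k v) ⊗ₜ[k] 1 - 1 ⊗ₜ[k] MulOpposite.op (q (TensorAlgebra.ι k v)) :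
        Env k B) ⊗ₜ[k] (1 : TensorAlgebra k V) := by
    rw [TensorProduct.sub_tmul, ← h2, ← h3, tensorD, koszulOp, if_pos (by simp)]
    rfl
  rw [h1, bimodD_apply, tensorIncl_restrD]
  refine (congrArg _ h4).trans ?_
  rw [freeLift_tmul]
  simp [← Algebra.TensorProduct.one_def]

theorem adjoin_range_letters (hq : Function.Surjective q) :
    Algebra.adjoin k (Set.range (q ∘ TensorAlgebra.ι k)) = ⊤ := by
  rw [Set.range_comp, ← AlgHom.map_adjoin, TensorAlgebra.adjoin_range_ι, Algebra.map_top,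
    AlgHom.range_eq_top]
  exact hq

/-- On letters the first differential takes the values `v ⊗ 1 - 1 ⊗ v`, and these generate the
kernel of the multiplication because the letters generate `B`. -/
theorem bimodAug_exact (hq : Function.Surjective q) :
    Function.Exact (bimodD e q hN R 0) (bimodAug B N R) := by
  intro x
  constructor
  · intro hx
    have := mem_of_envMul_eq_zero (adjoin_range_letters q hq)
      (LinearMap.range (bimodZero B N R ∘ₗ bimodD e q hN R 0)) (by
        rintro _ ⟨v, rfl⟩
        exact ⟨_, bimodZero_bimodD e q hN R v⟩) hx
    obtain ⟨y, hy⟩ := this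
    refine ⟨y, ?_⟩
    rw [eq_bimodZero_tmul_one hN R (bimodD e q hN R 0 y), eq_bimodZero_tmul_one hN R x, ← hy]
    rfl
  · rintro ⟨y, rfl⟩
    suffices h : bimodAug B N R ∘ₗ bimodD e q hN R 0 = 0 from LinearMap.congr_fun h y
    refine free_hom_ext fun w => ?_
    obtain ⟨v, hv⟩ := exists_ι_of_mem_koszulW_one R w.2
    have hw : w = ⟨TensorAlgebra.ι k v, ι_mem_koszulW_one R hN v⟩ := Subtype.ext hv.symm
    rw [hw, LinearMap.comp_apply, bimodAug, LinearMap.comp_apply, bimodZero_bimodD, map_sub,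
      ← MulOpposite.op_one, envMul_tmul, envMul_tmul, mul_one, one_mul, sub_self]
    rfl

instance projective_koszulBimod (i : ℕ) :
    Module.Projective (Env k B) (KoszulBimod B N R i) := inferInstance

instance finite_koszulBimod [FiniteDimensional k V] (i : ℕ) :
    Module.Finite (Env k B) (KoszulBimod B N R i) := inferInstance

end KoszulResolution
end
end NKoszulCY

namespace NKoszulCY
noncomputable section

/-! ### Cochains over `Bᵉ` modelled on `H ⊗ H` for a linear isomorphism `H ≃ B` -/

section Model

variable {k : Type u} [Field k] {V : Type v} [AddCommGroup V] [Module k V]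
  {ι : Type*} [Fintype ι] {e : Module.Basis ι k V} {B : Type (max u v)} [Ring B] [Algebra k B]
  {q : TensorAlgebra k V →ₐ[k] B} {N : ℕ} {R : Submodule k (TensorAlgebra k V)}
  {H : Type*} [AddCommGroup H] [Module k H]

theorem tensorD_rTensor {M M' : Type*} [AddCommGroup M] [Module k M] [AddCommGroup M']
    [Module k M'] (s : M →ₗ[k] M') {lam rho : ι → Module.End k M}
    {lam' rho' : ι → Module.End k M'} (hl : ∀ i x, s (lam i x) = lam' i (s x))
    (hr : ∀ i x, s (rho i x) = rho' i (s x)) (i : ℕ) (x : M ⊗[k] TensorAlgebra k V) :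
    LinearMap.rTensor _ s (tensorD e N lam rho i x) =
      tensorD e N lam' rho' i (LinearMap.rTensor _ s x) := by
  refine koszulOp_conj N i _ (fun x => ?_) (fun x => ?_) x
  · induction x using TensorProduct.induction_on with
    | zero => simp
    | tmul m t => simp [tensorL_tmul, hl]
    | add a b ha hb => simp only [map_add, ha, hb]
  · induction x using TensorProduct.induction_on with
    | zero => simp
    | tmul m t => simp [tensorR_tmul, hr]
    | add a b ha hb => simp only [map_add, ha, hb]

theorem rTensor_mem_tensorSub {M M' : Type*} [AddCommGroup M] [Module k M] [AddCommGroup M']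
    [Module k M'] (s : M →ₗ[k] M') {W : Submodule k (TensorAlgebra k V)}
    {x : M ⊗[k] TensorAlgebra k V} (hx : x ∈ tensorSub M W) :
    LinearMap.rTensor _ s x ∈ tensorSub M' W := by
  induction hx using tensorSub_induction with
  | h0 => rw [map_zero]; exact Submodule.zero_mem _
  | h1 m t ht => exact tmul_mem_tensorSub _ ht
  | hadd a b _ _ ha hb => rw [map_add]; exact Submodule.add_mem _ ha hb

/-- The operator `T` transported along the isomorphism `s`. -/
def pull (s : H ≃ₗ[k] B) (T : Module.End k B) : Module.End k H :=
  s.symm.toLinearMap ∘ₗ T ∘ₗ s.toLinearMap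

theorem apply_pull (s : H ≃ₗ[k] B) (T : Module.End k B) (x : H) : s (pull s T x) = T (s x) := by
  simp [pull]

/-- The isomorphism of `H ⊗ H` with the enveloping algebra given by an isomorphism `H ≃ B`. -/
def envEquiv (s : H ≃ₗ[k] B) : H ⊗[k] H ≃ₗ[k] Env k B :=
  TensorProduct.congr s (s ≪≫ₗ MulOpposite.opLinearEquiv k)

theorem envEquiv_tmul (s : H ≃ₗ[k] B) (x y : H) :
    envEquiv s (x ⊗ₜ y) = s x ⊗ₜ MulOpposite.op (s y) := rfl

variable (s : H ≃ₗ[k] B) (b : B) (x : H ⊗[k] H)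

/-- Of the four one-sided multiplications on `H ⊗ H`, left on the first factor and right on the
second become left multiplications of `Bᵉ` and build the differential of cochains. The other two
become right multiplications; they build the differential of chains and the module structure on Ext.
-/
theorem envEquiv_rTensor_mulLeft :
    envEquiv s (LinearMap.rTensor H (pull s (LinearMap.mulLeft k b)) x) =
      b ⊗ₜ[k] 1 * envEquiv s x := by
  induction x using TensorProduct.induction_on with
  | zero => simp
  | tmul x y => simp [envEquiv_tmul, apply_pull]
  | add a b ha hb => simp only [map_add, ha, hb, mul_add]

theorem envEquiv_rTensor_mulRight :
    envEquiv s (LinearMap.rTensor H (pull s (LinearMap.mulRight k b)) x) =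
      envEquiv s x * b ⊗ₜ[k] 1 := by
  induction x using TensorProduct.induction_on with
  | zero => simp
  | tmul x y => simp [envEquiv_tmul, apply_pull]
  | add a b ha hb => simp only [map_add, ha, hb, add_mul]

theorem envEquiv_lTensor_mulLeft :
    envEquiv s (LinearMap.lTensor H (pull s (LinearMap.mulLeft k b)) x) =
      envEquiv s x * 1 ⊗ₜ[k] MulOpposite.op b := by
  induction x using TensorProduct.induction_on with
  | zero => simp
  | tmul x y => simp [envEquiv_tmul, apply_pull]
  | add a b ha hb => simp only [map_add, ha, hb, add_mul]

theorem envEquiv_lTensor_mulRight :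
    envEquiv s (LinearMap.lTensor H (pull s (LinearMap.mulRight k b)) x) =
      1 ⊗ₜ[k] MulOpposite.op b * envEquiv s x := by
  induction x using TensorProduct.induction_on with
  | zero => simp
  | tmul x y => simp [envEquiv_tmul, apply_pull]
  | add a b ha hb => simp only [map_add, ha, hb, mul_add]

variable (e q) in
/-- Left multiplication by letters, transported along `s`. -/
def letL (i : ι) : Module.End k H := pull s (LinearMap.mulLeft k (q (TensorAlgebra.ι k (e i))))

variable (e q) in
/-- Right multiplication by letters, transported along `s`. -/
def letR (i : ι) : Module.End k H := pull s (LinearMap.mulRight k (q (TensorAlgebra.ι k (e i))))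

/-- The bimodule Koszul complex of `B` is exact in positive degrees. -/
theorem tensorExact_env {β : Type*} {a : Module.Basis β k H} {deg : β → ℕ}
    {L₀ R₀ : ι → Module.End k H}
    (hop : LetterOps a deg N L₀ R₀ (letL e q s) (letR e q s)) (hN : 1 ≤ N) {i : ℕ}
    (hD : ∀ x ∈ tensorSub (Env k B) (koszulW N R (nu N (i + 2))),
      tensorD e N (envLam e q) (envRho e q) i
        (tensorD e N (envLam e q) (envRho e q) (i + 1) x) = 0)
    (h : TensorExact e N R R₀ 0 i) : TensorExact e N R (envLam e q) (envRho e q) i := by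
  have hl : ∀ j x, envEquiv s (LinearMap.rTensor H (letR e q s j) x) =
      envLam e q j (envEquiv s x) := fun j x => envEquiv_rTensor_mulRight s _ x
  have hr : ∀ j x, envEquiv s (LinearMap.lTensor H (letL e q s j) x) =
      envRho e q j (envEquiv s x) := fun j x => envEquiv_lTensor_mulLeft s _ x
  refine TensorExact.of_equiv e N R (envEquiv s) hl hr (hop.tensorExact e R hN ?_ h)
  intro x hx
  have hinj : Function.Injective
      (LinearMap.rTensor (TensorAlgebra k V) (envEquiv s).toLinearMap) :=
    Module.Flat.rTensor_preserves_injective_linearMap _ (envEquiv s).injective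
  refine hinj ?_
  rw [tensorD_rTensor (lam' := envLam e q) (rho' := envRho e q) _ hl hr,
    tensorD_rTensor (lam' := envLam e q) (rho' := envRho e q) _ hl hr, map_zero]
  exact hD _ (rTensor_mem_tensorSub _ hx)

variable (e q N) in
/-- The differential on cochains with values in `H ⊗ H`. -/
def dualD (i : ℕ) : Module.End k (TensorAlgebra k V →ₗ[k] H ⊗[k] H) :=
  homD e N (fun j => LinearMap.rTensor H (letL e q s j))
    (fun j => LinearMap.lTensor H (letR e q s j)) i

variable (N R) in
/-- The bimodule map on a term of the Koszul complex given by a cochain. -/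
def hat (i : ℕ) (F : TensorAlgebra k V →ₗ[k] H ⊗[k] H) :
    KoszulBimod B N R i →ₗ[Env k B] Env k B :=
  freeLift ((envEquiv s).toLinearMap ∘ₗ F ∘ₗ (koszulW N R (nu N i)).subtype)

theorem hat_tmul (i : ℕ) (F : TensorAlgebra k V →ₗ[k] H ⊗[k] H) (x : Env k B)
    (w : koszulW N R (nu N i)) : hat N R s i F (x ⊗ₜ w) = x * envEquiv s (F w) :=
  freeLift_tmul _ _ _

/-- Linear maps extend from `W` to `T(V)`, so nothing is lost by defining cochains on all tensors.
-/
theorem hat_surjective (i : ℕ) : Function.Surjective (hat N R s i) := by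
  intro f
  obtain ⟨F, rfl⟩ := exists_freeLift f
  obtain ⟨G, hG⟩ := LinearMap.exists_extend ((envEquiv s).symm.toLinearMap ∘ₗ F)
  refine ⟨G, ?_⟩
  rw [hat, hG]
  congr 1
  ext w
  simp

theorem hat_add (i : ℕ) (F G : TensorAlgebra k V →ₗ[k] H ⊗[k] H) :
    hat N R s i (F + G) = hat N R s i F + hat N R s i G :=
  free_hom_ext fun w => by simp [hat_tmul]

theorem hat_sub (i : ℕ) (F G : TensorAlgebra k V →ₗ[k] H ⊗[k] H) :
    hat N R s i (F - G) = hat N R s i F - hat N R s i G :=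
  free_hom_ext fun w => by simp [hat_tmul]

theorem hat_eq_zero_iff (i : ℕ) (F : TensorAlgebra k V →ₗ[k] H ⊗[k] H) :
    hat N R s i F = 0 ↔ F ∈ homVanish (H ⊗[k] H) (koszulW N R (nu N i)) := by
  constructor
  · intro h w hw
    have := LinearMap.congr_fun h (1 ⊗ₜ ⟨w, hw⟩)
    rw [hat_tmul, one_mul, LinearMap.zero_apply, LinearEquiv.map_eq_zero_iff] at this
    exact this
  · intro h
    refine free_hom_ext fun w => ?_
    rw [hat_tmul, h w w.2, map_zero, mul_zero, LinearMap.zero_apply]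

theorem rmul_comp_hat (i : ℕ) (r : Env k B) (T : Module.End k (H ⊗[k] H))
    (hT : ∀ x, envEquiv s (T x) = envEquiv s x * r) (F : TensorAlgebra k V →ₗ[k] H ⊗[k] H) :
    rmul r ∘ₗ hat N R s i F = hat N R s i (T ∘ₗ F) :=
  free_hom_ext fun w => by simp [hat_tmul, hT]

/-- A cochain, extended to a bimodule map on `Bᵉ ⊗ T(V)`. -/
def fullHat (F : TensorAlgebra k V →ₗ[k] H ⊗[k] H) :
    Env k B ⊗[k] TensorAlgebra k V →ₗ[k] Env k B :=
  (freeLift ((envEquiv s).toLinearMap ∘ₗ F)).restrictScalars k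

theorem fullHat_tmul (F : TensorAlgebra k V →ₗ[k] H ⊗[k] H) (x : Env k B) (t : TensorAlgebra k V) :
    fullHat s F (x ⊗ₜ t) = x * envEquiv s (F t) :=
  freeLift_tmul _ _ _

theorem fullHat_tensorL (F : TensorAlgebra k V →ₗ[k] H ⊗[k] H)
    (x : Env k B ⊗[k] TensorAlgebra k V) : fullHat s F (tensorL e (envLam e q) x) =
      fullHat s (homL e (fun j => LinearMap.rTensor H (letL e q s j)) F) x := by
  induction x using TensorProduct.induction_on with
  | zero => simp
  | tmul x t =>
    rw [tensorL_tmul, map_sum, fullHat_tmul, homL_apply, map_sum, Finset.mul_sum]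
    refine Finset.sum_congr rfl fun i _ => ?_
    rw [fullHat_tmul, letL, envEquiv_rTensor_mulLeft, ← mul_assoc]
    rfl
  | add a b ha hb => simp only [map_add, ha, hb]

theorem fullHat_tensorR (F : TensorAlgebra k V →ₗ[k] H ⊗[k] H)
    (x : Env k B ⊗[k] TensorAlgebra k V) : fullHat s F (tensorR e (envRho e q) x) =
      fullHat s (homR e (fun j => LinearMap.lTensor H (letR e q s j)) F) x := by
  induction x using TensorProduct.induction_on with
  | zero => simp
  | tmul x t =>
    rw [tensorR_tmul, map_sum, fullHat_tmul, homR_apply, map_sum, Finset.mul_sum]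
    refine Finset.sum_congr rfl fun i _ => ?_
    rw [fullHat_tmul, letR, envEquiv_lTensor_mulRight, ← mul_assoc]
    rfl
  | add a b ha hb => simp only [map_add, ha, hb]

theorem fullHat_sub (F G : TensorAlgebra k V →ₗ[k] H ⊗[k] H)
    (x : Env k B ⊗[k] TensorAlgebra k V) :
    fullHat s (F - G) x = fullHat s F x - fullHat s G x := by
  induction x using TensorProduct.induction_on with
  | zero => simp
  | tmul x t => simp [fullHat_tmul, mul_sub]
  | add a b ha hb => rw [map_add, ha, hb, map_add, map_add]; abel

theorem fullHat_sum {α : Type*} (S : Finset α) (F : α → TensorAlgebra k V →ₗ[k] H ⊗[k] H)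
    (x : Env k B ⊗[k] TensorAlgebra k V) :
    fullHat s (∑ i ∈ S, F i) x = ∑ i ∈ S, fullHat s (F i) x := by
  induction x using TensorProduct.induction_on with
  | zero => simp
  | tmul x t => simp [fullHat_tmul, Finset.mul_sum, LinearMap.sum_apply]
  | add a b ha hb => simp only [map_add, ha, hb, Finset.sum_add_distrib]

theorem koszulOp_apply_odd {X : Type*} [AddCommGroup X] [Module k X] {i : ℕ} (hi : ¬ Even i)
    (dl dr : Module.End k X) (x : X) :
    koszulOp N i dl dr x = ∑ a ∈ Finset.range N, (dl ^ a) ((dr ^ (N - 1 - a)) x) := by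
  rw [koszulOp, if_neg hi, LinearMap.sum_apply]; rfl

theorem koszulOp_apply_even {X : Type*} [AddCommGroup X] [Module k X] {i : ℕ} (hi : Even i)
    (dl dr : Module.End k X) (x : X) : koszulOp N i dl dr x = dl x - dr x := by
  rw [koszulOp, if_pos hi]; rfl

/-- Transposing a product `dl^a dr^(N-1-a)` reverses the factors; the dual operators commute, so the
formula for the differential survives. -/
theorem fullHat_tensorD (i : ℕ) (F : TensorAlgebra k V →ₗ[k] H ⊗[k] H)
    (x : Env k B ⊗[k] TensorAlgebra k V) :
    fullHat s F (tensorD e N (envLam e q) (envRho e q) i x) =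
      fullHat s (dualD e q N s i F) x := by
  have hL : ∀ n F x, fullHat s F ((tensorL e (envLam e q) ^ n) x) =
      fullHat s ((homL e (fun j => LinearMap.rTensor H (letL e q s j)) ^ n) F) x := by
    intro n
    induction n with
    | zero => intro F x; simp
    | succ n ih =>
      intro F x
      rw [pow_succ, Module.End.mul_apply, ih, fullHat_tensorL, ← Module.End.mul_apply,
        ← pow_succ']
  have hR : ∀ n F x, fullHat s F ((tensorR e (envRho e q) ^ n) x) =
      fullHat s ((homR e (fun j => LinearMap.lTensor H (letR e q s j)) ^ n) F) x := by
    intro n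
    induction n with
    | zero => intro F x; simp
    | succ n ih =>
      intro F x
      rw [pow_succ, Module.End.mul_apply, ih, fullHat_tensorR, ← Module.End.mul_apply,
        ← pow_succ']
  rw [tensorD, dualD, homD]
  by_cases hi : Even i
  · rw [koszulOp_apply_even hi, koszulOp_apply_even hi, fullHat_sub, ← fullHat_tensorL,
      ← fullHat_tensorR, ← map_sub]
  · rw [koszulOp_apply_odd hi, koszulOp_apply_odd hi, fullHat_sum, map_sum]
    refine Finset.sum_congr rfl fun a _ => ?_
    rw [hL, hR, ← Module.End.mul_apply, ← Module.End.mul_apply]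
    congr 2
    refine LinearMap.congr_fun ((commute_homL_homR e fun i j => ?_).pow_pow _ _).eq.symm F
    refine TensorProduct.ext' fun x y => ?_
    simp

theorem hat_comp_bimodD (hN : 2 ≤ N) (i : ℕ) (F : TensorAlgebra k V →ₗ[k] H ⊗[k] H) :
    hat N R s i F ∘ₗ bimodD e q hN R i = hat N R s (i + 1) (dualD e q N s i F) := by
  have h : ∀ i F x, hat N R s i F x = fullHat s F (tensorIncl (Env k B) _ x) := by
    intro i F x
    induction x using TensorProduct.induction_on with
    | zero => simp
    | tmul x w => rw [hat_tmul, tensorIncl, LinearMap.lTensor_tmul, fullHat_tmul]; rfl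
    | add a b ha hb => simp only [map_add, ha, hb]
  refine LinearMap.ext fun x => ?_
  rw [LinearMap.comp_apply, h, h, bimodD_apply, tensorIncl_restrD, fullHat_tensorD]

end Model
end
end NKoszulCY

namespace NKoszulCY
noncomputable section

/-! ### Koszul resolutions of `A` and `U`, and finiteness -/

section Koszul

variable {k : Type u} [Field k] {V : Type v} [AddCommGroup V] [Module k V]
  {ι : Type*} [Fintype ι] (e : Module.Basis ι k V) {N : ℕ} (hN : 2 ≤ N)
  {R : Submodule k (TensorAlgebra k V)} (hR : R ≤ tpow k V N) (φ : R →ₗ[k] k)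

/-- The ideal of relations starts in degree `N ≥ 2`. -/
theorem quotMk_ι_injective (hN : 2 ≤ N) (hR : R ≤ tpow k V N) :
    Function.Injective (quotMk R ∘ TensorAlgebra.ι k) := by
  intro v w h
  have h0 : quotMk R (TensorAlgebra.ι k (v - w)) = 0 := by
    rw [map_sub, map_sub, sub_eq_zero]; exact h
  have h1 := mem_iSup_of_quotMk_eq_zero hR (ι_mem_tpow _) h0
  have h2 : ⨆ (i : ℕ) (j : ℕ) (_ : i + N + j = 1), tpow k V i * R * tpow k V j ≤ ⊥ :=
    iSup_le fun i => iSup_le fun j => iSup_le fun h => by omega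
  have h3 := (Submodule.mem_bot k).1 (h2 h1)
  rwa [map_sub, sub_eq_zero, TensorAlgebra.ι_inj] at h3

theorem quotMk_self (r : R) : quotMk R r = algebraMap k _ ((0 : R →ₗ[k] k) r) := by
  rw [quotMk_of_mem r.2, LinearMap.zero_apply, map_zero]

theorem grA_F_neg (hR : R ≤ tpow k V N) {n : ℤ} (hn : n < 0) (M : ℕ) {x : QuotAlg R}
    (hx : x ∈ (grA hR).F M n) : x = 0 := by
  have hfull : (grA hR).Full := full_gr _ _
  rw [← hfull.mem_zero]
  refine (grA hR).mem_zero_of_forall_proj (hfull.mem_one x) fun j => ?_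
  by_cases hj : j ≤ n ∧ (M : ℤ) ∣ n - j
  · rw [hfull.mem_zero]
    have : (grA hR).proj j = 0 := (homBasis hR).ext fun b => by
      rw [grA_proj_of_mem hR (homBasis_mem hR b), if_neg (by omega)]
      rfl
    rw [this]; rfl
  · exact hx.2 j hj

/-- The correction has degree at most `1 - N < 0`, hence is zero. -/
theorem quotMk_deformedRel_ι (hN : 2 ≤ N) (v : V) :
    quotMk (deformedRel R φ) (TensorAlgebra.ι k v) =
      toDeform hR φ (quotMk R (TensorAlgebra.ι k v)) := by
  obtain ⟨x, hx, h⟩ := quotMk_sub_toDeform_mem hR φ (by omega) 1 _ (ι_mem_tpow v)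
  obtain rfl := grA_F_neg hR (by push_cast; omega) _ hx
  rw [map_zero] at h
  exact (sub_eq_zero.1 h.symm)

theorem quotMk_deformedRel_ι_injective (hN : 2 ≤ N) (hR : R ≤ tpow k V N)
    (hP : IsPBWDeformation R (deformedRel R φ)) :
    Function.Injective (quotMk (deformedRel R φ) ∘ TensorAlgebra.ι k) := by
  intro v w h
  rw [Function.comp_apply, Function.comp_apply, quotMk_deformedRel_ι hR φ hN,
    quotMk_deformedRel_ι hR φ hN] at h
  exact quotMk_ι_injective hN hR (toDeform_injective hR φ hP h)

/-- Exactness of the bimodule Koszul complex in positive degrees. -/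
theorem bimodD_exact (hK : IsKoszul N R) {B : Type (max u v)} [Ring B] [Algebra k B]
    (q : TensorAlgebra k V →ₐ[k] B) (hq : ∀ r : R, q r = algebraMap k B (φ r))
    (hinj : Function.Injective (q ∘ TensorAlgebra.ι k)) (s : QuotAlg R ≃ₗ[k] B)
    (hop : LetterOps (homBasis hR) homDeg N (letL e (quotMk R) (LinearEquiv.refl k _))
      (letR e (quotMk R) (LinearEquiv.refl k _)) (letL e q s) (letR e q s)) (i : ℕ) :
    Function.Exact (bimodD e q hN R (i + 1)) (bimodD e q hN R i) := by
  have hD := tensorD_tensorD e q φ (by omega) hR hq hinj i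
  exact restrD_exact e hN R _ _ i hD
    (tensorExact_env s hop (by omega) hD (hK.tensorExact hN e i))

/-- The augmentation of `A`. -/
def augA (hN : 1 ≤ N) (hR : R ≤ tpow k V N) : QuotAlg R →ₐ[k] k :=
  quotLift R TensorAlgebra.algebraMapInv fun r hr =>
    algebraMapInv_of_mem_tpow (m := N - 1) (by rw [Nat.sub_add_cancel hN]; exact hR hr)

theorem augA_ι (hN : 1 ≤ N) (v : V) : augA hN hR (quotMk R (TensorAlgebra.ι k v)) = 0 := by
  rw [augA, quotLift_quotMk]
  simp [TensorAlgebra.algebraMapInv]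

/-- The augmentation of the enveloping algebra of `A`. -/
def augEnv (hN : 1 ≤ N) (hR : R ≤ tpow k V N) : Env k (QuotAlg R) →ₐ[k] k :=
  Algebra.TensorProduct.lift (augA hN hR)
    ((augA hN hR).fromOpposite fun _ _ => Commute.all _ _) fun _ _ => Commute.all _ _

theorem augEnv_tmul (hN : 1 ≤ N) (x y : QuotAlg R) :
    augEnv hN hR (x ⊗ₜ MulOpposite.op y) = augA hN hR x * augA hN hR y := by
  rw [augEnv, Algebra.TensorProduct.lift_tmul]
  rfl

include hR in
/-- If `A` has a finite resolution, the Koszul resolution is finite. -/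
theorem koszulW_eq_bot
    (hexact : ∀ i, Function.Exact (bimodD e (quotMk R) hN R (i + 1)) (bimodD e (quotMk R) hN R i))
    (hfin : HasFiniteBimoduleResolution k (QuotAlg R)) :
    ∃ m : ℕ, ∀ i, m < i → koszulW N R (nu N i) = ⊥ := by
  obtain ⟨m, hm⟩ := hfin.exists_comp_eq
    (P := fun i => KoszulBimod (QuotAlg R) N R i) (bimodD e (quotMk R) hN R) (bimodAug (QuotAlg R) N R)
    (fun i => projective_koszulBimod R i) (bimodAug_surjective hN R)
    (bimodAug_exact e (quotMk R) hN R (quotMk_surjective R)) hexact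
  -- The trivial bimodule `k`, lifted to the universe of the Koszul terms.
  let Y := ULift.{max u v} k
  let act : Env k (QuotAlg R) →+* k := (augEnv (by omega) hR : Env k (QuotAlg R) →ₐ[k] k).toRingHom
  let _ : Module (Env k (QuotAlg R)) Y := Module.compHom Y act
  have hsmul : ∀ (x : Env k (QuotAlg R)) (y : Y), x • y = act x • y := fun _ _ => rfl
  have : IsScalarTower k (Env k (QuotAlg R)) Y := ⟨fun c x y => by
    have h : act (c • x) = c • act x := map_smul (augEnv (by omega) hR) c x
    rw [hsmul, hsmul, h, smul_assoc]⟩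
  -- Minimality: each summand of the differential multiplies by a letter, and letters act by zero on
  -- `k`.
  have hzero : ∀ i (g : KoszulBimod (QuotAlg R) N R i →ₗ[Env k (QuotAlg R)] Y),
      g ∘ₗ bimodD e (quotMk R) hN R i = 0 := by
    intro i g
    obtain ⟨G, rfl⟩ := exists_freeLift g
    obtain ⟨G', hG'⟩ := LinearMap.exists_extend G
    let ev : Env k (QuotAlg R) ⊗[k] TensorAlgebra k V →ₗ[k] Y :=
      (freeLift (E := Env k (QuotAlg R)) G').restrictScalars k
    have hev : ∀ x t, ev (x ⊗ₜ t) = act x • G' t := fun x t => freeLift_tmul _ _ _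
    have hevL : ∀ x, ev (tensorL e (envLam e (quotMk R)) x) = 0 := by
      intro x
      induction x using TensorProduct.induction_on with
      | zero => simp
      | tmul x t =>
        rw [tensorL_tmul, map_sum]
        refine Finset.sum_eq_zero fun j _ => ?_
        rw [hev, envLam, LinearMap.mulRight_apply, map_mul]
        have : act (quotMk R (TensorAlgebra.ι k (e j)) ⊗ₜ[k] 1) = 0 := by
          change augEnv _ hR _ = 0
          rw [← MulOpposite.op_one, augEnv_tmul, augA_ι, zero_mul]
        rw [this, mul_zero, zero_smul]
      | add a b ha hb => rw [map_add, map_add, ha, hb, add_zero]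
    have hevR : ∀ x, ev (tensorR e (envRho e (quotMk R)) x) = 0 := by
      intro x
      induction x using TensorProduct.induction_on with
      | zero => simp
      | tmul x t =>
        rw [tensorR_tmul, map_sum]
        refine Finset.sum_eq_zero fun j _ => ?_
        rw [hev, envRho, LinearMap.mulRight_apply, map_mul]
        have : act (1 ⊗ₜ[k] MulOpposite.op (quotMk R (TensorAlgebra.ι k (e j)))) = 0 := by
          change augEnv _ hR _ = 0
          rw [augEnv_tmul, augA_ι, mul_zero]
        rw [this, mul_zero, zero_smul]
      | add a b ha hb => rw [map_add, map_add, ha, hb, add_zero]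
    have hevD : ∀ x, ev (tensorD e N (envLam e (quotMk R)) (envRho e (quotMk R)) i x) = 0 := by
      intro x
      rw [tensorD]
      by_cases hi : Even i
      · rw [koszulOp_apply_even hi]
        exact (map_sub ev _ _).trans (by rw [hevL, hevR, sub_zero])
      · rw [koszulOp_apply_odd hi, map_sum]
        refine Finset.sum_eq_zero fun a ha => ?_
        obtain _ | a := a
        -- The summand `dr^(N-1)` contains a letter because `N ≥ 2`.
        · obtain ⟨m, hm⟩ : ∃ m, N - 1 - 0 = m + 1 := ⟨N - 2, by omega⟩
          rw [hm, pow_zero, pow_succ']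
          exact hevR _
        · rw [pow_succ']
          exact hevL _
    have hg : ∀ x, freeLift G x = ev (tensorIncl (Env k (QuotAlg R)) _ x) := by
      intro x
      induction x using TensorProduct.induction_on with
      | zero => simp
      | tmul x w => rw [freeLift_tmul, tensorIncl, LinearMap.lTensor_tmul, hev, ← hG']; rfl
      | add a b ha hb => simp only [map_add, ha, hb]
    refine LinearMap.ext fun x => ?_
    rw [LinearMap.comp_apply, hg, bimodD_apply, tensorIncl_restrD, hevD]
    rfl
  refine ⟨m, fun i hi => ?_⟩
  obtain ⟨i, rfl⟩ : ∃ j, i = j + 1 := ⟨i - 1, by omega⟩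
  rw [eq_bot_iff]
  intro w hw
  by_contra hw0
  obtain ⟨f, hf⟩ := Module.Projective.exists_dual_ne_zero k
    (x := (⟨w, hw⟩ : koszulW N R (nu N (i + 1)))) fun h => hw0 (congrArg Subtype.val h)
  let F : koszulW N R (nu N (i + 1)) →ₗ[k] Y := ULift.moduleEquiv.symm.toLinearMap ∘ₗ f
  -- In large degrees every linear form on `W` is a coboundary, while all coboundaries vanish.
  obtain ⟨g, hg⟩ := hm i (by omega) Y (freeLift F) (hzero _ _)
  rw [hzero] at hg
  have h1 := LinearMap.congr_fun hg ((1 : Env k (QuotAlg R)) ⊗ₜ ⟨w, hw⟩)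
  rw [freeLift_tmul, one_smul, LinearMap.zero_apply] at h1
  exact hf (congrArg ULift.down h1.symm)

end Koszul
end
end NKoszulCY

namespace NKoszulCY
noncomputable section

/-! ### Filtration and module operators on cochains -/

section CochainGrading

variable {k : Type u} [Field k] {V : Type v} [AddCommGroup V] [Module k V]
  {M : Type*} [AddCommGroup M] [Module k M] {G : GrMod k M} {hG : G.Full}
  {W : Submodule k (TensorAlgebra k V)} [FiniteDimensional k W] {c : ℤ} {N : ℕ}

theorem mem_hom_F {n : ℤ} {f : TensorAlgebra k V →ₗ[k] M} :
    f ∈ (G.hom hG W c).F N n ↔ ∀ w ∈ W, f w ∈ G.F N (n + c) := by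
  constructor
  · intro hf w hw
    rw [hG.mem_F]
    intro j hj
    have := hf.2 (j - c) (by
      rw [show n - (j - c) = n + c - j by ring]
      exact fun h => hj ⟨by omega, h.2⟩) w hw
    rwa [show (G.hom hG W c).proj (j - c) f w = G.proj (j - c + c) (f w) from rfl,
      sub_add_cancel] at this
  · refine fun h => ⟨trivial, fun j hj w hw => ?_⟩
    refine hG.mem_F.1 (h w hw) _ fun h' => hj ⟨by omega, ?_⟩
    have := h'.2
    rwa [add_sub_add_right_eq_sub] at this

theorem hom_proj_comp {T : Module.End k M} {p : ℤ} (hT : HomogOp G.proj p T) (n : ℤ)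
    (f : TensorAlgebra k V →ₗ[k] M) :
    (G.hom hG W c).proj (n + p) (T ∘ₗ f) = T ∘ₗ (G.hom hG W c).proj n f :=
  LinearMap.ext fun t => by
    change G.proj (n + p + c) (T (f t)) = T (G.proj (n + c) (f t))
    rw [show n + p + c = n + c + p by ring, hT]

theorem comp_mem_hom_F {T : Module.End k M} {p : ℤ} (hT : ∀ n, ∀ x ∈ G.F N n, T x ∈ G.F N (n + p))
    {n : ℤ} {f : TensorAlgebra k V →ₗ[k] M} (hf : f ∈ (G.hom hG W c).F N n) :
    T ∘ₗ f ∈ (G.hom hG W c).F N (n + p) := by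
  rw [mem_hom_F] at hf ⊢
  intro w hw
  rw [show n + p + c = n + c + p by ring]
  exact hT _ _ (hf w hw)

omit [FiniteDimensional k W] in
theorem comp_mem_homVanish (T : Module.End k M) {f : TensorAlgebra k V →ₗ[k] M}
    (hf : f ∈ homVanish M W) : T ∘ₗ f ∈ homVanish M W := fun w hw => by
  rw [LinearMap.comp_apply, hf w hw, map_zero]

variable {ι : Type*} [Fintype ι] (e : Module.Basis ι k V)

theorem homD_comp {lam rho : ι → Module.End k M} {T : Module.End k M}
    (hl : ∀ j x, T (lam j x) = lam j (T x)) (hr : ∀ j x, T (rho j x) = rho j (T x)) (i : ℕ)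
    (f : TensorAlgebra k V →ₗ[k] M) :
    homD e N lam rho i (T ∘ₗ f) = T ∘ₗ homD e N lam rho i f := by
  refine (koszulOp_conj N i (LinearMap.llcomp k (TensorAlgebra k V) M M T) (fun f => ?_)
    (fun f => ?_) f).symm
  · refine LinearMap.ext fun t => ?_
    simp only [LinearMap.llcomp_apply, homL_apply, map_sum, hl]
  · refine LinearMap.ext fun t => ?_
    simp only [LinearMap.llcomp_apply, homR_apply, map_sum, hr]

end CochainGrading

/-! ### The cochain complex of `B` on the space of `A`-cochains -/

section Cochains

variable {k : Type u} [Field k] {V : Type v} [AddCommGroup V] [Module k V]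
  {ι : Type*} [Fintype ι] (e : Module.Basis ι k V) {N : ℕ} (hN : 2 ≤ N)
  {R : Submodule k (TensorAlgebra k V)} (hR : R ≤ tpow k V N)
  {B : Type (max u v)} [Ring B] [Algebra k B] (q : TensorAlgebra k V →ₐ[k] B)
  (s : QuotAlg R ≃ₗ[k] B)

/-- The action of `b ∈ B` on cochains by right multiplication with `b ⊗ 1`. -/
def actR (b : B) : Module.End k (TensorAlgebra k V →ₗ[k] QuotAlg R ⊗[k] QuotAlg R) :=
  LinearMap.llcomp k _ _ _ (LinearMap.rTensor (QuotAlg R) (pull s (LinearMap.mulRight k b)))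

/-- The action of `b ∈ B` on cochains by right multiplication with `1 ⊗ b`. -/
def actL (b : B) : Module.End k (TensorAlgebra k V →ₗ[k] QuotAlg R ⊗[k] QuotAlg R) :=
  LinearMap.llcomp k _ _ _ (LinearMap.lTensor (QuotAlg R) (pull s (LinearMap.mulLeft k b)))

theorem rmul_comp_hat_actR (i : ℕ) (b : B)
    (F : TensorAlgebra k V →ₗ[k] QuotAlg R ⊗[k] QuotAlg R) :
    rmul (b ⊗ₜ[k] 1) ∘ₗ hat N R s i F = hat N R s i (actR s b F) :=
  rmul_comp_hat s i _ _ (envEquiv_rTensor_mulRight s b) F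

theorem rmul_comp_hat_actL (i : ℕ) (b : B)
    (F : TensorAlgebra k V →ₗ[k] QuotAlg R ⊗[k] QuotAlg R) :
    rmul (1 ⊗ₜ[k] MulOpposite.op b) ∘ₗ hat N R s i F = hat N R s i (actL s b F) :=
  rmul_comp_hat s i _ _ (envEquiv_lTensor_mulLeft s b) F

/-- The differential multiplies values on the left in `Bᵉ`, the action on the right. -/
theorem dualD_actR (i : ℕ) (b : B) (F : TensorAlgebra k V →ₗ[k] QuotAlg R ⊗[k] QuotAlg R) :
    dualD e q N s i (actR s b F) = actR s b (dualD e q N s i F) :=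
  homD_comp e (lam := fun j => LinearMap.rTensor (QuotAlg R) (letL e q s j))
    (rho := fun j => LinearMap.lTensor (QuotAlg R) (letR e q s j))
    (T := LinearMap.rTensor (QuotAlg R) (pull s (LinearMap.mulRight k b))) (fun j x => (envEquiv s).injective (by
      rw [envEquiv_rTensor_mulRight, letL, envEquiv_rTensor_mulLeft, envEquiv_rTensor_mulLeft,
        envEquiv_rTensor_mulRight, mul_assoc]))
    (fun j x => (envEquiv s).injective (by
      rw [envEquiv_rTensor_mulRight, letR, envEquiv_lTensor_mulRight, envEquiv_lTensor_mulRight,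
        envEquiv_rTensor_mulRight, mul_assoc])) i F

theorem dualD_actL (i : ℕ) (b : B) (F : TensorAlgebra k V →ₗ[k] QuotAlg R ⊗[k] QuotAlg R) :
    dualD e q N s i (actL s b F) = actL s b (dualD e q N s i F) :=
  homD_comp e (lam := fun j => LinearMap.rTensor (QuotAlg R) (letL e q s j))
    (rho := fun j => LinearMap.lTensor (QuotAlg R) (letR e q s j))
    (T := LinearMap.lTensor (QuotAlg R) (pull s (LinearMap.mulLeft k b))) (fun j x => (envEquiv s).injective (by
      rw [envEquiv_lTensor_mulLeft, letL, envEquiv_rTensor_mulLeft, envEquiv_rTensor_mulLeft,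
        envEquiv_lTensor_mulLeft, mul_assoc]))
    (fun j x => (envEquiv s).injective (by
      rw [envEquiv_lTensor_mulLeft, letR, envEquiv_lTensor_mulRight, envEquiv_lTensor_mulRight,
        envEquiv_lTensor_mulLeft, mul_assoc])) i F

theorem actR_one (F : TensorAlgebra k V →ₗ[k] QuotAlg R ⊗[k] QuotAlg R) : actR s 1 F = F := by
  refine LinearMap.ext fun t => (envEquiv s).injective ?_
  exact (envEquiv_rTensor_mulRight s 1 (F t)).trans
    (by rw [← Algebra.TensorProduct.one_def, mul_one])

theorem actR_add (b b' : B) (F : TensorAlgebra k V →ₗ[k] QuotAlg R ⊗[k] QuotAlg R) :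
    actR s (b + b') F = actR s b F + actR s b' F := by
  refine LinearMap.ext fun t => (envEquiv s).injective ?_
  rw [LinearMap.add_apply, map_add]
  refine (envEquiv_rTensor_mulRight s _ (F t)).trans ?_
  rw [TensorProduct.add_tmul, mul_add]
  exact congrArg₂ _ (envEquiv_rTensor_mulRight s b (F t)).symm
    (envEquiv_rTensor_mulRight s b' (F t)).symm

theorem actR_smul (r : k) (b : B) (F : TensorAlgebra k V →ₗ[k] QuotAlg R ⊗[k] QuotAlg R) :
    actR s (r • b) F = r • actR s b F := by
  refine LinearMap.ext fun t => (envEquiv s).injective ?_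
  rw [LinearMap.smul_apply, map_smul]
  refine (envEquiv_rTensor_mulRight s _ (F t)).trans ?_
  rw [← TensorProduct.smul_tmul', mul_smul_comm]
  exact congrArg _ (envEquiv_rTensor_mulRight s b (F t)).symm

theorem dualD_dualD_mem (hD : ∀ i, Function.Exact (bimodD e q hN R (i + 1)) (bimodD e q hN R i))
    (i : ℕ) (F : TensorAlgebra k V →ₗ[k] QuotAlg R ⊗[k] QuotAlg R) :
    dualD e q N s (i + 1) (dualD e q N s i F) ∈ homVanish _ (koszulW N R (nu N (i + 2))) := by
  rw [← hat_eq_zero_iff (N := N) (R := R) s, ← hat_comp_bimodD s hN, ← hat_comp_bimodD s hN]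
  refine LinearMap.ext fun x => ?_
  rw [LinearMap.comp_apply, LinearMap.comp_apply, (hD i).apply_apply_eq_zero, map_zero]
  rfl

variable [FiniteDimensional k V]

/-- The grading of the cochains in degree `i`. -/
def cochainGr (i : ℕ) : GrMod k (TensorAlgebra k V →ₗ[k] QuotAlg R ⊗[k] QuotAlg R) :=
  (gr2 (homBasis hR) homDeg 1 1).hom (full_gr2 _ _ _ _) (koszulW N R (nu N i)) (1 * nu N i)

theorem cochainGr_zero (i : ℕ) : (cochainGr hR i).zero = homVanish _ (koszulW N R (nu N i)) := rfl

variable {q s}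

/-- Needed for `N' = N`, to lift and centralize the generator, and for `N' = 1`, to treat arbitrary
cochains. -/
theorem perturb_dualD (hN : 1 ≤ N) {N' : ℕ} (hN' : (N' : ℤ) ∣ N) (hle : N' ≤ N)
    (hop : LetterOps (homBasis hR) homDeg N (letL e (quotMk R) (LinearEquiv.refl k _))
      (letR e (quotMk R) (LinearEquiv.refl k _)) (letL e q s) (letR e q s)) (i : ℕ) :
    GrMod.Perturb (cochainGr hR i) (cochainGr hR (i + 1)) N'
      (dualD e (quotMk R) N (LinearEquiv.refl k _) i) (dualD e q N s i) := by
  refine perturb_homD e N R (full_gr2 (homBasis hR) homDeg 1 1) hN (fun j => ?_) (fun j => ?_)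
    (fun j => ?_) (fun j => ?_) i
  · simpa using homogOp_rTensor (w₁ := 1) (w₂ := 1) (hop.homL j)
  · simpa using homogOp_lTensor (w₁ := 1) (w₂ := 1) (hop.homR j)
  · simpa using congrOp_rTensor (w₁ := 1) (w₂ := 1) (N' := N') (by simpa using hN')
      (by simpa using hN') (by simpa using hle) (hop.congrL j)
  · simpa using congrOp_lTensor (w₁ := 1) (w₂ := 1) (N' := N') (by simpa using hN')
      (by simpa using hN') (by simpa using hle) (hop.congrR j)

end Cochains
end
end NKoszulCY

namespace NKoszulCY
noncomputable section

/-! ### A homogeneous generator of the top cohomology -/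

section ClassMap

variable {k : Type u} [Field k] {A : Type*} [Ring A] [Algebra k A]
  {X : Type*} [AddCommGroup X] [Module k X]

/-- `θ` identifies the classes of cocycles modulo coboundaries with the bimodule `A`. -/
structure ClassMap (cyc cob : Submodule k X) (aR aL : A → Module.End k X) (θ : X → A) : Prop where
  cob_le : cob ≤ cyc
  add : ∀ f ∈ cyc, ∀ g ∈ cyc, θ (f + g) = θ f + θ g
  eq_zero : ∀ f ∈ cyc, (θ f = 0 ↔ f ∈ cob)
  aR_mem : ∀ a, ∀ f ∈ cyc, aR a f ∈ cyc
  aL_mem : ∀ a, ∀ f ∈ cyc, aL a f ∈ cyc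
  map_aR : ∀ a, ∀ f ∈ cyc, θ (aR a f) = θ f * a
  map_aL : ∀ a, ∀ f ∈ cyc, θ (aL a f) = a * θ f
  aR_algebraMap : ∀ r f, aR (algebraMap k A r) f = r • f
  surj : ∀ b, ∃ f ∈ cyc, θ f = b

/-- The cocycles: the elements whose image under `d` is zero in the subquotient. -/
def cocycles {Y : Type*} [AddCommGroup Y] [Module k Y] (d : X →ₗ[k] Y) (Z : Submodule k Y) :
    Submodule k X := Submodule.comap d Z

/-- The coboundaries: the elements that agree with a value of `e` in the subquotient. -/
def coboundaries {E : Type*} [AddCommGroup E] [Module k E] (e : E →ₗ[k] X) (Z : Submodule k X) :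
    Submodule k X := LinearMap.range e ⊔ Z

namespace ClassMap

variable {cyc cob : Submodule k X} {aR aL : A → Module.End k X} {θ : X → A}
  (h : ClassMap cyc cob aR aL θ)

include h

theorem map_zero : θ 0 = 0 := (h.eq_zero 0 cyc.zero_mem).2 cob.zero_mem

theorem map_smul (r : k) {f : X} (hf : f ∈ cyc) : θ (r • f) = r • θ f := by
  rw [← h.aR_algebraMap, h.map_aR _ _ hf, ← Algebra.commutes, ← Algebra.smul_def]

theorem map_sub {f g : X} (hf : f ∈ cyc) (hg : g ∈ cyc) : θ (f - g) = θ f - θ g := by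
  rw [sub_eq_add_neg, ← neg_one_smul k g, h.add _ hf _ (cyc.smul_mem _ hg), h.map_smul _ hg,
    neg_one_smul, sub_eq_add_neg]

theorem map_sum {α : Type*} (s : Finset α) {f : α → X} (hf : ∀ i ∈ s, f i ∈ cyc) :
    θ (∑ i ∈ s, f i) = ∑ i ∈ s, θ (f i) := by
  classical
  induction s using Finset.induction_on with
  | empty => exact h.map_zero
  | insert a s ha ih =>
    rw [Finset.sum_insert ha, Finset.sum_insert ha, h.add _ (hf a (by simp)) _
      (cyc.sum_mem fun i hi => hf i (by simp [hi])), ih fun i hi => hf i (by simp [hi])]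

theorem eq_of_sub_mem {f g : X} (hf : f ∈ cyc) (hg : g ∈ cyc) (hfg : f - g ∈ cob) :
    θ f = θ g := by
  rw [← sub_eq_zero, ← h.map_sub hf hg]
  exact (h.eq_zero _ (cyc.sub_mem hf hg)).2 hfg

theorem sub_mem {f g : X} (hf : f ∈ cyc) (hg : g ∈ cyc) (hfg : θ f = θ g) : f - g ∈ cob := by
  rw [← h.eq_zero _ (cyc.sub_mem hf hg), h.map_sub hf hg, hfg, sub_self]

/-- The class map, multiplied by a central unit. -/
theorem central_mul {z w : A} (hz : ∀ a, Commute w a) (hzw : z * w = 1) :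
    ClassMap cyc cob aR aL fun f => w * θ f where
  cob_le := h.cob_le
  add f hf g hg := by rw [h.add f hf g hg, mul_add]
  eq_zero f hf := by
    rw [← h.eq_zero f hf]
    refine ⟨fun h0 => ?_, fun h0 => by rw [h0, mul_zero]⟩
    rw [← one_mul (θ f), ← hzw, mul_assoc, h0, mul_zero]
  aR_mem := h.aR_mem
  aL_mem := h.aL_mem
  map_aR a f hf := by rw [h.map_aR a f hf, mul_assoc]
  map_aL a f hf := by rw [h.map_aL a f hf, ← mul_assoc, (hz a).eq, mul_assoc]
  aR_algebraMap := h.aR_algebraMap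
  surj b := by
    obtain ⟨f, hf, hfb⟩ := h.surj (z * b)
    exact ⟨f, hf, by rw [hfb, ← mul_assoc, (hz z).eq, hzw, one_mul]⟩

variable {G : GrMod k X} {ι : Type*} [Fintype ι] {x : ι → A} {aug : A →ₐ[k] k}

/-- The identification with `A` is not assumed to respect degrees. Some homogeneous component of a
representative of `1` has class `z` outside the augmentation ideal. This `z` is central, the classes
of all homogeneous components are multiples of it, so `z` is a unit and can be divided out. -/
theorem exists_pure (hone : ∀ f, f ∈ G.one) (hzero : G.zero ≤ cob)
    (hcyc : ∀ n, ∀ f ∈ cyc, G.proj n f ∈ cyc) (hcob : ∀ n, ∀ f ∈ cob, G.proj n f ∈ cob)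
    (hR : ∀ j, HomogOp G.proj 1 (aR (x j))) (hL : ∀ j, HomogOp G.proj 1 (aL (x j)))
    (hker : ∀ a, ∃ b : ι → A, a = algebraMap k A (aug a) + ∑ j, b j * x j)
    (hgen : ∀ z : A, (∀ j, Commute z (x j)) → ∀ a, Commute z a) :
    ∃ (θ' : X → A) (l : ℤ) (c : X), ClassMap cyc cob aR aL θ' ∧ c ∈ cyc ∧ G.proj l c = c ∧
      θ' c = 1 := by
  have hsum : ∀ f ∈ cyc, ∃ S : Finset ℤ, θ f = ∑ n ∈ S, θ (G.proj n f) := by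
    intro f hf
    obtain ⟨S, hS⟩ := G.exists_sum f (hone f)
    refine ⟨S, ?_⟩
    rw [← h.map_sum S fun n _ => hcyc n f hf]
    exact h.eq_of_sub_mem hf (cyc.sum_mem fun n _ => hcyc n f hf) (hzero hS)
  obtain ⟨F, hF, hF1⟩ := h.surj 1
  -- Otherwise `1`, the sum of the classes of the components, would lie in the augmentation ideal.
  obtain ⟨l, hl⟩ : ∃ l, aug (θ (G.proj l F)) ≠ 0 := by
    by_contra! hcon
    obtain ⟨S, hS⟩ := hsum F hF
    have h1 : aug (θ F) = 0 := by
      rw [hS, _root_.map_sum]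
      exact Finset.sum_eq_zero fun n _ => hcon n
    rw [hF1, map_one] at h1
    exact one_ne_zero h1
  set c := G.proj l F with hc
  have hcc : c ∈ cyc := hcyc l F hF
  have hcl : G.proj l c = c := G.proj_proj_self l F
  set z := θ c with hz
  -- The two multiples of `F` by a generator are cohomologous; so are their components of degree `l
  -- + 1`, which are the multiples of `c`.
  have hzx : ∀ a, Commute z a := by
    refine hgen z fun j => ?_
    have h1 : aR (x j) F - aL (x j) F ∈ cob := by
      refine h.sub_mem (h.aR_mem _ _ hF) (h.aL_mem _ _ hF) ?_
      rw [h.map_aR _ _ hF, h.map_aL _ _ hF, hF1, mul_one, one_mul]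
    have h2 := hcob (l + 1) _ h1
    rw [_root_.map_sub, hR j, hL j] at h2
    have h3 := h.eq_of_sub_mem (h.aR_mem _ _ hcc) (h.aL_mem _ _ hcc) h2
    rwa [h.map_aR _ _ hcc, h.map_aL _ _ hcc] at h3
  -- Induction on the degree, from the lower bound upwards. Subtracting a multiple of `z` moves the
  -- class into the augmentation ideal, where it is `∑ a_j x_j`. Lifting the `a_j` to cocycles and
  -- taking components of degree `n` leaves lower components multiplied by generators.
  have hpure : ∀ n : ℤ, ∀ f ∈ cyc, ∃ w, θ (G.proj n f) = z * w := by
    obtain ⟨b, hb⟩ := G.bdd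
    intro n
    obtain ⟨m, hm⟩ : ∃ m : ℕ, n - m < b := ⟨(n - b).toNat + 1, by omega⟩
    induction m generalizing n with
    | zero =>
      intro f hf
      refine ⟨0, ?_⟩
      rw [mul_zero, h.eq_zero _ (hcyc n f hf)]
      exact hzero (hb n (by simpa using hm) f (hone f))
    | succ m ih =>
      intro f hf
      set t := θ (G.proj n f) with ht
      obtain ⟨a, ha⟩ := hker (t - (aug t / aug z) • z)
      have h0 : aug (t - (aug t / aug z) • z) = 0 := by
        rw [_root_.map_sub, _root_.map_smul, smul_eq_mul, div_mul_cancel₀ _ hl, sub_self]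
      rw [h0, _root_.map_zero, zero_add] at ha
      choose g hg hga using fun j => h.surj (a j)
      have hmem : ∀ j, aR (x j) (g j) ∈ cyc := fun j => h.aR_mem _ _ (hg j)
      have h1 : G.proj n f - (aug t / aug z) • c - ∑ j, aR (x j) (g j) ∈ cob := by
        rw [← h.eq_zero _ (cyc.sub_mem (cyc.sub_mem (hcyc n f hf) (cyc.smul_mem _ hcc))
          (cyc.sum_mem fun j _ => hmem j)), h.map_sub (cyc.sub_mem (hcyc n f hf)
          (cyc.smul_mem _ hcc)) (cyc.sum_mem fun j _ => hmem j),
          h.map_sub (hcyc n f hf) (cyc.smul_mem _ hcc), h.map_smul _ hcc,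
          h.map_sum _ fun j _ => hmem j, ← ht, ← hz, ha, sub_eq_zero]
        exact Finset.sum_congr rfl fun j _ => by rw [h.map_aR _ _ (hg j), hga]
      have h2 := hcob n _ h1
      rw [_root_.map_sub, _root_.map_sub, G.proj_proj_self, _root_.map_smul, _root_.map_sum] at h2
      have h3 : ∀ j, G.proj n (aR (x j) (g j)) = aR (x j) (G.proj (n - 1) (g j)) := fun j => by
        rw [← hR j, sub_add_cancel]
      simp only [h3] at h2
      choose w hw using fun j => ih (n - 1) (by push_cast at hm; omega) (g j) (hg j)
      have hmem' : ∀ j, aR (x j) (G.proj (n - 1) (g j)) ∈ cyc :=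
        fun j => h.aR_mem _ _ (hcyc _ _ (hg j))
      -- The component of degree `n` of the homogeneous `c` is `c` or `0`.
      obtain ⟨r, hr⟩ : ∃ r : k, (aug t / aug z) • G.proj n c = r • c := by
        by_cases hnl : n = l
        · exact ⟨_, by rw [hnl, hcl]⟩
        · exact ⟨0, by rw [← hcl, G.proj_proj_of_ne n l c hnl, smul_zero, zero_smul]⟩
      rw [hr, sub_sub] at h2
      have h4 := h.eq_of_sub_mem (hcyc n f hf) (cyc.add_mem (cyc.smul_mem _ hcc)
        (cyc.sum_mem fun j _ => hmem' j)) h2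
      rw [h.add _ (cyc.smul_mem _ hcc) _ (cyc.sum_mem fun j _ => hmem' j), h.map_smul _ hcc,
        h.map_sum _ fun j _ => hmem' j] at h4
      refine ⟨algebraMap k A r + ∑ j, w j * x j, h4.trans ?_⟩
      rw [mul_add, Finset.mul_sum, ← Algebra.commutes, ← Algebra.smul_def]
      exact congrArg _ (Finset.sum_congr rfl fun j _ => by
        rw [h.map_aR _ _ (hcyc _ _ (hg j)), hw, mul_assoc])
  obtain ⟨w, hw⟩ : ∃ w, z * w = 1 := by
    obtain ⟨S, hS⟩ := hsum F hF
    choose w hw using fun n => hpure n F hF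
    refine ⟨∑ n ∈ S, w n, ?_⟩
    rw [Finset.mul_sum, ← hF1, hS]
    exact Finset.sum_congr rfl fun n _ => (hw n).symm
  have hwz : w * z = 1 := by rw [← (hzx w).eq, hw]
  refine ⟨fun f => w * θ f, l, c, h.central_mul (fun a => ?_) hw, hcc, hcl, hwz⟩
  calc w * a = w * (a * z) * w := by rw [mul_assoc, mul_assoc, hw, mul_one]
    _ = w * (z * a) * w := by rw [(hzx a).eq]
    _ = a * w := by rw [← mul_assoc, hwz, one_mul]

end ClassMap

end ClassMap
end
end NKoszulCY

namespace NKoszulCY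
noncomputable section

/-! ### Shifted gradings and products -/

namespace GrMod

variable {k : Type u} [Field k] {X : Type*} [AddCommGroup X] [Module k X]
  {Y : Type*} [AddCommGroup Y] [Module k Y] {Z : Type*} [AddCommGroup Z] [Module k Z]

/-- The grading with degrees raised by `l`. -/
def shift (G : GrMod k X) (l : ℤ) : GrMod k X where
  proj n := G.proj (n - l)
  one := G.one
  zero := G.zero
  zero_le := G.zero_le
  proj_proj_self _ := G.proj_proj_self _
  proj_proj_of_ne _ _ y h := G.proj_proj_of_ne _ _ y fun h' => h (by omega)
  proj_mem_one _ := G.proj_mem_one _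
  proj_mem_zero _ := G.proj_mem_zero _
  exists_sum y hy := by
    obtain ⟨s, hs⟩ := G.exists_sum y hy
    refine ⟨s.map (addRightEmbedding l), ?_⟩
    rw [Finset.sum_map]
    simpa using hs
  bdd := by
    obtain ⟨b, hb⟩ := G.bdd
    exact ⟨b + l, fun i hi => hb _ (by omega)⟩

theorem mem_shift_F {G : GrMod k X} {l : ℤ} {N : ℕ} {n : ℤ} {x : X} :
    x ∈ (G.shift l).F N n ↔ x ∈ G.F N (n - l) := by
  refine ⟨fun h => ⟨h.1, fun j hj => ?_⟩, fun h => ⟨h.1, fun j hj => ?_⟩⟩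
  · have := h.2 (j + l) fun h' => hj ⟨by omega, by
      have := h'.2
      rwa [show n - (j + l) = n - l - j by ring] at this⟩
    change G.proj (j + l - l) x ∈ G.zero at this
    rwa [add_sub_cancel_right] at this
  · exact h.2 (j - l) fun h' => hj ⟨by omega, by
      have := h'.2
      rwa [show n - l - (j - l) = n - j by ring] at this⟩

theorem sub_sum_proj_mem_zero [DecidableEq ℤ] (G : GrMod k X) {y : X} {s t : Finset ℤ} (hst : s ⊆ t)
    (hs : y - ∑ i ∈ s, G.proj i y ∈ G.zero) : y - ∑ i ∈ t, G.proj i y ∈ G.zero := by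
  rw [← Finset.sum_sdiff hst, add_comm, ← sub_sub]
  refine G.zero.sub_mem hs (G.zero.sum_mem fun i hi => ?_)
  have := G.proj_mem_zero i _ hs
  rwa [map_sub, map_sum, Finset.sum_eq_zero, sub_zero] at this
  exact fun j hj => G.proj_proj_of_ne i j y fun h => (Finset.mem_sdiff.1 hi).2 (h ▸ hj)

/-- The grading of a product. -/
def prod (G : GrMod k X) (H : GrMod k Y) : GrMod k (X × Y) where
  proj n := (G.proj n).prodMap (H.proj n)
  one := G.one.prod H.one
  zero := G.zero.prod H.zero
  zero_le := Submodule.prod_mono G.zero_le H.zero_le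
  proj_proj_self _ _ := Prod.ext (G.proj_proj_self _ _) (H.proj_proj_self _ _)
  proj_proj_of_ne _ _ _ h := Prod.ext (G.proj_proj_of_ne _ _ _ h) (H.proj_proj_of_ne _ _ _ h)
  proj_mem_one _ _ hy := ⟨G.proj_mem_one _ _ hy.1, H.proj_mem_one _ _ hy.2⟩
  proj_mem_zero _ _ hy := ⟨G.proj_mem_zero _ _ hy.1, H.proj_mem_zero _ _ hy.2⟩
  exists_sum y hy := by
    classical
    obtain ⟨s, hs⟩ := G.exists_sum _ hy.1
    obtain ⟨t, ht⟩ := H.exists_sum _ hy.2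
    refine ⟨s ∪ t, ?_, ?_⟩
    · rw [Prod.fst_sub, Prod.fst_sum]
      exact G.sub_sum_proj_mem_zero Finset.subset_union_left hs
    · rw [Prod.snd_sub, Prod.snd_sum]
      exact H.sub_sum_proj_mem_zero Finset.subset_union_right ht
  bdd := by
    obtain ⟨b, hb⟩ := G.bdd
    obtain ⟨c, hc⟩ := H.bdd
    exact ⟨min b c, fun i hi y hy => ⟨hb i (by omega) _ hy.1, hc i (by omega) _ hy.2⟩⟩

theorem mem_prod_F {G : GrMod k X} {H : GrMod k Y} {N : ℕ} {n : ℤ} {x : X × Y} :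
    x ∈ (G.prod H).F N n ↔ x.1 ∈ G.F N n ∧ x.2 ∈ H.F N n :=
  ⟨fun h => ⟨⟨h.1.1, fun j hj => (h.2 j hj).1⟩, ⟨h.1.2, fun j hj => (h.2 j hj).2⟩⟩,
    fun h => ⟨⟨h.1.1, h.2.1⟩, fun j hj => ⟨h.1.2 j hj, h.2.2 j hj⟩⟩⟩

variable {G : GrMod k X} {H : GrMod k Y} {K : GrMod k Z} {N : ℕ}

theorem Perturb.coprod {f₀ f : X →ₗ[k] Z} {g₀ g : Y →ₗ[k] Z} (hf : Perturb G K N f₀ f)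
    (hg : Perturb H K N g₀ g) : Perturb (G.prod H) K N (f₀.coprod g₀) (f.coprod g) where
  homog n x := by
    rw [LinearMap.coprod_apply, map_add, hf.homog, hg.homog]
    rfl
  map_one₀ x hx := by
    rw [LinearMap.coprod_apply]
    exact add_mem (hf.map_one₀ _ hx.1) (hg.map_one₀ _ hx.2)
  map_zero₀ x hx := by
    rw [LinearMap.coprod_apply]
    exact add_mem (hf.map_zero₀ _ hx.1) (hg.map_zero₀ _ hx.2)
  map_zero x hx := by
    rw [LinearMap.coprod_apply]
    exact add_mem (hf.map_zero _ hx.1) (hg.map_zero _ hx.2)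
  lower n x hx := by
    rw [mem_prod_F] at hx
    rw [LinearMap.coprod_apply, LinearMap.coprod_apply, add_sub_add_comm]
    exact add_mem (hf.lower n _ hx.1) (hg.lower n _ hx.2)

theorem Perturb.inr {g₀ g : X →ₗ[k] Y} (hg : Perturb G H N g₀ g) :
    Perturb G (K.prod H) N (LinearMap.inr k Z Y ∘ₗ g₀) (LinearMap.inr k Z Y ∘ₗ g) where
  homog n x := Prod.ext (K.proj n).map_zero (hg.homog n x)
  map_one₀ x hx := ⟨K.one.zero_mem, hg.map_one₀ x hx⟩
  map_zero₀ x hx := ⟨K.zero.zero_mem, hg.map_zero₀ x hx⟩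
  map_zero x hx := ⟨K.zero.zero_mem, hg.map_zero x hx⟩
  lower n x hx := by
    rw [LinearMap.comp_apply, LinearMap.comp_apply, ← map_sub, mem_prod_F]
    exact ⟨Submodule.zero_mem _, hg.lower n x hx⟩

end GrMod

/-! ### Lifting the top cohomology to the deformation -/

section Lifting

variable {k : Type u} [Field k] {A : Type*} [Ring A] [Algebra k A]
  {W : Type*} [AddCommGroup W] [Module k W] {E : Type*} [AddCommGroup E] [Module k E]
  {X : Type*} [AddCommGroup X] [Module k X] {Y : Type*} [AddCommGroup Y] [Module k Y]
  {Z : Type*} [AddCommGroup Z] [Module k Z]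
  {GA : GrMod k A} {GW : GrMod k W} {GE : GrMod k E} {GX : GrMod k X} {GY : GrMod k Y}
  {GZ : GrMod k Z} {N : ℕ}
  {w₀ w : W →ₗ[k] E} {e₀ e : E →ₗ[k] X} {d₀ d : X →ₗ[k] Y} {g₀ g : Y →ₗ[k] Z}
  {aR aL : A → Module.End k X} {θ : X → A} {l : ℤ} {c : X}

open GrMod

/-- A pure generator of the top cohomology can be deformed. -/
theorem exists_lift_cocycle (hN : 1 ≤ N) (hd : Perturb GX GY N d₀ d) (hg : Perturb GY GZ N g₀ g)
    (hgd : ∀ x, g (d x) ∈ GZ.zero) (hone : ∀ x, x ∈ GX.one)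
    (hex : ∀ y, g₀ y ∈ GZ.zero → ∃ x, y - d₀ x ∈ GY.zero)
    (hc : d₀ c ∈ GY.zero) (hcl : GX.proj l c = c) :
    ∃ y ∈ GX.F N (l - N), d (c - y) ∈ GY.zero := by
  -- The leading part `d₀ c` vanishes, so `d c` sits `N` lower. It is a cocycle, and exactness one
  -- degree higher writes it as `d y` with `y` equally low.
  have h1 : d c ∈ GY.F N (l - N) := by
    have := hd.lower l c (GX.mem_F_of_pure N (hone c) hcl)
    rw [← sub_add_cancel (d c) (d₀ c)]
    exact add_mem this (GY.zero_le_F N _ hc)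
  obtain ⟨y, hy, hyc⟩ := hd.exact_F hg hN (fun x _ => hgd x) (fun j _ y _ _ hy0 => by
    obtain ⟨x, hx⟩ := hex y hy0
    exact ⟨x, hone x, hx⟩) h1 (hgd c)
  exact ⟨y, hy, by rwa [_root_.map_sub]⟩

variable (hθ : ClassMap (cocycles d₀ GY.zero) (coboundaries e₀ GX.zero) aR aL θ)
  (hc : d₀ c ∈ GY.zero) (hc1 : θ c = 1)

include hθ hc hc1

theorem ClassMap.exists_sub_mem {f : X} (hf : d₀ f ∈ GY.zero) :
    ∃ h, f - aR (θ f) c - e₀ h ∈ GX.zero := by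
  have h1 := hθ.sub_mem (f := f) (g := aR (θ f) c) hf (hθ.aR_mem _ _ hc) (by
    rw [hθ.map_aR _ _ hc, hc1, one_mul])
  obtain ⟨y, ⟨h, rfl⟩, z, hz, hyz⟩ := Submodule.mem_sup.1 h1
  exact ⟨h, by rwa [← hyz, add_sub_cancel_left]⟩

/-- Up to a coboundary `f` is a multiple of `c`; in degree `j` the multiplier has degree `j - l <
0`, so it vanishes. -/
theorem ClassMap.exists_of_degree_lt (hone : ∀ x, x ∈ GE.one) (he : Perturb GE GX N e₀ e)
    (hact : ∀ a n, GX.proj n (aR a c) = aR (GA.proj (n - l) a) c)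
    (hneg : ∀ n < 0, ∀ a, GA.proj n a = 0) {j : ℤ} (hj : j < l) {f : X} (hfj : GX.proj j f = f)
    (hf : d₀ f ∈ GY.zero) : ∃ h ∈ GE.one, f - e₀ h ∈ GX.zero := by
  obtain ⟨h, hh⟩ := hθ.exists_sub_mem hc hc1 hf
  have h1 := GX.proj_mem_zero j _ hh
  rw [_root_.map_sub, _root_.map_sub, hact, hneg _ (by omega), he.homog, hfj] at h1
  have h2 : aR 0 c = 0 := by
    have := hθ.aR_algebraMap 0 c
    rwa [_root_.map_zero, zero_smul] at this
  rw [h2, sub_zero] at h1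
  exact ⟨_, hone _, h1⟩

/-- In leading order the commutator of `c` with `x` is a coboundary of degree `l + 1`. After
removing it, what remains is a cocycle in filtration `l + 1 - N`, too low to carry a nonzero class.
-/
theorem ClassMap.exists_central_lift (hN : 2 ≤ N) (hone : ∀ x, x ∈ GE.one)
    (honeX : ∀ x, x ∈ GX.one)
    (he : Perturb GE GX N e₀ e) (hd : Perturb GX GY N d₀ d) (hde : ∀ x, d (e x) ∈ GY.zero)
    (hact : ∀ a n, GX.proj n (aR a c) = aR (GA.proj (n - l) a) c)
    (hneg : ∀ n < 0, ∀ a, GA.proj n a = 0) (hcl : GX.proj l c = c) {y : X}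
    (hy : y ∈ GX.F N (l - N)) {x : A} {bR bL : Module.End k X}
    (hR : CongrOp (GX.F N) N 1 (aR x) bR) (hL : CongrOp (GX.F N) N 1 (aL x) bL)
    (hR₀ : HomogOp GX.proj 1 (aR x)) (hL₀ : HomogOp GX.proj 1 (aL x))
    (hbR : d (bR (c - y)) ∈ GY.zero) (hbL : d (bL (c - y)) ∈ GY.zero) :
    ∃ h, bR (c - y) - bL (c - y) - e h ∈ GX.zero := by
  have hcF : c ∈ GX.F N l := GX.mem_F_of_pure N (honeX c) hcl
  have h1 := hθ.sub_mem (f := aR x c) (g := aL x c) (hθ.aR_mem _ _ hc) (hθ.aL_mem _ _ hc) (by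
    rw [hθ.map_aR _ _ hc, hθ.map_aL _ _ hc, hc1, one_mul, mul_one])
  obtain ⟨_, ⟨h, rfl⟩, z, hz, hyz⟩ := Submodule.mem_sup.1 h1
  have h2 := GX.proj_mem_zero (l + 1) z hz
  have h3 : GX.proj (l + 1) (aR x c - aL x c) = aR x c - aL x c := by
    rw [_root_.map_sub, hR₀, hL₀, hcl]
  have h4 : aR x c - aL x c - e₀ (GE.proj (l + 1) h) ∈ GX.zero := by
    rw [← h3, ← hyz, _root_.map_add, he.homog, add_sub_cancel_left]
    exact h2
  -- The commutator is homogeneous of degree `l + 1`, so the primitive may be taken homogeneous.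
  set h' := GE.proj (l + 1) h with hh'
  have hF : h' ∈ GE.F N (l + 1) := GE.mem_F_of_pure N (hone _) (GE.proj_proj_self _ _)
  have h5 : bR (c - y) - bL (c - y) - e h' ∈ GX.F N (l + 1 - N) := by
    have h6 : bR (c - y) - bL (c - y) - e h' = (bR c - aR x c) - (bL c - aL x c) - bR y + bL y
        - (e h' - e₀ h') + (aR x c - aL x c - e₀ h') := by
      rw [_root_.map_sub, _root_.map_sub]; abel
    rw [h6]
    have h7 : l - N + 1 = l + 1 - N := by ring
    have hmono := GX.F_sub_le N
    exact add_mem (Submodule.sub_mem _ (add_mem (Submodule.sub_mem _ (Submodule.sub_mem _ (hR.lower l c hcF) (hL.lower l c hcF))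
      (h7 ▸ hR.map hmono _ y hy)) (h7 ▸ hL.map hmono _ y hy)) (he.lower _ _ hF))
      (GX.zero_le_F N _ h4)
  have h8 : d (bR (c - y) - bL (c - y) - e h') ∈ GY.zero := by
    rw [_root_.map_sub, _root_.map_sub]
    exact Submodule.sub_mem _ (Submodule.sub_mem _ hbR hbL) (hde _)
  -- Here `N ≥ 2` gives `l + 1 - N < l`. A drop by `1` alone would reach degree `l`, where the
  -- leading cohomology contains the class of `c`.
  obtain ⟨h'', -, hh⟩ := he.exact_F hd (by omega) (fun x _ => hde x) (fun j hj f _ hfj hf =>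
    hθ.exists_of_degree_lt hc hc1 hone he hact hneg (by omega) hfj hf) h5 h8
  exact ⟨h' + h'', by rwa [_root_.map_add, ← sub_sub]⟩

variable {act₀ act : A →ₗ[k] X} (hact₀ : ∀ a, act₀ a = aR a c) (honeA : ∀ x, x ∈ GA.one)
  (honeE : ∀ x, x ∈ GE.one)

include hact₀ honeA honeE

/-- The perturbation principle for `(a, h) ↦ act a + e h`, whose leading part maps onto the cocycles
modulo zero because `c` generates. -/
theorem ClassMap.exists_lift_of_cocycle (honeX : ∀ x, x ∈ GX.one)
    (hact : Perturb (GA.shift l) GX 1 act₀ act) (he : Perturb GE GX 1 e₀ e)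
    (hd : Perturb GX GY 1 d₀ d) (hde : ∀ x, d (e x) ∈ GY.zero)
    (hda : ∀ a, d (act a) ∈ GY.zero) {f : X} (hf : d f ∈ GY.zero) :
    ∃ a h, f - act a - e h ∈ GX.zero := by
  obtain ⟨⟨a, h⟩, -, hx⟩ := (hact.coprod he).exact hd (fun x _ => by
    rw [LinearMap.coprod_apply, _root_.map_add]
    exact add_mem (hda _) (hde _)) (fun y _ hy => by
      obtain ⟨h, hh⟩ := hθ.exists_sub_mem hc hc1 hy
      exact ⟨(θ y, h), ⟨honeA _, honeE _⟩, by rwa [LinearMap.coprod_apply, hact₀, ← sub_sub]⟩)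
    (honeX f) hf
  exact ⟨a, h, by rwa [LinearMap.coprod_apply, ← sub_sub] at hx⟩

/-- The same map, one step to the left: if `c·a` is a coboundary in leading order, then `a`, its
class, is zero, so the leading kernel is the image of `w₀` in the second component. Exactness there
passes to the perturbation, and the first component stays zero. -/
theorem ClassMap.eq_zero_of_lift_mem (hA : GA.zero = ⊥) (honeW : ∀ x, x ∈ GW.one)
    (hexE : ∀ x, e₀ x ∈ GX.zero → ∃ y, x - w₀ y ∈ GE.zero)
    (hact : Perturb (GA.shift l) GX 1 act₀ act) (he : Perturb GE GX 1 e₀ e)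
    (hw : Perturb GW GE 1 w₀ w) (hew : ∀ x, e (w x) ∈ GX.zero) {a : A} {h : E}
    (hah : act a - e h ∈ GX.zero) : a = 0 := by
  obtain ⟨y, -, hx⟩ := (hw.inr (K := GA.shift l)).exact (hact.coprod he) (fun x _ => by
    rw [LinearMap.comp_apply, LinearMap.inr_apply, LinearMap.coprod_apply, _root_.map_zero, zero_add]
    exact hew x) (fun y _ hy => by
      rw [LinearMap.coprod_apply, hact₀] at hy
      have h1 : aR y.1 c ∈ coboundaries e₀ GX.zero := Submodule.mem_sup.2
        ⟨e₀ (-y.2), ⟨_, rfl⟩, _, hy, by rw [_root_.map_neg]; abel⟩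
      have h2 := (hθ.eq_zero _ (hθ.cob_le h1)).2 h1
      rw [hθ.map_aR _ _ hc, hc1, one_mul] at h2
      rw [← hact₀, h2, _root_.map_zero, zero_add] at hy
      obtain ⟨x, hx⟩ := hexE _ hy
      refine ⟨x, honeW x, ?_, ?_⟩
      · change y.1 - 0 ∈ GA.zero
        rw [h2, sub_zero]
        exact GA.zero.zero_mem
      · exact hx) (y := (a, -h)) ⟨honeA _, honeE _⟩ (by
      rw [LinearMap.coprod_apply, _root_.map_neg, ← sub_eq_add_neg]
      exact hah)
  have h1 : a - 0 ∈ GA.zero := hx.1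
  rwa [hA, sub_zero, Submodule.mem_bot] at h1

end Lifting
end
end NKoszulCY

namespace NKoszulCY
noncomputable section

/-! ### Cochain form of the Calabi–Yau property of `A` -/

section KoszulCohomology

variable {k : Type u} [Field k] {V : Type v} [AddCommGroup V] [Module k V] [FiniteDimensional k V]
  {ι : Type*} [Fintype ι] (e : Module.Basis ι k V) {N : ℕ} (hN : 2 ≤ N)
  {R : Submodule k (TensorAlgebra k V)} (hR : R ≤ tpow k V N) (hK : IsKoszul N R)

theorem homogOp_cochain {T : Module.End k (QuotAlg R ⊗[k] QuotAlg R)} {p : ℤ}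
    (hT : HomogOp (gr2 (homBasis hR) homDeg 1 1).proj p T) (i : ℕ) :
    HomogOp (cochainGr hR i).proj p (LinearMap.llcomp k (TensorAlgebra k V) _ _ T) :=
  fun n f => hom_proj_comp hT n f

theorem congrOp_cochain {T₀ T : Module.End k (QuotAlg R ⊗[k] QuotAlg R)} {p : ℤ} {M : ℕ}
    (hT : CongrOp ((gr2 (homBasis hR) homDeg 1 1).F M) M p T₀ T) (i : ℕ) :
    CongrOp ((cochainGr hR i).F M) M p (LinearMap.llcomp k (TensorAlgebra k V) _ _ T₀)
      (LinearMap.llcomp k (TensorAlgebra k V) _ _ T) := by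
  refine ⟨fun n f hf => comp_mem_hom_F hT.map₀ hf, fun n f hf => ?_⟩
  have := comp_mem_hom_F (T := T - T₀) (p := p - M) (fun n x hx => by
    rw [← add_sub_assoc]; exact hT.lower n x hx) hf
  rwa [← add_sub_assoc, LinearMap.sub_comp] at this

theorem homogOp_actR {n : ℕ} {a : QuotAlg R} (ha : a ∈ homPiece R n) (i : ℕ) :
    HomogOp (cochainGr hR i).proj n (actR (LinearEquiv.refl k _) a) := by
  have h := homogOp_rTensor (w₁ := 1) (w₂ := 1) (homogOp_grA hR (p := n)
    (T := LinearMap.mulRight k a) fun m x hx => mul_mem_homPiece hx ha)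
  have h' := homogOp_cochain hR h i
  rw [Nat.cast_one, one_mul] at h'
  exact h'

theorem homogOp_actL {n : ℕ} {a : QuotAlg R} (ha : a ∈ homPiece R n) (i : ℕ) :
    HomogOp (cochainGr hR i).proj n (actL (LinearEquiv.refl k _) a) := by
  have h := homogOp_lTensor (w₁ := 1) (w₂ := 1) (homogOp_grA hR (p := n)
    (T := LinearMap.mulLeft k a) fun m x hx => by
      rw [add_comm]; exact mul_mem_homPiece ha hx)
  have h' := homogOp_cochain hR h i
  rw [Nat.cast_one, one_mul] at h'
  exact h'

theorem sub_mem_zero_of_hat_eq {B : Type (max u v)} [Ring B] [Algebra k B]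
    (s : QuotAlg R ≃ₗ[k] B) {i : ℕ} {F G : TensorAlgebra k V →ₗ[k] QuotAlg R ⊗[k] QuotAlg R}
    (h : hat N R s i F = hat N R s i G) : F - G ∈ (cochainGr hR i).zero := by
  rw [cochainGr_zero, ← hat_eq_zero_iff s, hat_sub, h]
  exact sub_self (hat N R s i G)

theorem actR_mem_zero {B : Type (max u v)} [Ring B] [Algebra k B] (s : QuotAlg R ≃ₗ[k] B) (b : B)
    (i : ℕ) {f} (hf : f ∈ (cochainGr hR i).zero) : actR s b f ∈ (cochainGr hR i).zero :=
  comp_mem_homVanish (LinearMap.rTensor (QuotAlg R) (pull s (LinearMap.mulRight k b))) hf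

theorem actL_mem_zero {B : Type (max u v)} [Ring B] [Algebra k B] (s : QuotAlg R ≃ₗ[k] B) (b : B)
    (i : ℕ) {f} (hf : f ∈ (cochainGr hR i).zero) : actL s b f ∈ (cochainGr hR i).zero :=
  comp_mem_homVanish (LinearMap.lTensor (QuotAlg R) (pull s (LinearMap.mulLeft k b))) hf

omit [FiniteDimensional k V] in
include hN in
theorem exists_eq_augA_add (a : QuotAlg R) : ∃ b : ι → QuotAlg R,
    a = algebraMap k _ (augA (one_le_two.trans hN) hR a) + ∑ j, b j * quotMk R (TensorAlgebra.ι k (e j)) := by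
  obtain ⟨t, rfl⟩ := quotMk_surjective R a
  refine ⟨fun j => quotMk R (rcontr (e.coord j) t), ?_⟩
  conv_lhs => rw [← sum_rcontr_mul_ι e t]
  rw [map_add, map_sum, AlgHom.commutes, augA, quotLift_quotMk]
  simp only [map_mul]

omit [FiniteDimensional k V] [Fintype ι] in
theorem commute_of_commute_letters (z : QuotAlg R)
    (hz : ∀ j, Commute z (quotMk R (TensorAlgebra.ι k (e j)))) (a : QuotAlg R) : Commute z a := by
  obtain ⟨t, rfl⟩ := quotMk_surjective R a
  induction t using TensorAlgebra.induction with
  | algebraMap r => rw [AlgHom.commutes]; exact (Algebra.commutes r z).symm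
  | ι v =>
    induction e.mem_span v using Submodule.span_induction with
    | mem x hx => obtain ⟨j, rfl⟩ := hx; exact hz j
    | zero => rw [map_zero, map_zero]; exact Commute.zero_right z
    | add x y _ _ hx hy => rw [map_add, map_add]; exact hx.add_right hy
    | smul c x _ hx => rw [map_smul, map_smul]; exact hx.smul_right c
  | mul a b ha hb => rw [map_mul]; exact ha.mul_right hb
  | add a b ha hb => rw [map_add]; exact ha.add_right hb

omit [FiniteDimensional k V] in
include hR hK in
theorem bimodD_self_exact (i : ℕ) :
    Function.Exact (bimodD e (quotMk R) hN R (i + 1)) (bimodD e (quotMk R) hN R i) :=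
  bimodD_exact e hN hR 0 hK (quotMk R) quotMk_self (quotMk_ι_injective hN hR)
    (LinearEquiv.refl k _) (letterOps_self hR e) i

include hN in
theorem perturb_dualD_self (i : ℕ) :
    GrMod.Perturb (cochainGr hR i) (cochainGr hR (i + 1)) N
      (dualD e (quotMk R) N (LinearEquiv.refl k (QuotAlg R)) i)
      (dualD e (quotMk R) N (LinearEquiv.refl k (QuotAlg R)) i) :=
  perturb_dualD (q := quotMk R) (s := LinearEquiv.refl k _) e hR (by omega) dvd_rfl le_rfl (letterOps_self hR e) i

variable {d : ℕ} (hCY : IsCalabiYau k (QuotAlg R) d)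

include hN hK hCY

omit hK in
theorem mem_zero_of_dualD_mem {F : TensorAlgebra k V →ₗ[k] QuotAlg R ⊗[k] QuotAlg R}
    (hF : dualD e (quotMk R) N (LinearEquiv.refl k _) 0 F ∈ (cochainGr hR 1).zero) :
    F ∈ (cochainGr hR 0).zero := by
  rw [cochainGr_zero, ← hat_eq_zero_iff (LinearEquiv.refl k _)] at hF ⊢
  refine IsCalabiYau.eq_zero_of_comp_eq_zero (P := fun i => KoszulBimod (QuotAlg R) N R i)
    (bimodD e (quotMk R) hN R) (bimodAug (QuotAlg R) N R) hCY (bimodAug_surjective hN R)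
    (bimodAug_exact e (quotMk R) hN R (quotMk_surjective R)) _ ?_
  rw [hat_comp_bimodD]
  exact hF

theorem exists_sub_dualD_mem {i : ℕ} (hi : i + 1 ≠ d)
    {F : TensorAlgebra k V →ₗ[k] QuotAlg R ⊗[k] QuotAlg R}
    (hF : dualD e (quotMk R) N (LinearEquiv.refl k _) (i + 1) F ∈ (cochainGr hR (i + 2)).zero) :
    ∃ G, F - dualD e (quotMk R) N (LinearEquiv.refl k _) i G ∈ (cochainGr hR (i + 1)).zero := by
  rw [cochainGr_zero, ← hat_eq_zero_iff (LinearEquiv.refl k _)] at hF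
  obtain ⟨g, hg⟩ := IsCalabiYau.exists_comp_eq (P := fun i => KoszulBimod (QuotAlg R) N R i)
    (bimodD e (quotMk R) hN R) (bimodAug (QuotAlg R) N R) (fun i => projective_koszulBimod R i)
    (bimodAug_surjective hN R) (bimodAug_exact e (quotMk R) hN R (quotMk_surjective R))
    (bimodD_self_exact e hN hR hK) hCY i hi (hat N R (LinearEquiv.refl k _) (i + 1) F) (by
      rw [hat_comp_bimodD]; exact hF)
  obtain ⟨G, rfl⟩ := hat_surjective (LinearEquiv.refl k _) i g
  exact ⟨G, sub_mem_zero_of_hat_eq hR _ (by rw [← hg, hat_comp_bimodD])⟩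

end KoszulCohomology

/-! ### The class map of `A` in the top degree -/

section TopClass

variable {k : Type u} [Field k] {V : Type v} [AddCommGroup V] [Module k V] [FiniteDimensional k V]
  {ι : Type*} [Fintype ι] (e : Module.Basis ι k V) {N : ℕ} (hN : 2 ≤ N)
  {R : Submodule k (TensorAlgebra k V)} (hR : R ≤ tpow k V N) (hK : IsKoszul N R)
  {i : ℕ} (hCY : IsCalabiYau k (QuotAlg R) (i + 1))

include hK hCY hN

theorem exists_classMap : ∃ θ, ClassMap
    (cocycles (dualD e (quotMk R) N (LinearEquiv.refl k (QuotAlg R)) (i + 1))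
      (cochainGr hR (i + 1 + 1)).zero)
    (coboundaries (dualD e (quotMk R) N (LinearEquiv.refl k (QuotAlg R)) i)
      (cochainGr hR (i + 1)).zero)
    (actR (LinearEquiv.refl k (QuotAlg R))) (actL (LinearEquiv.refl k _)) θ := by
  obtain ⟨θ, hadd, hzero, hmul, hsurj⟩ := IsCalabiYau.exists_classMap
    (P := fun i => KoszulBimod (QuotAlg R) N R i)
    (bimodD e (quotMk R) hN R) (bimodAug (QuotAlg R) N R) (fun i => projective_koszulBimod R i)
    (bimodAug_surjective hN R) (bimodAug_exact e (quotMk R) hN R (quotMk_surjective R))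
    (bimodD_self_exact e hN hR hK) hCY
  have hcyc : ∀ f, f ∈ cocycles (dualD e (quotMk R) N (LinearEquiv.refl k (QuotAlg R)) (i + 1))
      (cochainGr hR (i + 1 + 1)).zero ↔
      hat N R (LinearEquiv.refl k _) (i + 1) f ∘ₗ bimodD e (quotMk R) hN R (i + 1) = 0 := by
    intro f
    rw [hat_comp_bimodD, hat_eq_zero_iff]
    rfl
  have hcob : ∀ f, f ∈ coboundaries (dualD e (quotMk R) N (LinearEquiv.refl k (QuotAlg R)) i)
      (cochainGr hR (i + 1)).zero ↔ ∃ g : KoszulBimod (QuotAlg R) N R i →ₗ[Env k (QuotAlg R)]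
        Env k (QuotAlg R), g ∘ₗ bimodD e (quotMk R) hN R i =
          hat N R (LinearEquiv.refl k _) (i + 1) f := by
    intro f
    constructor
    · intro hf
      obtain ⟨_, ⟨G, rfl⟩, z, hz, rfl⟩ := Submodule.mem_sup.1 hf
      refine ⟨hat N R (LinearEquiv.refl k _) i G, ?_⟩
      rw [cochainGr_zero, ← hat_eq_zero_iff (LinearEquiv.refl k _)] at hz
      rw [hat_comp_bimodD, hat_add, hz, add_zero]
    · rintro ⟨g, hg⟩
      obtain ⟨G, rfl⟩ := hat_surjective (LinearEquiv.refl k _) i g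
      refine Submodule.mem_sup.2 ⟨_, ⟨G, rfl⟩, f - dualD e (quotMk R) N _ i G,
        sub_mem_zero_of_hat_eq hR (LinearEquiv.refl k _) (by rw [← hg, hat_comp_bimodD]),
        by abel⟩
  refine ⟨fun f => θ (hat N R (LinearEquiv.refl k _) (i + 1) f), ?_⟩
  refine ⟨?_, fun f hf g hg => ?_, fun f hf => ?_, fun a f hf => ?_, fun a f hf => ?_,
    fun a f hf => ?_, fun a f hf => ?_, fun r f => ?_, fun b => ?_⟩
  · refine sup_le ?_ fun f hf => ?_
    · rintro _ ⟨G, rfl⟩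
      exact dualD_dualD_mem e hN (quotMk R) _ (bimodD_self_exact e hN hR hK) i G
    · exact (perturb_dualD_self e hN hR (i + 1)).map_zero f hf
  · rw [hat_add]
    exact hadd _ _ ((hcyc f).1 hf) ((hcyc g).1 hg)
  · rw [hzero _ ((hcyc f).1 hf), hcob]
  · rw [cocycles, Submodule.mem_comap, dualD_actR]
    exact actR_mem_zero hR _ _ _ hf
  · rw [cocycles, Submodule.mem_comap, dualD_actL]
    exact actL_mem_zero hR _ _ _ hf
  · have := hmul _ ((hcyc f).1 hf) a 1
    rwa [MulOpposite.op_one, rmul_comp_hat_actR, one_mul] at this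
  · have := hmul _ ((hcyc f).1 hf) 1 a
    rwa [rmul_comp_hat_actL, mul_one] at this
  · rw [Algebra.algebraMap_eq_smul_one, actR_smul, actR_one]
  · obtain ⟨f, hf, hfb⟩ := hsurj b
    obtain ⟨F, rfl⟩ := hat_surjective (LinearEquiv.refl k _) (i + 1) f
    exact ⟨F, (hcyc F).2 hf, hfb⟩

theorem exists_pure_classMap : ∃ θ l c, ClassMap
    (cocycles (dualD e (quotMk R) N (LinearEquiv.refl k (QuotAlg R)) (i + 1))
      (cochainGr hR (i + 1 + 1)).zero)
    (coboundaries (dualD e (quotMk R) N (LinearEquiv.refl k (QuotAlg R)) i)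
      (cochainGr hR (i + 1)).zero)
    (actR (LinearEquiv.refl k (QuotAlg R))) (actL (LinearEquiv.refl k _)) θ ∧
    dualD e (quotMk R) N (LinearEquiv.refl k _) (i + 1) c ∈ (cochainGr hR (i + 1 + 1)).zero ∧
    (cochainGr hR (i + 1)).proj l c = c ∧ θ c = 1 := by
  obtain ⟨θ, hθ⟩ := exists_classMap e hN hR hK hCY
  refine hθ.exists_pure (G := cochainGr hR (i + 1))
    (x := fun j => quotMk R (TensorAlgebra.ι k (e j))) (aug := augA (by omega) hR)
    (fun f => trivial) le_sup_right (fun n f hf => ?_) (fun n f hf => ?_)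
    (fun j => ?_) (fun j => ?_) (exists_eq_augA_add e hN hR) (commute_of_commute_letters e)
  · rw [cocycles, Submodule.mem_comap, ← (perturb_dualD_self e hN hR (i + 1)).homog]
    exact (cochainGr hR (i + 2)).proj_mem_zero n _ hf
  · obtain ⟨_, ⟨G, rfl⟩, z, hz, rfl⟩ := Submodule.mem_sup.1 hf
    rw [map_add, (perturb_dualD_self e hN hR i).homog]
    exact add_mem (Submodule.mem_sup_left ⟨_, rfl⟩)
      (Submodule.mem_sup_right ((cochainGr hR (i + 1)).proj_mem_zero n _ hz))
  · exact_mod_cast homogOp_actR hR (quotMk_mem_homPiece (ι_mem_tpow (e j))) (i + 1)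
  · exact_mod_cast homogOp_actL hR (quotMk_mem_homPiece (ι_mem_tpow (e j))) (i + 1)

end TopClass
end
end NKoszulCY

namespace NKoszulCY
noncomputable section

/-! ### Multiplication in `U` as a perturbation of multiplication in `A` -/

section DeformedOperators

theorem grA_proj_of_neg {k : Type u} [Field k] {V : Type v} [AddCommGroup V] [Module k V] {N : ℕ}
    {R : Submodule k (TensorAlgebra k V)} (hR : R ≤ tpow k V N) {j : ℤ} (hj : j < 0)
    (x : QuotAlg R) : (grA hR).proj j x = 0 := by
  have : (grA hR).proj j = 0 := (homBasis hR).ext fun b => by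
    rw [grA_proj_of_mem hR (homBasis_mem hR b), if_neg (by omega)]
    rfl
  rw [this, LinearMap.zero_apply]


variable {k : Type u} [Field k] {V : Type v} [AddCommGroup V] [Module k V] {N : ℕ} (hN : 1 ≤ N)
  {R : Submodule k (TensorAlgebra k V)} (hR : R ≤ tpow k V N) (φ : R →ₗ[k] k)
  (hP : IsPBWDeformation R (deformedRel R φ))

theorem deformEquiv_homBasis (b : HomIndex R) :
    deformEquiv hR φ hN hP (homBasis hR b) = quotMk (deformedRel R φ) (homLift hR b) :=
  congrArg (quotMk (deformedRel R φ)) (homSection_homBasis hR b)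

theorem deformEquiv_quotMk_ι (hN2 : 2 ≤ N) (v : V) :
    deformEquiv hR φ hN hP (quotMk R (TensorAlgebra.ι k v)) =
      quotMk (deformedRel R φ) (TensorAlgebra.ι k v) :=
  (quotMk_deformedRel_ι hR φ hN2 v).symm

theorem deformEquiv_symm_sub_mem {m : ℕ} {t : TensorAlgebra k V} (ht : t ∈ tpow k V m) :
    (deformEquiv hR φ hN hP).symm (quotMk (deformedRel R φ) t) - quotMk R t ∈
      (grA hR).F N (m - N) := by
  obtain ⟨x, hx, hxt⟩ := quotMk_sub_toDeform_mem hR φ hN m t ht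
  suffices h : (deformEquiv hR φ hN hP).symm (quotMk (deformedRel R φ) t) - quotMk R t = x by
    rw [h]; exact hx
  refine (deformEquiv hR φ hN hP).injective ?_
  rw [map_sub, LinearEquiv.apply_symm_apply]
  exact hxt.symm

theorem congrOp_pull_mulRight {n : ℕ} {a : QuotAlg R} (ha : a ∈ homPiece R n) :
    CongrOp ((grA hR).F N) N n (LinearMap.mulRight k a)
      (pull (deformEquiv hR φ hN hP) (LinearMap.mulRight k (deformEquiv hR φ hN hP a))) := by
  refine congrOp_grA hR (fun m x hx => mul_mem_homPiece hx ha) fun b => ?_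
  have h1 := deformEquiv_symm_sub_mem hN hR φ hP
    (mul_mem_tpow (homLift_mem hR b) (homSection_mem hR ha))
  have h2 : deformEquiv hR φ hN hP a = quotMk (deformedRel R φ) (homSection hR a) := rfl
  rw [map_mul (quotMk _), map_mul (quotMk R), quotMk_homLift, quotMk_homSection] at h1
  rw [pull, LinearMap.comp_apply, LinearMap.comp_apply, LinearMap.mulRight_apply,
    LinearMap.mulRight_apply, LinearEquiv.coe_coe, LinearEquiv.coe_coe, deformEquiv_homBasis, h2]
  rwa [Nat.cast_add] at h1

theorem congrOp_pull_mulLeft {n : ℕ} {a : QuotAlg R} (ha : a ∈ homPiece R n) :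
    CongrOp ((grA hR).F N) N n (LinearMap.mulLeft k a)
      (pull (deformEquiv hR φ hN hP) (LinearMap.mulLeft k (deformEquiv hR φ hN hP a))) := by
  refine congrOp_grA hR (fun m x hx => by rw [add_comm]; exact mul_mem_homPiece ha hx) fun b => ?_
  have h1 := deformEquiv_symm_sub_mem hN hR φ hP
    (mul_mem_tpow (homSection_mem hR ha) (homLift_mem hR b))
  have h2 : deformEquiv hR φ hN hP a = quotMk (deformedRel R φ) (homSection hR a) := rfl
  rw [map_mul (quotMk _), map_mul (quotMk R), quotMk_homLift, quotMk_homSection] at h1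
  rw [pull, LinearMap.comp_apply, LinearMap.comp_apply, LinearMap.mulLeft_apply,
    LinearMap.mulLeft_apply, LinearEquiv.coe_coe, LinearEquiv.coe_coe, deformEquiv_homBasis, h2]
  rwa [Nat.cast_add, add_comm (n : ℤ)] at h1

variable [FiniteDimensional k V]

theorem congrOp_actR {n : ℕ} {a : QuotAlg R} (ha : a ∈ homPiece R n) {M : ℕ} (hM : (M : ℤ) ∣ N)
    (hle : M ≤ N) (i : ℕ) : CongrOp ((cochainGr hR i).F M) M n (actR (LinearEquiv.refl k _) a)
      (actR (deformEquiv hR φ hN hP) (deformEquiv hR φ hN hP a)) := by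
  have h := congrOp_cochain hR (congrOp_rTensor (w₁ := 1) (w₂ := 1) (N' := M) (by simpa using hM)
    (by simpa using hM) (by simpa using hle) (congrOp_pull_mulRight hN hR φ hP ha)) i
  rw [Nat.cast_one, one_mul] at h
  exact h

theorem congrOp_actL {n : ℕ} {a : QuotAlg R} (ha : a ∈ homPiece R n) {M : ℕ} (hM : (M : ℤ) ∣ N)
    (hle : M ≤ N) (i : ℕ) : CongrOp ((cochainGr hR i).F M) M n (actL (LinearEquiv.refl k _) a)
      (actL (deformEquiv hR φ hN hP) (deformEquiv hR φ hN hP a)) := by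
  have h := congrOp_cochain hR (congrOp_lTensor (w₁ := 1) (w₂ := 1) (N' := M) (by simpa using hM)
    (by simpa using hM) (by simpa using hle) (congrOp_pull_mulLeft hN hR φ hP ha)) i
  rw [Nat.cast_one, one_mul] at h
  exact h

theorem hat_eq_of_sub_mem_zero {B : Type (max u v)} [Ring B] [Algebra k B]
    (s : QuotAlg R ≃ₗ[k] B) {i : ℕ} {F G : TensorAlgebra k V →ₗ[k] QuotAlg R ⊗[k] QuotAlg R}
    (h : F - G ∈ (cochainGr hR i).zero) : hat N R s i F = hat N R s i G := by
  rw [cochainGr_zero, ← hat_eq_zero_iff s, hat_sub] at h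
  exact eq_of_sub_eq_zero h

/-- The map `b ↦ c · (b ⊗ 1)`. -/
def actRLin {B : Type (max u v)} [Ring B] [Algebra k B] (s : QuotAlg R ≃ₗ[k] B)
    (c : TensorAlgebra k V →ₗ[k] QuotAlg R ⊗[k] QuotAlg R) :
    B →ₗ[k] TensorAlgebra k V →ₗ[k] QuotAlg R ⊗[k] QuotAlg R where
  toFun b := actR s b c
  map_add' b b' := actR_add s b b' c
  map_smul' r b := actR_smul s r b c

theorem proj_actR {i : ℕ} {l : ℤ} {c : TensorAlgebra k V →ₗ[k] QuotAlg R ⊗[k] QuotAlg R}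
    (hcl : (cochainGr hR i).proj l c = c) (a : QuotAlg R) (n : ℤ) :
    (cochainGr hR i).proj n (actR (LinearEquiv.refl k _) a c) =
      actR (LinearEquiv.refl k _) ((grA hR).proj (n - l) a) c := by
  have h := GrMod.ofBasis_homog (homBasis hR) (fun b => (homDeg b : ℤ)) ⟨0, fun _ => by positivity⟩
    (cochainGr hR i) (actRLin (LinearEquiv.refl k _) c) l (fun b => by
      have h1 := homogOp_actR hR (homBasis_mem hR b) i l c
      rw [hcl, add_comm] at h1
      exact h1) (n - l) a
  rw [sub_add_cancel] at h
  exact h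

/-- Two changes are made, each of lower order: `c` is replaced by `c - y`, and multiplication by `a`
in `A` by multiplication by its image in `U`. The source is shifted by `l`, the degree of `c`. -/
theorem perturb_actRLin {i : ℕ} {l : ℤ}
    {c y : TensorAlgebra k V →ₗ[k] QuotAlg R ⊗[k] QuotAlg R}
    (hcl : (cochainGr hR i).proj l c = c) (hy : y ∈ (cochainGr hR i).F N (l - N)) :
    GrMod.Perturb ((grA hR).shift l) (cochainGr hR i) 1 (actRLin (LinearEquiv.refl k _) c)
      (actRLin (deformEquiv hR φ hN hP) (c - y) ∘ₗ (deformEquiv hR φ hN hP).toLinearMap) := by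
  have hzero : ∀ x ∈ ((grA hR).shift l).zero, x = 0 := fun x hx =>
    ((full_gr (homBasis hR) homDeg).mem_zero).1 hx
  have hcF : c ∈ (cochainGr hR i).F 1 l := (cochainGr hR i).mem_F_of_pure 1 trivial hcl
  have hyF : y ∈ (cochainGr hR i).F 1 (l - 1) :=
    (cochainGr hR i).F_one_mono (by omega) ((cochainGr hR i).F_le_F_one N _ hy)
  have hmono := (cochainGr hR i).F_sub_le 1
  refine ⟨fun n x => proj_actR hR hcl x n, fun _ _ => trivial, fun x hx => ?_, fun x hx => ?_,
    fun n x hx => ?_⟩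
  · rw [hzero x hx, map_zero]
    exact Submodule.zero_mem _
  · rw [hzero x hx, map_zero]
    exact Submodule.zero_mem _
  · rw [GrMod.mem_shift_F] at hx
    refine GrMod.ofBasis_induction (homBasis hR) _ ⟨0, fun _ => by positivity⟩ 1
      (Submodule.comap (actRLin (deformEquiv hR φ hN hP) (c - y) ∘ₗ
        (deformEquiv hR φ hN hP).toLinearMap - actRLin (LinearEquiv.refl k _) c)
        ((cochainGr hR i).F 1 (n - (1 : ℕ)))) (fun b hb _ => ?_) hx
    have hop := congrOp_actR hN hR φ hP (homBasis_mem hR b) (M := 1) (by simp) hN i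
    have h1 := hop.lower l c hcF
    have h2 := hop.map hmono _ y hyF
    have h3 := (cochainGr hR i).F_one_mono (by push_cast; omega : l + (homDeg b : ℤ) - (1 : ℕ) ≤ n - (1 : ℕ)) h1
    have h4 := (cochainGr hR i).F_one_mono (by push_cast; omega : l - 1 + (homDeg b : ℤ) ≤ n - (1 : ℕ)) h2
    have h5 := Submodule.sub_mem _ h3 h4
    rw [sub_right_comm, ← map_sub] at h5
    exact h5

end DeformedOperators

/-! ### The deformation theorem -/

section Main

variable {k : Type u} [Field k] {V : Type v} [AddCommGroup V] [Module k V] [FiniteDimensional k V]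
  {N : ℕ} {R : Submodule k (TensorAlgebra k V)} {φ : R →ₗ[k] k}

/-- The three properties are those that `isCalabiYau_of_resolution` requires of its cocycle:
generation, freeness and centrality on letters. -/
theorem exists_deformed_generator {ι : Type*} [Fintype ι] (e : Module.Basis ι k V) {i : ℕ}
    (hN : 2 ≤ N) (hR : R ≤ tpow k V N) (hK : IsKoszul N R)
    (hCY : IsCalabiYau k (QuotAlg R) (i + 1 + 1)) (hP : IsPBWDeformation R (deformedRel R φ))
    {D : ℕ → Module.End k (TensorAlgebra k V →ₗ[k] QuotAlg R ⊗[k] QuotAlg R)}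
    {s : QuotAlg R ≃ₗ[k] QuotAlg (deformedRel R φ)}
    (hs : s = deformEquiv hR φ (one_le_two.trans hN) hP)
    (hD : ∀ j, D j = dualD e (quotMk (deformedRel R φ)) N s j)
    (hpN : ∀ j, GrMod.Perturb (cochainGr hR j) (cochainGr hR (j + 1)) N
      (dualD e (quotMk R) N (LinearEquiv.refl k (QuotAlg R)) j) (D j))
    (hp1 : ∀ j, GrMod.Perturb (cochainGr hR j) (cochainGr hR (j + 1)) 1
      (dualD e (quotMk R) N (LinearEquiv.refl k (QuotAlg R)) j) (D j))
    (hDD : ∀ j x, D (j + 1) (D j x) ∈ (cochainGr hR (j + 2)).zero) :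
    ∃ c, D (i + 1 + 1) c ∈ (cochainGr hR (i + 1 + 1 + 1)).zero ∧
      (∀ f, D (i + 1 + 1) f ∈ (cochainGr hR (i + 1 + 1 + 1)).zero →
        ∃ b h, f - actR s b c - D (i + 1) h ∈ (cochainGr hR (i + 1 + 1)).zero) ∧
      (∀ b h, actR s b c - D (i + 1) h ∈ (cochainGr hR (i + 1 + 1)).zero → b = 0) ∧
      ∀ v, ∃ h, actR s (quotMk (deformedRel R φ) (TensorAlgebra.ι k v)) c -
        actL s (quotMk (deformedRel R φ) (TensorAlgebra.ι k v)) c - D (i + 1) h ∈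
          (cochainGr hR (i + 1 + 1)).zero := by
  have hN1 : 1 ≤ N := one_le_two.trans hN
  have hex₀ : ∀ j, j ≠ i + 1 → ∀ F, dualD e (quotMk R) N (LinearEquiv.refl k (QuotAlg R)) (j + 1) F ∈
      (cochainGr hR (j + 2)).zero →
      ∃ H, F - dualD e (quotMk R) N (LinearEquiv.refl k (QuotAlg R)) j H ∈
        (cochainGr hR (j + 1)).zero := fun j hj F hF =>
    exists_sub_dualD_mem e hN hR hK hCY (by omega) hF
  obtain ⟨θ, l, c, hθ, hc, hcl, hc1⟩ := exists_pure_classMap e hN hR hK hCY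
  -- The obstruction to lifting lies one degree above the top, where the Ext of `A` vanishes.
  obtain ⟨y, hy, hcy⟩ := exists_lift_cocycle hN1 (hpN (i + 1 + 1)) (hpN (i + 1 + 1 + 1))
    (hDD (i + 1 + 1)) (fun _ => trivial) (hex₀ (i + 2) (by omega)) hc hcl
  have hcR : ∀ b, D (i + 1 + 1) (actR s b (c - y)) ∈ (cochainGr hR (i + 1 + 1 + 1)).zero := by
    intro b
    rw [hD, dualD_actR, ← hD]
    exact actR_mem_zero hR s b _ hcy
  have hcL : ∀ b, D (i + 1 + 1) (actL s b (c - y)) ∈ (cochainGr hR (i + 1 + 1 + 1)).zero := by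
    intro b
    rw [hD, dualD_actL, ← hD]
    exact actL_mem_zero hR s b _ hcy
  have hact := perturb_actRLin hN1 hR φ hP hcl hy
  have hA := full_gr (homBasis hR) homDeg
  rw [← hs] at hact
  refine ⟨c - y, hcy, fun f hf => ?_, fun b h hbh => ?_, fun v => ?_⟩
  · obtain ⟨a, h, hah⟩ := hθ.exists_lift_of_cocycle (GA := grA hR)
      (GE := cochainGr hR (i + 1)) (GX := cochainGr hR (i + 1 + 1))
      (GY := cochainGr hR (i + 1 + 1 + 1)) hc hc1
      (act₀ := actRLin (LinearEquiv.refl k (QuotAlg R)) c) (fun _ => rfl)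
      (fun x => hA.mem_one x) (fun _ => trivial) (fun _ => trivial)
      hact (hp1 (i + 1)) (hp1 (i + 1 + 1)) (hDD (i + 1)) (fun a => hcR (s a)) hf
    exact ⟨s a, h, hah⟩
  · obtain ⟨a, rfl⟩ := s.surjective b
    have := hθ.eq_zero_of_lift_mem (GA := grA hR) (GW := cochainGr hR i)
      (GE := cochainGr hR (i + 1)) (GX := cochainGr hR (i + 1 + 1))
      (GY := cochainGr hR (i + 1 + 1 + 1)) hc hc1
      (act₀ := actRLin (LinearEquiv.refl k (QuotAlg R)) c) (fun _ => rfl)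
      (fun x => hA.mem_one x) (fun _ => trivial)
      hA.zero_eq (fun _ => trivial) (hex₀ i (Nat.succ_ne_self i).symm) hact
      (hp1 (i + 1)) (hp1 i) (hDD i) hbh
    rw [this, map_zero]
  · have hv : quotMk R (TensorAlgebra.ι k v) ∈ homPiece R 1 := quotMk_mem_homPiece (ι_mem_tpow v)
    have hR1 := congrOp_actR hN1 hR φ hP hv (M := N) dvd_rfl le_rfl (i + 1 + 1)
    have hL1 := congrOp_actL hN1 hR φ hP hv (M := N) dvd_rfl le_rfl (i + 1 + 1)
    have hR2 := homogOp_actR hR hv (i + 1 + 1)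
    have hL2 := homogOp_actL hR hv (i + 1 + 1)
    rw [Nat.cast_one] at hR1 hL1 hR2 hL2
    rw [deformEquiv_quotMk_ι hN1 hR φ hP hN v, ← hs] at hR1 hL1
    exact hθ.exists_central_lift (GA := grA hR)
      (GE := cochainGr hR (i + 1)) (GX := cochainGr hR (i + 1 + 1))
      (GY := cochainGr hR (i + 1 + 1 + 1)) hc hc1 hN (fun _ => trivial)
      (fun _ => trivial) (hpN (i + 1)) (hpN (i + 1 + 1)) (hDD (i + 1))
      (fun a n => proj_actR hR hcl a n) (fun n hn a => grA_proj_of_neg hR hn a) hcl hy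
      hR1 hL1 hR2 hL2 (hcR _) (hcL _)

/-- A PBW deformation of an `N`-Koszul Calabi–Yau algebra is Calabi–Yau. -/
theorem isCalabiYau_deformation {d : ℕ} (hN : 2 ≤ N) (hd : 2 ≤ d) (hR : R ≤ tpow k V N)
    (hK : IsKoszul N R) (hCY : IsCalabiYau k (QuotAlg R) d)
    (hP : IsPBWDeformation R (deformedRel R φ)) :
    IsCalabiYau k (QuotAlg (deformedRel R φ)) d := by
  -- For `d ≥ 2` there is a differential into degree `d - 1`; exactness there enters the freeness of
  -- the generator.
  obtain ⟨i, rfl⟩ : ∃ i, d = i + 1 + 1 := ⟨d - 2, by omega⟩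
  let e := Module.finBasis k V
  have hN1 : 1 ≤ N := by omega
  obtain ⟨s, hs⟩ : ∃ s, s = deformEquiv hR φ hN1 hP := ⟨_, rfl⟩
  obtain ⟨q, hq'⟩ : ∃ q, q = quotMk (deformedRel R φ) := ⟨_, rfl⟩
  have hop : LetterOps (homBasis hR) homDeg N (letL e (quotMk R) (LinearEquiv.refl k _))
      (letR e (quotMk R) (LinearEquiv.refl k _)) (letL e q s) (letR e q s) := by
    rw [hs, hq']
    exact letterOps_deform hR φ hN1 hP e
  have hq : Function.Surjective q := by rw [hq']; exact quotMk_surjective _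
  have hexact : ∀ j, Function.Exact (bimodD e q hN R (j + 1)) (bimodD e q hN R j) :=
    bimodD_exact e hN hR φ hK q (by rw [hq']; exact quotMk_deformedRel φ)
      (by rw [hq']; exact quotMk_deformedRel_ι_injective φ hN hR hP) s hop
  have hpN := fun j => perturb_dualD e hR hN1 dvd_rfl le_rfl hop j
  have hp1 := fun j => perturb_dualD (N' := 1) e hR hN1 (by simp) hN1 hop j
  have hDD := fun j x => dualD_dualD_mem e hN q s hexact j x
  have hhat : ∀ j F, hat N R s j F ∘ₗ bimodD e q hN R j = 0 ↔
      dualD e q N s j F ∈ (cochainGr hR (j + 1)).zero := fun j F => by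
    rw [hat_comp_bimodD, hat_eq_zero_iff]
    rfl
  obtain ⟨c, hc, hgen, hinj, hcent⟩ := exists_deformed_generator e hN hR hK hCY hP hs
    (D := fun j => dualD e q N s j) (fun j => by rw [hq']) hpN hp1 hDD
  obtain ⟨m, hm⟩ := koszulW_eq_bot e hN hR (bimodD_self_exact e hN hR hK) hCY.finite_resolution
  refine isCalabiYau_of_resolution (P := fun i => KoszulBimod (QuotAlg (deformedRel R φ)) N R i)
    (bimodD e q hN R) (bimodAug (QuotAlg (deformedRel R φ)) N R)
    (fun i => projective_koszulBimod R i) (bimodAug_surjective hN R) (bimodAug_exact e q hN R hq)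
    hexact (fun i => finite_koszulBimod R i) m (fun j hj => ?_) (i + 1) (fun f hf => ?_)
    (fun j hj f hf => ?_) (hat N R s (i + 1 + 1) c) ((hhat _ _).2 hc) (fun f hf => ?_)
    (fun b g hbg => ?_) (Set.range (q ∘ TensorAlgebra.ι k)) (adjoin_range_letters q hq) ?_
  · refine subsingleton_of_forall_eq 0 fun x => ?_
    induction x using TensorProduct.induction_on with
    | zero => rfl
    | tmul x w =>
      rw [show w = 0 from Subtype.ext ((Submodule.mem_bot k).1 (hm j hj ▸ w.2)),
        TensorProduct.tmul_zero]
    | add x y hx hy => rw [hx, hy, add_zero]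
  · obtain ⟨F, rfl⟩ := hat_surjective s 0 f
    rw [hhat] at hf
    rw [hat_eq_zero_iff]
    -- Injectivity in degree `0` is exactness after the zero map, so the same principle applies.
    have h0 : GrMod.Perturb (cochainGr hR 0) (cochainGr hR 0) 1 0 0 :=
      ⟨fun n x => by simp, fun _ _ => trivial, fun x _ => Submodule.zero_mem _,
        fun x _ => Submodule.zero_mem _, fun n x _ => by simp⟩
    obtain ⟨x, -, hx⟩ := h0.exact (hp1 0) (fun x _ => by simp) (fun F _ hF => ⟨0, trivial, by
      rw [map_zero, sub_zero]
      exact mem_zero_of_dualD_mem e hN hR hCY hF⟩) (y := F) trivial hf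
    rwa [LinearMap.zero_apply, sub_zero] at hx
  · obtain ⟨F, rfl⟩ := hat_surjective s (j + 1) f
    rw [hhat] at hf
    obtain ⟨x, -, hx⟩ := (hp1 j).exact (hp1 (j + 1)) (fun x _ => hDD j x) (fun F _ hF => by
      obtain ⟨H, hH⟩ := exists_sub_dualD_mem e hN hR hK hCY (by omega) hF
      exact ⟨H, trivial, hH⟩) (y := F) trivial hf
    refine ⟨hat N R s j x, ?_⟩
    rw [hat_comp_bimodD]
    exact (hat_eq_of_sub_mem_zero hR s hx).symm
  · obtain ⟨F, rfl⟩ := hat_surjective s (i + 1 + 1) f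
    rw [hhat] at hf
    obtain ⟨b, h, hbh⟩ := hgen F hf
    refine ⟨b, hat N R s (i + 1) h, ?_⟩
    rw [rmul_comp_hat_actR, hat_comp_bimodD, ← hat_add]
    refine hat_eq_of_sub_mem_zero hR s ?_
    rw [← sub_sub]
    exact hbh
  · obtain ⟨h, rfl⟩ := hat_surjective s (i + 1) g
    rw [rmul_comp_hat_actR, hat_comp_bimodD] at hbg
    exact hinj b h (sub_mem_zero_of_hat_eq hR s hbg)
  · rintro _ ⟨v, rfl⟩
    obtain ⟨h, hh⟩ := hcent v
    refine ⟨hat N R s (i + 1) h, ?_⟩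
    rw [Function.comp_apply, rmul_comp_hat_actR, rmul_comp_hat_actL, hat_comp_bimodD, ← hat_sub]
    rw [← hq'] at hh
    exact hat_eq_of_sub_mem_zero hR s hh

end Main
end
end NKoszulCY

namespace NKoszulCY
noncomputable section

/-! ### Koszul complexes of commuting operators -/

section KoszulComplex

/-- The subsets with `i` elements of a set with `n` elements. -/
def KIdx : ℕ → ℕ → Type
  | 0, 0 => Unit
  | 0, _ + 1 => Empty
  | n + 1, 0 => KIdx n 0
  | n + 1, i + 1 => KIdx n (i + 1) ⊕ KIdx n i

namespace KIdx

instance instFintype : (n i : ℕ) → Fintype (KIdx n i)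
  | 0, 0 => inferInstanceAs (Fintype Unit)
  | 0, _ + 1 => inferInstanceAs (Fintype Empty)
  | n + 1, 0 => instFintype n 0
  | n + 1, i + 1 => @instFintypeSum _ _ (instFintype n (i + 1)) (instFintype n i)

theorem isEmpty : ∀ {n i : ℕ}, n < i → IsEmpty (KIdx n i)
  | 0, 0, h => absurd h (lt_irrefl 0)
  | 0, _ + 1, _ => inferInstanceAs (IsEmpty Empty)
  | n + 1, 0, h => absurd h (Nat.not_lt_zero _)
  | n + 1, i + 1, h => by
    have := isEmpty (show n < i + 1 by omega)
    have := isEmpty (show n < i by omega)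
    exact inferInstanceAs (IsEmpty (KIdx n (i + 1) ⊕ KIdx n i))

/-- The empty subset. -/
def bot : (n : ℕ) → KIdx n 0
  | 0 => ()
  | n + 1 => bot n

theorem eq_bot : ∀ {n : ℕ} (a : KIdx n 0), a = bot n
  | 0, _ => rfl
  | n + 1, a => eq_bot (n := n) a

/-- The full subset. -/
def top : (n : ℕ) → KIdx n n
  | 0 => ()
  | n + 1 => Sum.inr (top n)

theorem eq_top : ∀ {n : ℕ} (a : KIdx n n), a = top n
  | 0, _ => rfl
  | n + 1, Sum.inl a => (isEmpty (Nat.lt_succ_self n)).elim a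
  | _ + 1, Sum.inr a => congrArg Sum.inr (eq_top a)

end KIdx

variable {Y : Type*} [AddCommGroup Y] {k : Type*} [Ring k] [Module k Y]

/-- The homological Koszul differential of a sequence of operators. -/
def kD (T : ℕ → Module.End k Y) : (n i : ℕ) → (KIdx n (i + 1) → Y) → KIdx n i → Y
  | 0, _, _ => fun _ => 0
  | n + 1, 0, f => fun a => kD T n 0 (fun b => f (Sum.inl b)) a + T n (f (Sum.inr a))
  | n + 1, i + 1, f => Sum.elim (fun a => kD T n (i + 1) (fun b => f (Sum.inl b)) a + T n (f (Sum.inr a)))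
      (fun a => - kD T n i (fun b => f (Sum.inr b)) a)

/-- The cohomological Koszul differential of a sequence of operators. -/
def kDs (T : ℕ → Module.End k Y) : (n i : ℕ) → (KIdx n i → Y) → KIdx n (i + 1) → Y
  | 0, _, _ => fun _ => 0
  | n + 1, 0, g => Sum.elim (kDs T n 0 g) (fun a => T n (g a))
  | n + 1, i + 1, g => Sum.elim (kDs T n (i + 1) (fun b => g (Sum.inl b)))
      (fun a => T n (g (Sum.inl a)) - kDs T n i (fun b => g (Sum.inr b)) a)

variable (T : ℕ → Module.End k Y)

/-- The sum of the images of the first `n` operators. -/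
def imgSum : ℕ → Submodule k Y
  | 0 => ⊥
  | n + 1 => imgSum n ⊔ LinearMap.range (T n)

variable {T}

theorem apply_mem_imgSum {n j : ℕ} (hj : j < n) (y : Y) : T j y ∈ imgSum T n := by
  induction n with
  | zero => omega
  | succ n ih =>
    rcases Nat.lt_succ_iff_lt_or_eq.1 hj with h | rfl
    · exact Submodule.mem_sup_left (ih h)
    · exact Submodule.mem_sup_right ⟨y, rfl⟩

theorem imgSum_le {n : ℕ} {S : Submodule k Y} (h : ∀ j < n, ∀ y, T j y ∈ S) : imgSum T n ≤ S := by
  induction n with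
  | zero => exact bot_le
  | succ n ih =>
    refine sup_le (ih fun j hj => h j (by omega)) ?_
    rintro _ ⟨y, rfl⟩
    exact h n (by omega) y

variable (T) in
/-- Regularity of a sequence of operators. -/
def RegularOps (n : ℕ) : Prop := ∀ j < n, ∀ y, T j y ∈ imgSum T j → y ∈ imgSum T j

theorem kD_add (n i : ℕ) (f g : KIdx n (i + 1) → Y) :
    kD T n i (f + g) = kD T n i f + kD T n i g := by
  induction n generalizing i with
  | zero => funext a; exact (add_zero (0 : Y)).symm
  | succ n ih =>
    cases i with
    | zero =>
      funext a
      exact (congrArg₂ (· + ·) (congrFun (ih 0 (fun b => f (Sum.inl b)) fun b => g (Sum.inl b)) a)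
        (map_add (T n) _ _)).trans (add_add_add_comm _ _ _ _)
    | succ i =>
      funext a
      rcases a with a | a
      · exact (congrArg₂ (· + ·)
          (congrFun (ih (i + 1) (fun b => f (Sum.inl b)) fun b => g (Sum.inl b)) a)
          (map_add (T n) _ _)).trans (add_add_add_comm _ _ _ _)
      · exact (congrArg (- ·) (congrFun (ih i (fun b => f (Sum.inr b)) fun b => g (Sum.inr b)) a)).trans
          (neg_add _ _)

theorem kDs_add (n i : ℕ) (f g : KIdx n i → Y) :
    kDs T n i (f + g) = kDs T n i f + kDs T n i g := by
  induction n generalizing i with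
  | zero => funext a; exact (add_zero (0 : Y)).symm
  | succ n ih =>
    cases i with
    | zero =>
      funext a
      rcases a with a | a
      · exact congrFun (ih 0 f g) a
      · exact map_add (T n) _ _
    | succ i =>
      funext a
      rcases a with a | a
      · exact congrFun (ih (i + 1) (fun b => f (Sum.inl b)) (fun b => g (Sum.inl b))) a
      · exact (congrArg₂ (· - ·) (map_add (T n) _ _)
          (congrFun (ih i (fun b => f (Sum.inr b)) fun b => g (Sum.inr b)) a)).trans
          (add_sub_add_comm _ _ _ _)

/-- An operator that commutes with the given ones commutes with the differential. -/
theorem kD_comm {A : Y →+ Y} (n i : ℕ) (hA : ∀ j < n, ∀ y, A (T j y) = T j (A y))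
    (f : KIdx n (i + 1) → Y) (a : KIdx n i) :
    kD T n i (fun b => A (f b)) a = A (kD T n i f a) := by
  induction n generalizing i with
  | zero => exact (map_zero A).symm
  | succ n ih =>
    have ih' := fun i => ih i fun j hj => hA j (by omega)
    cases i with
    | zero =>
      change kD T n 0 (fun b => A (f (Sum.inl b))) a + T n (A (f (Sum.inr a))) = A (_ + _)
      rw [map_add, hA n (by omega)]
      exact congrArg (· + _) (ih' 0 (fun b => f (Sum.inl b)) a)
    | succ i =>
      rcases a with a | a
      · change kD T n (i + 1) (fun b => A (f (Sum.inl b))) a + T n (A (f (Sum.inr a))) =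
          A (_ + _)
        rw [map_add, hA n (by omega)]
        exact congrArg (· + _) (ih' (i + 1) (fun b => f (Sum.inl b)) a)
      · change - kD T n i (fun b => A (f (Sum.inr b))) a = A (- _)
        rw [map_neg]
        exact congrArg _ (ih' i (fun b => f (Sum.inr b)) a)

theorem kDs_comm {A : Y →+ Y} (n i : ℕ) (hA : ∀ j < n, ∀ y, A (T j y) = T j (A y))
    (f : KIdx n i → Y) (a : KIdx n (i + 1)) :
    kDs T n i (fun b => A (f b)) a = A (kDs T n i f a) := by
  induction n generalizing i with
  | zero => exact (map_zero A).symm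
  | succ n ih =>
    have ih' := fun i => ih i fun j hj => hA j (by omega)
    cases i with
    | zero =>
      rcases a with a | a
      · exact ih' 0 f a
      · exact (hA n (by omega) _).symm
    | succ i =>
      rcases a with a | a
      · exact ih' (i + 1) (fun b => f (Sum.inl b)) a
      · change T n (A (f (Sum.inl a))) - kDs T n i (fun b => A (f (Sum.inr b))) a =
          A (_ - _)
        rw [map_sub, hA n (by omega)]
        exact congrArg (_ - ·) (ih' i (fun b => f (Sum.inr b)) a)

theorem kD_smul (n i : ℕ) (r : k) (f : KIdx n (i + 1) → Y) : kD T n i (r • f) = r • kD T n i f :=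
  funext fun a => kD_comm (A := DistribSMul.toAddMonoidHom Y r) n i
    (fun j _ y => (map_smul (T j) r y).symm) f a

theorem kDs_smul (n i : ℕ) (r : k) (f : KIdx n i → Y) : kDs T n i (r • f) = r • kDs T n i f :=
  funext fun a => kDs_comm (A := DistribSMul.toAddMonoidHom Y r) n i
    (fun j _ y => (map_smul (T j) r y).symm) f a

variable (T) in
/-- The homological Koszul differential as a linear map. -/
def kDL (n i : ℕ) : (KIdx n (i + 1) → Y) →ₗ[k] (KIdx n i → Y) where
  toFun := kD T n i
  map_add' := kD_add n i
  map_smul' := kD_smul n i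

variable (T) in
/-- The cohomological Koszul differential as a linear map. -/
def kDsL (n i : ℕ) : (KIdx n i → Y) →ₗ[k] (KIdx n (i + 1) → Y) where
  toFun := kDs T n i
  map_add' := kDs_add n i
  map_smul' := kDs_smul n i

variable (hT : ∀ i j y, T i (T j y) = T j (T i y))

include hT

theorem kDL_comm (n m i : ℕ) (f : KIdx n (i + 1) → Y) :
    kDL T n i (fun b => T m (f b)) = fun a => T m (kDL T n i f a) :=
  funext fun a => kD_comm (A := (T m).toAddMonoidHom) n i (fun j _ y => hT m j y) f a

theorem kDsL_comm (n m i : ℕ) (f : KIdx n i → Y) :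
    kDsL T n i (fun b => T m (f b)) = fun a => T m (kDsL T n i f a) :=
  funext fun a => kDs_comm (A := (T m).toAddMonoidHom) n i (fun j _ y => hT m j y) f a

/-- Splitting off the last operator exhibits the complex as a mapping cone of `T n`; the mixed terms
cancel because `T n` commutes with the smaller differential. -/
theorem kDL_kDL (n i : ℕ) (f : KIdx n (i + 2) → Y) : kDL T n i (kDL T n (i + 1) f) = 0 := by
  induction n generalizing i with
  | zero => rfl
  | succ n ih =>
    have h1 : ∀ i (f₁ : KIdx n (i + 2) → Y) (f₂ : KIdx n (i + 1) → Y) (a : KIdx n i),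
        kDL T n i (fun b => kDL T n (i + 1) f₁ b + T n (f₂ b)) a + T n (- kDL T n i f₂ a) = 0 := by
      intro i f₁ f₂ a
      have h2 := map_add (kDL T n i) (kDL T n (i + 1) f₁) (fun b => T n (f₂ b))
      rw [ih, kDL_comm hT, zero_add] at h2
      rw [map_neg, ← sub_eq_add_neg, sub_eq_zero]
      exact congrFun h2 a
    cases i with
    | zero => exact funext fun a => h1 0 (fun b => f (Sum.inl b)) (fun b => f (Sum.inr b)) a
    | succ i =>
      funext a
      rcases a with a | a
      · exact h1 (i + 1) (fun b => f (Sum.inl b)) (fun b => f (Sum.inr b)) a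
      · change - kDL T n i (- kDL T n (i + 1) (fun b => f (Sum.inr b))) a = 0
        rw [map_neg, ih]
        simp

omit hT in
/-- The image of the homological differential in degree `0`. -/
theorem exists_kDL_zero_iff (n : ℕ) (g : KIdx n 0 → Y) :
    (∃ f, kDL T n 0 f = g) ↔ g (KIdx.bot n) ∈ imgSum T n := by
  induction n with
  | zero =>
    refine ⟨?_, fun h => ⟨0, funext fun a => ?_⟩⟩
    · rintro ⟨f, rfl⟩
      exact Submodule.zero_mem _
    · rw [KIdx.eq_bot a, (Submodule.mem_bot k).1 h]
      rfl
  | succ n ih =>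
    constructor
    · rintro ⟨f, rfl⟩
      exact Submodule.add_mem_sup ((ih _).1 ⟨fun b => f (Sum.inl b), rfl⟩) ⟨_, rfl⟩
    · intro h
      obtain ⟨y, hy, _, ⟨z, rfl⟩, hyz⟩ := Submodule.mem_sup.1 h
      obtain ⟨f, hf⟩ := (ih fun _ => y).2 hy
      refine ⟨Sum.elim f fun _ => z, funext fun a => ?_⟩
      rw [KIdx.eq_bot a, ← hyz]
      exact congrArg (· + _) (congrFun hf (KIdx.bot n))

/-- Induction along the cone. The second component of a cycle is a boundary: by induction in
positive degree, and in degree `0` because `T n` is injective modulo the earlier images. Then the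
first component can be corrected to a cycle. -/
theorem exists_kDL_eq {n : ℕ} (hreg : RegularOps T n) (i : ℕ) {f : KIdx n (i + 1) → Y}
    (hf : kDL T n i f = 0) : ∃ g, kDL T n (i + 1) g = f := by
  induction n generalizing i with
  | zero => exact ⟨0, funext fun a => ((KIdx.isEmpty (Nat.succ_pos i)).false a).elim⟩
  | succ n ih =>
    have ih' := fun i f => ih (fun j hj => hreg j (by omega)) i (f := f)
    have h2 : ∃ h₂, kDL T n i h₂ = fun b => - f (Sum.inr b) := by
      cases i with
      | zero =>
        rw [exists_kDL_zero_iff]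
        refine Submodule.neg_mem _ (hreg n (by omega) _ ?_)
        have h3 := congrFun hf (KIdx.bot n)
        change kDL T n 0 (fun b => f (Sum.inl b)) (KIdx.bot n) + T n (f (Sum.inr (KIdx.bot n))) = 0
          at h3
        rw [eq_neg_of_add_eq_zero_right h3]
        exact Submodule.neg_mem _ ((exists_kDL_zero_iff n _).1 ⟨_, rfl⟩)
      | succ i =>
        refine ih' i _ (funext fun a => ?_)
        have h3 := congrFun hf (Sum.inr a)
        have h4 := map_neg (kDL T n i) (fun b => f (Sum.inr b))
        exact (congrFun h4 a).trans h3
    obtain ⟨h₂, hh₂⟩ := h2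
    obtain ⟨h₁, hh₁⟩ := ih' i (fun b => f (Sum.inl b) - T n (h₂ b)) (by
      have h3 := map_sub (kDL T n i) (fun b => f (Sum.inl b)) (fun b => T n (h₂ b))
      rw [kDL_comm hT, hh₂] at h3
      refine h3.trans (funext fun a => ?_)
      rw [Pi.sub_apply, map_neg, sub_neg_eq_add]
      cases i with
      | zero => exact congrFun hf a
      | succ i => exact congrFun hf (Sum.inl a))
    refine ⟨Sum.elim h₁ h₂, funext fun a => ?_⟩
    rcases a with a | a
    · change kDL T n (i + 1) h₁ a + T n (h₂ a) = _
      rw [hh₁, sub_add_cancel]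
    · change - kDL T n i h₂ a = _
      rw [hh₂, neg_neg]

/-- The image of the cohomological differential into degree `i`. -/
def prevRange (T : ℕ → Module.End k Y) (n : ℕ) : (i : ℕ) → Submodule k (KIdx n i → Y)
  | 0 => ⊥
  | i + 1 => LinearMap.range (kDsL T n i)

omit hT in
theorem mem_prevRange_succ (n i : ℕ) (g : KIdx (n + 1) (i + 1) → Y) :
    g ∈ prevRange T (n + 1) (i + 1) ↔ ∃ h : KIdx n i → Y,
      kDsL T n i h = (fun b => g (Sum.inl b)) ∧
        (fun b => T n (h b) - g (Sum.inr b)) ∈ prevRange T n i := by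
  cases i with
  | zero =>
    constructor
    · rintro ⟨h, rfl⟩
      exact ⟨h, rfl, funext fun b => sub_self _⟩
    · rintro ⟨h, h1, h2⟩
      refine ⟨h, funext fun a => ?_⟩
      rcases a with a | a
      · exact congrFun h1 a
      · exact sub_eq_zero.1 (congrFun h2 a)
  | succ i =>
    constructor
    · rintro ⟨h, rfl⟩
      exact ⟨fun b => h (Sum.inl b), rfl, fun b => h (Sum.inr b),
        funext fun b => (sub_sub_cancel _ _).symm⟩
    · rintro ⟨h, h1, h₂, h2⟩
      refine ⟨Sum.elim h h₂, funext fun a => ?_⟩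
      rcases a with a | a
      · exact congrFun h1 a
      · exact (congrArg (T n (h a) - ·) (congrFun h2 a)).trans (sub_sub_cancel _ _)

omit hT in
theorem kDsL_mem_prevRange (n i : ℕ) (g : KIdx n i → Y) : kDsL T n i g ∈ prevRange T n (i + 1) :=
  ⟨g, rfl⟩

omit hT in
/-- The image of the cohomological differential in the top degree. -/
theorem mem_prevRange_self (n : ℕ) (g : KIdx n n → Y) :
    g ∈ prevRange T n n ↔ g (KIdx.top n) ∈ imgSum T n := by
  induction n with
  | zero => exact ⟨fun h => congrFun h (), fun h => funext fun _ => h⟩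
  | succ n ih =>
    rw [mem_prevRange_succ, imgSum, Submodule.mem_sup]
    constructor
    · rintro ⟨h, -, h2⟩
      exact ⟨_, Submodule.neg_mem _ ((ih _).1 h2), _, ⟨h (KIdx.top n), rfl⟩,
        by rw [neg_sub, sub_add_cancel]; rfl⟩
    · rintro ⟨y, hy, _, ⟨z, rfl⟩, hyz⟩
      refine ⟨fun _ => z, funext fun a => ((KIdx.isEmpty (Nat.lt_succ_self n)).false a).elim,
        (ih _).2 ?_⟩
      change T n z - g (KIdx.top (n + 1)) ∈ _
      rw [← hyz, sub_add_cancel_right]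
      exact Submodule.neg_mem _ hy

theorem mem_prevRange_of_kDsL_eq_zero {n : ℕ} (hreg : RegularOps T n) {i : ℕ} (hi : i < n)
    {g : KIdx n i → Y} (hg : kDsL T n i g = 0) : g ∈ prevRange T n i := by
  induction n generalizing i with
  | zero => omega
  | succ n ih =>
    -- Below degree `n` the smaller complex has no cohomology. In degree `n` its cohomology is the
    -- quotient by the earlier images, on which `T n` is injective.
    have key : ∀ i ≤ n, ∀ g : KIdx n i → Y, kDsL T n i g = 0 →
        (fun a => T n (g a)) ∈ prevRange T n i → g ∈ prevRange T n i := by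
      intro i hi g hg hTg
      rcases hi.lt_or_eq with h | rfl
      · exact ih (fun j hj => hreg j (by omega)) h hg
      · rw [mem_prevRange_self] at hTg ⊢
        exact hreg i (by omega) _ hTg
    cases i with
    | zero =>
      refine key 0 (Nat.zero_le n) g (funext fun a => congrFun hg (Sum.inl a)) ?_
      exact funext fun a => congrFun hg (Sum.inr a)
    | succ i =>
      have h1 : kDsL T n (i + 1) (fun b => g (Sum.inl b)) = 0 :=
        funext fun a => congrFun hg (Sum.inl a)
      have h2 : kDsL T n i (fun b => g (Sum.inr b)) = fun b => T n (g (Sum.inl b)) :=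
        funext fun a => (sub_eq_zero.1 (congrFun hg (Sum.inr a))).symm
      obtain ⟨h, hh⟩ := key (i + 1) (by omega) _ h1 (h2 ▸ kDsL_mem_prevRange n i _)
      rw [mem_prevRange_succ]
      refine ⟨h, hh, ih (fun j hj => hreg j (by omega)) (by omega) ?_⟩
      have h3 := map_sub (kDsL T n i) (fun b => T n (h b)) (fun b => g (Sum.inr b))
      rw [kDsL_comm hT, h2, hh] at h3
      exact h3.trans (sub_self _)

end KoszulComplex
end
end NKoszulCY

namespace NKoszulCY
noncomputable section

/-! ### Duality between the two Koszul differentials -/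

section Pairing

variable {E : Type v} [Ring E]

/-- The linear form on a free module given by a family of coefficients. -/
def pair {α : Type} [Fintype α] (g : α → E) : (α → E) →ₗ[E] E :=
  ∑ a, rmul (g a) ∘ₗ LinearMap.proj a

theorem pair_apply {α : Type} [Fintype α] (g p : α → E) : pair g p = ∑ a, p a * g a := by
  simp [pair]

theorem pair_single {α : Type} [Fintype α] [DecidableEq α] (g : α → E) (a : α) :
    pair g (Pi.single a 1) = g a := by
  rw [pair_apply, Finset.sum_eq_single a]
  · rw [Pi.single_eq_same, one_mul]
  · intro b _ hb
    rw [Pi.single_eq_of_ne hb, zero_mul]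
  · intro h
    exact absurd (Finset.mem_univ a) h

theorem pair_top {n : ℕ} (z : E) :
    pair (fun _ : KIdx n n => z) = rmul z ∘ₗ LinearMap.proj (KIdx.top n) := by
  refine LinearMap.ext fun p => ?_
  rw [pair_apply, Finset.sum_eq_single (KIdx.top n) (fun a _ ha => absurd (KIdx.eq_top a) ha)
    (fun h => absurd (Finset.mem_univ _) h)]
  rfl

theorem pair_injective {α : Type} [Fintype α] {g g' : α → E} (h : pair g = pair g') : g = g' := by
  classical
  funext a
  rw [← pair_single g a, h, pair_single]

theorem pair_surjective {α : Type} [Fintype α] (f : (α → E) →ₗ[E] E) : ∃ g, pair g = f := by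
  classical
  refine ⟨fun a => f (Pi.single a 1), LinearMap.pi_ext' fun a => LinearMap.ext_ring ?_⟩
  exact pair_single _ a

variable {k : Type u} [CommRing k] [Algebra k E] (X : ℕ → E)

/-- By `(p X) g = p (X g)`, right multiplication on coordinates becomes left multiplication on
coefficients; the signs of `kD` and `kDs` are chosen to match. -/
theorem pair_comp_kDL (n i : ℕ) (g : KIdx n i → E) :
    pair g ∘ₗ kDL (fun j => rmul (X j)) n i = pair (kDsL (fun j => LinearMap.mulLeft k (X j)) n i g) := by
  refine LinearMap.ext fun p => ?_
  rw [LinearMap.comp_apply, pair_apply, pair_apply]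
  induction n generalizing i with
  | zero =>
    have := KIdx.isEmpty (Nat.succ_pos i)
    refine (Finset.sum_eq_zero fun a _ => zero_mul (g a)).trans ?_
    rw [Fintype.sum_empty]
  | succ n ih =>
    cases i with
    | zero =>
      refine Eq.trans ?_ (Fintype.sum_sum_type (α₁ := KIdx n 1) (α₂ := KIdx n 0) _).symm
      refine Eq.trans ?_ (congrArg (· + _) (ih 0 g fun b => p (Sum.inl b)))
      rw [← Finset.sum_add_distrib]
      refine Finset.sum_congr rfl fun a _ => ?_
      exact (add_mul _ _ _).trans (congrArg (_ + ·) (mul_assoc _ _ _))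
    | succ i =>
      refine Eq.trans (Fintype.sum_sum_type (α₁ := KIdx n (i + 1)) (α₂ := KIdx n i) _)
        (Eq.trans ?_ (Fintype.sum_sum_type (α₁ := KIdx n (i + 2)) (α₂ := KIdx n (i + 1)) _).symm)
      have h1 := ih (i + 1) (fun b => g (Sum.inl b)) fun b => p (Sum.inl b)
      have h2 := ih i (fun b => g (Sum.inr b)) fun b => p (Sum.inr b)
      have h3 : ∀ a : KIdx n (i + 1),
          kDL (fun j => rmul (X j)) (n + 1) (i + 1) p (Sum.inl a) * g (Sum.inl a) =
          kDL (fun j => rmul (X j)) n (i + 1) (fun b => p (Sum.inl b)) a * g (Sum.inl a) +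
            p (Sum.inr a) * (X n * g (Sum.inl a)) := fun a =>
        (add_mul _ _ _).trans (congrArg (_ + ·) (mul_assoc _ _ _))
      have h4 : ∀ a : KIdx n i,
          kDL (fun j => rmul (X j)) (n + 1) (i + 1) p (Sum.inr a) * g (Sum.inr a) =
          - (kDL (fun j => rmul (X j)) n i (fun b => p (Sum.inr b)) a * g (Sum.inr a)) := fun a =>
        neg_mul _ _
      have h5 : ∀ a : KIdx n (i + 1),
          p (Sum.inr a) * kDsL (fun j => LinearMap.mulLeft k (X j)) (n + 1) (i + 1) g (Sum.inr a) =
          p (Sum.inr a) * (X n * g (Sum.inl a)) - p (Sum.inr a) *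
            kDsL (fun j => LinearMap.mulLeft k (X j)) n i (fun b => g (Sum.inr b)) a := fun a =>
        mul_sub _ _ _
      simp only [h3, h4, h5, Finset.sum_add_distrib, Finset.sum_sub_distrib, Finset.sum_neg_distrib,
        h1, h2]
      rw [add_assoc, ← sub_eq_add_neg]
      rfl

theorem mem_imgSum_iff {k : Type*} [Ring k] {Y : Type*} [AddCommGroup Y] [Module k Y]
    {T : ℕ → Module.End k Y} {n : ℕ} {y : Y} :
    y ∈ imgSum T n ↔ ∃ w : ℕ → Y, y = ∑ j ∈ Finset.range n, T j (w j) := by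
  constructor
  · intro hy
    induction n generalizing y with
    | zero => exact ⟨0, by rw [Finset.range_zero, Finset.sum_empty]; exact hy⟩
    | succ n ih =>
      obtain ⟨y', hy', _, ⟨z, rfl⟩, rfl⟩ := Submodule.mem_sup.1 hy
      obtain ⟨w, rfl⟩ := ih hy'
      refine ⟨Function.update w n z, ?_⟩
      rw [Finset.sum_range_succ, Function.update_self]
      refine congrArg (· + _) (Finset.sum_congr rfl fun j hj => ?_)
      rw [Function.update_of_ne (Finset.mem_range.1 hj).ne]
  · rintro ⟨w, rfl⟩
    exact Submodule.sum_mem _ fun j hj => apply_mem_imgSum (Finset.mem_range.1 hj) _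

end Pairing

/-! ### The anti-automorphism of the enveloping algebra -/

section Swap

variable {k : Type u} [Field k] {B : Type v} [Ring B] [Algebra k B]

variable (k B) in
/-- The anti-automorphism `x ⊗ y ↦ y ⊗ x` of the enveloping algebra. -/
def envSwap : Env k B ≃ₗ[k] Env k B :=
  TensorProduct.comm k B Bᵐᵒᵖ ≪≫ₗ
    TensorProduct.congr (MulOpposite.opLinearEquiv k).symm (MulOpposite.opLinearEquiv k)

@[simp]
theorem envSwap_tmul (x y : B) :
    envSwap k B (x ⊗ₜ MulOpposite.op y) = y ⊗ₜ MulOpposite.op x := rfl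

theorem envSwap_envSwap (z : Env k B) : envSwap k B (envSwap k B z) = z := by
  induction z using TensorProduct.induction_on with
  | zero => rw [map_zero, map_zero]
  | tmul x y => rfl
  | add x y hx hy => rw [map_add, map_add, hx, hy]

theorem envSwap_mul (z w : Env k B) : envSwap k B (z * w) = envSwap k B w * envSwap k B z := by
  induction z using TensorProduct.induction_on with
  | zero => rw [zero_mul, map_zero, mul_zero]
  | add x y hx hy => rw [add_mul, map_add, map_add, hx, hy, mul_add]
  | tmul x y =>
    induction w using TensorProduct.induction_on with
    | zero => rw [mul_zero, map_zero, zero_mul]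
    | add a b ha hb => rw [mul_add, map_add, map_add, ha, hb, add_mul]
    | tmul a b =>
      induction y using MulOpposite.rec'
      induction b using MulOpposite.rec'
      rw [Algebra.TensorProduct.tmul_mul_tmul, ← MulOpposite.op_mul, envSwap_tmul, envSwap_tmul,
        envSwap_tmul, Algebra.TensorProduct.tmul_mul_tmul, ← MulOpposite.op_mul]

/-- The difference `x ⊗ 1 - 1 ⊗ x`. -/
def envDiff (x : B) : Env k B := x ⊗ₜ[k] 1 - 1 ⊗ₜ[k] MulOpposite.op x

theorem envSwap_envDiff (x : B) : envSwap k B (envDiff x) = (-1 : k) • envDiff x := by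
  rw [envDiff, map_sub, ← MulOpposite.op_one, envSwap_tmul, envSwap_tmul, MulOpposite.op_one]
  have key : ∀ {M : Type v} [AddCommGroup M] [Module k M] (a b : M), b - a = (-1 : k) • (a - b) :=
    fun a b => by rw [neg_one_smul, neg_sub]
  exact key _ _

theorem envMul_envDiff (x : B) : envMul k B (envDiff x) = 0 := by
  rw [envDiff, map_sub, ← MulOpposite.op_one, envMul_tmul, envMul_tmul, mul_one, one_mul]
  exact sub_self (x : B)

/-- The swap reverses products and changes the differences only by a sign, so it exchanges the left
and the right ideal they generate. -/
theorem envSwap_mem_imgSum {x : ℕ → B} {n : ℕ} {z : Env k B} :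
    envSwap k B z ∈ imgSum (fun j => rmul (envDiff (k := k) (x j))) n ↔
      z ∈ imgSum (fun j => LinearMap.mulLeft k (envDiff (k := k) (x j))) n := by
  rw [mem_imgSum_iff, mem_imgSum_iff]
  constructor
  · rintro ⟨w, hw⟩
    refine ⟨fun j => (-1 : k) • envSwap k B (w j), ?_⟩
    rw [← envSwap_envSwap z, hw, map_sum]
    exact Finset.sum_congr rfl fun j _ => by
      rw [rmul_apply, envSwap_mul, envSwap_envDiff, LinearMap.mulLeft_apply, smul_mul_assoc,
        mul_smul_comm]
  · rintro ⟨w, rfl⟩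
    refine ⟨fun j => (-1 : k) • envSwap k B (w j), ?_⟩
    rw [map_sum]
    exact Finset.sum_congr rfl fun j _ => by
      rw [rmul_apply, LinearMap.mulLeft_apply, envSwap_mul, envSwap_envDiff, mul_smul_comm,
        smul_mul_assoc]

theorem regularOps_mulLeft {x : ℕ → B} {n : ℕ}
    (h : RegularOps (fun j => rmul (envDiff (k := k) (x j))) n) :
    RegularOps (fun j => LinearMap.mulLeft k (envDiff (k := k) (x j))) n := by
  intro j hj z hz
  rw [← envSwap_mem_imgSum] at hz ⊢
  refine h j hj _ ?_
  rw [LinearMap.mulLeft_apply, envSwap_mul, envSwap_envDiff, mul_smul_comm] at hz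
  have := Submodule.smul_of_tower_mem _ (-1 : k) hz
  rwa [smul_smul, neg_one_mul, neg_neg, one_smul] at this

end Swap

/-! ### Calabi–Yau algebras from regular sequences of differences -/

section Criterion

variable {k : Type u} [Field k] {B : Type v} [Ring B] [Algebra k B]

/-- An algebra is Calabi–Yau if the differences `x ⊗ 1 - 1 ⊗ x` of generators `x` form a regular
sequence of commuting elements of the enveloping algebra. -/
theorem isCalabiYau_of_regularOps {n : ℕ} (hn : 1 ≤ n) (x : ℕ → B)
    (hx : Algebra.adjoin k (x '' Set.Iio n) = ⊤)
    (hcomm : ∀ i j, envDiff (k := k) (x i) * envDiff (x j) = envDiff (x j) * envDiff (x i))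
    (hreg : RegularOps (fun j => rmul (envDiff (k := k) (x j))) n) : IsCalabiYau k B n := by
  obtain ⟨e, rfl⟩ : ∃ e, n = e + 1 := ⟨n - 1, by omega⟩
  have hT : ∀ i j (y : Env k B), rmul (envDiff (k := k) (x i)) (rmul (envDiff (k := k) (x j)) y) =
      rmul (envDiff (k := k) (x j)) (rmul (envDiff (x i)) y) := fun i j y => by
    simp only [rmul_apply, mul_assoc, hcomm i j]
  have hT' : ∀ i j (y : Env k B), LinearMap.mulLeft k (envDiff (x i))
      (LinearMap.mulLeft k (envDiff (x j)) y) = LinearMap.mulLeft k (envDiff (x j))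
        (LinearMap.mulLeft k (envDiff (x i)) y) := fun i j y => by
    simp only [LinearMap.mulLeft_apply, ← mul_assoc, hcomm i j]
  have hreg' := regularOps_mulLeft hreg
  have hker : ∀ z : Env k B,
      envMul k B z = 0 ↔ z ∈ imgSum (fun j => rmul (envDiff (k := k) (x j))) (e + 1) := by
    refine fun z => ⟨mem_of_envMul_eq_zero hx _ ?_, fun hz => ?_⟩
    · rintro _ ⟨j, hj, rfl⟩
      have := apply_mem_imgSum (T := fun j => rmul (envDiff (k := k) (x j))) (Set.mem_Iio.1 hj) 1
      rwa [rmul_apply, one_mul] at this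
    · refine (imgSum_le (S := LinearMap.ker (envMul k B)) fun j _ y => ?_) hz
      rw [LinearMap.mem_ker, rmul_apply, ← smul_eq_mul, map_smul, envMul_envDiff, smul_zero]
  have hcoh : ∀ i (g : KIdx (e + 1) i → Env k B), pair g ∘ₗ kDL (fun j => rmul (envDiff (k := k) (x j)))
      (e + 1) i = 0 ↔ kDsL (fun j => LinearMap.mulLeft k (envDiff (x j))) (e + 1) i g = 0 := by
    intro i g
    rw [pair_comp_kDL (k := k)]
    refine ⟨fun h => pair_injective (h.trans ?_), fun h => ?_⟩
    · exact LinearMap.ext fun p => by rw [pair_apply]; simp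
    · rw [h]
      exact LinearMap.ext fun p => by rw [pair_apply]; simp
  have hempty : ∀ i, e + 1 < i → Subsingleton (KIdx (e + 1) i → Env k B) := fun i hi => by
    have := KIdx.isEmpty hi
    infer_instance
  -- The top coboundaries form the right ideal generated by the differences.
  have htop : ∀ z : Env k B, z ∈ imgSum (fun j => LinearMap.mulLeft k (envDiff (k := k) (x j))) (e + 1) →
      ∃ g : (KIdx (e + 1) e → Env k B) →ₗ[Env k B] Env k B,
        rmul z ∘ₗ LinearMap.proj (KIdx.top (e + 1)) = g ∘ₗ
          kDL (fun j => rmul (envDiff (k := k) (x j))) (e + 1) e := by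
    intro z hz
    obtain ⟨h, hh⟩ := (mem_prevRange_self (e + 1) fun _ => z).2 hz
    refine ⟨pair h, ?_⟩
    rw [pair_comp_kDL (k := k), hh, pair_top]
  refine isCalabiYau_of_resolution (P := fun i => KIdx (e + 1) i → Env k B)
    (fun i => kDL (fun j => rmul (envDiff (k := k) (x j))) (e + 1) i)
    (envMul k B ∘ₗ LinearMap.proj (KIdx.bot (e + 1))) (fun i => inferInstance) (fun b => ?_)
    (fun p => ?_) (fun i f => ?_) (fun i => inferInstance) (e + 1) hempty e (fun f hf => ?_)
    (fun i hi f hf => ?_) (LinearMap.proj (KIdx.top (e + 1))) ?_ (fun f hf => ?_)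
    (fun b g hg => ?_) _ hx ?_
  · obtain ⟨z, hz⟩ := envMul_surjective b
    exact ⟨fun _ => z, hz⟩
  · rw [LinearMap.comp_apply, LinearMap.proj_apply, hker, ← exists_kDL_zero_iff]
    rfl
  · refine ⟨exists_kDL_eq hT hreg i, ?_⟩
    rintro ⟨g, rfl⟩
    exact kDL_kDL hT (e + 1) i g
  · obtain ⟨g, rfl⟩ := pair_surjective f
    rw [hcoh] at hf
    have h1 : g = 0 := mem_prevRange_of_kDsL_eq_zero hT' hreg' (Nat.succ_pos e) hf
    rw [h1]
    exact LinearMap.ext fun p => by rw [pair_apply]; simp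
  · rcases lt_or_ge (e + 1) (i + 1) with h | h
    · have := hempty (i + 1) h
      exact ⟨0, LinearMap.ext fun p => by
        rw [Subsingleton.elim p 0, map_zero, map_zero]⟩
    · obtain ⟨g, rfl⟩ := pair_surjective f
      rw [hcoh] at hf
      obtain ⟨g', rfl⟩ := mem_prevRange_of_kDsL_eq_zero hT' hreg' (by omega) hf
      exact ⟨pair g', pair_comp_kDL _ _ _ _⟩
  · have := hempty (e + 1 + 1) (by omega)
    exact LinearMap.ext fun p => by rw [Subsingleton.elim p 0, map_zero, map_zero]
  · obtain ⟨g, rfl⟩ := pair_surjective f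
    set z := g (KIdx.top (e + 1)) with hz
    have hg : pair g = rmul z ∘ₗ LinearMap.proj (KIdx.top (e + 1)) := by
      rw [← pair_top]
      exact congrArg pair (funext fun a => by rw [KIdx.eq_top a])
    -- The swap takes the quotient of `Bᵉ` by that right ideal to the quotient by the left ideal,
    -- which is `B`. So `b` is the class of `z`.
    obtain ⟨b, hb⟩ : ∃ b : B, envMul k B (envSwap k B z) = (show selfBimodule k B from b) :=
      ⟨_, rfl⟩
    have h1 : envMul k B (envSwap k B (z - b ⊗ₜ[k] 1)) = 0 := by
      rw [map_sub, map_sub, hb, ← MulOpposite.op_one, envSwap_tmul, envMul_tmul, one_mul]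
      exact sub_self (b : B)
    rw [hker, envSwap_mem_imgSum] at h1
    obtain ⟨g', hg'⟩ := htop _ h1
    refine ⟨b, g', ?_⟩
    rw [← hg', hg, ← LinearMap.add_comp, ← rmul_add, add_sub_cancel]
  · obtain ⟨h, rfl⟩ := pair_surjective g
    rw [← pair_top, pair_comp_kDL (k := k)] at hg
    have h1 := (mem_prevRange_self (T := fun j => LinearMap.mulLeft k (envDiff (k := k) (x j)))
      (e + 1) fun _ => b ⊗ₜ[k] 1).1 ⟨h, (pair_injective hg).symm⟩
    rw [← envSwap_mem_imgSum, ← hker, ← MulOpposite.op_one, envSwap_tmul, envMul_tmul,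
      one_mul] at h1
    exact h1
  · rintro _ ⟨j, hj, rfl⟩
    -- The two multiples of the generator differ by `envDiff (x j)`, an element of the right ideal.
    obtain ⟨g, hg⟩ := htop (envDiff (x j)) (by
      have := apply_mem_imgSum (T := fun j => LinearMap.mulLeft k (envDiff (k := k) (x j)))
        (Set.mem_Iio.1 hj) 1
      rwa [LinearMap.mulLeft_apply, mul_one] at this)
    refine ⟨g, ?_⟩
    rw [← hg, envDiff, rmul_sub, LinearMap.sub_comp]

end Criterion
end
end NKoszulCY

namespace NKoszulCY
noncomputable section

/-! ### Variables act regularly on `k[X] ⊗ B` -/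

section Variables

variable (k : Type u) [Field k] (B : Type v) [AddCommGroup B] [Module k B]

/-- Multiplication by a variable on `k[X₀, X₁, …] ⊗ B`. -/
def varOp (j : ℕ) : Module.End k (MvPolynomial ℕ k ⊗[k] B) :=
  LinearMap.rTensor B (LinearMap.mulLeft k (MvPolynomial.X j))

variable {k B}

@[simp]
theorem varOp_tmul (j : ℕ) (p : MvPolynomial ℕ k) (b : B) :
    varOp k B j (p ⊗ₜ b) = (MvPolynomial.X j * p) ⊗ₜ b := rfl

theorem varOp_comm (i j : ℕ) (y : MvPolynomial ℕ k ⊗[k] B) :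
    varOp k B i (varOp k B j y) = varOp k B j (varOp k B i y) := by
  refine LinearMap.congr_fun (f := varOp k B i ∘ₗ varOp k B j) (g := varOp k B j ∘ₗ varOp k B i)
    (TensorProduct.ext' fun p b => ?_) y
  simp only [LinearMap.comp_apply, varOp_tmul, mul_left_comm]

theorem varOp_mem_imgSum (i : ℕ) {n : ℕ} {y : MvPolynomial ℕ k ⊗[k] B}
    (hy : y ∈ imgSum (varOp k B) n) : varOp k B i y ∈ imgSum (varOp k B) n :=
  imgSum_le (S := Submodule.comap (varOp k B i) (imgSum (varOp k B) n)) (fun j hj z => by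
    rw [Submodule.mem_comap, varOp_comm]
    exact apply_mem_imgSum hj _) hy

variable (k) in
/-- The substitution that annihilates the first `n` variables. -/
def killVars (n : ℕ) : MvPolynomial ℕ k →ₐ[k] MvPolynomial ℕ k :=
  MvPolynomial.aeval fun i => if i < n then 0 else MvPolynomial.X i

theorem sub_killVars_mem (n : ℕ) (p : MvPolynomial ℕ k) (b : B) :
    (p - killVars k n p) ⊗ₜ[k] b ∈ imgSum (varOp k B) n := by
  induction p using MvPolynomial.induction_on with
  | C r =>
    rw [← MvPolynomial.algebraMap_eq, AlgHom.commutes, sub_self, TensorProduct.zero_tmul]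
    exact Submodule.zero_mem _
  | add p q hp hq =>
    rw [map_add, add_sub_add_comm, TensorProduct.add_tmul]
    exact Submodule.add_mem _ hp hq
  | mul_X p i hp =>
    by_cases hi : i < n
    · have : killVars k n (p * MvPolynomial.X i) = 0 := by simp [killVars, hi]
      rw [this, sub_zero, mul_comm]
      exact apply_mem_imgSum (T := varOp k B) hi (p ⊗ₜ b)
    · have : killVars k n (p * MvPolynomial.X i) = killVars k n p * MvPolynomial.X i := by
        simp [killVars, hi]
      rw [this, ← sub_mul, mul_comm]
      exact varOp_mem_imgSum i hp

theorem mem_imgSum_varOp_iff {n : ℕ} {y : MvPolynomial ℕ k ⊗[k] B} :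
    y ∈ imgSum (varOp k B) n ↔ LinearMap.rTensor B (killVars k n).toLinearMap y = 0 := by
  constructor
  · refine fun hy => imgSum_le (S := LinearMap.ker (LinearMap.rTensor B (killVars k n).toLinearMap))
      (fun j hj z => ?_) hy
    rw [LinearMap.mem_ker]
    refine LinearMap.congr_fun (f := LinearMap.rTensor B (killVars k n).toLinearMap ∘ₗ varOp k B j)
      (g := 0) (TensorProduct.ext' fun p b => ?_) z
    simp [killVars, hj]
  · intro hy
    have : ∀ y, y - LinearMap.rTensor B (killVars k n).toLinearMap y ∈ imgSum (varOp k B) n := by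
      intro y
      induction y using TensorProduct.induction_on with
      | zero => rw [map_zero, sub_zero]; exact Submodule.zero_mem _
      | tmul p b =>
        rw [LinearMap.rTensor_tmul, ← TensorProduct.sub_tmul]
        exact sub_killVars_mem n p b
      | add x y hx hy =>
        rw [map_add, add_sub_add_comm]
        exact Submodule.add_mem _ hx hy
    have h := this y
    rwa [hy, sub_zero] at h

variable (k B) in
-- Modulo the first `j` variables an element is determined by `killVars k j`, which commutes with
-- the injective multiplication by `X j`.
theorem regularOps_varOp (n : ℕ) : RegularOps (varOp k B) n := by
  intro j _ y hy
  rw [mem_imgSum_varOp_iff] at hy ⊢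
  have h1 : Function.Injective (varOp k B j) := by
    refine Module.Flat.rTensor_preserves_injective_linearMap _ ?_
    exact mul_right_injective₀ (MvPolynomial.X_ne_zero j)
  refine h1 ?_
  rw [map_zero, ← hy]
  refine LinearMap.congr_fun (f := varOp k B j ∘ₗ LinearMap.rTensor B (killVars k j).toLinearMap)
    (g := LinearMap.rTensor B (killVars k j).toLinearMap ∘ₗ varOp k B j)
    (TensorProduct.ext' fun p b => ?_) y
  simp [killVars]

end Variables

/-! ### Algebras presented by scalar commutators -/

section ScalarCommutators

variable {k : Type u} [Field k] {B : Type v} [Ring B] [Algebra k B]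

/-- A retract of a regular sequence of operators is regular. -/
theorem RegularOps.of_retract {k₁ k₂ : Type*} [Ring k₁] [Ring k₂] {Y M : Type*} [AddCommGroup Y]
    [Module k₁ Y] [AddCommGroup M] [Module k₂ M] {T : ℕ → Module.End k₁ Y} {S : ℕ → Module.End k₂ M}
    {n : ℕ} (hS : RegularOps S n) (f : Y →+ M) (g : M →+ Y) (hf : ∀ j < n, ∀ y, f (T j y) = S j (f y))
    (hg : ∀ j y, g (S j y) = T j (g y)) (hgf : ∀ y, g (f y) = y) : RegularOps T n := by
  intro j hj y hy
  have h1 : f y ∈ imgSum S j := by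
    refine hS j hj _ ?_
    rw [mem_imgSum_iff] at hy ⊢
    obtain ⟨w, hw⟩ := hy
    refine ⟨fun i => f (w i), ?_⟩
    rw [← hf j hj, hw, map_sum]
    exact Finset.sum_congr rfl fun i hi => hf i ((Finset.mem_range.1 hi).trans hj) _
  rw [mem_imgSum_iff] at h1 ⊢
  obtain ⟨w, hw⟩ := h1
  exact ⟨fun i => g (w i), by rw [← hgf y, hw, map_sum]; simp only [hg]⟩

variable (x : ℕ → B) (c : ℕ → ℕ → k)

/-- The derivation of the polynomial ring with values `c j i` at the variables `X j`. -/
def scalarDer (i : ℕ) : Derivation k (MvPolynomial ℕ k) (MvPolynomial ℕ k) :=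
  MvPolynomial.mkDerivation k fun j => MvPolynomial.C (c j i)

/-- The commutator of two derivations is a derivation; it kills the variables because the
derivations take constant values on them. -/
theorem scalarDer_comm (i j : ℕ) (p : MvPolynomial ℕ k) :
    scalarDer c i (scalarDer c j p) = scalarDer c j (scalarDer c i p) := by
  have h : ⁅scalarDer c i, scalarDer c j⁆ = 0 := MvPolynomial.derivation_ext fun l => by
    rw [Derivation.commutator_apply]
    simp [scalarDer]
  have := congrArg (· p) h
  rw [Derivation.commutator_apply] at this
  exact sub_eq_zero.1 this

/-- The operator by which `1 ⊗ x i` acts on `k[X₀, X₁, …] ⊗ B`. -/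
def genOp (i : ℕ) : Module.End k (MvPolynomial ℕ k ⊗[k] B) :=
  LinearMap.rTensor B (scalarDer c i : MvPolynomial ℕ k →ₗ[k] MvPolynomial ℕ k) +
    LinearMap.lTensor _ (LinearMap.mulLeft k (x i))

@[simp]
theorem genOp_tmul (i : ℕ) (p : MvPolynomial ℕ k) (b : B) :
    genOp x c i (p ⊗ₜ b) = scalarDer c i p ⊗ₜ b + p ⊗ₜ (x i * b) := rfl

/-- The derivation in `genOp` reproduces the scalar commutator of `x j ⊗ 1 - 1 ⊗ x j` with `1 ⊗ x
i`, computed in `envDiff_mul_op`. -/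
theorem genOp_varOp (i j : ℕ) :
    genOp x c i * varOp k B j = varOp k B j * genOp x c i + algebraMap k _ (c j i) := by
  refine TensorProduct.ext' fun p b => ?_
  have h : scalarDer c i (MvPolynomial.X j * p) =
      MvPolynomial.X j * scalarDer c i p + c j i • p := by
    rw [Derivation.leibniz, scalarDer, MvPolynomial.mkDerivation_X, smul_eq_mul, smul_eq_mul,
      MvPolynomial.smul_eq_C_mul, mul_comm p]
  simp only [Module.End.mul_apply, LinearMap.add_apply, varOp_tmul, genOp_tmul, map_add, h,
    Module.algebraMap_end_apply, TensorProduct.add_tmul, TensorProduct.smul_tmul']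
  abel

variable {x c}
variable (hc : ∀ i j, x i * x j - x j * x i = algebraMap k B (c i j))

include hc

theorem genOp_genOp (i j : ℕ) :
    genOp x c i * genOp x c j = genOp x c j * genOp x c i + algebraMap k _ (c i j) := by
  refine TensorProduct.ext' fun p b => ?_
  have h : p ⊗ₜ[k] (x i * (x j * b)) = p ⊗ₜ[k] (x j * (x i * b)) + c i j • (p ⊗ₜ[k] b) := by
    rw [← TensorProduct.tmul_smul, ← TensorProduct.tmul_add, ← mul_assoc, ← mul_assoc,
      Algebra.smul_def, ← hc, sub_mul, add_sub_cancel]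
  simp only [Module.End.mul_apply, LinearMap.add_apply, genOp_tmul, map_add, h,
    Module.algebraMap_end_apply, scalarDer_comm c i j]
  abel

theorem envDiff_mul_op (i j : ℕ) : envDiff (x j) * (1 ⊗ₜ[k] MulOpposite.op (x i)) =
    1 ⊗ₜ[k] MulOpposite.op (x i) * envDiff (x j) + c j i • 1 := by
  have h : (1 : B) ⊗ₜ[k] MulOpposite.op (x j * x i - x i * x j) = c j i • (1 : Env k B) := by
    rw [hc, one_tmul_op_algebraMap]
  rw [← h, envDiff, sub_mul, mul_sub, Algebra.TensorProduct.tmul_mul_tmul,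
    Algebra.TensorProduct.tmul_mul_tmul, Algebra.TensorProduct.tmul_mul_tmul,
    Algebra.TensorProduct.tmul_mul_tmul, MulOpposite.op_sub, TensorProduct.tmul_sub]
  simp only [mul_one, one_mul, MulOpposite.op_mul]
  abel

/-- Passing to the opposite algebra changes the sign of commutators, so the scalars from the two
tensor factors cancel. -/
theorem envDiff_comm (i j : ℕ) :
    envDiff (k := k) (x i) * envDiff (x j) = envDiff (x j) * envDiff (x i) := by
  have h : (x j * x i - x i * x j) ⊗ₜ[k] (1 : Bᵐᵒᵖ) = c j i • (1 : Env k B) := by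
    rw [hc, Algebra.algebraMap_eq_smul_one, ← TensorProduct.smul_tmul',
      ← Algebra.TensorProduct.one_def]
  have h1 : envDiff (x j) * (x i ⊗ₜ[k] 1) = x i ⊗ₜ[k] 1 * envDiff (x j) + c j i • 1 := by
    rw [← h, envDiff, sub_mul, mul_sub, Algebra.TensorProduct.tmul_mul_tmul,
      Algebra.TensorProduct.tmul_mul_tmul, Algebra.TensorProduct.tmul_mul_tmul,
      Algebra.TensorProduct.tmul_mul_tmul, TensorProduct.sub_tmul]
    simp only [mul_one, one_mul]
    abel
  have h2 : envDiff (x j) * envDiff (x i) =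
      envDiff (x j) * (x i ⊗ₜ[k] 1) - envDiff (x j) * (1 ⊗ₜ[k] MulOpposite.op (x i)) :=
    mul_sub _ _ _
  have h3 : envDiff (x i) * envDiff (x j) =
      x i ⊗ₜ[k] 1 * envDiff (x j) - 1 ⊗ₜ[k] MulOpposite.op (x i) * envDiff (x j) :=
    sub_mul _ _ _
  rw [h2, h3, h1, envDiff_mul_op hc]
  abel

open scoped IsMulCommutative in
/-- Evaluation of a polynomial at the commuting elements `x j ⊗ 1 - 1 ⊗ x j`. -/
theorem exists_evalDiff : ∃ P : MvPolynomial ℕ k →ₐ[k] Env k B,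
    ∀ j, P (MvPolynomial.X j) = envDiff (x j) := by
  let S : Set (Env k B) := Set.range fun j => envDiff (x j)
  have : IsMulCommutative (Algebra.adjoin k S) := Algebra.isMulCommutative_adjoin k (by
    rintro _ ⟨i, rfl⟩ _ ⟨j, rfl⟩
    exact envDiff_comm hc i j)
  refine ⟨(Algebra.adjoin k S).val.comp
    (MvPolynomial.aeval fun j => ⟨envDiff (x j), Algebra.subset_adjoin ⟨j, rfl⟩⟩), fun j => ?_⟩
  rw [AlgHom.comp_apply, MvPolynomial.aeval_X]
  rfl

theorem evalDiff_mul_op {P : MvPolynomial ℕ k →ₐ[k] Env k B}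
    (hP : ∀ j, P (MvPolynomial.X j) = envDiff (x j)) (i : ℕ) (p : MvPolynomial ℕ k) :
    P p * (1 ⊗ₜ[k] MulOpposite.op (x i)) =
      1 ⊗ₜ[k] MulOpposite.op (x i) * P p + P (scalarDer c i p) := by
  induction p using MvPolynomial.induction_on with
  | C r =>
    rw [scalarDer, MvPolynomial.derivation_C, map_zero, add_zero, ← MvPolynomial.algebraMap_eq,
      AlgHom.commutes]
    exact Algebra.commutes _ _
  | add p q hp hq =>
    simp only [map_add, add_mul, mul_add, hp, hq]
    abel
  | mul_X p j hp =>
    have h : scalarDer c i (p * MvPolynomial.X j) = scalarDer c i p * MvPolynomial.X j + c j i • p := by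
      rw [Derivation.leibniz, scalarDer, MvPolynomial.mkDerivation_X, smul_eq_mul, smul_eq_mul,
        MvPolynomial.smul_eq_C_mul, mul_comm p, mul_comm (MvPolynomial.X j), add_comm]
    rw [h, map_add, map_mul, map_mul, hP, mul_assoc, envDiff_mul_op hc, mul_add, ← mul_assoc, hp,
      add_mul, map_smul, mul_smul_comm, mul_one, mul_assoc]
    abel

/-- The differences `x j ⊗ 1 - 1 ⊗ x j` form a regular sequence if the algebra is presented by the
commutation relations. -/
theorem regularOps_envDiff {n : ℕ} (hx : Algebra.adjoin k (x '' Set.Iio n) = ⊤)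
    (hlift : ∀ {C : Type (max u v)} [Ring C] [Algebra k C] (y : ℕ → C),
      (∀ i j, y i * y j - y j * y i = algebraMap k C (c i j)) →
        ∃ f : B →ₐ[k] C, ∀ i < n, f (x i) = y i) :
    RegularOps (fun j => rmul (envDiff (k := k) (x j))) n := by
  obtain ⟨P, hP⟩ := exists_evalDiff hc
  have hsub : ∀ {C : Type (max u v)} [Ring C] {a b r : C}, a = b + r → a - b = r := fun h =>
    sub_eq_of_eq_add' h
  -- The presentation of `B` is used to build a right action of `Bᵉ` on `k[X] ⊗ B`. The operators
  -- `genOp` obey the relations and give the action of `1 ⊗ b`.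
  obtain ⟨lam, hlam⟩ := hlift (genOp x c) fun i j => hsub (genOp_genOp hc i j)
  have hYY : ∀ i j, varOp k B i * varOp k B j = varOp k B j * varOp k B i := fun i j =>
    LinearMap.ext fun y => varOp_comm i j y
  have hsum : ∀ i j, (varOp k B j + genOp x c j) * (varOp k B i + genOp x c i) =
      (varOp k B i + genOp x c i) * (varOp k B j + genOp x c j) + algebraMap k _ (c i j) := by
    intro i j
    simp only [mul_add, add_mul, genOp_varOp x c i j, genOp_varOp x c j i, genOp_genOp hc j i,
      hYY i j]
    abel
  -- As `x_j ⊗ 1` is the `j`-th difference plus `1 ⊗ x_j`, it has to act by `varOp + genOp`; the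
  -- opposite ring accounts for acting on the right.
  obtain ⟨mu, hmu⟩ := hlift (fun j => MulOpposite.op (varOp k B j + genOp x c j)) fun i j => by
    rw [← MulOpposite.op_mul, ← MulOpposite.op_mul]
    exact hsub (congrArg MulOpposite.op (hsum i j))
  have hgen : ∀ i j, Commute (MulOpposite.op (varOp k B j + genOp x c j))
      (MulOpposite.op (genOp x c i)) := by
    intro i j
    have h : genOp x c i * (varOp k B j + genOp x c j) = (varOp k B j + genOp x c j) * genOp x c i := by
      simp only [mul_add, add_mul, genOp_varOp x c i j, genOp_genOp hc j i]
      abel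
    exact congrArg MulOpposite.op h
  have hcomm₁ : ∀ b, ∀ i < n, Commute (mu b) (MulOpposite.op (genOp x c i)) := by
    intro b i hi
    have hb : b ∈ Algebra.adjoin k (x '' Set.Iio n) := hx ▸ Algebra.mem_top
    induction hb using Algebra.adjoin_induction with
    | mem b hb =>
      obtain ⟨j, hj, rfl⟩ := hb
      rw [hmu j hj]
      exact hgen i j
    | algebraMap r => rw [AlgHom.commutes]; exact Algebra.commutes r _
    | add a b _ _ ha hb => rw [map_add]; exact ha.add_left hb
    | mul a b _ _ ha hb => rw [map_mul]; exact ha.mul_left hb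
  have hcomm₂ : ∀ b b', Commute (mu b) (MulOpposite.op (lam b')) := by
    intro b b'
    have hb : b' ∈ Algebra.adjoin k (x '' Set.Iio n) := hx ▸ Algebra.mem_top
    induction hb using Algebra.adjoin_induction with
    | mem b' hb =>
      obtain ⟨j, hj, rfl⟩ := hb
      rw [hlam j hj]
      exact hcomm₁ b j hj
    | algebraMap r => rw [AlgHom.commutes]; exact (Algebra.commutes r (mu b)).symm
    | add a b _ _ ha hb => rw [map_add, MulOpposite.op_add]; exact ha.add_right hb
    | mul a b _ _ ha hb => rw [map_mul, MulOpposite.op_mul]; exact hb.mul_right ha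
  have hcomm : ∀ b b', Commute (mu b) (AlgHom.op lam b') := fun b b' => hcomm₂ b b'.unop
  let rho := Algebra.TensorProduct.lift mu (AlgHom.op lam) hcomm
  -- The comparison map `p ⊗ b ↦ (1 ⊗ b) P(p)`, which is equivariant for the right action.
  -- Bijectivity is not needed, only a section.
  let Θ : MvPolynomial ℕ k ⊗[k] B →ₗ[k] Env k B := TensorProduct.lift
    ((LinearMap.mul k (Env k B)).flip.compl₁₂ P.toLinearMap
      ((TensorProduct.mk k B Bᵐᵒᵖ 1) ∘ₗ (MulOpposite.opLinearEquiv k).toLinearMap))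
  have hΘ : ∀ p b, Θ (p ⊗ₜ b) = 1 ⊗ₜ[k] MulOpposite.op b * P p := fun p b => rfl
  have hΘY : ∀ j m, Θ (varOp k B j m) = Θ m * envDiff (x j) := by
    intro j m
    induction m using TensorProduct.induction_on with
    | zero => rw [map_zero, map_zero, zero_mul]
    | tmul p b => rw [varOp_tmul, hΘ, hΘ, mul_comm, map_mul, hP, mul_assoc]
    | add a b ha hb => rw [map_add, map_add, ha, hb, map_add, add_mul]
  have hΘZ : ∀ i m, Θ (genOp x c i m) = Θ m * (1 ⊗ₜ[k] MulOpposite.op (x i)) := by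
    intro i m
    induction m using TensorProduct.induction_on with
    | zero => rw [map_zero, map_zero, zero_mul]
    | tmul p b =>
      rw [genOp_tmul, map_add, hΘ, hΘ, hΘ, mul_assoc, evalDiff_mul_op hc hP, mul_add, ← mul_assoc,
        Algebra.TensorProduct.tmul_mul_tmul, one_mul, ← MulOpposite.op_mul, add_comm]
    | add a b ha hb => rw [map_add, map_add, ha, hb, map_add, add_mul]
  have hΘlam : ∀ b m, Θ (lam b m) = Θ m * (1 ⊗ₜ[k] MulOpposite.op b) := by
    intro b
    have hb : b ∈ Algebra.adjoin k (x '' Set.Iio n) := hx ▸ Algebra.mem_top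
    induction hb using Algebra.adjoin_induction with
    | mem b hb =>
      obtain ⟨j, hj, rfl⟩ := hb
      rw [hlam j hj]
      exact hΘZ j
    | algebraMap r =>
      intro m
      rw [AlgHom.commutes, Module.algebraMap_end_apply, map_smul, one_tmul_op_algebraMap,
        mul_smul_comm, mul_one]
    | add a b _ _ ha hb =>
      intro m
      rw [map_add, LinearMap.add_apply, map_add, ha, hb, MulOpposite.op_add, TensorProduct.tmul_add,
        mul_add]
    | mul a b _ _ ha hb =>
      intro m
      rw [map_mul, Module.End.mul_apply, ha, hb, mul_assoc, Algebra.TensorProduct.tmul_mul_tmul,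
        one_mul, ← MulOpposite.op_mul]
  have hΘmu : ∀ b m, Θ ((mu b).unop m) = Θ m * (b ⊗ₜ[k] 1) := by
    intro b
    have hb : b ∈ Algebra.adjoin k (x '' Set.Iio n) := hx ▸ Algebra.mem_top
    induction hb using Algebra.adjoin_induction with
    | mem b hb =>
      obtain ⟨j, hj, rfl⟩ := hb
      intro m
      rw [hmu j hj, MulOpposite.unop_op, LinearMap.add_apply, map_add, hΘY, hΘZ, ← mul_add, envDiff,
        sub_add_cancel]
    | algebraMap r =>
      intro m
      rw [AlgHom.commutes, MulOpposite.algebraMap_apply, MulOpposite.unop_op,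
        Module.algebraMap_end_apply, map_smul, Algebra.algebraMap_eq_smul_one,
        ← TensorProduct.smul_tmul', mul_smul_comm, ← Algebra.TensorProduct.one_def, mul_one]
    | add a b _ _ ha hb =>
      intro m
      rw [map_add, MulOpposite.unop_add, LinearMap.add_apply, map_add, ha, hb,
        TensorProduct.add_tmul, mul_add]
    | mul a b _ _ ha hb =>
      intro m
      rw [map_mul, MulOpposite.unop_mul, Module.End.mul_apply, hb, ha, mul_assoc,
        Algebra.TensorProduct.tmul_mul_tmul, mul_one]
  have hΘrho : ∀ u m, Θ ((rho u).unop m) = Θ m * u := by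
    intro u m
    induction u using TensorProduct.induction_on with
    | zero => rw [map_zero, mul_zero]; exact map_zero Θ
    | tmul b y =>
      rw [show rho (b ⊗ₜ y) = mu b * MulOpposite.op (lam y.unop) from
        Algebra.TensorProduct.lift_tmul _ _ _ _ _, MulOpposite.unop_mul, MulOpposite.unop_op,
        Module.End.mul_apply, hΘlam, hΘmu, mul_assoc, Algebra.TensorProduct.tmul_mul_tmul, mul_one,
        one_mul, MulOpposite.op_unop]
    | add a b ha hb =>
      rw [map_add, MulOpposite.unop_add, LinearMap.add_apply, map_add, ha, hb, mul_add]
  have hrho : ∀ j < n, (rho (envDiff (x j))).unop = varOp k B j := by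
    intro j hj
    have h1 : rho (envDiff (x j)) = mu (x j) - MulOpposite.op (lam (x j)) := by
      rw [envDiff, map_sub, show rho (x j ⊗ₜ 1) = mu (x j) * AlgHom.op lam 1 from
        Algebra.TensorProduct.lift_tmul _ _ _ _ _, show rho (1 ⊗ₜ MulOpposite.op (x j)) =
          mu 1 * MulOpposite.op (lam (x j)) from Algebra.TensorProduct.lift_tmul _ _ _ _ _,
        map_one, map_one, mul_one, one_mul]
    rw [h1, hmu j hj, hlam j hj, ← MulOpposite.op_sub]
    exact add_sub_cancel_right (varOp k B j) (genOp x c j)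
  -- The orbit map of `1 ⊗ 1`. By equivariance `Θ (Ψ u) = Θ (1 ⊗ 1) * u = u`.
  let Ψ : Env k B →+ MvPolynomial ℕ k ⊗[k] B :=
    { toFun := fun u => (rho u).unop (1 ⊗ₜ 1)
      map_zero' := by rw [map_zero]; rfl
      map_add' := fun u v => by rw [map_add]; rfl }
  refine (regularOps_varOp k B n).of_retract Ψ Θ.toAddMonoidHom (fun j hj u => ?_)
    (fun j m => hΘY j m) fun u => ?_
  · change (rho (u * envDiff (x j))).unop (1 ⊗ₜ 1) = varOp k B j ((rho u).unop (1 ⊗ₜ 1))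
    rw [map_mul, MulOpposite.unop_mul, hrho j hj]
    rfl
  · change Θ ((rho u).unop (1 ⊗ₜ 1)) = u
    rw [hΘrho, hΘ, map_one, mul_one, MulOpposite.op_one, ← Algebra.TensorProduct.one_def, one_mul]

/-- An algebra presented by scalar commutation relations between `n ≥ 1` generators is
`n`-Calabi–Yau. -/
theorem isCalabiYau_of_scalar_commutators {n : ℕ} (hn : 1 ≤ n)
    (hx : Algebra.adjoin k (x '' Set.Iio n) = ⊤)
    (hlift : ∀ {C : Type (max u v)} [Ring C] [Algebra k C] (y : ℕ → C),
      (∀ i j, y i * y j - y j * y i = algebraMap k C (c i j)) →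
        ∃ f : B →ₐ[k] C, ∀ i < n, f (x i) = y i) : IsCalabiYau k B n :=
  isCalabiYau_of_regularOps hn x hx (envDiff_comm hc) (regularOps_envDiff hc hx hlift)

end ScalarCommutators
end
end NKoszulCY

namespace NKoszulCY
noncomputable section

/-! ### Sridharan enveloping algebras -/

section Sridharan
variable {k : Type u} [Field k] {g : Type w} [LieRing g] [LieAlgebra k g]

theorem adjoin_range_mkAlgHom_ι (f : g →ₗ[k] g →ₗ[k] k) :
    Algebra.adjoin k (Set.range fun z : g =>
      RingQuot.mkAlgHom k (SridharanRel k f) (TensorAlgebra.ι k z)) = ⊤ := by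
  have h := congrArg (Subalgebra.map (RingQuot.mkAlgHom k (SridharanRel k f)))
    (TensorAlgebra.adjoin_range_ι (R := k) (M := g))
  rw [AlgHom.map_adjoin, Algebra.map_top, ← Set.range_comp,
    (AlgHom.range_eq_top _).2 (RingQuot.mkAlgHom_surjective k _)] at h
  exact h

/-- Sridharan enveloping algebras of abelian Lie algebras are Calabi–Yau. -/
theorem isCalabiYau_sridharan [IsLieAbelian g] [FiniteDimensional k g] (f : g →ₗ[k] g →ₗ[k] k)
    {n : ℕ} (hn : 1 ≤ n) (hg : Module.finrank k g = n) : IsCalabiYau k (Sridharan k f) n := by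
  let b : Module.Basis (Fin n) k g := Module.finBasisOfFinrankEq k g hg
  -- Generators are indexed by `ℕ`; those from `n` on are zero and satisfy the relations trivially.
  let e : ℕ → g := fun j => if h : j < n then b ⟨j, h⟩ else 0
  let m : g →ₗ[k] Sridharan k f :=
    (RingQuot.mkAlgHom k (SridharanRel k f)).toLinearMap ∘ₗ TensorAlgebra.ι k
  have he : ∀ j : Fin n, e j = b j := fun j => dif_pos j.2
  refine isCalabiYau_of_scalar_commutators (x := fun j => m (e j)) (c := fun i j => f (e i) (e j))
    (fun i j => ?_) hn ?_ fun {C} _ _ y hy => ?_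
  · have h := RingQuot.mkAlgHom_rel k (SridharanRel.rel (f := f) (e i) (e j))
    rw [trivial_lie_zero, map_zero, zero_add, AlgHom.commutes, map_sub, map_mul, map_mul] at h
    exact h
  · refine top_unique ((adjoin_range_mkAlgHom_ι f).ge.trans (Algebra.adjoin_le ?_))
    rintro _ ⟨z, rfl⟩
    have hz : ∑ j, b.repr z j • m (b j) = m z := by
      rw [← congrArg m (b.sum_repr z), map_sum]
      exact Finset.sum_congr rfl fun j _ => (map_smul m _ _).symm
    change m z ∈ _
    rw [← hz]
    refine Subalgebra.sum_mem _ fun j _ => Subalgebra.smul_mem _ (Algebra.subset_adjoin ?_) _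
    exact ⟨j, j.2, congrArg m (he j)⟩
  · let L : g →ₗ[k] C := b.constr k fun j : Fin n => y j
    have hLb : ∀ j, L (b j) = y j := fun j => b.constr_basis k _ j
    have hL : ∀ p q, L p * L q - L q * L p = algebraMap k C (f p q) := by
      intro p q
      let F₁ := (LinearMap.mul k C).compl₁₂ L L - ((LinearMap.mul k C).compl₁₂ L L).flip
      let F₂ := f.compr₂ (Algebra.linearMap k C)
      -- Both sides are bilinear, so the relations on basis elements imply them for all of `g`.
      have : F₁ = F₂ := b.ext fun i => b.ext fun j => by
        change L (b i) * L (b j) - L (b j) * L (b i) = algebraMap k _ (f (b i) (b j))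
        rw [hLb, hLb, hy, he, he]
      exact LinearMap.congr_fun₂ this p q
    refine ⟨RingQuot.liftAlgHom k ⟨TensorAlgebra.lift k L, ?_⟩, fun i hi => ?_⟩
    · rintro _ _ ⟨p, q⟩
      rw [trivial_lie_zero, map_zero, zero_add, AlgHom.commutes, map_sub, map_mul, map_mul,
        TensorAlgebra.lift_ι_apply, TensorAlgebra.lift_ι_apply, hL]
    · change RingQuot.liftAlgHom k _ (RingQuot.mkAlgHom k _ (TensorAlgebra.ι k (e i))) = _
      rw [RingQuot.liftAlgHom_mkAlgHom_apply, TensorAlgebra.lift_ι_apply, he ⟨i, hi⟩, hLb]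

end Sridharan

/-! ### Weyl algebras -/

section Weyl
variable (k : Type u) [Field k]

/-- The scalar commutators of the generators of the Weyl algebra. -/
def weylForm {n : ℕ} : Fin n ⊕ Fin n → Fin n ⊕ Fin n → k
  | Sum.inl _, Sum.inl _ => 0
  | Sum.inr _, Sum.inr _ => 0
  | Sum.inr i, Sum.inl j => if i = j then 1 else 0
  | Sum.inl i, Sum.inr j => if j = i then -1 else 0

theorem weyl_commutator {n : ℕ} (s t : Fin n ⊕ Fin n) :
    RingQuot.mkAlgHom k (WeylRel k n) (FreeAlgebra.ι k s * FreeAlgebra.ι k t -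
      FreeAlgebra.ι k t * FreeAlgebra.ι k s) = algebraMap k (Weyl k n) (weylForm k s t) := by
  have key : ∀ i j : Fin n, RingQuot.mkAlgHom k (WeylRel k n)
      (FreeAlgebra.ι k (Sum.inr i) * FreeAlgebra.ι k (Sum.inl j) -
        FreeAlgebra.ι k (Sum.inl j) * FreeAlgebra.ι k (Sum.inr i)) =
      algebraMap k (Weyl k n) (if i = j then 1 else 0) := fun i j => by
    rw [RingQuot.mkAlgHom_rel k (WeylRel.yx i j)]
    split_ifs <;> simp
  rcases s with i | i <;> rcases t with j | j
  · rw [map_sub, RingQuot.mkAlgHom_rel k (WeylRel.xx i j), sub_self]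
    exact (map_zero _).symm
  · rw [← neg_sub, map_neg, key, ← map_neg]
    congr 1
    simp only [weylForm]
    split_ifs <;> simp
  · exact key i j
  · rw [map_sub, RingQuot.mkAlgHom_rel k (WeylRel.yy i j), sub_self]
    exact (map_zero _).symm

/-- The Weyl algebra `A_n` is `2n`-Calabi–Yau. -/
theorem isCalabiYau_weyl {n : ℕ} (hn : 1 ≤ n) : IsCalabiYau k (Weyl k n) (2 * n) := by
  let E : Fin n ⊕ Fin n ≃ Fin (2 * n) := finSumFinEquiv.trans (finCongr (two_mul n).symm)
  let m : FreeAlgebra k (Fin n ⊕ Fin n) →ₐ[k] Weyl k n := RingQuot.mkAlgHom k (WeylRel k n)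
  let e : ℕ → FreeAlgebra k (Fin n ⊕ Fin n) := fun j =>
    if h : j < 2 * n then FreeAlgebra.ι k (E.symm ⟨j, h⟩) else 0
  have he : ∀ s, e (E s) = FreeAlgebra.ι k s := fun s =>
    (dif_pos (E s).2).trans (congrArg _ (E.symm_apply_apply s))
  -- As for `e`, the value `0` out of range matches the vanishing of the padded generators.
  let c : ℕ → ℕ → k := fun i j => if h : i < 2 * n ∧ j < 2 * n then
    weylForm k (E.symm ⟨i, h.1⟩) (E.symm ⟨j, h.2⟩) else 0
  have hc : ∀ s t, c (E s) (E t) = weylForm k s t := fun s t => by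
    simp only [c]
    rw [dif_pos ⟨(E s).2, (E t).2⟩, Fin.eta, Fin.eta, E.symm_apply_apply, E.symm_apply_apply]
  refine isCalabiYau_of_scalar_commutators (x := fun j => m (e j)) (c := c)
    (fun i j => ?_) (by omega) ?_ fun {C} _ _ y hy => ?_
  · by_cases h : i < 2 * n ∧ j < 2 * n
    · obtain ⟨s, hs⟩ := E.surjective ⟨i, h.1⟩
      obtain ⟨t, ht⟩ := E.surjective ⟨j, h.2⟩
      obtain rfl : (E s : ℕ) = i := congrArg Fin.val hs
      obtain rfl : (E t : ℕ) = j := congrArg Fin.val ht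
      rw [hc, ← weyl_commutator, map_sub, map_mul, map_mul, he, he]
    · have h0 : e i = 0 ∨ e j = 0 := (not_and_or.1 h).imp (fun h => dif_neg h) fun h => dif_neg h
      rw [show c i j = 0 from dif_neg h, map_zero]
      rcases h0 with h0 | h0 <;> rw [h0, map_zero, zero_mul, mul_zero, sub_zero]
  · have h := congrArg (Subalgebra.map m) (FreeAlgebra.adjoin_range_ι (R := k) (X := Fin n ⊕ Fin n))
    rw [AlgHom.map_adjoin, Algebra.map_top, ← Set.range_comp,
      (AlgHom.range_eq_top m).2 (RingQuot.mkAlgHom_surjective k _)] at h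
    refine top_unique (h.ge.trans (Algebra.adjoin_mono ?_))
    rintro _ ⟨s, rfl⟩
    exact ⟨E s, (E s).2, congrArg m (he s)⟩
  · have hy' : ∀ s t, y (E s) * y (E t) - y (E t) * y (E s) = algebraMap k _ (weylForm k s t) :=
      fun s t => by rw [hy, hc]
    refine ⟨RingQuot.liftAlgHom k ⟨FreeAlgebra.lift k fun s => y (E s), ?_⟩, fun i hi => ?_⟩
    · rintro _ _ (⟨i, j⟩ | ⟨i, j⟩ | ⟨i, j⟩)
      · simp only [map_mul, FreeAlgebra.lift_ι_apply]
        exact sub_eq_zero.1 ((hy' _ _).trans (map_zero _))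
      · simp only [map_mul, FreeAlgebra.lift_ι_apply]
        exact sub_eq_zero.1 ((hy' _ _).trans (map_zero _))
      · simp only [map_sub, map_mul, FreeAlgebra.lift_ι_apply, hy', weylForm]
        split_ifs <;> simp
    · obtain ⟨s, hs⟩ := E.surjective ⟨i, hi⟩
      obtain rfl : (E s : ℕ) = i := congrArg Fin.val hs
      change RingQuot.liftAlgHom k _ (RingQuot.mkAlgHom k _ (e (E s))) = _
      rw [RingQuot.liftAlgHom_mkAlgHom_apply, he, FreeAlgebra.lift_ι_apply]

end Weyl
end
end NKoszulCY

theorem mainTheorem8 {k : Type u} [Field k] :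
    (∀ (V : Type v) [AddCommGroup V] [Module k V] [FiniteDimensional k V] (N d : ℕ)
        (R : Submodule k (TensorAlgebra k V)) (φ : R →ₗ[k] k),
        2 ≤ N → 2 ≤ d → R ≤ NKoszulCY.tpow k V N → NKoszulCY.IsKoszul N R →
        NKoszulCY.IsCalabiYau k (NKoszulCY.QuotAlg R) d →
        NKoszulCY.IsPBWDeformation R (NKoszulCY.deformedRel R φ) →
        NKoszulCY.IsCalabiYau k (NKoszulCY.QuotAlg (NKoszulCY.deformedRel R φ)) d) ∧
    (∀ (g : Type w) [LieRing g] [LieAlgebra k g] [IsLieAbelian g] [FiniteDimensional k g]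
        (f : g →ₗ[k] g →ₗ[k] k) (n : ℕ), 1 ≤ n → Module.finrank k g = n →
        NKoszulCY.IsTwoCocycle k f → NKoszulCY.IsCalabiYau k (NKoszulCY.Sridharan k f) n) ∧
    (∀ n : ℕ, 1 ≤ n → NKoszulCY.IsCalabiYau k (NKoszulCY.Weyl k n) (2 * n)) := by
  refine ⟨?_, ?_, fun n hn => NKoszulCY.isCalabiYau_weyl k hn⟩
  · intro V _ _ _ N d R φ hN hd hR hK hCY hP
    exact NKoszulCY.isCalabiYau_deformation hN hd hR hK hCY hP
  · intro g _ _ _ _ f n hn hg _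
    exact NKoszulCY.isCalabiYau_sridharan f hn hg
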